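/- **Setting.** Let $b\neq0$, $27s-38b^2>0$, $\varepsilon>0$, $\omega\in(-\frac12,\frac12)$ with $1+2\varepsilon\omega>0$. Put $\mathcal A=1+(1+2\varepsilon\omega)\partial_x^2+\partial_y^2$, $L=-\mathcal A^2$, $f(u)=\varepsilon^2u+bu^2-su^3$. Let $\tilde u=\tilde u(x)$ be a roll, i.e. a real, even, $2\pi$-periodic stationary solution of $$\partial_tu=Lu+f(u)\quad\text{on }\mathbb R^2, \tag{1}$$ and let $\mathcal L=L+f'(\tilde u)$. For $\sigma\in\mathbb R^2$ let $B(\sigma)=-[1+(1+2\varepsilon\omega)(\partial_x+i\sigma_1)^2-\sigma_2^2]^2+f'(\tilde u)$, acting on $L^2(\mathbb T)$, $\mathbb T=\mathbb R/2\pi\mathbb Z$, with domain $H^4(\mathbb T)$. Let $\bar\sigma\in\mathbb R^2$ be a most unstable Bloch vector and $\lambda$ the associated branch: $\lambda$ is real analytic on an open neighbourhood $\mathcal N$ of $\bar\sigma$, for each $\sigma\in\mathcal N$ the number $\lambda(\sigma)>0$ is an eigenvalue of $B(\sigma)$, and $\lambda_M:=\lambda(\bar\sigma)$ is the largest of all eigenvalues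 of all the operators $B(\sigma)$, $\sigma\in\mathbb R^2$. Let $\bar c>0$ with $[\bar\sigma_1,\bar\sigma_1+\bar c]\times[\bar\sigma_2,\bar\sigma_2+\bar c]\subset\mathcal N$ and, for $\sigma$ in this square, let $W(\cdot,\sigma)\ne0$ be an eigenfunction of $B(\sigma)$ for $\lambda(\sigma)$ that depends continuously on $\sigma$ in $H^2(\mathbb T)$. For $0<c_0\le\bar c$ let $I\times J=[\bar\sigma_1,\bar\sigma_1+c_0]\times[\bar\sigma_2,\bar\sigma_2+c_0]$, $$U(x,y)=\int_{I\times J}e^{i(\sigma_1x+\sigma_2y)}W(x,\sigma)\,d\sigma,\qquad e(t)=\Big(\int_{I\times J}e^{2(\lambda(\sigma)-\lambda_M)t}\,d\sigma\Big)^{1/2}.$$ For $N\ge1$ let $V_1,\dots,V_N\in C([0,\infty);H^2(\mathbb R^2))$ be the weak solutions of $\partial_tV_1=\mathcal LV_1$, $V_1(0)=U$, and, for $2\le j\le N$ (sums over indices $\ge1$), $$\partial_tV_j=\mathcal LV_j-(3s\tilde u-b)\sum_{k+p=j}V_kV_p-s\sum_{k+p+q=j}V_kV_pV_q,\qquad V_j(0)=0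 .$$ For $\delta>0$ let $V^{\mathrm{app}}=\tilde u+\sum_{j=1}^N\delta^jV_j$. The remainder $v\in C([0,T];H^2(\mathbb R^2))$ is determined by: $v(0)=0$ and $V^{\mathrm{app}}+v$ is a weak solution of (1). Let $$T_M=\sup\{T>0:\ v\text{ exists on }[0,T]\text{ and }\|v(t)\|_{H^2}\le\tfrac12\text{ for all }0\le t\le T\}\in(0,\infty].$$ **Lemma (Energy estimate).** There are constants $\rho,C>0$ and $N_0$ such that for every $N\ge N_0$ and every $\theta\in(0,\frac12)$ with $CN^2\theta^{N+1}<\frac12$ there is $c_*\in(0,\bar c]$ such that for every $c_0\in(0,c_*]$ the following holds. The profiles $V_1,\dots,V_N$ exist, $\|V_j(t)\|_{H^2}\le(\rho e^{\lambda_Mt}e(t))^j$ for $1\le j\le N$, $t\ge0$, and for every $\delta>0$ with $\delta\rho\,e(0)\le\theta$ there is exactly one time $T^\delta\ge0$ with $\delta\rho\,e^{\lambda_MT^\delta}e(T^\delta)=\theta$, and 1. $T^\delta<T_M$; in particular $v$ exists and $\|v(t)\|_{H^2}\le\frac12$ on $[0,T^\delta]$; 2. $\|v(t)\|_{H^2(\mathbb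 R^2)}\le CN^2\big(\delta\rho\,e^{\lambda_Mt}e(t)\big)^{N+1}$ for all $0\le t\le T^\delta$. -/

import Mathlib

open MeasureTheory Filter Topology
open scoped ENNReal FourierTransform

namespace GSHE

noncomputable section

/-- The plane of the spatial variables `(x, y)`, `x = p 0`, `y = p 1`, with the Euclidean norm. -/
abbrev Plane : Type := EuclideanSpace ℝ (Fin 2)

/-! ### Sobolev norms -/

open Classical in
/-- The norm of `H²(ℝ²)`, with value `∞` for functions that are not in `H²(ℝ²)`:
`‖f‖² = ∫ (1 + |2πξ|²)² |𝓕 f (ξ)|² dξ` (that is `‖(1 - Δ) f‖²` in `L²`), where `𝓕` is the Fourier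
transform on `L²(ℝ²)`, normalized by `𝓕 f (ξ) = ∫ e^{-2πi x·ξ} f(x) dx`. -/
def h2Norm (f : Plane → ℂ) : ℝ≥0∞ :=
  if h : MemLp f 2 (volume : Measure Plane) then
    (∫⁻ ξ : Plane, ENNReal.ofReal
      ((1 + (2 * Real.pi * ‖ξ‖) ^ 2) ^ 2 * ‖(𝓕 (h.toLp f) : Lp ℂ 2 (volume : Measure Plane)) ξ‖ ^ 2))
      ^ (1 / 2 : ℝ)
  else ⊤

/-- `u ∈ C(S; H²(ℝ²))` for a set `S` of times. -/
def ContinuousInH2 (S : Set ℝ) (u : ℝ → Plane → ℂ) : Prop :=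
  (∀ t ∈ S, h2Norm (u t) < ⊤) ∧
    ∀ t₀ ∈ S, Tendsto (fun t => h2Norm (u t - u t₀)) (𝓝[S] t₀) (𝓝 0)

/-- The Fourier coefficient `(1/2π) ∫₀^{2π} e^{-ijx} h(x) dx` of a `2π`-periodic function. -/
def torusCoeff (h : ℝ → ℂ) (j : ℤ) : ℂ :=
  (1 / (2 * Real.pi) : ℂ) *
    ∫ x in (0 : ℝ)..(2 * Real.pi), Complex.exp (-(Complex.I * j * x)) * h x

/-- The norm of `Hᵖ(𝕋)`, `‖h‖² = ∑ⱼ (1 + j²)ᵖ |ĥ(j)|²`, possibly `∞`. -/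
def torusNorm (p : ℕ) (h : ℝ → ℂ) : ℝ≥0∞ :=
  (∑' j : ℤ, ENNReal.ofReal ((1 + (j : ℝ) ^ 2) ^ p * ‖torusCoeff h j‖ ^ 2)) ^ (1 / 2 : ℝ)

/-- `h` is (the `2π`-periodic extension of) a function in `Hᵖ(𝕋)`. -/
structure MemTorus (p : ℕ) (h : ℝ → ℂ) : Prop where
  periodic : Function.Periodic h (2 * Real.pi)
  memLp : MemLp h 2 (volume.restrict (Set.Ioc 0 (2 * Real.pi)))
  norm_lt_top : torusNorm p h < ⊤

/-! ### Rolls and Bloch operators -/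

/-- `1 + (1 + 2εω) d²/dx²` on functions of one variable. -/
def rollOp (ε ω : ℝ) (u : ℝ → ℝ) (x : ℝ) : ℝ :=
  u x + (1 + 2 * ε * ω) * iteratedDeriv 2 u x

/-- `u` is an even `2π`-periodic stationary solution, independent of `y`, of
`∂ₜu = -(1 + (1 + 2εω)∂ₓ² + ∂_y²)² u + ε² u + b u² - s u³`. -/
structure IsRoll (ε ω b s : ℝ) (u : ℝ → ℝ) : Prop where
  contDiff : ContDiff ℝ 4 u
  periodic : Function.Periodic u (2 * Real.pi)
  even : Function.Even u
  stationary : ∀ x,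
    -(rollOp ε ω (rollOp ε ω u) x) + ε ^ 2 * u x + b * u x ^ 2 - s * u x ^ 3 = 0

/-- The potential `f'(ũ) = ε² + 2bũ - 3sũ²`. -/
def potential (ε b s : ℝ) (ut : ℝ → ℝ) (x : ℝ) : ℝ :=
  ε ^ 2 + 2 * b * ut x - 3 * s * ut x ^ 2

/-- The Fourier coefficients of `B(σ) W`, where
`B(σ) = -[1 + (1 + 2εω)(∂ₓ + iσ₁)² - σ₂²]² + ε² + 2bũ - 3sũ²` acts on `H⁴(𝕋)`:
`∂ₓ + iσ₁` multiplies the `j`-th Fourier coefficient by `i(j + σ₁)`. -/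
def blochCoeff (ε ω b s : ℝ) (ut : ℝ → ℝ) (σ : ℝ × ℝ) (W : ℝ → ℂ) (j : ℤ) : ℂ :=
  -(1 + (1 + 2 * ε * ω) * (Complex.I * (j + σ.1)) ^ 2 - σ.2 ^ 2) ^ 2 * torusCoeff W j +
    torusCoeff (fun x => (potential ε b s ut x : ℂ) * W x) j

/-- `W ∈ H⁴(𝕋)`, `W ≠ 0` and `B(σ) W = μ W`. -/
structure IsBlochEigenfunction (ε ω b s : ℝ) (ut : ℝ → ℝ) (σ : ℝ × ℝ) (μ : ℝ) (W : ℝ → ℂ) :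
    Prop where
  mem : MemTorus 4 W
  ne_zero : ∃ j, torusCoeff W j ≠ 0
  eigen : ∀ j, blochCoeff ε ω b s ut σ W j = μ * torusCoeff W j

/-- `μ` is an eigenvalue of the Bloch operator `B(σ)`. -/
def IsBlochEigenvalue (ε ω b s : ℝ) (ut : ℝ → ℝ) (σ : ℝ × ℝ) (μ : ℝ) : Prop :=
  ∃ W, IsBlochEigenfunction ε ω b s ut σ μ W

/-- `lam` is a real-analytic branch of unstable (positive) eigenvalues of `B(σ)`, `σ` in the open
neighbourhood `𝒩` of `σbar`, and `lam σbar` is the largest of all the eigenvalues of all the Bloch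
operators. -/
structure IsMostUnstableBranch (ε ω b s : ℝ) (ut : ℝ → ℝ) (σbar : ℝ × ℝ) (𝒩 : Set (ℝ × ℝ))
    (lam : ℝ × ℝ → ℝ) : Prop where
  isOpen : IsOpen 𝒩
  mem : σbar ∈ 𝒩
  analytic : AnalyticOnNhd ℝ lam 𝒩
  unstable : ∀ σ ∈ 𝒩, 0 < lam σ ∧ IsBlochEigenvalue ε ω b s ut σ (lam σ)
  isGreatest : IsGreatest {μ | ∃ σ, IsBlochEigenvalue ε ω b s ut σ μ} (lam σbar)

/-- The square `I × J = [σ̄₁, σ̄₁ + c] × [σ̄₂, σ̄₂ + c]`. -/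
def square (σbar : ℝ × ℝ) (c : ℝ) : Set (ℝ × ℝ) :=
  Set.Icc σbar.1 (σbar.1 + c) ×ˢ Set.Icc σbar.2 (σbar.2 + c)

/-- `W(·, σ)`, `σ` in the square of side `c`, is a family of eigenfunctions of `B(σ)` for the
eigenvalue `lam σ`, each given by its continuous representative, that depends continuously on `σ`
in `H²(𝕋)`. -/
structure IsEigenfunctionFamily (ε ω b s : ℝ) (ut : ℝ → ℝ) (σbar : ℝ × ℝ) (lam : ℝ × ℝ → ℝ)
    (c : ℝ) (W : ℝ × ℝ → ℝ → ℂ) : Prop where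
  continuous : ∀ σ ∈ square σbar c, Continuous (W σ)
  eigenfunction : ∀ σ ∈ square σbar c, IsBlochEigenfunction ε ω b s ut σ (lam σ) (W σ)
  tendsto : ∀ σ₀ ∈ square σbar c,
    Tendsto (fun σ => torusNorm 2 (W σ - W σ₀)) (𝓝[square σbar c] σ₀) (𝓝 0)

/-- `U(x, y) = ∫_{I×J} e^{i(σ₁x + σ₂y)} W(x, σ) dσ`. -/
def modeData (σbar : ℝ × ℝ) (W : ℝ × ℝ → ℝ → ℂ) (c₀ : ℝ) (p : Plane) : ℂ :=
  ∫ σ in square σbar c₀, Complex.exp (Complex.I * (σ.1 * p 0 + σ.2 * p 1)) * W σ (p 0)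

/-- `e(t) = (∫_{I×J} e^{2(λ(σ) - λ_M)t} dσ)^{1/2}`, with `λ_M = λ(σ̄)`. -/
def prefactor (σbar : ℝ × ℝ) (lam : ℝ × ℝ → ℝ) (c₀ t : ℝ) : ℝ :=
  Real.sqrt (∫ σ in square σbar c₀, Real.exp (2 * (lam σ - lam σbar) * t))

/-- The growth factor `e^{λ_M t} e(t)`. -/
def growth (σbar : ℝ × ℝ) (lam : ℝ × ℝ → ℝ) (c₀ t : ℝ) : ℝ :=
  Real.exp (lam σbar * t) * prefactor σbar lam c₀ t

/-! ### Evolution equations in the plane -/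

/-- The partial derivative in the `i`-th variable. -/
def partialD (i : Fin 2) (φ : Plane → ℝ) (p : Plane) : ℝ :=
  lineDeriv ℝ φ p (EuclideanSpace.single i 1)

/-- `𝒜 = 1 + (1 + 2εω)∂ₓ² + ∂_y²`, on test functions. -/
def opA (ε ω : ℝ) (φ : Plane → ℝ) (p : Plane) : ℝ :=
  φ p + (1 + 2 * ε * ω) * partialD 0 (partialD 0 φ) p + partialD 1 (partialD 1 φ) p

/-- `L = -𝒜²`, on test functions; it is formally self-adjoint. -/
def opL (ε ω : ℝ) (φ : Plane → ℝ) (p : Plane) : ℝ := -(opA ε ω (opA ε ω φ) p)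

/-- `u` solves `∂ₜu = Lu + G` in the weak sense at the times in `S` (an interval that starts
at `0`): tested against every `φ ∈ C_c^∞(ℝ²)` and integrated in time. -/
def IsWeakSolution (ε ω : ℝ) (S : Set ℝ) (u G : ℝ → Plane → ℂ) : Prop :=
  ∀ φ : Plane → ℝ, ContDiff ℝ (⊤ : ℕ∞) φ → HasCompactSupport φ → ∀ t ∈ S,
    ∫ p, u t p * (φ p : ℂ) = (∫ p, u 0 p * (φ p : ℂ)) +
      ∫ τ in (0 : ℝ)..t, ∫ p, (u τ p * (opL ε ω φ p : ℂ) + G τ p * (φ p : ℂ))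

/-- `f(z) = ε² z + b z² - s z³`. -/
def nonlin (ε b s : ℝ) (z : ℂ) : ℂ := ε ^ 2 * z + b * z ^ 2 - s * z ^ 3

/-- `-(3sũ - b) ∑_{k+l=j} V_k V_l - s ∑_{k+l+q=j} V_k V_l V_q` with all indices at least `1`. It is
`0` for `j = 1` and `-(3sũ - b) V₁²` for `j = 2`. -/
def profileForcing (b s : ℝ) (ut : ℝ → ℝ) (V : ℕ → ℝ → Plane → ℂ) (j : ℕ) (t : ℝ) (p : Plane) :
    ℂ :=
  -(3 * s * ut (p 0) - b) *
      (∑ k ∈ Finset.Icc 1 j, ∑ l ∈ Finset.Icc 1 j,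
        if k + l = j then V k t p * V l t p else 0) -
    s * (∑ k ∈ Finset.Icc 1 j, ∑ l ∈ Finset.Icc 1 j, ∑ q ∈ Finset.Icc 1 j,
        if k + l + q = j then V k t p * V l t p * V q t p else 0)

/-- `V₁, …, V_N ∈ C([0,∞); H²(ℝ²))` are the profiles of the approximate solution: with
`ℒ = L + f'(ũ)`, `V₁` solves `∂ₜV₁ = ℒV₁` with `V₁(0) = U`, and `V_j`, `2 ≤ j ≤ N`, solves
`∂ₜV_j = ℒV_j -(3sũ - b) ∑ V_k V_l - s ∑ V_k V_l V_q` with `V_j(0) = 0`. -/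
structure IsProfiles (ε ω b s : ℝ) (ut : ℝ → ℝ) (U : Plane → ℂ) (N : ℕ) (V : ℕ → ℝ → Plane → ℂ) :
    Prop where
  continuousInH2 : ∀ j ∈ Finset.Icc 1 N, ContinuousInH2 (Set.Ici 0) (V j)
  initial : ∀ j ∈ Finset.Icc 1 N, V j 0 =ᵐ[volume] if j = 1 then U else 0
  solution : ∀ j ∈ Finset.Icc 1 N, IsWeakSolution ε ω (Set.Ici 0) (V j)
    fun t p => (potential ε b s ut (p 0) : ℂ) * V j t p + profileForcing b s ut V j t p

/-- `V^app = ũ + ∑_{j=1}^N δʲ V_j`. -/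
def approx (ut : ℝ → ℝ) (N : ℕ) (V : ℕ → ℝ → Plane → ℂ) (δ t : ℝ) (p : Plane) : ℂ :=
  ut (p 0) + ∑ j ∈ Finset.Icc 1 N, (δ : ℂ) ^ j * V j t p

/-- `v` is the remainder on `[0, T]`: `v ∈ C([0,T]; H²(ℝ²))`, `v(0) = 0`, and `V^app + v` solves
`∂ₜu = Lu + ε² u + b u² - s u³` on `[0, T]`. -/
structure IsRemainder (ε ω b s : ℝ) (ut : ℝ → ℝ) (N : ℕ) (V : ℕ → ℝ → Plane → ℂ) (δ T : ℝ)
    (v : ℝ → Plane → ℂ) : Prop where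
  continuousInH2 : ContinuousInH2 (Set.Icc 0 T) v
  initial : v 0 =ᵐ[volume] 0
  solution : IsWeakSolution ε ω (Set.Icc 0 T) (fun t p => approx ut N V δ t p + v t p)
    fun t p => nonlin ε b s (approx ut N V δ t p + v t p)

/-- `T_M = sup {T > 0 | v exists on [0,T] and ‖v(t)‖_{H²} ≤ 1/2 for 0 ≤ t ≤ T}`, possibly `+∞`. -/
def maximalTime (ε ω b s : ℝ) (ut : ℝ → ℝ) (N : ℕ) (V : ℕ → ℝ → Plane → ℂ) (δ : ℝ) : EReal :=
  sSup ((fun T : ℝ => (T : EReal)) '' {T : ℝ | 0 < T ∧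
    ∃ v, IsRemainder ε ω b s ut N V δ T v ∧ ∀ t ∈ Set.Icc 0 T, h2Norm (v t) ≤ 1 / 2})

end

end GSHE

namespace GSHE

noncomputable section

/-! A function in H²(ℝ²) is encoded by its coordinate a, its Fourier transform times 1 + |2πξ|². The
H² norm becomes the L² norm of a, and a weak solution becomes an ordinary differential equation on
every ball of frequencies (`isWeakSolution_iff`). In two dimensions H² is an algebra (`prodH2`), and
f is a cubic polynomial, so the perturbation w of the roll solves exactly ∂ₜw = 𝓛w plus a quadratic
and a cubic term with bounded coefficient operators.

Linear estimate. The Bloch decomposition reduces the quadratic form of 𝓛 to those of the operators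
B(σ), which have compact resolvent; hence the bound λ_M on their eigenvalues bounds the form, ⟨𝓛z,
z⟩ ≤ λ_M‖z‖² (`bloch_form_le`, `form_le`). The energy ⟨(Λ - 𝓛)w, w⟩ is comparable with the squared
H² norm because 𝓛 is elliptic of order four, and along ∂ₜw = 𝓛w it grows at rate at most 2λ_M, by
the form bound and Cauchy–Schwarz (`exists_energyForm`). This gives a Duhamel estimate in H² with
the sharp rate λ_M and no polynomial loss (`exists_energy_estimate`).

Growth factor. The first profile is explicit: every Bloch wave in U is multiplied by e^{λ(σ)t}, and
so ‖V₁(t)‖ ≤ B G(t) with G(t)² = ∫ e^{2λ(σ)t} dσ (`exists_first_profile`). On a small square λ ≥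
¾λ_M, so G^j with j ≥ 2 grows strictly faster than e^{λ_M t}. The Duhamel integral of a forcing of
size G^j then costs only the factor 4/(jλ_M) (`HasEnergyEstimate.norm_le_pow`).

Profiles. With X = (B/η)G one proves ‖V_j‖ ≤ η j⁻² X^j by induction. The weight j⁻² is reproduced by
convolution up to a constant, so nothing deteriorates with N. The forcing is at least quadratic,
hence of size η², and a small η closes the induction (`IsCoordProfiles.norm_le`).

Remainder. It is driven by a residual of size (δX)^(N+1) and by terms that are bounded by a fixed
constant times the remainder itself. The latter are not small, but the factor 4/((N+1)λ_M) absorbs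
them once N is large. A continuity argument yields ‖v‖ ≤ (δX)^(N+1) for every remainder as long as
δX < 1 (`remainder_norm_le`). Existence up to the time when δX = 1/2, which lies beyond T^δ since θ
< 1/2, follows from solving a globally Lipschitz modification whose solution never feels the
modification (`exists_coord_remainder`). -/

/-- Square-integrable functions of the frequency variable. -/
abbrev FreqSpace : Type := Lp ℂ 2 (volume : Measure Plane)

/-! ### Multiplication operators -/

/-- Bounded measurable real functions on the plane. -/
structure BddMeas (h : Plane → ℝ) : Prop where
  meas : Measurable h
  bdd : ∃ C, ∀ ξ, |h ξ| ≤ C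

theorem BddMeas.mul {h k : Plane → ℝ} (hh : BddMeas h) (hk : BddMeas k) :
    BddMeas (fun ξ => h ξ * k ξ) := by
  obtain ⟨C, hC⟩ := hh.bdd
  obtain ⟨D, hD⟩ := hk.bdd
  refine ⟨hh.meas.mul hk.meas, C * D, fun ξ => ?_⟩
  rw [abs_mul]
  exact mul_le_mul (hC ξ) (hD ξ) (abs_nonneg _) ((abs_nonneg _).trans (hC ξ))

theorem BddMeas.add {h k : Plane → ℝ} (hh : BddMeas h) (hk : BddMeas k) :
    BddMeas (fun ξ => h ξ + k ξ) := by
  obtain ⟨C, hC⟩ := hh.bdd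
  obtain ⟨D, hD⟩ := hk.bdd
  exact ⟨hh.meas.add hk.meas, C + D, fun ξ => (abs_add_le _ _).trans (add_le_add (hC ξ) (hD ξ))⟩

theorem BddMeas.const (c : ℝ) : BddMeas (fun _ => c) :=
  ⟨measurable_const, |c|, fun _ => le_rfl⟩

theorem BddMeas.neg {h : Plane → ℝ} (hh : BddMeas h) : BddMeas (fun ξ => -h ξ) := by
  simpa using (BddMeas.const (-1)).mul hh

theorem BddMeas.const_mul {h : Plane → ℝ} (c : ℝ) (hh : BddMeas h) : BddMeas (fun ξ => c * h ξ) :=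
  (BddMeas.const c).mul hh

theorem BddMeas.exp {h : Plane → ℝ} (hh : BddMeas h) : BddMeas (fun ξ => Real.exp (h ξ)) := by
  obtain ⟨C, hC⟩ := hh.bdd
  refine ⟨Real.measurable_exp.comp hh.meas, Real.exp C, fun ξ => ?_⟩
  rw [abs_of_pos (Real.exp_pos _)]
  exact Real.exp_le_exp.2 ((le_abs_self _).trans (hC ξ))

theorem memLp_bdd_mul {h : Plane → ℝ} (hm : Measurable h) {C : ℝ} (hC : ∀ ξ, |h ξ| ≤ C)
    {f : Plane → ℂ} (hf : MemLp f 2) : MemLp (fun ξ => (h ξ : ℂ) * f ξ) 2 :=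
  hf.of_le_mul (c := C) ((Complex.measurable_ofReal.comp hm).aestronglyMeasurable.mul hf.1)
    (ae_of_all _ fun ξ => by
      rw [norm_mul, Complex.norm_real, Real.norm_eq_abs]
      exact mul_le_mul_of_nonneg_right (hC ξ) (norm_nonneg _))

open Classical in
/-- Multiplication by a bounded measurable real function (zero for other functions). -/
def mulOp (h : Plane → ℝ) : FreqSpace →L[ℂ] FreqSpace :=
  if hh : BddMeas h then
    LinearMap.mkContinuous
      { toFun := fun f => (memLp_bdd_mul hh.meas hh.bdd.choose_spec (Lp.memLp f)).toLp
        map_add' := fun f g => by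
          rw [← MemLp.toLp_add, MemLp.toLp_eq_toLp_iff]
          filter_upwards [Lp.coeFn_add f g] with ξ hξ
          rw [hξ, Pi.add_apply, Pi.add_apply, mul_add]
        map_smul' := fun c f => by
          rw [RingHom.id_apply, ← MemLp.toLp_const_smul, MemLp.toLp_eq_toLp_iff]
          filter_upwards [Lp.coeFn_smul c f] with ξ hξ
          simp [hξ, mul_left_comm] } hh.bdd.choose
      (fun f => by
        refine Lp.norm_le_mul_norm_of_ae_le_mul ?_
        filter_upwards [MemLp.coeFn_toLp
          (memLp_bdd_mul hh.meas hh.bdd.choose_spec (Lp.memLp f))] with ξ hξ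
        simp only [LinearMap.coe_mk, AddHom.coe_mk]
        rw [hξ, norm_mul, Complex.norm_real, Real.norm_eq_abs]
        exact mul_le_mul_of_nonneg_right (hh.bdd.choose_spec ξ) (norm_nonneg _))
  else 0

theorem coeFn_mulOp {h : Plane → ℝ} (hh : BddMeas h) (f : FreqSpace) :
    mulOp h f =ᵐ[volume] fun ξ => (h ξ : ℂ) * f ξ := by
  rw [mulOp, dif_pos hh]
  exact MemLp.coeFn_toLp (memLp_bdd_mul hh.meas hh.bdd.choose_spec (Lp.memLp f))

theorem norm_mulOp_apply_le {h : Plane → ℝ} (hm : Measurable h) {C : ℝ} (hC : ∀ ξ, |h ξ| ≤ C)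
    (f : FreqSpace) : ‖mulOp h f‖ ≤ C * ‖f‖ := by
  refine Lp.norm_le_mul_norm_of_ae_le_mul ?_
  filter_upwards [coeFn_mulOp ⟨hm, C, hC⟩ f] with ξ hξ
  rw [hξ, norm_mul, Complex.norm_real, Real.norm_eq_abs]
  exact mul_le_mul_of_nonneg_right (hC ξ) (norm_nonneg _)

theorem norm_mulOp_le {h : Plane → ℝ} (hm : Measurable h) {C : ℝ} (hC : ∀ ξ, |h ξ| ≤ C) :
    ‖mulOp h‖ ≤ C :=
  ContinuousLinearMap.opNorm_le_bound _ ((abs_nonneg _).trans (hC 0))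
    (norm_mulOp_apply_le hm hC)

theorem mulOp_mulOp {h k : Plane → ℝ} (hh : BddMeas h) (hk : BddMeas k) (f : FreqSpace) :
    mulOp h (mulOp k f) = mulOp (fun ξ => h ξ * k ξ) f := by
  refine Lp.ext ?_
  filter_upwards [coeFn_mulOp hh (mulOp k f), coeFn_mulOp hk f, coeFn_mulOp (hh.mul hk) f]
    with ξ h1 h2 h3
  rw [h1, h2, h3]; push_cast; ring

theorem mulOp_comm {h k : Plane → ℝ} (hh : BddMeas h) (hk : BddMeas k) (f : FreqSpace) :
    mulOp h (mulOp k f) = mulOp k (mulOp h f) := by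
  rw [mulOp_mulOp hh hk, mulOp_mulOp hk hh]
  simp only [mul_comm]

theorem mulOp_add {h k : Plane → ℝ} (hh : BddMeas h) (hk : BddMeas k) (f : FreqSpace) :
    mulOp (fun ξ => h ξ + k ξ) f = mulOp h f + mulOp k f := by
  refine Lp.ext ?_
  filter_upwards [coeFn_mulOp hh f, coeFn_mulOp hk f, coeFn_mulOp (hh.add hk) f,
    Lp.coeFn_add (mulOp h f) (mulOp k f)] with ξ h1 h2 h3 h4
  rw [h3, h4, Pi.add_apply, h1, h2]; push_cast; ring

theorem mulOp_const (c : ℝ) (f : FreqSpace) : mulOp (fun _ => c) f = (c : ℂ) • f := by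
  refine Lp.ext ?_
  filter_upwards [coeFn_mulOp (BddMeas.const c) f, Lp.coeFn_smul (c : ℂ) f] with ξ h1 h2
  rw [h1, h2]; simp

theorem mulOp_neg {h : Plane → ℝ} (hh : BddMeas h) (f : FreqSpace) :
    mulOp (fun ξ => -h ξ) f = -mulOp h f := by
  refine Lp.ext ?_
  filter_upwards [coeFn_mulOp hh f, coeFn_mulOp hh.neg f, Lp.coeFn_neg (mulOp h f)] with ξ h1 h2 h3
  rw [h2, h3, Pi.neg_apply, h1]; simp

theorem mulOp_const_mul {h : Plane → ℝ} (hh : BddMeas h) (c : ℝ) (f : FreqSpace) :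
    mulOp (fun ξ => c * h ξ) f = (c : ℂ) • mulOp h f := by
  rw [← mulOp_mulOp (BddMeas.const c) hh, mulOp_const]

theorem inner_mulOp_left {h : Plane → ℝ} (hh : BddMeas h) (f g : FreqSpace) :
    inner ℂ (mulOp h f) g = inner ℂ f (mulOp h g) := by
  rw [L2.inner_def, L2.inner_def]
  refine integral_congr_ae ?_
  filter_upwards [coeFn_mulOp hh f, coeFn_mulOp hh g] with ξ h1 h2
  rw [h1, h2]
  simp only [RCLike.inner_apply, map_mul, Complex.conj_ofReal]
  ring

/-- Dominated convergence for multiplication operators. -/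
theorem tendsto_mulOp {ι : Type*} {l : Filter ι} [l.IsCountablyGenerated] {h : ι → Plane → ℝ}
    {h₀ : Plane → ℝ} {C : ℝ} (hm : ∀ i, Measurable (h i)) (hC : ∀ i ξ, |h i ξ| ≤ C)
    (hm₀ : Measurable h₀) (hC₀ : ∀ ξ, |h₀ ξ| ≤ C)
    (hlim : ∀ ξ, Tendsto (fun i => h i ξ) l (𝓝 (h₀ ξ))) (f : FreqSpace) :
    Tendsto (fun i => mulOp (h i) f) l (𝓝 (mulOp h₀ f)) := by
  rw [tendsto_iff_norm_sub_tendsto_zero]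
  have hsq : ∀ i, ‖mulOp (h i) f - mulOp h₀ f‖ =
      Real.sqrt (∫ ξ, (h i ξ - h₀ ξ) ^ 2 * ‖f ξ‖ ^ 2) := by
    intro i
    rw [eq_comm, Real.sqrt_eq_iff_eq_sq
      (integral_nonneg fun ξ => mul_nonneg (sq_nonneg _) (sq_nonneg _)) (norm_nonneg _)]
    have := @inner_self_eq_norm_sq ℂ _ _ _ _ (mulOp (h i) f - mulOp h₀ f)
    rw [← this, L2.inner_def, ← integral_re]
    · refine integral_congr_ae ?_
      filter_upwards [coeFn_mulOp ⟨hm i, C, hC i⟩ f, coeFn_mulOp ⟨hm₀, C, hC₀⟩ f,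
        Lp.coeFn_sub (mulOp (h i) f) (mulOp h₀ f)] with ξ h1 h2 h3
      rw [h3, Pi.sub_apply, h1, h2, inner_self_eq_norm_sq, ← sub_mul, norm_mul, mul_pow,
        ← Complex.ofReal_sub, Complex.norm_real, Real.norm_eq_abs, sq_abs]
    · exact L2.integrable_inner _ _
  simp_rw [hsq]
  have hint : Integrable (fun ξ => ‖f ξ‖ ^ 2) := (Lp.memLp f).integrable_norm_pow (by norm_num)
  have : Tendsto (fun i => ∫ ξ, (h i ξ - h₀ ξ) ^ 2 * ‖f ξ‖ ^ 2) l (𝓝 (∫ _ : Plane, (0 : ℝ))) := by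
    refine tendsto_integral_filter_of_dominated_convergence (fun ξ => (C + C) ^ 2 * ‖f ξ‖ ^ 2)
      (Eventually.of_forall fun i => ?_) (Eventually.of_forall fun i => ae_of_all _ fun ξ => ?_)
      (hint.const_mul _) (ae_of_all _ fun ξ => ?_)
    · exact (((hm i).sub hm₀).pow_const 2).aestronglyMeasurable.mul hint.1
    · rw [Real.norm_of_nonneg (by positivity)]
      refine mul_le_mul_of_nonneg_right ?_ (by positivity)
      refine sq_le_sq' ?_ ?_
      · linarith [abs_le.1 (hC i ξ), abs_le.1 (hC₀ ξ)]
      · linarith [abs_le.1 (hC i ξ), abs_le.1 (hC₀ ξ)]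
    · have := (((hlim ξ).sub_const (h₀ ξ)).pow 2).mul_const (‖f ξ‖ ^ 2)
      simpa using this
  simpa [Function.comp_def] using (Real.continuous_sqrt.tendsto _).comp this

/-! ### The weight and reconstruction of functions in `H²` -/

/-- The Fourier multiplier `1 + |2πξ|²` of `1 - Δ`. -/
def wt (ξ : Plane) : ℝ := 1 + (2 * Real.pi * ‖ξ‖) ^ 2

theorem continuous_wt : Continuous wt := by unfold wt; fun_prop

theorem one_le_wt (ξ : Plane) : 1 ≤ wt ξ := by unfold wt; nlinarith [sq_nonneg (2 * Real.pi * ‖ξ‖)]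

theorem wt_pos (ξ : Plane) : 0 < wt ξ := zero_lt_one.trans_le (one_le_wt ξ)

theorem wt_ne_zero (ξ : Plane) : (wt ξ : ℂ) ≠ 0 := by exact_mod_cast (wt_pos ξ).ne'

theorem continuous_wt_inv : Continuous fun ξ => (wt ξ)⁻¹ :=
  continuous_wt.inv₀ fun ξ => (wt_pos ξ).ne'

theorem bddMeas_wt_inv : BddMeas fun ξ => (wt ξ)⁻¹ :=
  ⟨continuous_wt_inv.measurable, 1, fun ξ => by
    rw [abs_of_pos (inv_pos.2 (wt_pos ξ))]
    exact inv_le_one_of_one_le₀ (one_le_wt ξ)⟩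

/-- This is where dimension two enters: the square of `wt⁻¹` decays like |ξ|⁻⁴, and 4 > 2. It makes
H² consist of bounded continuous functions and form an algebra. -/
theorem memLp_wt_inv : MemLp (fun ξ => ((wt ξ)⁻¹ : ℝ)) 2 (volume : Measure Plane) := by
  refine (memLp_two_iff_integrable_sq continuous_wt_inv.aestronglyMeasurable).2 ?_
  have h := integrable_rpow_neg_one_add_norm_sq (E := Plane) (μ := volume) (r := 4)
    (by rw [finrank_euclideanSpace_fin]; norm_num)
  refine h.mono' (continuous_wt_inv.pow 2).aestronglyMeasurable (ae_of_all _ fun ξ => ?_)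
  have h1 : (1 : ℝ) + ‖ξ‖ ^ 2 ≤ wt ξ := by
    have : (1 : ℝ) ≤ (2 * Real.pi) ^ 2 := by nlinarith [Real.pi_gt_three]
    unfold wt; rw [mul_pow]; nlinarith [sq_nonneg ‖ξ‖]
  have h0 : (0 : ℝ) < 1 + ‖ξ‖ ^ 2 := by positivity
  rw [Real.norm_of_nonneg (by positivity), show (-4 / 2 : ℝ) = ((-2 : ℤ) : ℝ) by norm_num,
    Real.rpow_intCast, zpow_neg, inv_pow]
  exact inv_anti₀ (by positivity) (by exact_mod_cast pow_le_pow_left₀ h0.le h1 2)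

/-- The Fourier transform of the function with coordinate `a`. -/
def hatOp : FreqSpace →L[ℂ] FreqSpace := mulOp fun ξ => (wt ξ)⁻¹

theorem coeFn_hatOp (a : FreqSpace) : hatOp a =ᵐ[volume] fun ξ => ((wt ξ)⁻¹ : ℂ) * a ξ := by
  filter_upwards [coeFn_mulOp bddMeas_wt_inv a] with ξ h
  rw [hatOp, h]; push_cast; rfl

/-- The `L²` norm of `(1 + |2πξ|²)⁻¹`. -/
def wtConst : ℝ := ‖(memLp_wt_inv.toLp : Lp ℝ 2 (volume : Measure Plane))‖

theorem integrable_wt_inv_mul (a : FreqSpace) :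
    Integrable fun ξ => ((wt ξ)⁻¹ : ℂ) * a ξ := by
  have h : MemLp (fun ξ => ((wt ξ)⁻¹ : ℂ)) 2 (volume : Measure Plane) := by
    simpa using memLp_wt_inv.ofReal (K := ℂ)
  exact h.integrable_mul (Lp.memLp a)

theorem integral_norm_wt_inv_mul_le (a : FreqSpace) :
    ∫ ξ, ‖((wt ξ)⁻¹ : ℂ) * a ξ‖ ≤ wtConst * ‖a‖ := by
  have h2 : MemLp (fun ξ => ‖a ξ‖) 2 := (Lp.memLp a).norm
  have h3 : ∫ ξ, ‖((wt ξ)⁻¹ : ℂ) * a ξ‖ = inner ℝ (memLp_wt_inv.toLp) (h2.toLp) := by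
    rw [L2.inner_def]
    refine integral_congr_ae ?_
    filter_upwards [memLp_wt_inv.coeFn_toLp, h2.coeFn_toLp] with ξ h4 h5
    rw [h4, h5, norm_mul, ← Complex.ofReal_inv, Complex.norm_real,
      Real.norm_of_nonneg (inv_nonneg.2 (wt_pos ξ).le)]
    simp [mul_comm]
  rw [h3]
  refine (real_inner_le_norm _ _).trans (mul_le_mul_of_nonneg_left ?_ (norm_nonneg _))
  rw [Lp.norm_toLp, Lp.norm_def, eLpNorm_norm]

theorem wtConst_nonneg : 0 ≤ wtConst := norm_nonneg _

/-- The function in `H²` with coordinate `a`, i.e. with Fourier transform `(1 + |2πξ|²)⁻¹ a`. -/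
def recon (a : FreqSpace) (x : Plane) : ℂ := 𝓕⁻ (fun ξ : Plane => ((wt ξ)⁻¹ : ℂ) * a ξ) x

theorem recon_eq (a : FreqSpace) (x : Plane) :
    recon a x = ∫ ξ : Plane, Real.fourierChar (inner ℝ ξ x) • (((wt ξ)⁻¹ : ℂ) * a ξ) :=
  Real.fourierInv_eq _ _

theorem norm_recon_le (a : FreqSpace) (x : Plane) : ‖recon a x‖ ≤ wtConst * ‖a‖ := by
  rw [recon_eq]
  refine (norm_integral_le_integral_norm _).trans ?_
  simp only [Circle.norm_smul]
  exact integral_norm_wt_inv_mul_le a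

theorem recon_add (a b : FreqSpace) (x : Plane) : recon (a + b) x = recon a x + recon b x := by
  have h : ∀ c : FreqSpace, Integrable fun ξ : Plane =>
      Real.fourierChar (inner ℝ ξ x) • (((wt ξ)⁻¹ : ℂ) * c ξ) := fun c => by
    have := (Real.fourierIntegral_convergent_iff (V := Plane) (μ := volume) (-x)).2
      (integrable_wt_inv_mul c)
    simpa using this
  rw [recon_eq, recon_eq, recon_eq, ← integral_add (h a) (h b)]
  refine integral_congr_ae ?_
  filter_upwards [Lp.coeFn_add a b] with ξ hξ
  rw [hξ, Pi.add_apply, mul_add, smul_add]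

theorem recon_smul (c : ℂ) (a : FreqSpace) (x : Plane) : recon (c • a) x = c * recon a x := by
  rw [recon_eq, recon_eq, ← integral_const_mul]
  refine integral_congr_ae ?_
  filter_upwards [Lp.coeFn_smul c a] with ξ hξ
  rw [hξ, Pi.smul_apply, smul_eq_mul, Circle.smul_def, Circle.smul_def, smul_eq_mul, smul_eq_mul]
  ring

/-- Evaluation of the function with coordinate `a` at a point, as a continuous functional. -/
def evalAt (x : Plane) : FreqSpace →L[ℂ] ℂ :=
  LinearMap.mkContinuous
    { toFun := fun a => recon a x
      map_add' := fun a b => recon_add a b x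
      map_smul' := fun c a => recon_smul c a x } wtConst (fun a => norm_recon_le a x)

@[simp] theorem evalAt_apply (x : Plane) (a : FreqSpace) : evalAt x a = recon a x := rfl

theorem continuous_recon (a : FreqSpace) : Continuous (recon a) := by
  have h := (Real.Lp.fourierTransformInv ((memLp_one_iff_integrable.2
    (integrable_wt_inv_mul a)).toLp)).continuous
  rw [Real.Lp.coe_fourierTransformInv] at h
  refine h.congr fun x => ?_
  exact Real.fourierInv_congr_ae (MemLp.coeFn_toLp _) x

theorem integral_smul_fourierInv (φ : SchwartzMap Plane ℂ) {g : Plane → ℂ} (hg : Integrable g) :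
    ∫ x, φ x * 𝓕⁻ g x = ∫ ξ, (𝓕⁻ φ) ξ * g ξ := by
  have h := VectorFourier.integral_fourierIntegral_smul_eq_flip (e := Real.fourierChar)
    (μ := (volume : Measure Plane)) (ν := (volume : Measure Plane)) (L := -(innerₗ Plane))
    (f := φ) (g := g) Real.continuous_fourierChar (continuous_inner.neg) φ.integrable hg
  rw [SchwartzMap.fourierInv_coe]
  have e1 : ∀ ξ, 𝓕⁻ (φ : Plane → ℂ) ξ =
      VectorFourier.fourierIntegral Real.fourierChar volume (-(innerₗ Plane)) φ ξ := fun ξ => by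
    rw [Real.fourierInv_eq, VectorFourier.fourierIntegral]; simp
  have e2 : ∀ x, 𝓕⁻ g x =
      VectorFourier.fourierIntegral Real.fourierChar volume (-(innerₗ Plane)).flip g x := fun x => by
    rw [Real.fourierInv_eq, VectorFourier.fourierIntegral]; simp [real_inner_comm]
  simp only [e1, e2]
  simpa [smul_eq_mul] using h.symm

/-- The inversion integral and the inverse Fourier transform on L² are both transposes of the
inverse transform on Schwartz functions. They therefore have the same integrals against test
functions, and these determine a locally integrable function. -/
theorem recon_ae_eq (a : FreqSpace) : recon a =ᵐ[volume] (𝓕⁻ (hatOp a) : FreqSpace) := by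
  refine ae_eq_of_integral_contDiff_smul_eq (continuous_recon a).locallyIntegrable
    ((Lp.memLp _).locallyIntegrable (by norm_num)) fun φ hφ hφc => ?_
  let ψ : SchwartzMap Plane ℂ := (hφc.comp_left (g := fun r : ℝ => (r : ℂ)) rfl).toSchwartzMap
    (Complex.ofRealCLM.contDiff.comp hφ)
  have h1 : ∀ x, ψ x = (φ x : ℂ) := fun x => rfl
  have h2 := congrArg (fun T => T ψ) (Lp.fourierInv_toTemperedDistribution_eq (hatOp a))
  simp only [TemperedDistribution.fourierInv_apply, Lp.toTemperedDistribution_apply, h1] at h2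
  have h3 := integral_smul_fourierInv ψ (integrable_wt_inv_mul a)
  simp only [h1] at h3
  calc ∫ x, φ x • recon a x = ∫ x, (φ x : ℂ) * recon a x := by simp
    _ = ∫ ξ : Plane, (𝓕⁻ ψ : SchwartzMap Plane ℂ) ξ * (((wt ξ)⁻¹ : ℂ) * a ξ) := h3
    _ = ∫ ξ, (𝓕⁻ ψ : SchwartzMap Plane ℂ) ξ • (hatOp a) ξ := by
        refine integral_congr_ae ?_
        filter_upwards [coeFn_hatOp a] with ξ hξ
        rw [hξ, smul_eq_mul]
    _ = _ := h2
    _ = _ := by simp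

theorem memLp_recon (a : FreqSpace) : MemLp (recon a) 2 :=
  (memLp_congr_ae (recon_ae_eq a)).2 (Lp.memLp _)

theorem fourier_toLp_recon (a : FreqSpace) (h : MemLp (recon a) 2) :
    (𝓕 h.toLp : FreqSpace) = hatOp a := by
  have : (h.toLp : FreqSpace) = 𝓕⁻ (hatOp a) :=
    Lp.ext ((h.coeFn_toLp).trans (recon_ae_eq a))
  rw [this, FourierTransform.fourier_fourierInv_eq]

theorem h2Norm_congr {f g : Plane → ℂ} (h : f =ᵐ[volume] g) : h2Norm f = h2Norm g := by
  unfold h2Norm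
  by_cases hf : MemLp f 2 volume
  · have hg := (memLp_congr_ae h).1 hf
    rw [dif_pos hf, dif_pos hg, MemLp.toLp_congr hf hg h]
  · have hg : ¬ MemLp g 2 volume := fun hg => hf ((memLp_congr_ae h).2 hg)
    rw [dif_neg hf, dif_neg hg]

theorem ofReal_norm_eq_lintegral (a : FreqSpace) :
    ENNReal.ofReal ‖a‖ = (∫⁻ ξ, ENNReal.ofReal (‖a ξ‖ ^ 2)) ^ (1 / 2 : ℝ) := by
  rw [Lp.norm_def, ENNReal.ofReal_toReal (Lp.eLpNorm_ne_top a),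
    eLpNorm_eq_lintegral_rpow_enorm_toReal (by norm_num) (by norm_num)]
  simp only [ENNReal.toReal_ofNat]
  congr 1
  refine lintegral_congr fun ξ => ?_
  rw [ENNReal.ofReal_pow (norm_nonneg _), ofReal_norm]
  norm_num

/-- The weight put into the coordinate cancels the weight of the norm. Together with
`exists_recon_of_h2Norm_lt_top` this identifies H² isometrically with L². -/
theorem h2Norm_recon (a : FreqSpace) : h2Norm (recon a) = ENNReal.ofReal ‖a‖ := by
  unfold h2Norm
  rw [dif_pos (memLp_recon a), fourier_toLp_recon a (memLp_recon a), ofReal_norm_eq_lintegral]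
  congr 1
  refine lintegral_congr_ae ?_
  filter_upwards [coeFn_hatOp a] with ξ hξ
  rw [hξ, norm_mul, mul_pow ‖((wt ξ : ℂ))⁻¹‖, ← mul_assoc, ← Complex.ofReal_inv,
    Complex.norm_real, Real.norm_eq_abs, sq_abs, ← mul_pow]
  have : (1 + (2 * Real.pi * ‖ξ‖) ^ 2) * (wt ξ)⁻¹ = 1 := mul_inv_cancel₀ (wt_pos ξ).ne'
  rw [this, one_pow, one_mul]

theorem exists_recon_of_h2Norm_lt_top {f : Plane → ℂ} (hf : h2Norm f < ⊤) :
    ∃ a : FreqSpace, f =ᵐ[volume] recon a := by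
  unfold h2Norm at hf
  by_cases h : MemLp f 2 volume
  · rw [dif_pos h] at hf
    set g : FreqSpace := 𝓕 h.toLp with hg
    have hfin : (∫⁻ ξ : Plane, ENNReal.ofReal ((1 + (2 * Real.pi * ‖ξ‖) ^ 2) ^ 2 * ‖g ξ‖ ^ 2)) < ⊤ := by
      by_contra hcon
      rw [not_lt, top_le_iff] at hcon
      rw [hcon, ENNReal.top_rpow_of_pos (by norm_num)] at hf
      exact lt_irrefl _ hf
    have hm : MemLp (fun ξ => (wt ξ : ℂ) * g ξ) 2 := by
      have hms : AEStronglyMeasurable (fun ξ => (wt ξ : ℂ) * g ξ) volume :=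
        (Complex.continuous_ofReal.comp continuous_wt).aestronglyMeasurable.mul (Lp.memLp g).1
      refine ⟨hms, ?_⟩
      rw [eLpNorm_eq_lintegral_rpow_enorm_toReal (by norm_num) (by norm_num)]
      refine ENNReal.rpow_lt_top_of_nonneg (by norm_num) (ne_of_lt ?_)
      refine lt_of_eq_of_lt (lintegral_congr fun ξ => ?_) hfin
      rw [← ofReal_norm, ENNReal.toReal_ofNat, ENNReal.rpow_ofNat, ← ENNReal.ofReal_pow (norm_nonneg _),
        norm_mul, mul_pow, Complex.norm_real, Real.norm_eq_abs, sq_abs]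
      rfl
    refine ⟨hm.toLp, ?_⟩
    have hh : hatOp hm.toLp = g := by
      refine Lp.ext ?_
      filter_upwards [coeFn_hatOp hm.toLp, hm.coeFn_toLp] with ξ h1 h2
      rw [h1, h2, ← mul_assoc, inv_mul_cancel₀ (wt_ne_zero ξ), one_mul]
    refine EventuallyEq.trans ?_ (recon_ae_eq _).symm
    rw [hh, hg, FourierTransform.fourierInv_fourier_eq]
    exact h.coeFn_toLp.symm
  · rw [dif_neg h] at hf
    exact absurd hf (lt_irrefl _)

theorem recon_sub (a b : FreqSpace) (x : Plane) : recon (a - b) x = recon a x - recon b x :=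
  (evalAt x).map_sub a b

theorem recon_injective {a b : FreqSpace} (h : recon a =ᵐ[volume] recon b) : a = b := by
  have h1 : h2Norm (recon (a - b)) = h2Norm (recon 0) := h2Norm_congr <| by
    filter_upwards [h] with x hx
    rw [recon_sub, hx, sub_self, ← evalAt_apply, map_zero]
  rw [h2Norm_recon, h2Norm_recon, norm_zero, ENNReal.ofReal_zero, ENNReal.ofReal_eq_zero] at h1
  exact sub_eq_zero.1 (norm_le_zero_iff.1 h1)

end

noncomputable section

/-! ### Products of functions in `H²` -/

/-- Young's inequality `L² * L¹ ⊆ L²` for nonnegative functions. -/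
theorem lintegral_conv_sq_le {F G : Plane → ℝ≥0∞} (hF : AEMeasurable F) (hG : AEMeasurable G) :
    ∫⁻ ξ, (∫⁻ t, G t * F (ξ - t)) ^ 2 ≤ (∫⁻ t, G t) ^ 2 * ∫⁻ ξ, F ξ ^ 2 := by
  have hFs : ∀ ξ : Plane, AEMeasurable fun t => F (ξ - t) := fun ξ =>
    hF.comp_quasiMeasurePreserving (quasiMeasurePreserving_sub_left volume ξ)
  have hCS : ∀ ξ : Plane, (∫⁻ t, G t * F (ξ - t)) ^ 2 ≤
      (∫⁻ t, G t) * ∫⁻ t, G t * F (ξ - t) ^ 2 := by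
    intro ξ
    -- Cauchy–Schwarz for the measure G(t) dt, applied to the functions 1 and F(ξ - t).
    have h := ENNReal.lintegral_mul_le_Lp_mul_Lq volume (p := 2) (q := 2)
      Real.HolderConjugate.two_two (f := fun t => G t ^ (1 / 2 : ℝ))
      (g := fun t => G t ^ (1 / 2 : ℝ) * F (ξ - t)) (hG.pow_const _) ((hG.pow_const _).mul (hFs ξ))
    have e0 : ∀ x : ℝ≥0∞, (x ^ (1 / 2 : ℝ)) ^ (2 : ℝ) = x := fun x => by
      rw [← ENNReal.rpow_mul]; norm_num
    have e1 : ∀ x : ℝ≥0∞, x ^ (1 / 2 : ℝ) * x ^ (1 / 2 : ℝ) = x := fun x => by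
      rw [← ENNReal.rpow_add_of_nonneg _ _ (by norm_num) (by norm_num)]; norm_num
    simp only [Pi.mul_apply, ← mul_assoc, e1, ENNReal.mul_rpow_of_nonneg _ _ zero_le_two, e0] at h
    have h2 := ENNReal.rpow_le_rpow h (z := 2) zero_le_two
    rw [ENNReal.mul_rpow_of_nonneg _ _ zero_le_two, e0, e0] at h2
    simpa only [ENNReal.rpow_ofNat] using h2
  have hmeas : AEMeasurable (Function.uncurry fun (ξ t : Plane) => G t * F (ξ - t) ^ 2)
      (volume.prod volume) := by
    refine AEMeasurable.mul ?_ (AEMeasurable.pow_const ?_ 2)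
    · exact hG.comp_quasiMeasurePreserving Measure.quasiMeasurePreserving_snd
    · exact hF.comp_quasiMeasurePreserving
        (quasiMeasurePreserving_sub_of_right_invariant volume volume)
  calc ∫⁻ ξ, (∫⁻ t, G t * F (ξ - t)) ^ 2
      ≤ ∫⁻ ξ, (∫⁻ t, G t) * ∫⁻ t, G t * F (ξ - t) ^ 2 := lintegral_mono hCS
    _ = (∫⁻ t, G t) * ∫⁻ ξ, ∫⁻ t, G t * F (ξ - t) ^ 2 :=
        lintegral_const_mul'' _ hmeas.lintegral_prod_right'
    _ = (∫⁻ t, G t) * ∫⁻ t, ∫⁻ ξ, G t * F (ξ - t) ^ 2 := by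
        rw [lintegral_lintegral_swap hmeas]
    _ = (∫⁻ t, G t) * ∫⁻ t, G t * ∫⁻ ξ, F ξ ^ 2 := by
        congr 1
        refine lintegral_congr fun t => ?_
        rw [lintegral_const_mul'', lintegral_sub_right_eq_self (fun ξ => F ξ ^ 2) t]
        exact (hF.comp_quasiMeasurePreserving
          (measurePreserving_sub_right volume t).quasiMeasurePreserving).pow_const 2
    _ = _ := by
        rw [lintegral_mul_const'' _ hG, sq, mul_assoc]

theorem ennreal_add_sq_le (x y : ℝ≥0∞) : (x + y) ^ 2 ≤ 2 * (x ^ 2 + y ^ 2) := by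
  have h := ENNReal.rpow_add_le_mul_rpow_add_rpow x y (p := 2) one_le_two
  norm_num at h
  exact h

/-- In a convolution this moves the weight onto one of the factors, where it cancels `wt⁻¹` and
leaves an L² function, while the other factor stays integrable. -/
theorem wt_le_two_mul (ξ t : Plane) : wt ξ ≤ 2 * (wt t + wt (ξ - t)) := by
  have h : ‖ξ‖ ≤ ‖t‖ + ‖ξ - t‖ := by simpa using norm_add_le t (ξ - t)
  have h2 : ‖ξ‖ ^ 2 ≤ 2 * (‖t‖ ^ 2 + ‖ξ - t‖ ^ 2) :=
    (pow_le_pow_left₀ (norm_nonneg _) h 2).trans (add_sq_le)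
  unfold wt
  have := mul_le_mul_of_nonneg_left h2 (sq_nonneg (2 * Real.pi))
  rw [mul_pow, mul_pow, mul_pow]
  nlinarith

theorem lintegral_enorm_sq (a : FreqSpace) : ∫⁻ ξ, ‖a ξ‖ₑ ^ 2 = ENNReal.ofReal ‖a‖ ^ 2 := by
  rw [ofReal_norm_eq_lintegral, ← ENNReal.rpow_ofNat, ← ENNReal.rpow_mul]
  norm_num

theorem lintegral_enorm_wt_inv_mul_le (a : FreqSpace) :
    ∫⁻ ξ, ‖((wt ξ)⁻¹ : ℂ) * a ξ‖ₑ ≤ ENNReal.ofReal (wtConst * ‖a‖) := by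
  rw [← ofReal_integral_norm_eq_lintegral_enorm (integrable_wt_inv_mul a)]
  exact ENNReal.ofReal_le_ofReal (integral_norm_wt_inv_mul_le a)

/-- Fourier transform of the product of the functions with coordinates `a` and `b`, times `wt`. -/
def mulFun (a b : FreqSpace) (ξ : Plane) : ℂ :=
  (wt ξ : ℂ) * convolution (fun ξ => ((wt ξ)⁻¹ : ℂ) * a ξ) (fun ξ => ((wt ξ)⁻¹ : ℂ) * b ξ)
    (ContinuousLinearMap.mul ℂ ℂ) volume ξ

theorem aestronglyMeasurable_mulFun (a b : FreqSpace) :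
    AEStronglyMeasurable (mulFun a b) volume :=
  (Complex.continuous_ofReal.comp continuous_wt).aestronglyMeasurable.mul
    ((integrable_wt_inv_mul a).integrable_convolution (ContinuousLinearMap.mul ℂ ℂ)
      (integrable_wt_inv_mul b)).1

theorem enorm_mulFun_le (a b : FreqSpace) (ξ : Plane) : ‖mulFun a b ξ‖ₑ ≤
    2 * ((∫⁻ t, ‖((wt t)⁻¹ : ℂ) * b t‖ₑ * ‖a (ξ - t)‖ₑ) +
      ∫⁻ t, ‖((wt t)⁻¹ : ℂ) * a t‖ₑ * ‖b (ξ - t)‖ₑ) := by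
  have hma : ∀ c : FreqSpace, AEMeasurable fun t => ‖c t‖ₑ := fun c => (Lp.memLp c).1.enorm
  have hmw : ∀ c : FreqSpace, AEMeasurable fun t => ‖((wt t)⁻¹ : ℂ) * c t‖ₑ := fun c =>
    (integrable_wt_inv_mul c).1.enorm
  -- The substitution t ↦ ξ - t restores the order of the factors in the convolution. The statement
  -- has the integrable factor first in both terms, ready for Young's inequality.
  have h1 : (∫⁻ t, ‖((wt t)⁻¹ : ℂ) * b t‖ₑ * ‖a (ξ - t)‖ₑ) =
      ∫⁻ t, ‖a t‖ₑ * ‖((wt (ξ - t))⁻¹ : ℂ) * b (ξ - t)‖ₑ := by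
    rw [← lintegral_sub_left_eq_self _ ξ]
    refine lintegral_congr fun t => ?_
    rw [sub_sub_cancel, mul_comm]
  rw [h1, ← lintegral_add_left', ← lintegral_const_mul'']
  · rw [mulFun, convolution, enorm_mul]
    refine (mul_le_mul_right (enorm_integral_le_lintegral_enorm _) _).trans ?_
    rw [← lintegral_const_mul' _ _ enorm_ne_top]
    refine lintegral_mono fun t => ?_
    simp only [ContinuousLinearMap.mul_apply', enorm_mul]
    rw [← ofReal_norm (wt ξ : ℂ), Complex.norm_real, Real.norm_of_nonneg (wt_pos ξ).le]
    have hw := ENNReal.ofReal_le_ofReal (wt_le_two_mul ξ t)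
    rw [ENNReal.ofReal_mul zero_le_two, ENNReal.ofReal_add (wt_pos _).le (wt_pos _).le] at hw
    have hc : ∀ η : Plane, ENNReal.ofReal (wt η) * ‖((wt η : ℂ))⁻¹‖ₑ = 1 := fun η => by
      rw [← ofReal_norm, ← Complex.ofReal_inv, Complex.norm_real,
        Real.norm_of_nonneg (inv_nonneg.2 (wt_pos η).le), ← ENNReal.ofReal_mul (wt_pos η).le,
        mul_inv_cancel₀ (wt_pos η).ne', ENNReal.ofReal_one]
    have h2 : ENNReal.ofReal 2 = 2 := by norm_num
    rw [h2] at hw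
    calc _ ≤ 2 * (ENNReal.ofReal (wt t) + ENNReal.ofReal (wt (ξ - t))) *
          (‖((wt t : ℂ))⁻¹‖ₑ * ‖a t‖ₑ * (‖((wt (ξ - t) : ℂ))⁻¹‖ₑ * ‖b (ξ - t)‖ₑ)) :=
          mul_le_mul_left hw _
      _ = 2 * ((ENNReal.ofReal (wt t) * ‖((wt t : ℂ))⁻¹‖ₑ) *
            (‖a t‖ₑ * (‖((wt (ξ - t) : ℂ))⁻¹‖ₑ * ‖b (ξ - t)‖ₑ)) +
            (ENNReal.ofReal (wt (ξ - t)) * ‖((wt (ξ - t) : ℂ))⁻¹‖ₑ) *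
            (‖((wt t : ℂ))⁻¹‖ₑ * ‖a t‖ₑ * ‖b (ξ - t)‖ₑ)) := by ring
      _ = _ := by rw [hc, hc, one_mul, one_mul]
  · exact ((hma a).mul ((hmw b).comp_quasiMeasurePreserving
        (quasiMeasurePreserving_sub_left volume ξ))).add
      ((hmw a).mul ((hma b).comp_quasiMeasurePreserving
        (quasiMeasurePreserving_sub_left volume ξ)))
  · exact (hma a).mul ((hmw b).comp_quasiMeasurePreserving
      (quasiMeasurePreserving_sub_left volume ξ))

theorem lintegral_mulFun_le (a b : FreqSpace) :
    ∫⁻ ξ, ‖mulFun a b ξ‖ₑ ^ 2 ≤ ENNReal.ofReal (4 * wtConst * ‖a‖ * ‖b‖) ^ 2 := by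
  have hma : ∀ c : FreqSpace, AEMeasurable fun t => ‖c t‖ₑ := fun c => (Lp.memLp c).1.enorm
  have hmw : ∀ c : FreqSpace, AEMeasurable fun t => ‖((wt t)⁻¹ : ℂ) * c t‖ₑ := fun c =>
    (integrable_wt_inv_mul c).1.enorm
  have hY : ∀ c d : FreqSpace, ∫⁻ ξ, (∫⁻ t, ‖((wt t)⁻¹ : ℂ) * d t‖ₑ * ‖c (ξ - t)‖ₑ) ^ 2 ≤
      ENNReal.ofReal (wtConst * ‖c‖ * ‖d‖) ^ 2 := fun c d => by
    refine (lintegral_conv_sq_le (hma c) (hmw d)).trans ?_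
    rw [lintegral_enorm_sq]
    refine (mul_le_mul_left (pow_le_pow_left' (lintegral_enorm_wt_inv_mul_le d) 2) _).trans ?_
    rw [← mul_pow, ← ENNReal.ofReal_mul (mul_nonneg wtConst_nonneg (norm_nonneg _))]
    rw [mul_right_comm]
  have hms : AEMeasurable fun ξ => (∫⁻ t, ‖((wt t)⁻¹ : ℂ) * b t‖ₑ * ‖a (ξ - t)‖ₑ) := by
    refine AEMeasurable.lintegral_prod_right' (f := fun z : Plane × Plane =>
      ‖((wt z.2)⁻¹ : ℂ) * b z.2‖ₑ * ‖a (z.1 - z.2)‖ₑ) ?_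
    exact ((hmw b).comp_quasiMeasurePreserving Measure.quasiMeasurePreserving_snd).mul
      ((hma a).comp_quasiMeasurePreserving
        (quasiMeasurePreserving_sub_of_right_invariant volume volume))
  -- The 8 is 2² · 2: the factor 2 squared, and (x + y)² ≤ 2(x² + y²). The two terms have equal
  -- bounds, so the total is 16 = 4².
  calc ∫⁻ ξ, ‖mulFun a b ξ‖ₑ ^ 2
      ≤ ∫⁻ ξ, 8 * ((∫⁻ t, ‖((wt t)⁻¹ : ℂ) * b t‖ₑ * ‖a (ξ - t)‖ₑ) ^ 2 +
      (∫⁻ t, ‖((wt t)⁻¹ : ℂ) * a t‖ₑ * ‖b (ξ - t)‖ₑ) ^ 2) := by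
        refine lintegral_mono fun ξ => ?_
        refine (pow_le_pow_left' (enorm_mulFun_le a b ξ) 2).trans ?_
        rw [mul_pow]
        refine (mul_le_mul_right (ennreal_add_sq_le _ _) _).trans (le_of_eq ?_)
        rw [← mul_assoc]; norm_num
    _ ≤ 8 * (ENNReal.ofReal (wtConst * ‖a‖ * ‖b‖) ^ 2 +
          ENNReal.ofReal (wtConst * ‖b‖ * ‖a‖) ^ 2) := by
        rw [lintegral_const_mul' _ _ (by norm_num), lintegral_add_left' (hms.pow_const 2)]
        exact mul_le_mul_right (add_le_add (hY a b) (hY b a)) _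
    _ = ENNReal.ofReal (4 * wtConst * ‖a‖ * ‖b‖) ^ 2 := by
        rw [mul_right_comm wtConst ‖b‖ ‖a‖, ← two_mul, ← mul_assoc,
          show (4 * wtConst * ‖a‖ * ‖b‖) = 4 * (wtConst * ‖a‖ * ‖b‖) by ring,
          ENNReal.ofReal_mul (p := 4) (by norm_num), mul_pow]
        generalize ENNReal.ofReal (wtConst * ‖a‖ * ‖b‖) = z
        norm_num

theorem memLp_mulFun (a b : FreqSpace) : MemLp (mulFun a b) 2 := by
  refine ⟨aestronglyMeasurable_mulFun a b, ?_⟩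
  rw [eLpNorm_eq_lintegral_rpow_enorm_toReal (by norm_num) (by norm_num)]
  refine ENNReal.rpow_lt_top_of_nonneg (by norm_num) (ne_of_lt ?_)
  simp only [ENNReal.toReal_ofNat, ENNReal.rpow_ofNat]
  exact (lintegral_mulFun_le a b).trans_lt (ENNReal.pow_lt_top ENNReal.ofReal_lt_top)

theorem norm_toLp_mulFun_le (a b : FreqSpace) :
    ‖((memLp_mulFun a b).toLp : FreqSpace)‖ ≤ 4 * wtConst * ‖a‖ * ‖b‖ := by
  have h := lintegral_enorm_sq (memLp_mulFun a b).toLp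
  rw [lintegral_congr_ae (g := fun ξ => ‖mulFun a b ξ‖ₑ ^ 2)] at h
  · have h2 := lintegral_mulFun_le a b
    rw [h, ← ENNReal.ofReal_pow (norm_nonneg _), ← ENNReal.ofReal_pow, ENNReal.ofReal_le_ofReal_iff]
      at h2
    · refine le_of_sq_le_sq ?_ ?_
      exact h2
      have := wtConst_nonneg
      positivity
    · positivity
    · have := wtConst_nonneg
      positivity
  · filter_upwards [(memLp_mulFun a b).coeFn_toLp] with ξ hξ
    rw [hξ]

theorem recon_toLp_mulFun (a b : FreqSpace) (x : Plane) :
    recon ((memLp_mulFun a b).toLp) x = recon a x * recon b x := by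
  have h := Real.fourier_mul_convolution_eq (integrable_wt_inv_mul a) (integrable_wt_inv_mul b) (-x)
  rw [← Real.fourierInv_eq_fourier_neg, ← Real.fourierInv_eq_fourier_neg,
    ← Real.fourierInv_eq_fourier_neg] at h
  rw [recon, recon, recon, ← h]
  refine Real.fourierInv_congr_ae ?_ x
  filter_upwards [(memLp_mulFun a b).coeFn_toLp] with ξ hξ
  rw [hξ, mulFun, ← mul_assoc, inv_mul_cancel₀ (wt_ne_zero ξ), one_mul]

theorem recon_ext {a b : FreqSpace} (h : ∀ x, recon a x = recon b x) : a = b :=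
  recon_injective (ae_of_all _ h)

/-- The coordinate of the product of two functions in `H²`. -/
def prodH2 : FreqSpace →L[ℂ] FreqSpace →L[ℂ] FreqSpace :=
  LinearMap.mkContinuous₂
    (LinearMap.mk₂ ℂ (fun a b => (memLp_mulFun a b).toLp)
      -- Bilinearity is checked on the reconstructed functions, where the product is pointwise.
      (fun a a' b => recon_ext fun x => by simp only [recon_add, recon_toLp_mulFun]; ring)
      (fun c a b => recon_ext fun x => by simp only [recon_smul, recon_toLp_mulFun]; ring)
      (fun a b b' => recon_ext fun x => by simp only [recon_add, recon_toLp_mulFun]; ring)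
      (fun c a b => recon_ext fun x => by simp only [recon_smul, recon_toLp_mulFun]; ring))
    (4 * wtConst) norm_toLp_mulFun_le

theorem recon_prodH2 (a b : FreqSpace) (x : Plane) :
    recon (prodH2 a b) x = recon a x * recon b x := recon_toLp_mulFun a b x

end

noncomputable section

/-! ### Fourier series -/

local instance factTwoPiPos : Fact (0 < 2 * Real.pi) := ⟨by positivity⟩

theorem torusCoeff_eq_fourierCoeffOn (h : ℝ → ℂ) (j : ℤ) :
    torusCoeff h j = fourierCoeffOn (Real.two_pi_pos) h j := by
  rw [fourierCoeffOn_eq_integral, torusCoeff, sub_zero, Complex.real_smul]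
  congr 1
  · push_cast; rfl
  · refine intervalIntegral.integral_congr fun x _ => ?_
    simp only [smul_eq_mul]
    rw [fourier_coe_apply]
    congr 2
    have : (Real.pi : ℂ) ≠ 0 := by exact_mod_cast Real.pi_ne_zero
    push_cast
    field_simp

/-- The exponential `e^{ikx}`. -/
def expI (k : ℤ) (x : ℝ) : ℂ := Complex.exp (Complex.I * k * x)

theorem norm_expI (k : ℤ) (x : ℝ) : ‖expI k x‖ = 1 := by
  have : (Complex.I * k * x : ℂ) = ((k * x : ℝ) : ℂ) * Complex.I := by push_cast; ring
  rw [expI, this, Complex.norm_exp_ofReal_mul_I]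

theorem continuous_expI (k : ℤ) : Continuous (expI k) := by unfold expI; fun_prop

theorem expI_periodic (k : ℤ) : Function.Periodic (expI k) (2 * Real.pi) := fun x => by
  unfold expI
  rw [Complex.exp_eq_exp_iff_exists_int]
  exact ⟨k, by push_cast; ring⟩

theorem hasSum_torusCoeff {h : ℝ → ℂ} (hc : Continuous h) (hp : Function.Periodic h (2 * Real.pi))
    (hs : Summable (torusCoeff h)) (x : ℝ) :
    HasSum (fun j => torusCoeff h j * expI j x) (h x) := by
  let g : C(AddCircle (2 * Real.pi), ℂ) := ⟨hp.lift, continuous_coinduced_dom.mpr hc⟩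
  have hg : ∀ x : ℝ, g x = h x := fun x => hp.lift_coe x
  have e : ∀ j, fourierCoeff (g : AddCircle (2 * Real.pi) → ℂ) j = torusCoeff h j := fun j => by
    rw [torusCoeff_eq_fourierCoeffOn, fourierCoeff_eq_intervalIntegral _ _ 0,
      fourierCoeffOn_eq_integral, zero_add, sub_zero]
    simp only [hg]
  have h2 := has_pointwise_sum_fourier_series_of_summable (f := g) (by rw [funext e]; exact hs) x
  rw [hg] at h2
  refine h2.congr_fun ?_
  intro j
  rw [e, fourier_coe_apply, smul_eq_mul, expI]
  congr 2
  have : (Real.pi : ℂ) ≠ 0 := by exact_mod_cast Real.pi_ne_zero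
  push_cast
  field_simp

theorem torusCoeff_deriv {p p' : ℝ → ℂ} (hd : ∀ x, HasDerivAt p (p' x) x) (hc : Continuous p')
    (hp : Function.Periodic p (2 * Real.pi)) (j : ℤ) :
    torusCoeff p' j = Complex.I * j * torusCoeff p j := by
  have h1 : p (2 * Real.pi) = p 0 := by simpa using hp 0
  by_cases hj : j = 0
  · subst hj
    rw [torusCoeff]
    simp only [Int.cast_zero, mul_zero, zero_mul, neg_zero, Complex.exp_zero, one_mul]
    rw [intervalIntegral.integral_eq_sub_of_hasDerivAt (fun x _ => hd x)
      (hc.intervalIntegrable _ _), h1, sub_self, mul_zero]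
  · rw [torusCoeff_eq_fourierCoeffOn, torusCoeff_eq_fourierCoeffOn,
      fourierCoeffOn_of_hasDerivAt _ hj (fun x _ => hd x) (hc.intervalIntegrable _ _), h1]
    have h2 : (Real.pi : ℂ) ≠ 0 := by exact_mod_cast Real.pi_ne_zero
    have h3 : (j : ℂ) ≠ 0 := by exact_mod_cast hj
    have h4 := Complex.I_ne_zero
    push_cast
    field_simp
    ring

theorem norm_torusCoeff_le {p : ℝ → ℂ} {C : ℝ} (hC : ∀ x, ‖p x‖ ≤ C) (j : ℤ) :
    ‖torusCoeff p j‖ ≤ C := by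
  rw [torusCoeff, norm_mul]
  have h := intervalIntegral.norm_integral_le_of_norm_le_const (a := 0) (b := 2 * Real.pi)
    (f := fun x : ℝ => Complex.exp (-(Complex.I * j * x)) * p x) (C := C) (fun x _ => by
      have e := norm_expI (-j) x
      have : expI (-j) x = Complex.exp (-(Complex.I * j * x)) := by
        unfold expI; congr 1; push_cast; ring
      rw [norm_mul, ← this, e, one_mul]
      exact hC x)
  have hn : ‖(1 / (2 * Real.pi) : ℂ)‖ = 1 / (2 * Real.pi) := by
    rw [show (1 / (2 * Real.pi) : ℂ) = ((1 / (2 * Real.pi) : ℝ) : ℂ) by push_cast; rfl,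
      Complex.norm_real, Real.norm_of_nonneg (by positivity)]
  rw [hn]
  refine (mul_le_mul_of_nonneg_left h (by positivity)).trans (le_of_eq ?_)
  rw [sub_zero, abs_of_pos Real.two_pi_pos]
  field_simp

theorem exists_bound_of_periodic {p : ℝ → ℂ} (hc : Continuous p)
    (hp : Function.Periodic p (2 * Real.pi)) : ∃ C, ∀ x, ‖p x‖ ≤ C := by
  obtain ⟨C, hC⟩ := isCompact_Icc.exists_bound_of_continuousOn (hc.continuousOn (s := Set.Icc 0 (0 + 2 * Real.pi)))
  refine ⟨C, fun x => ?_⟩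
  obtain ⟨y, hy, e⟩ := hp.exists_mem_Ico₀ Real.two_pi_pos x
  rw [e]
  exact hC y ⟨hy.1, by simpa using hy.2.le⟩

/-- Four integrations by parts give |c_j| ≲ (1 + j²)⁻². One factor 1 + j² is spent on the weight,
which multiplication on H² needs, and the other one makes the series converge. -/
theorem summable_int_sq_mul {p : ℝ → ℂ} (h4 : ContDiff ℝ 4 p)
    (hp : Function.Periodic p (2 * Real.pi)) :
    Summable fun j : ℤ => (1 + (j : ℝ) ^ 2) * ‖torusCoeff p j‖ := by
  have hper : ∀ n : ℕ, Function.Periodic (iteratedDeriv n p) (2 * Real.pi) := fun n x => by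
    have := iteratedDeriv_comp_add_const n p (2 * Real.pi)
    have h := congrFun this x
    rw [← h]
    congr 1
    funext y
    exact hp y
  have hcoef : ∀ n : ℕ, n ≤ 4 → ∀ j : ℤ,
      torusCoeff (iteratedDeriv n p) j = (Complex.I * j) ^ n * torusCoeff p j := by
    intro n
    induction n with
    | zero => intro _ j; simp
    | succ n ih =>
      intro hn j
      have hd : Differentiable ℝ (iteratedDeriv n p) :=
        h4.differentiable_iteratedDeriv n (by exact_mod_cast (Nat.lt_of_succ_le hn))
      rw [torusCoeff_deriv (p := iteratedDeriv n p) (p' := iteratedDeriv (n + 1) p)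
        (fun x => by rw [iteratedDeriv_succ]; exact (hd x).hasDerivAt)
        (h4.continuous_iteratedDeriv (n + 1) (by exact_mod_cast hn)) (hper n), ih (by omega), pow_succ]
      ring
  obtain ⟨C₀, hC₀⟩ := exists_bound_of_periodic h4.continuous hp
  obtain ⟨C₄, hC₄⟩ := exists_bound_of_periodic (h4.continuous_iteratedDeriv 4 le_rfl) (hper 4)
  have hb : ∀ j : ℤ, (1 + (j : ℝ) ^ 2) * ‖torusCoeff p j‖ ≤
      (2 * (C₀ + C₄)) * (1 / (1 + (j : ℝ) ^ 2)) := fun j => by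
    have h0 := norm_torusCoeff_le hC₀ j
    have h4' := norm_torusCoeff_le hC₄ j
    rw [hcoef 4 le_rfl, norm_mul, norm_pow, norm_mul, Complex.norm_I, one_mul, Complex.norm_intCast] at h4'
    have e : |(j : ℝ)| ^ 4 = ((j : ℝ) ^ 2) ^ 2 := by rw [← sq_abs (j : ℝ)]; ring
    rw [e] at h4'
    have hpos : (0 : ℝ) < 1 + (j : ℝ) ^ 2 := by positivity
    rw [mul_one_div, le_div_iff₀ hpos]
    -- (1 + j²)² ≤ 2(1 + j⁴), and j⁴ times the coefficient is bounded by the fourth derivative.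
    nlinarith [norm_nonneg (torusCoeff p j), sq_nonneg ((j : ℝ) ^ 2 - 1)]
  refine Summable.of_nonneg_of_le (fun j => by positivity) hb (Summable.mul_left _ ?_)
  refine Summable.of_norm_bounded_eventually (g := fun j : ℤ => |(j : ℝ)| ^ (-2 : ℝ))
    (Real.summable_abs_int_rpow (by norm_num)) ?_
  rw [Filter.eventually_cofinite]
  refine (Set.finite_singleton (0 : ℤ)).subset fun j hj => ?_
  by_contra hj0
  refine hj ?_
  have h1 : (0 : ℝ) < (j : ℝ) ^ 2 := by
    have : (j : ℝ) ≠ 0 := by exact_mod_cast hj0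
    positivity
  rw [Real.norm_of_nonneg (by positivity), Real.rpow_neg (abs_nonneg _), Real.rpow_ofNat, sq_abs,
    one_div]
  exact inv_anti₀ h1 (by linarith)

theorem summable_norm_of_summable_sq_mul {c : ℤ → ℂ}
    (h : Summable fun j : ℤ => (1 + (j : ℝ) ^ 2) * ‖c j‖) : Summable fun j => ‖c j‖ :=
  Summable.of_nonneg_of_le (fun j => norm_nonneg _)
    (fun j => by nlinarith [norm_nonneg (c j), sq_nonneg (j : ℝ)]) h

theorem torusCoeff_expI_mul (W : ℝ → ℂ) (k j : ℤ) :
    torusCoeff (fun x => expI k x * W x) j = torusCoeff W (j - k) := by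
  rw [torusCoeff, torusCoeff]
  congr 1
  refine intervalIntegral.integral_congr fun x _ => ?_
  rw [expI, ← mul_assoc, ← Complex.exp_add]
  congr 2
  push_cast; ring

/-- Fourier coefficients of a product, as a convolution. -/
theorem hasSum_torusCoeff_mul {p W : ℝ → ℂ} {c : ℤ → ℂ} (hc : Summable fun k => ‖c k‖)
    (hp : ∀ x, HasSum (fun k => c k * expI k x) (p x)) (hW : Continuous W) (j : ℤ) :
    HasSum (fun k => c k * torusCoeff W (j - k)) (torusCoeff (fun x => p x * W x) j) := by
  obtain ⟨C, hC⟩ := isCompact_Icc.exists_bound_of_continuousOn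
    (hW.continuousOn (s := Set.uIcc 0 (2 * Real.pi)))
  have hn : ∀ x : ℝ, ‖Complex.exp (-(Complex.I * j * x))‖ = 1 := fun x => by
    have := norm_expI (-j) x
    rw [expI] at this
    rw [← this]; congr 2; push_cast; ring
  have h := intervalIntegral.hasSum_integral_of_dominated_convergence (μ := volume) (a := 0)
    (b := 2 * Real.pi)
    (F := fun (k : ℤ) (x : ℝ) => Complex.exp (-(Complex.I * j * x)) * (c k * (expI k x * W x)))
    (f := fun x => Complex.exp (-(Complex.I * j * x)) * (p x * W x))
    (fun k _ => ‖c k‖ * C)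
    (fun k => by
      have := continuous_expI k
      exact (by fun_prop : Continuous fun x : ℝ =>
        Complex.exp (-(Complex.I * j * x)) * (c k * (expI k x * W x))).aestronglyMeasurable)
    (fun k => ae_of_all _ fun x hx => by
      rw [norm_mul, norm_mul, norm_mul, hn, norm_expI, one_mul, one_mul]
      exact mul_le_mul_of_nonneg_left (hC x (Set.uIoc_subset_uIcc hx)) (norm_nonneg _))
    (ae_of_all _ fun x _ => hc.mul_right C)
    (by simp)
    (ae_of_all _ fun x _ => by
      have := ((hp x).mul_right (W x)).mul_left (Complex.exp (-(Complex.I * j * x)))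
      simpa only [mul_assoc] using this)
  have h2 := h.mul_left (1 / (2 * Real.pi) : ℂ)
  refine h2.congr_fun (fun k => ?_)
  rw [← torusCoeff_expI_mul W k j, torusCoeff, mul_left_comm, ← intervalIntegral.integral_const_mul]
  congr 1
  refine intervalIntegral.integral_congr fun x _ => ?_
  ring

theorem torusCoeff_one (j : ℤ) : torusCoeff (fun _ => 1) j = if j = 0 then 1 else 0 := by
  by_cases hj : j = 0
  · subst hj
    have : (Real.pi : ℂ) ≠ 0 := by exact_mod_cast Real.pi_ne_zero
    simp [torusCoeff]
    field_simp
  · have h := torusCoeff_deriv (p := fun _ => (1 : ℂ)) (p' := fun _ => 0)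
      (fun x => hasDerivAt_const x _) continuous_const (fun _ => rfl) j
    have h0 : torusCoeff (fun _ => (0 : ℂ)) j = 0 := by simp [torusCoeff]
    rw [h0, eq_comm, mul_eq_zero, mul_eq_zero] at h
    rw [if_neg hj]
    rcases h with (h | h) | h
    · exact absurd h Complex.I_ne_zero
    · exact absurd (by exact_mod_cast h) hj
    · exact h

/-- An absolutely convergent trigonometric series has the expected Fourier coefficients. -/
theorem torusCoeff_of_hasSum {p : ℝ → ℂ} {c : ℤ → ℂ} (hc : Summable fun k => ‖c k‖)
    (hp : ∀ x, HasSum (fun k => c k * expI k x) (p x)) (j : ℤ) : torusCoeff p j = c j := by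
  have h := hasSum_torusCoeff_mul hc hp (W := fun _ => 1) continuous_const j
  simp only [torusCoeff_one, mul_one] at h
  refine h.unique ?_
  convert hasSum_ite_eq j (c j) using 2 with k
  by_cases hk : k = j
  · subst hk; simp
  · rw [if_neg hk, if_neg (by omega), mul_zero]

/-- This is the source of the self-adjointness of the linearization and of the Bloch operators. -/
theorem torusCoeff_neg_of_real (p : ℝ → ℝ) (j : ℤ) :
    torusCoeff (fun x => (p x : ℂ)) (-j) = (starRingEnd ℂ) (torusCoeff (fun x => (p x : ℂ)) j) := by
  rw [torusCoeff, torusCoeff, map_mul]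
  congr 1
  · rw [map_div₀, map_mul, map_one, Complex.conj_ofReal, map_ofNat]
  · rw [intervalIntegral.integral_of_le Real.two_pi_pos.le, intervalIntegral.integral_of_le Real.two_pi_pos.le,
      ← integral_conj]
    refine integral_congr_ae (ae_of_all _ fun x => ?_)
    simp only [map_mul, Complex.conj_ofReal, ← Complex.exp_conj]
    congr 2
    simp

end

noncomputable section

/-! ### Multiplication by periodic functions of `x` -/

/-- The frequency of `e^{ikx}`. -/
def shiftVec (k : ℤ) : Plane := EuclideanSpace.single 0 (k / (2 * Real.pi))

theorem wt_shiftVec (k : ℤ) : wt (shiftVec k) = 1 + (k : ℝ) ^ 2 := by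
  have h : (2 * Real.pi : ℝ) ≠ 0 := by positivity
  rw [wt, shiftVec, PiLp.norm_single, Real.norm_eq_abs, mul_pow, sq_abs, ← mul_pow,
    mul_div_cancel₀ _ h]

theorem shiftVec_zero : shiftVec 0 = 0 := by simp [shiftVec]

theorem shiftVec_add (k l : ℤ) : shiftVec (k + l) = shiftVec k + shiftVec l := by
  ext i
  fin_cases i <;> simp [shiftVec, add_div]

theorem shiftVec_neg (k : ℤ) : shiftVec (-k) = -shiftVec k := by
  have := shiftVec_add k (-k)
  rw [add_neg_cancel, shiftVec_zero] at this
  exact (neg_eq_of_add_eq_zero_right this.symm).symm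

/-- Translation by `shiftVec k`: multiplication by `e^{ikx}` on the Fourier side. -/
def shiftOp (k : ℤ) : FreqSpace →L[ℂ] FreqSpace :=
  (Lp.compMeasurePreservingₗᵢ ℂ (fun ξ : Plane => ξ - shiftVec k)
    (measurePreserving_sub_right volume (shiftVec k))).toContinuousLinearMap

theorem coeFn_shiftOp (k : ℤ) (f : FreqSpace) :
    shiftOp k f =ᵐ[volume] fun ξ => f (ξ - shiftVec k) :=
  Lp.coeFn_compMeasurePreserving f (measurePreserving_sub_right volume (shiftVec k))

theorem norm_shiftOp_apply (k : ℤ) (f : FreqSpace) : ‖shiftOp k f‖ = ‖f‖ :=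
  LinearIsometry.norm_map _ f

theorem norm_shiftOp_le (k : ℤ) : ‖shiftOp k‖ ≤ 1 :=
  ContinuousLinearMap.opNorm_le_bound _ zero_le_one fun f => by rw [norm_shiftOp_apply, one_mul]

theorem ae_shift {P : Plane → Prop} (h : ∀ᵐ ξ, P ξ) (k : ℤ) : ∀ᵐ ξ, P (ξ - shiftVec k) :=
  (measurePreserving_sub_right volume (shiftVec k)).quasiMeasurePreserving.ae h

theorem inner_shiftOp (k : ℤ) (f g : FreqSpace) :
    inner ℂ (shiftOp k f) g = inner ℂ f (shiftOp (-k) g) := by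
  rw [L2.inner_def, L2.inner_def,
    ← integral_sub_right_eq_self (fun ξ => inner ℂ (f ξ) (shiftOp (-k) g ξ)) (shiftVec k)]
  refine integral_congr_ae ?_
  filter_upwards [coeFn_shiftOp k f, ae_shift (coeFn_shiftOp (-k) g) k] with ξ h1 h2
  rw [h1, h2, shiftVec_neg]
  simp

/-- A Peetre inequality: both weights on the right of `wt_le_two_mul` are at least 1, so their sum
is at most twice their product. The growth 1 + k² dictates the summability that is required of the
coefficients. -/
theorem bddMeas_wt_ratio (k : ℤ) : BddMeas fun ξ => wt ξ / wt (ξ - shiftVec k) := by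
  refine ⟨(continuous_wt.div (continuous_wt.comp (continuous_id.sub continuous_const))
    fun ξ => (wt_pos _).ne').measurable, 4 * (1 + (k : ℝ) ^ 2), fun ξ => ?_⟩
  rw [abs_of_pos (div_pos (wt_pos _) (wt_pos _)), div_le_iff₀ (wt_pos _), ← wt_shiftVec]
  have h := wt_le_two_mul ξ (shiftVec k)
  nlinarith [one_le_wt (shiftVec k), one_le_wt (ξ - shiftVec k)]

/-- Multiplication by `e^{ikx}` in terms of coordinates in `H²`. -/
def shiftH2 (k : ℤ) : FreqSpace →L[ℂ] FreqSpace :=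
  (mulOp fun ξ => wt ξ / wt (ξ - shiftVec k)).comp (shiftOp k)

theorem norm_shiftH2_le (k : ℤ) : ‖shiftH2 k‖ ≤ 4 * (1 + (k : ℝ) ^ 2) := by
  have hb := bddMeas_wt_ratio k
  have h1 : ‖mulOp fun ξ => wt ξ / wt (ξ - shiftVec k)‖ ≤ 4 * (1 + (k : ℝ) ^ 2) :=
    norm_mulOp_le hb.meas fun ξ => by
      rw [abs_of_pos (div_pos (wt_pos _) (wt_pos _)), div_le_iff₀ (wt_pos _), ← wt_shiftVec]
      have h := wt_le_two_mul ξ (shiftVec k)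
      nlinarith [one_le_wt (shiftVec k), one_le_wt (ξ - shiftVec k)]
  refine (ContinuousLinearMap.opNorm_comp_le _ _).trans ?_
  exact (mul_le_mul h1 (norm_shiftOp_le k) (norm_nonneg _) (by positivity)).trans (by rw [mul_one])

theorem coeFn_shiftH2 (k : ℤ) (a : FreqSpace) : shiftH2 k a =ᵐ[volume]
    fun ξ => ((wt ξ / wt (ξ - shiftVec k) : ℝ) : ℂ) * a (ξ - shiftVec k) := by
  filter_upwards [coeFn_mulOp (bddMeas_wt_ratio k) (shiftOp k a), coeFn_shiftOp k a] with ξ h1 h2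
  rw [shiftH2, ContinuousLinearMap.comp_apply, h1, h2]

theorem hatOp_shiftH2 (k : ℤ) (a : FreqSpace) : hatOp (shiftH2 k a) = shiftOp k (hatOp a) := by
  refine Lp.ext ?_
  filter_upwards [coeFn_hatOp (shiftH2 k a), coeFn_shiftH2 k a, coeFn_shiftOp k (hatOp a),
    ae_shift (coeFn_hatOp a) k] with ξ h1 h2 h3 h4
  rw [h1, h2, h3, h4]
  push_cast
  have := wt_ne_zero ξ
  field_simp

theorem recon_shiftH2 (k : ℤ) (a : FreqSpace) (x : Plane) :
    recon (shiftH2 k a) x = expI k (x 0) * recon a x := by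
  rw [recon_eq, recon_eq, ← integral_add_right_eq_self _ (shiftVec k), ← integral_const_mul]
  have hq : Measure.QuasiMeasurePreserving (fun ξ : Plane => ξ + shiftVec k) volume volume :=
    (measurePreserving_add_right volume (shiftVec k)).quasiMeasurePreserving
  refine integral_congr_ae ?_
  filter_upwards [hq.ae (coeFn_shiftH2 k a)] with ξ h1
  rw [h1, add_sub_cancel_right, inner_add_left, AddChar.map_add_eq_mul, Circle.smul_def,
    Circle.smul_def, Circle.coe_mul]
  have h2 : ((Real.fourierChar (inner ℝ (shiftVec k) x) : Circle) : ℂ) = expI k (x 0) := by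
    have : inner ℝ (shiftVec k) x = (k / (2 * Real.pi)) * x 0 := by
      rw [shiftVec, EuclideanSpace.inner_single_left]; simp
    rw [this, Real.fourierChar_apply, expI]
    congr 1
    have : (Real.pi : ℂ) ≠ 0 := by exact_mod_cast Real.pi_ne_zero
    push_cast
    field_simp
  rw [h2, smul_eq_mul, smul_eq_mul]
  push_cast
  have := wt_ne_zero (ξ + shiftVec k)
  field_simp

/-- Multiplication by `∑ₖ cₖ e^{ikx}` in terms of Fourier transforms. -/
def convHat (c : ℤ → ℂ) : FreqSpace →L[ℂ] FreqSpace := ∑' k, c k • shiftOp k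

/-- Multiplication by `∑ₖ cₖ e^{ikx}` in terms of coordinates in `H²`. -/
def multH2 (c : ℤ → ℂ) : FreqSpace →L[ℂ] FreqSpace := ∑' k, c k • shiftH2 k

theorem hasSum_convHat {c : ℤ → ℂ} (hc : Summable fun k => ‖c k‖) :
    HasSum (fun k => c k • shiftOp k) (convHat c) := by
  refine (Summable.of_norm_bounded hc fun k => ?_).hasSum
  rw [norm_smul]
  exact mul_le_of_le_one_right (norm_nonneg _) (norm_shiftOp_le k)

theorem hasSum_convHat_apply {c : ℤ → ℂ} (hc : Summable fun k => ‖c k‖) (f : FreqSpace) :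
    HasSum (fun k => c k • shiftOp k f) (convHat c f) :=
  (hasSum_convHat hc).mapL (ContinuousLinearMap.apply ℂ FreqSpace f)

theorem hasSum_multH2 {c : ℤ → ℂ} (hc : Summable fun k : ℤ => (1 + (k : ℝ) ^ 2) * ‖c k‖)
    (a : FreqSpace) : HasSum (fun k => c k • shiftH2 k a) (multH2 c a) := by
  have h : HasSum (fun k => c k • shiftH2 k) (multH2 c) := by
    refine (Summable.of_norm_bounded (hc.mul_left 4) fun k => ?_).hasSum
    rw [norm_smul]
    nlinarith [norm_shiftH2_le k, norm_nonneg (c k)]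
  exact h.mapL (ContinuousLinearMap.apply ℂ FreqSpace a)

/-- Energy identities are computed on the plain Fourier transform, where multiplication by a real
function is symmetric; the evolution is written in H² coordinates, where it need not be. This
intertwining passes from one to the other. -/
theorem hatOp_multH2 {c : ℤ → ℂ} (hc : Summable fun k : ℤ => (1 + (k : ℝ) ^ 2) * ‖c k‖)
    (a : FreqSpace) : hatOp (multH2 c a) = convHat c (hatOp a) := by
  have h1 := (hasSum_multH2 hc a).mapL hatOp
  simp only [map_smul, hatOp_shiftH2] at h1
  exact h1.unique (hasSum_convHat_apply (summable_norm_of_summable_sq_mul hc) _)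

theorem recon_multH2 {c : ℤ → ℂ} (hc : Summable fun k : ℤ => (1 + (k : ℝ) ^ 2) * ‖c k‖)
    {p : ℝ → ℂ} (hp : ∀ x, HasSum (fun k => c k * expI k x) (p x)) (a : FreqSpace) (x : Plane) :
    recon (multH2 c a) x = p (x 0) * recon a x := by
  have h1 := (hasSum_multH2 hc a).mapL (evalAt x)
  simp only [map_smul, evalAt_apply, recon_shiftH2, smul_eq_mul, ← mul_assoc] at h1
  exact h1.unique ((hp (x 0)).mul_right _)

theorem inner_convHat {c : ℤ → ℂ} (hc : Summable fun k => ‖c k‖)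
    (hconj : ∀ k, c (-k) = (starRingEnd ℂ) (c k)) (f g : FreqSpace) :
    inner ℂ (convHat c f) g = inner ℂ f (convHat c g) := by
  have h1 := (hasSum_convHat_apply hc f).map
    (AddMonoidHom.mk' (fun u : FreqSpace => inner ℂ u g) fun u v => inner_add_left u v g)
    (by simpa using (continuous_id.inner continuous_const))
  have h2 := (hasSum_convHat_apply hc g).mapL (innerSL ℂ f)
  simp only [Function.comp_def, AddMonoidHom.mk'_apply, inner_smul_left, inner_shiftOp] at h1
  simp only [innerSL_apply_apply, inner_smul_right] at h2
  have h3 := (Equiv.neg ℤ).hasSum_iff.2 h2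
  simp only [Function.comp_def, Equiv.neg_apply, hconj] at h3
  exact h1.unique h3

theorem coeFn_sum {ι : Type*} (s : Finset ι) (f : ι → FreqSpace) :
    (∑ k ∈ s, f k : FreqSpace) =ᵐ[volume] ∑ k ∈ s, (f k : Plane → ℂ) := by
  classical
  induction s using Finset.induction_on with
  | empty => simpa using Lp.coeFn_zero ℂ 2 (volume : Measure Plane)
  | insert i s hi ih =>
    rw [Finset.sum_insert hi, Finset.sum_insert hi]
    filter_upwards [Lp.coeFn_add (f i) (∑ k ∈ s, f k), ih] with ξ h1 h2
    rw [h1, Pi.add_apply, Pi.add_apply, h2]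

/-- Pointwise formula for `convHat`. -/
theorem coeFn_convHat {c : ℤ → ℂ} (hc : Summable fun k => ‖c k‖) {f : FreqSpace} {F : Plane → ℂ}
    (hF : f =ᵐ[volume] F) {G : Plane → ℂ}
    (hG : ∀ᵐ ξ, HasSum (fun k => c k * F (ξ - shiftVec k)) (G ξ)) :
    convHat c f =ᵐ[volume] G := by
  -- The series converges in L², so a subsequence of its partial sums converges almost everywhere,
  -- and the pointwise sum identifies the limit.
  obtain ⟨s, hs⟩ := exists_seq_tendsto (atTop : Filter (Finset ℤ))
  have h1 : Tendsto (fun n => ∑ k ∈ s n, c k • shiftOp k f) atTop (𝓝 (convHat c f)) :=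
    (hasSum_convHat_apply hc f).comp hs
  obtain ⟨ns, hns, h2⟩ := (tendstoInMeasure_of_tendsto_Lp h1).exists_seq_tendsto_ae
  have h3 : ∀ᵐ ξ, ∀ k, shiftOp k f ξ = F (ξ - shiftVec k) := ae_all_iff.2 fun k => by
    filter_upwards [coeFn_shiftOp k f, ae_shift hF k] with ξ e1 e2
    rw [e1, e2]
  have h4 : ∀ᵐ ξ, ∀ n, (∑ k ∈ s n, c k • shiftOp k f : FreqSpace) ξ =
      ∑ k ∈ s n, c k * shiftOp k f ξ := ae_all_iff.2 fun n => by
    have e1 := coeFn_sum (s n) (fun k => c k • shiftOp k f)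
    have e2 : ∀ᵐ ξ, ∀ k, (c k • shiftOp k f : FreqSpace) ξ = c k * shiftOp k f ξ :=
      ae_all_iff.2 fun k => by
        filter_upwards [Lp.coeFn_smul (c k) (shiftOp k f)] with ξ e
        rw [e]; rfl
    filter_upwards [e1, e2] with ξ e1 e2
    rw [e1, Finset.sum_apply]
    exact Finset.sum_congr rfl fun k _ => e2 k
  filter_upwards [h2, h3, h4, hG] with ξ h2 h3 h4 hG
  refine tendsto_nhds_unique h2 ?_
  have h5 : Tendsto (fun n => ∑ k ∈ s n, c k * F (ξ - shiftVec k)) atTop (𝓝 (G ξ)) := hG.comp hs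
  refine (h5.comp hns.tendsto_atTop).congr fun n => ?_
  rw [h4, Function.comp_apply]
  exact Finset.sum_congr rfl fun k _ => by rw [h3]

end

noncomputable section

/-! ### Test functions and Fourier multipliers -/

/-- Smooth real functions with compact support. -/
structure IsTest (φ : Plane → ℝ) : Prop where
  smooth : ContDiff ℝ (⊤ : ℕ∞) φ
  compact : HasCompactSupport φ

theorem partialD_eq {φ : Plane → ℝ} (hφ : Differentiable ℝ φ) (i : Fin 2) :
    partialD i φ = fun p => fderiv ℝ φ p (EuclideanSpace.single i 1) :=
  funext fun p => (hφ p).lineDeriv_eq_fderiv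

namespace IsTest

variable {φ ψ : Plane → ℝ}

theorem differentiable (h : IsTest φ) : Differentiable ℝ φ :=
  h.smooth.differentiable (by simp)

theorem partialD (h : IsTest φ) (i : Fin 2) : IsTest (partialD i φ) := by
  rw [partialD_eq h.differentiable]
  exact ⟨(h.smooth.fderiv_right (m := (⊤ : ℕ∞)) (by simp)).clm_apply contDiff_const,
    h.compact.fderiv_apply ℝ _⟩

theorem add (h : IsTest φ) (h' : IsTest ψ) : IsTest (fun p => φ p + ψ p) :=
  ⟨h.smooth.add h'.smooth, h.compact.add h'.compact⟩

theorem const_mul (h : IsTest φ) (c : ℝ) : IsTest (fun p => c * φ p) :=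
  ⟨contDiff_const.mul h.smooth, h.compact.mul_left⟩

theorem opA (h : IsTest φ) (ε ω : ℝ) : IsTest (opA ε ω φ) :=
  (h.add (((h.partialD 0).partialD 0).const_mul _)).add ((h.partialD 1).partialD 1)

theorem opL (h : IsTest φ) (ε ω : ℝ) : IsTest (opL ε ω φ) := by
  have e : GSHE.opL ε ω φ = fun p => -1 * GSHE.opA ε ω (GSHE.opA ε ω φ) p :=
    funext fun p => (neg_one_mul _).symm
  rw [e]
  exact ((h.opA ε ω).opA ε ω).const_mul (-1)

theorem translate (h : IsTest φ) (y : Plane) : IsTest (fun p => φ (p - y)) :=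
  ⟨h.smooth.comp (contDiff_id.sub contDiff_const),
    h.compact.comp_homeomorph (Homeomorph.subRight y)⟩

/-- A test function as a complex Schwartz function. -/
def toS (h : IsTest φ) : SchwartzMap Plane ℂ :=
  (h.compact.comp_left (g := fun r : ℝ => (r : ℂ)) rfl).toSchwartzMap
    (Complex.ofRealCLM.contDiff.comp h.smooth)

@[simp] theorem toS_apply (h : IsTest φ) (p : Plane) : h.toS p = (φ p : ℂ) := rfl

/-- The inverse Fourier transform of a test function. -/
def check (h : IsTest φ) : SchwartzMap Plane ℂ := 𝓕⁻ h.toS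

theorem check_eq (h : IsTest φ) (ξ : Plane) :
    h.check ξ = ∫ p, Real.fourierChar (inner ℝ p ξ) • (φ p : ℂ) := by
  rw [check, SchwartzMap.fourierInv_coe, Real.fourierInv_eq]
  rfl

theorem integrable_check_eq (h : IsTest φ) (ξ : Plane) :
    Integrable fun p => Real.fourierChar (inner ℝ p ξ) • (φ p : ℂ) := by
  have := (Real.fourierIntegral_convergent_iff (V := Plane) (μ := volume) (-ξ)).2 h.toS.integrable
  simpa using this

theorem check_add (h : IsTest φ) (h' : IsTest ψ) (ξ : Plane) :
    (h.add h').check ξ = h.check ξ + h'.check ξ := by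
  rw [check_eq, check_eq, check_eq, ← integral_add (h.integrable_check_eq ξ)
    (h'.integrable_check_eq ξ)]
  congr 1
  funext p
  rw [Complex.ofReal_add, smul_add]

theorem check_const_mul (h : IsTest φ) (c : ℝ) (ξ : Plane) :
    (h.const_mul c).check ξ = c * h.check ξ := by
  rw [check_eq, check_eq, ← integral_const_mul]
  congr 1
  funext p
  simp only [Circle.smul_def, smul_eq_mul]
  push_cast; ring

theorem check_partialD (h : IsTest φ) (i : Fin 2) (ξ : Plane) :
    (h.partialD i).check ξ = -(2 * Real.pi * Complex.I * ξ i) * h.check ξ := by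
  have e : (h.partialD i).toS = LineDeriv.lineDerivOp (EuclideanSpace.single i (1 : ℝ) : Plane) h.toS := by
    ext p
    rw [toS_apply, SchwartzMap.lineDerivOp_apply]
    have h1 : HasLineDerivAt ℝ φ (GSHE.partialD i φ p) p (EuclideanSpace.single i 1) :=
      ((h.differentiable p).lineDifferentiableAt).hasLineDerivAt
    exact (HasDerivAt.ofReal_comp h1).deriv.symm
  rw [IsTest.check, e, SchwartzMap.fourierInv_lineDerivOp_eq, _root_.smul_apply,
    SchwartzMap.smulLeftCLM_apply_apply (by fun_prop)]
  rw [EuclideanSpace.inner_single_right, IsTest.check]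
  simp only [smul_eq_mul, Complex.real_smul]
  simp
  ring

end IsTest

/-- The symbol of `𝒜 = 1 + (1 + 2εω)∂ₓ² + ∂_y²`. -/
def symA (ε ω : ℝ) (ξ : Plane) : ℝ :=
  1 - (1 + 2 * ε * ω) * (2 * Real.pi * ξ 0) ^ 2 - (2 * Real.pi * ξ 1) ^ 2

/-- The symbol of `𝒜²`. -/
def sym (ε ω : ℝ) (ξ : Plane) : ℝ := symA ε ω ξ ^ 2

theorem continuous_symA (ε ω : ℝ) : Continuous (symA ε ω) := by unfold symA; fun_prop

theorem continuous_sym (ε ω : ℝ) : Continuous (sym ε ω) := (continuous_symA ε ω).pow 2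

theorem sym_nonneg (ε ω : ℝ) (ξ : Plane) : 0 ≤ sym ε ω ξ := sq_nonneg _

theorem IsTest.check_opA {φ : Plane → ℝ} (h : IsTest φ) (ε ω : ℝ) (ξ : Plane) :
    (h.opA ε ω).check ξ = symA ε ω ξ * h.check ξ := by
  have e : (h.opA ε ω).check ξ = ((h.add (((h.partialD 0).partialD 0).const_mul
    (1 + 2 * ε * ω))).add ((h.partialD 1).partialD 1)).check ξ := rfl
  rw [e, (h.add (((h.partialD 0).partialD 0).const_mul (1 + 2 * ε * ω))).check_add
      ((h.partialD 1).partialD 1),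
    h.check_add (((h.partialD 0).partialD 0).const_mul (1 + 2 * ε * ω)),
    ((h.partialD 0).partialD 0).check_const_mul (1 + 2 * ε * ω), (h.partialD 0).check_partialD 0,
    h.check_partialD 0, (h.partialD 1).check_partialD 1, h.check_partialD 1, symA]
  push_cast
  linear_combination ((1 + 2 * ε * ω) * (2 * Real.pi * ξ 0) ^ 2 + (2 * Real.pi * ξ 1) ^ 2) *
    h.check ξ * Complex.I_sq

theorem IsTest.check_opL {φ : Plane → ℝ} (h : IsTest φ) (ε ω : ℝ) (ξ : Plane) :
    (h.opL ε ω).check ξ = -sym ε ω ξ * h.check ξ := by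
  have e : (h.opL ε ω).check ξ = (((h.opA ε ω).opA ε ω).const_mul (-1)).check ξ := by
    rw [check_eq, check_eq]
    simp [GSHE.opL]
  rw [e, ((h.opA ε ω).opA ε ω).check_const_mul, (h.opA ε ω).check_opA ε ω, h.check_opA ε ω, sym]
  push_cast; ring

/-- Pairing of the function with coordinate `a` with the function whose inverse Fourier transform
is `χ`. -/
def pairing (χ : SchwartzMap Plane ℂ) : FreqSpace →L[ℂ] ℂ :=
  LinearMap.mkContinuous
    { toFun := fun a => ∫ ξ, χ ξ * (((wt ξ)⁻¹ : ℂ) * a ξ)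
      map_add' := fun a b => by
        have h : ∀ c : FreqSpace, Integrable fun ξ => χ ξ * (((wt ξ)⁻¹ : ℂ) * c ξ) := fun c =>
          (integrable_wt_inv_mul c).bdd_mul χ.continuous.aestronglyMeasurable
            (ae_of_all _ χ.toBoundedContinuousFunction.norm_coe_le_norm)
        rw [← integral_add (h a) (h b)]
        refine integral_congr_ae ?_
        filter_upwards [Lp.coeFn_add a b] with ξ hξ
        rw [hξ, Pi.add_apply]; ring
      map_smul' := fun c a => by
        rw [RingHom.id_apply, smul_eq_mul, ← integral_const_mul]
        refine integral_congr_ae ?_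
        filter_upwards [Lp.coeFn_smul c a] with ξ hξ
        rw [hξ, Pi.smul_apply, smul_eq_mul]; ring }
    (‖χ.toBoundedContinuousFunction‖ * wtConst) (fun a => by
      simp only [LinearMap.coe_mk, AddHom.coe_mk]
      refine (norm_integral_le_integral_norm _).trans ?_
      rw [mul_assoc]
      refine le_trans ?_ (mul_le_mul_of_nonneg_left (integral_norm_wt_inv_mul_le a)
        (norm_nonneg χ.toBoundedContinuousFunction))
      rw [← integral_const_mul]
      refine integral_mono_of_nonneg (ae_of_all _ fun ξ => norm_nonneg _)
        ((integrable_wt_inv_mul a).norm.const_mul _) (ae_of_all _ fun ξ => ?_)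
      simp only [norm_mul]
      exact mul_le_mul_of_nonneg_right (χ.toBoundedContinuousFunction.norm_coe_le_norm ξ)
        (by positivity))

theorem pairing_apply (χ : SchwartzMap Plane ℂ) (a : FreqSpace) :
    pairing χ a = ∫ ξ, χ ξ * (((wt ξ)⁻¹ : ℂ) * a ξ) := rfl

theorem integral_recon_mul {φ : Plane → ℝ} (h : IsTest φ) (a : FreqSpace) :
    ∫ p, recon a p * (φ p : ℂ) = pairing h.check a := by
  rw [pairing_apply, IsTest.check, ← integral_smul_fourierInv h.toS (integrable_wt_inv_mul a)]
  refine integral_congr_ae (ae_of_all _ fun p => ?_)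
  simp only [IsTest.toS_apply, mul_comm]
  rfl

theorem integrable_pairing (χ : SchwartzMap Plane ℂ) (a : FreqSpace) :
    Integrable fun ξ => χ ξ * (((wt ξ)⁻¹ : ℂ) * a ξ) :=
  (integrable_wt_inv_mul a).bdd_mul χ.continuous.aestronglyMeasurable
    (ae_of_all _ χ.toBoundedContinuousFunction.norm_coe_le_norm)

/-- An integrable function is zero if its inverse Fourier transform is zero. -/
theorem ae_eq_zero_of_fourierInv_eq_zero {F : Plane → ℂ} (hF : Integrable F)
    (h : ∀ y, 𝓕⁻ F y = 0) : F =ᵐ[volume] 0 := by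
  refine ae_eq_zero_of_integral_contDiff_smul_eq_zero hF.locallyIntegrable fun g hg hgc => ?_
  have hT : IsTest g := ⟨hg, hgc⟩
  have h1 := integral_smul_fourierInv (𝓕 hT.toS) hF
  rw [FourierTransform.fourierInv_fourier_eq] at h1
  simp only [h, mul_zero, integral_zero, IsTest.toS_apply] at h1
  simpa using h1.symm

theorem IsTest.check_translate {φ : Plane → ℝ} (h : IsTest φ) (y ξ : Plane) :
    (h.translate y).check ξ = Real.fourierChar (inner ℝ ξ y) • h.check ξ := by
  rw [check_eq, check_eq, ← integral_add_right_eq_self _ y, Circle.smul_def, smul_eq_mul,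
    ← integral_const_mul]
  congr 1
  funext p
  rw [add_sub_cancel_right, inner_add_left, AddChar.map_add_eq_mul, Circle.smul_def,
    Circle.smul_def, Circle.coe_mul, smul_eq_mul, smul_eq_mul, real_inner_comm y ξ]
  ring

/-- On every ball there is a test function whose inverse Fourier transform has no zeros. -/
theorem exists_test_check_ne_zero (R : ℝ) :
    ∃ φ : Plane → ℝ, ∃ h : IsTest φ, ∀ ξ, ‖ξ‖ ≤ R → h.check ξ ≠ 0 := by
  -- With this radius |2π⟨p, ξ⟩| ≤ 1 for |p| ≤ r and |ξ| ≤ R, so the cosine is at least 1/2 on the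
  -- support of the bump and the transform has positive real part.
  set r : ℝ := 1 / (2 * Real.pi * (|R| + 1)) with hr
  have hr0 : 0 < r := by positivity
  let f : ContDiffBump (0 : Plane) := ⟨r / 2, r, by positivity, by linarith⟩
  have hT : IsTest f := ⟨f.contDiff, f.hasCompactSupport⟩
  refine ⟨f, hT, fun ξ hξ h0 => ?_⟩
  have h1 := congrArg Complex.re h0
  have hi := hT.integrable_check_eq ξ
  rw [hT.check_eq, ← RCLike.re_eq_complex_re, ← integral_re hi] at h1
  have h2 : (1 / 2) * ∫ p, f p ≤ ∫ p, RCLike.re (Real.fourierChar (inner ℝ p ξ) • (f p : ℂ)) := by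
    rw [← integral_const_mul]
    refine integral_mono (f.integrable.const_mul _) hi.re fun p => ?_
    rw [Circle.smul_def, Real.fourierChar_apply, smul_eq_mul, RCLike.re_eq_complex_re]
    simp only
    rw [Complex.re_mul_ofReal, Complex.exp_ofReal_mul_I_re]
    by_cases hp : p ∈ Metric.ball (0 : Plane) r
    · refine mul_le_mul_of_nonneg_right ?_ f.nonneg
      have h3 : |2 * Real.pi * inner ℝ p ξ| ≤ 1 := by
        rw [abs_mul, abs_of_pos Real.two_pi_pos]
        have h4 : |inner ℝ p ξ| ≤ r * (|R| + 1) :=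
          (abs_real_inner_le_norm p ξ).trans (mul_le_mul (by simpa using (Metric.mem_ball.1 hp).le)
            (by linarith [le_abs_self R]) (norm_nonneg _) hr0.le)
        have h5 : 2 * Real.pi * (r * (|R| + 1)) = 1 := by rw [hr]; field_simp
        nlinarith [Real.two_pi_pos]
      have h6 := Real.one_sub_sq_div_two_le_cos (x := 2 * Real.pi * inner ℝ p ξ)
      have h7 : (2 * Real.pi * inner ℝ p ξ) ^ 2 ≤ 1 := by rw [← sq_abs]; nlinarith [abs_nonneg (2 * Real.pi * inner ℝ p ξ)]
      linarith
    · have : f p = 0 := f.zero_of_le_dist (by simpa using hp)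
      simp [this]
  rw [h1] at h2
  have := f.integral_pos (μ := volume)
  simp at h2
  linarith

/-- A coordinate is zero if it is annihilated by all `(1 + 𝒜²) φ`, `φ` a test function. -/
theorem eq_zero_of_pairing (ε ω : ℝ) {z : FreqSpace}
    (h : ∀ (φ : Plane → ℝ) (hφ : IsTest φ),
      pairing hφ.check z - pairing (hφ.opL ε ω).check z = 0) : z = 0 := by
  have key : ∀ n : ℕ, ∀ᵐ ξ, ‖ξ‖ ≤ n → z ξ = 0 := by
    intro n
    obtain ⟨φ, hφ, hne⟩ := exists_test_check_ne_zero n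
    set F : Plane → ℂ := fun ξ => hφ.check ξ * (((wt ξ)⁻¹ : ℂ) * z ξ) -
      (hφ.opL ε ω).check ξ * (((wt ξ)⁻¹ : ℂ) * z ξ) with hF
    have hFi : Integrable F := (integrable_pairing _ z).sub (integrable_pairing _ z)
    -- The hypothesis for the translate of φ by y says that the inverse Fourier transform of F
    -- vanishes at y. Hence F = 0, and the factors of F other than z do not vanish on the ball.
    have h0 := ae_eq_zero_of_fourierInv_eq_zero hFi fun y => by
      rw [Real.fourierInv_eq, ← h _ (hφ.translate y), pairing_apply, pairing_apply,
        ← integral_sub (integrable_pairing _ z) (integrable_pairing _ z)]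
      congr 1
      funext ξ
      rw [(hφ.translate y).check_opL, hφ.check_translate, hF]
      simp only
      rw [hφ.check_opL, Circle.smul_def, Circle.smul_def, smul_eq_mul, smul_eq_mul]
      ring
    filter_upwards [h0] with ξ h1 hξ
    rw [hF] at h1
    simp only [Pi.zero_apply, hφ.check_opL] at h1
    have h2 : hφ.check ξ * ((1 + sym ε ω ξ : ℝ) : ℂ) * ((wt ξ)⁻¹ : ℂ) * z ξ = 0 := by
      rw [← h1]; push_cast; ring
    have h3 : ((1 + sym ε ω ξ : ℝ) : ℂ) ≠ 0 := by
      have := sym_nonneg ε ω ξ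
      exact_mod_cast (by positivity : (1 + sym ε ω ξ) ≠ 0)
    simpa only [mul_eq_zero, hne ξ hξ, h3, inv_eq_zero, wt_ne_zero ξ, false_or] using h2
  refine Lp.ext ?_
  filter_upwards [ae_all_iff.2 key, Lp.coeFn_zero ℂ 2 (volume : Measure Plane)] with ξ h1 h2
  obtain ⟨n, hn⟩ := exists_nat_ge ‖ξ‖
  rw [h1 n hn, h2, Pi.zero_apply]

end

noncomputable section

/-! ### Weak solutions in terms of coordinates -/

/-- The indicator function of the ball of radius `n`. -/
def cut (n : ℕ) (ξ : Plane) : ℝ := (Metric.closedBall (0 : Plane) n).indicator 1 ξ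

theorem cut_of_le {n : ℕ} {ξ : Plane} (h : ‖ξ‖ ≤ n) : cut n ξ = 1 :=
  Set.indicator_of_mem (by simpa using h) _

theorem cut_of_lt {n : ℕ} {ξ : Plane} (h : (n : ℝ) < ‖ξ‖) : cut n ξ = 0 :=
  Set.indicator_of_notMem (by simpa using h) _

theorem cut_eq (n : ℕ) (ξ : Plane) : cut n ξ = 0 ∨ cut n ξ = 1 :=
  (le_or_gt ‖ξ‖ n).elim (fun h => Or.inr (cut_of_le h)) fun h => Or.inl (cut_of_lt h)

theorem cut_mul_self (n : ℕ) (ξ : Plane) : cut n ξ * cut n ξ = cut n ξ := by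
  rcases cut_eq n ξ with h | h <;> simp [h]

theorem measurable_cut (n : ℕ) : Measurable (cut n) :=
  measurable_one.indicator Metric.isClosed_closedBall.measurableSet

theorem abs_cut_le (n : ℕ) (ξ : Plane) : |cut n ξ| ≤ 1 := by
  rcases cut_eq n ξ with h | h <;> simp [h]

theorem bddMeas_cut (n : ℕ) : BddMeas (cut n) := ⟨measurable_cut n, 1, abs_cut_le n⟩

theorem BddMeas.mul_cut {h : Plane → ℝ} (hh : Continuous h) (n : ℕ) :
    BddMeas fun ξ => h ξ * cut n ξ := by
  obtain ⟨C, hC⟩ := (isCompact_closedBall (0 : Plane) (n : ℝ)).exists_bound_of_continuousOn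
    hh.continuousOn
  refine ⟨hh.measurable.mul (measurable_cut n), |C|, fun ξ => ?_⟩
  rcases le_or_gt ‖ξ‖ n with h | h
  · rw [cut_of_le h, mul_one]
    exact (hC ξ (by simpa using h)).trans (le_abs_self _)
  · rw [cut_of_lt h]; simp

/-- The restriction to frequencies in the ball of radius `n`. -/
def cutOp (n : ℕ) : FreqSpace →L[ℂ] FreqSpace := mulOp (cut n)

theorem norm_cutOp_apply_le (n : ℕ) (a : FreqSpace) : ‖cutOp n a‖ ≤ ‖a‖ := by
  simpa [cutOp] using norm_mulOp_apply_le (measurable_cut n) (abs_cut_le n) a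

theorem tendsto_cutOp (a : FreqSpace) : Tendsto (fun n => cutOp n a) atTop (𝓝 a) := by
  have h := tendsto_mulOp (l := atTop) (h := cut) (h₀ := fun _ => 1) (C := 1) measurable_cut
    abs_cut_le measurable_const (by simp) (fun ξ => ?_) a
  · rwa [mulOp_const, Complex.ofReal_one, one_smul] at h
  · obtain ⟨n, hn⟩ := exists_nat_ge ‖ξ‖
    refine tendsto_const_nhds.congr' ?_
    filter_upwards [eventually_ge_atTop n] with m hm
    rw [cut_of_le (hn.trans (by exact_mod_cast hm))]

/-- The generator `L`, restricted to frequencies in the ball of radius `n`. -/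
def genOp (ε ω : ℝ) (n : ℕ) : FreqSpace →L[ℂ] FreqSpace := mulOp fun ξ => -sym ε ω ξ * cut n ξ

theorem bddMeas_gen (ε ω : ℝ) (n : ℕ) : BddMeas fun ξ => -sym ε ω ξ * cut n ξ :=
  BddMeas.mul_cut (continuous_sym ε ω).neg n

theorem cutOp_cutOp (n : ℕ) (a : FreqSpace) : cutOp n (cutOp n a) = cutOp n a := by
  rw [cutOp, mulOp_mulOp (bddMeas_cut n) (bddMeas_cut n)]
  simp only [cut_mul_self]

theorem genOp_cutOp (ε ω : ℝ) (n : ℕ) (a : FreqSpace) :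
    genOp ε ω n (cutOp n a) = genOp ε ω n a := by
  rw [cutOp, genOp, mulOp_mulOp (bddMeas_gen ε ω n) (bddMeas_cut n)]
  simp only [mul_assoc, cut_mul_self]

theorem cutOp_genOp (ε ω : ℝ) (n : ℕ) (a : FreqSpace) :
    cutOp n (genOp ε ω n a) = genOp ε ω n a := by
  rw [← genOp_cutOp ε ω n a, cutOp, genOp, mulOp_comm (bddMeas_cut n) (bddMeas_gen ε ω n)]
  exact congrArg _ (cutOp_cutOp n a)

/-- The coordinate `a` solves `∂ₜ a = L a + g` at the times in `S`: an ordinary differential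
equation on every ball of frequencies. -/
def IsFreqSol (ε ω : ℝ) (S : Set ℝ) (a g : ℝ → FreqSpace) : Prop :=
  ∀ t ∈ S, ∀ n : ℕ, cutOp n (a t) =
    cutOp n (a 0) + ∫ τ in (0 : ℝ)..t, (genOp ε ω n (a τ) + cutOp n (g τ))

theorem bddMeas_res (ε ω : ℝ) : BddMeas fun ξ => (1 + sym ε ω ξ)⁻¹ := by
  have h0 : ∀ ξ, 0 < 1 + sym ε ω ξ := fun ξ => by have := sym_nonneg ε ω ξ; positivity
  refine ⟨((continuous_const.add (continuous_sym ε ω)).inv₀ fun ξ => (h0 ξ).ne').measurable, 1,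
    fun ξ => ?_⟩
  rw [abs_of_pos (inv_pos.2 (h0 ξ))]
  exact inv_le_one_of_one_le₀ (by linarith [sym_nonneg ε ω ξ])

theorem bddMeas_resGen (ε ω : ℝ) : BddMeas fun ξ => -sym ε ω ξ * (1 + sym ε ω ξ)⁻¹ := by
  have h0 : ∀ ξ, 0 < 1 + sym ε ω ξ := fun ξ => by have := sym_nonneg ε ω ξ; positivity
  refine ⟨(continuous_sym ε ω).neg.measurable.mul (bddMeas_res ε ω).meas, 1, fun ξ => ?_⟩
  rw [abs_mul, abs_neg, abs_of_nonneg (sym_nonneg ε ω ξ), abs_of_pos (inv_pos.2 (h0 ξ)),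
    ← div_eq_mul_inv, div_le_one (h0 ξ)]
  linarith

section

variable {ε ω : ℝ} {a g : ℝ → FreqSpace} {t : ℝ}

/-- The defect of the equation `∂ₜ a = L a + g`, multiplied by `(1 - L)⁻¹`. -/
def defect (ε ω : ℝ) (a g : ℝ → FreqSpace) (t : ℝ) : FreqSpace :=
  mulOp (fun ξ => (1 + sym ε ω ξ)⁻¹) (a t - a 0) - ∫ τ in (0 : ℝ)..t,
    (mulOp (fun ξ => -sym ε ω ξ * (1 + sym ε ω ξ)⁻¹) (a τ) +
      mulOp (fun ξ => (1 + sym ε ω ξ)⁻¹) (g τ))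

theorem intervalIntegrable_clm_add (A B : FreqSpace →L[ℂ] FreqSpace)
    (ha : ContinuousOn a (Set.uIcc 0 t)) (hg : ContinuousOn g (Set.uIcc 0 t)) :
    IntervalIntegrable (fun τ => A (a τ) + B (g τ)) volume 0 t :=
  ((A.continuous.comp_continuousOn ha).add (B.continuous.comp_continuousOn hg)).intervalIntegrable

/-- The symbol of L is unbounded, so the equation lives in L² only after a truncation or after
applying the resolvent. Multiplying the defect by (1 + sym) · cut produces the truncated equation
for each n. Conversely, the truncations of the defect converge to the defect. -/
theorem freq_eq_iff_defect_eq_zero (ha : ContinuousOn a (Set.uIcc 0 t))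
    (hg : ContinuousOn g (Set.uIcc 0 t)) :
    (∀ n : ℕ, cutOp n (a t) =
      cutOp n (a 0) + ∫ τ in (0 : ℝ)..t, (genOp ε ω n (a τ) + cutOp n (g τ))) ↔
    defect ε ω a g t = 0 := by
  have h0 : ∀ ξ, 1 + sym ε ω ξ ≠ 0 := fun ξ => by have := sym_nonneg ε ω ξ; positivity
  have hb : ∀ n, BddMeas fun ξ => (1 + sym ε ω ξ) * cut n ξ := fun n =>
    BddMeas.mul_cut (continuous_const.add (continuous_sym ε ω)) n
  have e1 : ∀ n (b : FreqSpace), mulOp (fun ξ => (1 + sym ε ω ξ) * cut n ξ)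
      (mulOp (fun ξ => (1 + sym ε ω ξ)⁻¹) b) = cutOp n b := fun n b => by
    rw [mulOp_mulOp (hb n) (bddMeas_res ε ω), cutOp]
    congr 2; funext ξ; have := h0 ξ; field_simp
  have e2 : ∀ n (b : FreqSpace), mulOp (fun ξ => (1 + sym ε ω ξ) * cut n ξ)
      (mulOp (fun ξ => -sym ε ω ξ * (1 + sym ε ω ξ)⁻¹) b) = genOp ε ω n b := fun n b => by
    rw [mulOp_mulOp (hb n) (bddMeas_resGen ε ω), genOp]
    congr 2; funext ξ; have := h0 ξ; field_simp
  have key : ∀ n, mulOp (fun ξ => (1 + sym ε ω ξ) * cut n ξ) (defect ε ω a g t) =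
      cutOp n (a t) - cutOp n (a 0) -
        ∫ τ in (0 : ℝ)..t, (genOp ε ω n (a τ) + cutOp n (g τ)) := fun n => by
    rw [defect, map_sub, ← ContinuousLinearMap.intervalIntegral_comp_comm _
      (intervalIntegrable_clm_add _ _ ha hg), e1, map_sub]
    simp only [map_add, e1, e2]
  constructor
  · intro h
    refine tendsto_nhds_unique (tendsto_cutOp _) ?_
    refine tendsto_const_nhds.congr fun n => ?_
    have h1 : mulOp (fun ξ => (1 + sym ε ω ξ) * cut n ξ) (defect ε ω a g t) = 0 := by
      rw [key, h n]; abel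
    have h2 := congrArg (mulOp fun ξ => (1 + sym ε ω ξ)⁻¹) h1
    rw [mulOp_comm (bddMeas_res ε ω) (hb n), e1, map_zero] at h2
    exact h2.symm
  · intro h n
    have h1 := key n
    rw [h, map_zero] at h1
    rw [eq_comm, sub_sub, sub_eq_zero] at h1
    exact h1

/-- The test function (1 - L)φ pairs with (1 - L)⁻¹b as φ pairs with b. So the weak equation for φ
says that (1 - L)φ annihilates the defect, and these test functions separate points by
`eq_zero_of_pairing`. -/
theorem weak_eq_iff_defect_eq_zero (ha : ContinuousOn a (Set.uIcc 0 t))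
    (hg : ContinuousOn g (Set.uIcc 0 t)) :
    (∀ (φ : Plane → ℝ) (hφ : IsTest φ), pairing hφ.check (a t) = pairing hφ.check (a 0) +
      ∫ τ in (0 : ℝ)..t, (pairing (hφ.opL ε ω).check (a τ) + pairing hφ.check (g τ))) ↔
    defect ε ω a g t = 0 := by
  have h0 : ∀ ξ, ((1 + sym ε ω ξ : ℝ) : ℂ) ≠ 0 := fun ξ => by
    have := sym_nonneg ε ω ξ; exact_mod_cast (by positivity : 1 + sym ε ω ξ ≠ 0)
  have e1 : ∀ (φ : Plane → ℝ) (hφ : IsTest φ) (b : FreqSpace),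
      (pairing hφ.check - pairing (hφ.opL ε ω).check) (mulOp (fun ξ => (1 + sym ε ω ξ)⁻¹) b) =
        pairing hφ.check b := fun φ hφ b => by
    rw [sub_apply, pairing_apply, pairing_apply, pairing_apply,
      ← integral_sub (integrable_pairing _ _) (integrable_pairing _ _)]
    refine integral_congr_ae ?_
    filter_upwards [coeFn_mulOp (bddMeas_res ε ω) b] with ξ hξ
    have h1 := h0 ξ
    rw [hξ, hφ.check_opL, Complex.ofReal_inv]
    calc _ = (hφ.check ξ * ((wt ξ : ℂ)⁻¹ * b ξ)) *
          (((1 + sym ε ω ξ : ℝ) : ℂ) * ((1 + sym ε ω ξ : ℝ) : ℂ)⁻¹) := by push_cast; ring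
      _ = _ := by rw [mul_inv_cancel₀ h1, mul_one]
  have e2 : ∀ (φ : Plane → ℝ) (hφ : IsTest φ) (b : FreqSpace),
      (pairing hφ.check - pairing (hφ.opL ε ω).check)
        (mulOp (fun ξ => -sym ε ω ξ * (1 + sym ε ω ξ)⁻¹) b) =
        pairing (hφ.opL ε ω).check b := fun φ hφ b => by
    have : mulOp (fun ξ => -sym ε ω ξ * (1 + sym ε ω ξ)⁻¹) b =
        mulOp (fun ξ => (1 + sym ε ω ξ)⁻¹) b - b := by
      refine Lp.ext ?_
      filter_upwards [coeFn_mulOp (bddMeas_res ε ω) b, coeFn_mulOp (bddMeas_resGen ε ω) b,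
        Lp.coeFn_sub (mulOp (fun ξ => (1 + sym ε ω ξ)⁻¹) b) b] with ξ h1 h2 h3
      rw [h2, h3, Pi.sub_apply, h1]
      have h4 := h0 ξ
      push_cast at h4 ⊢
      field_simp
      ring
    rw [this, map_sub, e1, sub_apply]
    ring
  have key : ∀ (φ : Plane → ℝ) (hφ : IsTest φ),
      pairing hφ.check (defect ε ω a g t) - pairing (hφ.opL ε ω).check (defect ε ω a g t) =
      pairing hφ.check (a t) - pairing hφ.check (a 0) -
      ∫ τ in (0 : ℝ)..t, (pairing (hφ.opL ε ω).check (a τ) + pairing hφ.check (g τ)) :=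
    fun φ hφ => by
      rw [← sub_apply, defect, map_sub, ← ContinuousLinearMap.intervalIntegral_comp_comm _
        (intervalIntegrable_clm_add _ _ ha hg), e1, map_sub]
      simp only [map_add, e1, e2]
  constructor
  · intro h
    refine eq_zero_of_pairing ε ω fun φ hφ => ?_
    rw [key, h φ hφ]; ring
  · intro h φ hφ
    have h1 := key φ hφ
    rw [h, map_zero, map_zero, sub_zero, eq_comm, sub_sub, sub_eq_zero] at h1
    exact h1

end

theorem continuous_test_integrable {φ : Plane → ℝ} (h : IsTest φ) {u : Plane → ℂ}
    (hu : Continuous u) : Integrable fun p => u p * (φ p : ℂ) :=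
  (hu.mul (Complex.continuous_ofReal.comp h.smooth.continuous)).integrable_of_hasCompactSupport
    ((h.compact.comp_left (g := fun r : ℝ => (r : ℂ)) rfl).mul_left)

/-- A function with values in `H²` is a weak solution if and only if its coordinate solves the
equation on the Fourier side. -/
theorem isWeakSolution_iff {ε ω : ℝ} {S : Set ℝ} (hS : ∀ t ∈ S, 0 ≤ t ∧ Set.Icc 0 t ⊆ S)
    {u G : ℝ → Plane → ℂ} {a g : ℝ → FreqSpace} (ha : ContinuousOn a S) (hg : ContinuousOn g S)
    (hu : ∀ t ∈ S, u t =ᵐ[volume] recon (a t)) (hG : ∀ t ∈ S, G t =ᵐ[volume] recon (g t)) :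
    IsWeakSolution ε ω S u G ↔ IsFreqSol ε ω S a g := by
  have hsub : ∀ t ∈ S, Set.uIcc 0 t ⊆ S := fun t ht => by
    rw [Set.uIcc_of_le (hS t ht).1]; exact (hS t ht).2
  have hpair : ∀ (φ : Plane → ℝ) (_ : IsTest φ), ∀ τ ∈ S, ∫ p, u τ p * (φ p : ℂ) =
      ∫ p, recon (a τ) p * (φ p : ℂ) := fun φ _ τ hτ => by
    refine integral_congr_ae ?_
    filter_upwards [hu τ hτ] with p hp
    rw [hp]
  have hpair2 : ∀ (φ : Plane → ℝ) (hφ : IsTest φ), ∀ τ ∈ S,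
      ∫ p, (u τ p * (opL ε ω φ p : ℂ) + G τ p * (φ p : ℂ)) =
      pairing (hφ.opL ε ω).check (a τ) + pairing hφ.check (g τ) := fun φ hφ τ hτ => by
    rw [← integral_recon_mul, ← integral_recon_mul, ← integral_add
      (continuous_test_integrable (hφ.opL ε ω) (continuous_recon _))
      (continuous_test_integrable hφ (continuous_recon _))]
    refine integral_congr_ae ?_
    filter_upwards [hu τ hτ, hG τ hτ] with p h1 h2
    rw [h1, h2]
  have hweak : IsWeakSolution ε ω S u G ↔ ∀ t ∈ S, ∀ (φ : Plane → ℝ) (hφ : IsTest φ),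
      pairing hφ.check (a t) = pairing hφ.check (a 0) +
      ∫ τ in (0 : ℝ)..t, (pairing (hφ.opL ε ω).check (a τ) + pairing hφ.check (g τ)) := by
    have hint : ∀ (φ : Plane → ℝ) (hφ : IsTest φ), ∀ t ∈ S,
        ((∫ p, u t p * (φ p : ℂ) = (∫ p, u 0 p * (φ p : ℂ)) +
          ∫ τ in (0 : ℝ)..t, ∫ p, (u τ p * (opL ε ω φ p : ℂ) + G τ p * (φ p : ℂ))) ↔
        (pairing hφ.check (a t) = pairing hφ.check (a 0) +
          ∫ τ in (0 : ℝ)..t, (pairing (hφ.opL ε ω).check (a τ) + pairing hφ.check (g τ)))) :=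
      fun φ hφ t ht => by
        rw [hpair φ hφ t ht, hpair φ hφ 0 ((hS t ht).2 ⟨le_rfl, (hS t ht).1⟩),
          integral_recon_mul hφ, integral_recon_mul hφ,
          intervalIntegral.integral_congr fun τ hτ => hpair2 φ hφ τ (hsub t ht hτ)]
    exact ⟨fun h t ht φ hφ => (hint φ hφ t ht).1 (h φ hφ.smooth hφ.compact t ht),
      fun h φ h1 h2 t ht => (hint φ ⟨h1, h2⟩ t ht).2 (h t ht φ ⟨h1, h2⟩)⟩
  rw [hweak, IsFreqSol]
  refine forall₂_congr fun t ht => ?_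
  rw [weak_eq_iff_defect_eq_zero (ha.mono (hsub t ht)) (hg.mono (hsub t ht)),
    freq_eq_iff_defect_eq_zero (ha.mono (hsub t ht)) (hg.mono (hsub t ht))]

end

noncomputable section

/-! ### A variational principle for compact perturbations -/

section

variable {E : Type*} [NormedAddCommGroup E] [InnerProductSpace ℂ E] [CompleteSpace E]

/-- For the operator `G = D (1 - T)⁻¹ D`, an upper bound for the eigenvalues is an upper bound for
the form. -/
theorem norm_sq_le_of_eigenvalues {D T : E →L[ℂ] E} (hD : D.IsSymmetric) (hT : T.IsSymmetric)
    (hc : IsCompactOperator D) (hT1 : ‖T‖ < 1) {γ : ℝ} (hγ : 0 < γ)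
    (heig : ∀ k : ℝ, k ≠ 0 → ∀ y : E, y ≠ 0 → D (D y) = (k : ℂ) • (y - T y) → |k| ≤ γ)
    {v z : E} (hz : D z = v - T v) : ‖D v‖ ^ 2 ≤ γ * (inner ℂ v (v - T v)).re := by
  -- R = (1 - T)⁻¹, by the Neumann series.
  obtain ⟨R, hR1, hR2⟩ : ∃ R : E →L[ℂ] E, (1 - T) * R = 1 ∧ R * (1 - T) = 1 :=
    ⟨_, (Units.oneSub T hT1).mul_inv, (Units.oneSub T hT1).inv_mul⟩
  have hR1' : ∀ u, R u - T (R u) = u := fun u => by simpa using congrArg (fun S => S u) hR1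
  have hR2' : ∀ u, R (u - T u) = u := fun u => by
    simpa using congrArg (fun S : E →L[ℂ] E => S u) hR2
  have hRs : R.IsSymmetric := fun x y => by
    have h1 : inner ℂ (R x) (R y - T (R y)) = inner ℂ (R x - T (R x)) (R y) := by
      rw [inner_sub_left, inner_sub_right]
      congr 1
      exact (hT (R x) (R y)).symm
    rw [hR1', hR1'] at h1
    exact h1
  set G : E →L[ℂ] E := D * R * D with hG
  have hGa : ∀ u, G u = D (R (D u)) := fun u => rfl
  have hGs : G.IsSymmetric := fun x y => by
    have h1 := hD (R (D x)) y
    have h2 := hRs (D x) (D y)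
    have h3 := hD x (R (D y))
    exact h1.trans (h2.trans h3)
  have hGc : IsCompactOperator G := by
    have : IsCompactOperator (D ∘ (R * D)) := hc.comp_clm (R * D)
    exact this
  -- For a self-adjoint operator the norm is the spectral radius, and by compactness the nonzero
  -- spectrum consists of eigenvalues, which are real. An eigenvector z of G for k gives y = R D z
  -- with D D y = k (y - T y).
  have hGn : ‖G‖ ≤ γ := by
    have h1 := G.spectralRadius_eq_nnnorm hGs.isSelfAdjoint
    have h2 : spectralRadius ℂ G ≤ ENNReal.ofReal γ := by
      refine iSup₂_le fun k hk => ?_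
      by_cases hk0 : k = 0
      · simp [hk0]
      have hev := (hGc.hasEigenvalue_iff_mem_spectrum hk0).2 hk
      obtain ⟨r, hr⟩ := Complex.conj_eq_iff_real.1
        (LinearMap.IsSymmetric.conj_eigenvalue_eq_self hGs hev)
      obtain ⟨z, hz⟩ := hev.exists_hasEigenvector
      have hz1 : D (R (D z)) = k • z := hz.apply_eq_smul
      have hr0 : r ≠ 0 := fun h => hk0 (by rw [hr, h]; simp)
      have h3 := heig r hr0 (R (D z)) (fun h => by
        rw [h, map_zero] at hz1
        exact (smul_ne_zero hk0 hz.2) hz1.symm) (by rw [hz1, hR1', map_smul, hr])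
      rw [hr, ← ENNReal.ofReal_coe_nnreal, coe_nnnorm, Complex.norm_real]
      exact ENNReal.ofReal_le_ofReal h3
    rw [h1, ← ENNReal.ofReal_coe_nnreal, coe_nnnorm, ENNReal.ofReal_le_ofReal_iff hγ.le] at h2
    exact h2
  have hpos : ∀ u, 0 ≤ (inner ℂ (G u) u).re := fun u => by
    have e : inner ℂ (G u) u = inner ℂ (R (D u)) (R (D u) - T (R (D u))) := by
      rw [hR1']; exact hD (R (D u)) u
    rw [e, inner_sub_right, Complex.sub_re, inner_self_eq_norm_sq_to_K]
    have h1 : (inner ℂ (R (D u)) (T (R (D u)))).re ≤ ‖R (D u)‖ * (‖T‖ * ‖R (D u)‖) :=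
      (Complex.re_le_norm _).trans ((norm_inner_le_norm _ _).trans
        (mul_le_mul_of_nonneg_left (T.le_opNorm _) (norm_nonneg _)))
    have h2 : ((‖R (D u)‖ : ℂ) ^ 2).re = ‖R (D u)‖ ^ 2 := by
      rw [← Complex.ofReal_pow, Complex.ofReal_re]
    simp only [Complex.coe_algebraMap]
    rw [h2]
    nlinarith [sq_nonneg ‖R (D u)‖]
  have hGz : G z = D v := by rw [hGa, hz, hR2']
  -- Positivity of G at z - γ⁻¹Gz, combined with ‖G‖ ≤ γ, gives ‖Gz‖² ≤ γ⟨Gz, z⟩. Here Gz = Dv and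
  -- ⟨Gz, z⟩ = ⟨v, v - Tv⟩.
  have h4 := hpos (z - ((γ⁻¹ : ℝ) : ℂ) • G z)
  have h5 : (inner ℂ (G z) z).re = (inner ℂ v (v - T v)).re := by
    rw [hGz, ← hz]; exact congrArg Complex.re (hD v z)
  have h6 : (inner ℂ (G (G z)) z) = inner ℂ (G z) (G z) := hGs (G z) z
  have h7 : (inner ℂ (G (G z)) (G z)).re ≤ γ * ‖G z‖ ^ 2 := by
    refine (Complex.re_le_norm _).trans ((norm_inner_le_norm _ _).trans ?_)
    have := (G.le_opNorm (G z)).trans (mul_le_mul_of_nonneg_right hGn (norm_nonneg _))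
    nlinarith [norm_nonneg (G z)]
  have h8 : (inner ℂ (G z) (G z)).re = ‖G z‖ ^ 2 := by
    rw [inner_self_eq_norm_sq_to_K]
    exact (congrArg Complex.re (Complex.ofReal_pow _ 2).symm).trans (Complex.ofReal_re _)
  rw [map_sub, map_smul, inner_sub_left, inner_sub_right, inner_sub_right, inner_smul_left,
    inner_smul_left, inner_smul_right, inner_smul_right, h6, Complex.conj_ofReal] at h4
  simp only [Complex.sub_re, Complex.re_ofReal_mul, h8] at h4
  rw [← h5, ← hGz]
  have h9 : γ⁻¹ * (γ⁻¹ * (inner ℂ (G (G z)) (G z)).re) ≤ γ⁻¹ * (γ⁻¹ * (γ * ‖G z‖ ^ 2)) := by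
    gcongr
  have h10 : γ⁻¹ * (γ⁻¹ * (γ * ‖G z‖ ^ 2)) = γ⁻¹ * ‖G z‖ ^ 2 := by field_simp
  have h11 : γ⁻¹ * ‖G z‖ ^ 2 ≤ (inner ℂ (G z) z).re := by linarith
  rw [inv_mul_le_iff₀ hγ] at h11
  exact h11

end

/-! ### Operators on `ℓ²(ℤ)` -/

/-- Square summable sequences. -/
abbrev SeqSpace : Type := lp (fun _ : ℤ => ℂ) 2

theorem memlp_two_iff {z : ℤ → ℂ} : Memℓp z 2 ↔ Summable fun j => ‖z j‖ ^ 2 := by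
  rw [memℓp_gen_iff (by norm_num)]
  norm_num

theorem SeqSpace.summable (z : SeqSpace) : Summable fun j => ‖z j‖ ^ 2 :=
  memlp_two_iff.1 (lp.memℓp z)

theorem SeqSpace.norm_sq (z : SeqSpace) : ‖z‖ ^ 2 = ∑' j, ‖z j‖ ^ 2 := by
  have := lp.norm_rpow_eq_tsum (p := 2) (by norm_num) z
  norm_num at this
  exact this

theorem SeqSpace.norm_le_of_sq {z w : SeqSpace} {C : ℝ} (hC : 0 ≤ C)
    (h : ∀ j, ‖z j‖ ≤ C * ‖w j‖) : ‖z‖ ≤ C * ‖w‖ := by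
  refine le_of_sq_le_sq ?_ (by positivity)
  rw [mul_pow, SeqSpace.norm_sq, SeqSpace.norm_sq, ← tsum_mul_left]
  refine z.summable.tsum_le_tsum (fun j => ?_) (w.summable.mul_left _)
  rw [← mul_pow]
  exact pow_le_pow_left₀ (norm_nonneg _) (h j) 2

theorem memlp_bdd_mul {d : ℤ → ℝ} {C : ℝ} (hd : ∀ j, |d j| ≤ C) (z : SeqSpace) :
    Memℓp (fun j => (d j : ℂ) * z j) 2 := by
  refine memlp_two_iff.2 (Summable.of_nonneg_of_le (fun j => by positivity) (fun j => ?_)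
    (z.summable.mul_left (C ^ 2)))
  rw [norm_mul, mul_pow, Complex.norm_real, Real.norm_eq_abs]
  gcongr
  exact hd j

/-- The diagonal operator with entries `d`. -/
def diagOp (d : ℤ → ℝ) {C : ℝ} (hd : ∀ j, |d j| ≤ C) : SeqSpace →L[ℂ] SeqSpace :=
  LinearMap.mkContinuous
    { toFun := fun z => ⟨fun j => (d j : ℂ) * z j, memlp_bdd_mul hd z⟩
      map_add' := fun z w => lp.ext (funext fun j => mul_add _ _ _)
      map_smul' := fun c z => lp.ext (funext fun j => by
        simp only [lp.coeFn_smul, Pi.smul_apply, smul_eq_mul, RingHom.id_apply]; ring) } C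
    (fun z => SeqSpace.norm_le_of_sq ((abs_nonneg _).trans (hd 0)) fun j => by
      simp only [LinearMap.coe_mk, AddHom.coe_mk]
      rw [norm_mul, Complex.norm_real, Real.norm_eq_abs]
      exact mul_le_mul_of_nonneg_right (hd j) (norm_nonneg _))

@[simp] theorem diagOp_apply (d : ℤ → ℝ) {C : ℝ} (hd : ∀ j, |d j| ≤ C) (z : SeqSpace) (j : ℤ) :
    diagOp d hd z j = (d j : ℂ) * z j := rfl

theorem norm_diagOp_le (d : ℤ → ℝ) {C : ℝ} (hd : ∀ j, |d j| ≤ C) : ‖diagOp d hd‖ ≤ C :=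
  LinearMap.mkContinuous_norm_le _ ((abs_nonneg _).trans (hd 0)) _

theorem diagOp_symm (d : ℤ → ℝ) {C : ℝ} (hd : ∀ j, |d j| ≤ C) : (diagOp d hd).IsSymmetric :=
  fun z w => by
    simp only [ContinuousLinearMap.coe_coe]
    rw [lp.inner_eq_tsum, lp.inner_eq_tsum]
    congr 1
    funext j
    rw [diagOp_apply, diagOp_apply]
    simp only [RCLike.inner_apply, map_mul, Complex.conj_ofReal]
    ring

/-- Finite truncations of the diagonal have finite rank and converge in operator norm, since the
entries tend to zero. -/
theorem isCompactOperator_diagOp (d : ℤ → ℝ) {C : ℝ} (hd : ∀ j, |d j| ≤ C)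
    (hlim : Tendsto d cofinite (𝓝 0)) : IsCompactOperator (diagOp d hd) := by
  have hcoord : ∀ (s : Finset ℤ), IsCompactOperator
      (⇑(∑ j ∈ s, (lp.singleContinuousLinearMap ℂ (fun _ : ℤ => ℂ) 2 j).comp
        ((d j : ℂ) • lp.evalCLM ℂ (fun _ : ℤ => ℂ) 2 j) : SeqSpace →L[ℂ] SeqSpace)) := by
    intro s
    induction s using Finset.cons_induction with
    | empty => simpa using isCompactOperator_zero
    | cons i s hi ih =>
      rw [Finset.sum_cons, FunLike.coe_add]
      refine IsCompactOperator.add ?_ ih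
      have hi : IsCompactOperator
          (lp.singleContinuousLinearMap ℂ (fun _ : ℤ => ℂ) 2 i : ℂ →L[ℂ] SeqSpace) :=
        isCompactOperator_of_locallyCompactSpace_rng
          (lp.singleContinuousLinearMap ℂ (fun _ : ℤ => ℂ) 2 i : ℂ →L[ℂ] SeqSpace)
      exact hi.comp_clm ((d i : ℂ) • lp.evalCLM ℂ (fun _ : ℤ => ℂ) 2 i)
  refine isCompactOperator_of_tendsto (l := (atTop : Filter (Finset ℤ))) ?_
    (Eventually.of_forall hcoord)
  rw [Metric.tendsto_atTop]
  intro r hr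
  have hfin : {j | ¬ |d j| < r / 2}.Finite := by
    have := Metric.tendsto_nhds.1 hlim (r / 2) (by positivity)
    simp only [Real.dist_eq, sub_zero] at this
    exact Filter.eventually_cofinite.1 this
  refine ⟨hfin.toFinset, fun s hs => ?_⟩
  rw [dist_eq_norm]
  refine lt_of_le_of_lt (ContinuousLinearMap.opNorm_le_bound _ (by positivity : 0 ≤ r / 2)
    fun z => SeqSpace.norm_le_of_sq (by positivity) fun j => ?_) (by linarith)
  rw [sub_apply, lp.coeFn_sub, Pi.sub_apply, sum_apply, lp.coeFn_sum,
    Finset.sum_apply, diagOp_apply]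
  have hterm : ∀ i ∈ s, ((lp.singleContinuousLinearMap ℂ (fun _ : ℤ => ℂ) 2 i).comp
        ((d i : ℂ) • lp.evalCLM ℂ (fun _ : ℤ => ℂ) 2 i) z : SeqSpace) j =
      if i = j then (d j : ℂ) * z j else 0 := fun i _ => by
    have : ((lp.singleContinuousLinearMap ℂ (fun _ : ℤ => ℂ) 2 i).comp
        ((d i : ℂ) • lp.evalCLM ℂ (fun _ : ℤ => ℂ) 2 i) z : SeqSpace) =
        lp.single 2 i ((d i : ℂ) * z i) := rfl
    rw [this]
    by_cases h : i = j
    · subst h; simp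
    · rw [lp.single_apply_ne _ _ _ (Ne.symm h), if_neg h]
  rw [Finset.sum_congr rfl hterm, Finset.sum_ite_eq']
  by_cases hj : j ∈ s
  · rw [if_pos hj, sub_self, norm_zero]; positivity
  · rw [if_neg hj, zero_sub, norm_neg, norm_mul, Complex.norm_real, Real.norm_eq_abs]
    refine mul_le_mul_of_nonneg_right ?_ (norm_nonneg _)
    by_contra hcon
    exact hj (hs (hfin.mem_toFinset.2 fun h => hcon h.le))

theorem memlp_shift (k : ℤ) (z : SeqSpace) : Memℓp (fun j => z (j - k)) 2 :=
  memlp_two_iff.2 ((Equiv.subRight k).summable_iff.2 z.summable)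

/-- Translation of sequences. -/
def seqShift (k : ℤ) : SeqSpace →L[ℂ] SeqSpace :=
  LinearMap.mkContinuous
    { toFun := fun z => ⟨fun j => z (j - k), memlp_shift k z⟩
      map_add' := fun z w => lp.ext rfl
      map_smul' := fun c z => lp.ext rfl } 1
    (fun z => by
      rw [one_mul]
      refine le_of_sq_le_sq (le_of_eq ?_) (norm_nonneg _)
      rw [SeqSpace.norm_sq, SeqSpace.norm_sq]
      exact (Equiv.subRight k).tsum_eq fun j => ‖z j‖ ^ 2)

@[simp] theorem seqShift_apply (k : ℤ) (z : SeqSpace) (j : ℤ) : seqShift k z j = z (j - k) :=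
  rfl

theorem norm_seqShift_le (k : ℤ) : ‖seqShift k‖ ≤ 1 :=
  LinearMap.mkContinuous_norm_le _ zero_le_one _

theorem inner_seqShift (k : ℤ) (z w : SeqSpace) :
    inner ℂ (seqShift k z) w = inner ℂ z (seqShift (-k) w) := by
  rw [lp.inner_eq_tsum, lp.inner_eq_tsum,
    ← (Equiv.subRight k).tsum_eq fun j => inner ℂ (z j) (seqShift (-k) w j)]
  congr 1
  funext j
  simp

/-- Convolution with the summable sequence `c`. -/
def seqConv (c : ℤ → ℂ) : SeqSpace →L[ℂ] SeqSpace := ∑' k, c k • seqShift k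

theorem hasSum_seqConv {c : ℤ → ℂ} (hc : Summable fun k => ‖c k‖) (z : SeqSpace) :
    HasSum (fun k => c k • seqShift k z) (seqConv c z) := by
  have h : HasSum (fun k => c k • seqShift k) (seqConv c) := by
    refine (Summable.of_norm_bounded hc fun k => ?_).hasSum
    rw [norm_smul]
    exact mul_le_of_le_one_right (norm_nonneg _) (norm_seqShift_le k)
  exact h.mapL (ContinuousLinearMap.apply ℂ SeqSpace z)

theorem norm_seqConv_le {c : ℤ → ℂ} (hc : Summable fun k => ‖c k‖) :
    ‖seqConv c‖ ≤ ∑' k, ‖c k‖ := by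
  refine tsum_of_norm_bounded hc.hasSum fun k => ?_
  rw [norm_smul]
  exact mul_le_of_le_one_right (norm_nonneg _) (norm_seqShift_le k)

theorem hasSum_seqConv_apply {c : ℤ → ℂ} (hc : Summable fun k => ‖c k‖) (z : SeqSpace) (j : ℤ) :
    HasSum (fun k => c k * z (j - k)) (seqConv c z j) :=
  (hasSum_seqConv hc z).mapL (lp.evalCLM ℂ (fun _ : ℤ => ℂ) 2 j)

theorem seqConv_symm {c : ℤ → ℂ} (hc : Summable fun k => ‖c k‖)
    (hconj : ∀ k, c (-k) = (starRingEnd ℂ) (c k)) : (seqConv c).IsSymmetric := fun f g => by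
  have h1 := (hasSum_seqConv hc f).map
    (AddMonoidHom.mk' (fun u : SeqSpace => inner ℂ u g) fun u v => inner_add_left u v g)
    (by simpa using (continuous_id.inner continuous_const))
  have h2 := (hasSum_seqConv hc g).mapL (innerSL ℂ f)
  simp only [Function.comp_def, AddMonoidHom.mk'_apply, inner_smul_left, inner_seqShift] at h1
  simp only [innerSL_apply_apply, inner_smul_right] at h2
  have h3 := (Equiv.neg ℤ).hasSum_iff.2 h2
  simp only [Function.comp_def, Equiv.neg_apply, hconj] at h3
  exact h1.unique h3

end

noncomputable section

/-! ### The quadratic form of the Bloch operators -/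

/-- `c` is the sequence of Fourier coefficients of `p`, with two derivatives to spare. -/
structure IsCoeff (c : ℤ → ℂ) (p : ℝ → ℂ) : Prop where
  summable_sq : Summable fun j : ℤ => (1 + (j : ℝ) ^ 2) * ‖c j‖
  hasSum : ∀ x, HasSum (fun k => c k * expI k x) (p x)

theorem IsCoeff.summable {c : ℤ → ℂ} {p : ℝ → ℂ} (h : IsCoeff c p) : Summable fun k => ‖c k‖ :=
  summable_norm_of_summable_sq_mul h.summable_sq

theorem isCoeff_torusCoeff {p : ℝ → ℂ} (h4 : ContDiff ℝ 4 p)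
    (hp : Function.Periodic p (2 * Real.pi)) : IsCoeff (torusCoeff p) p where
  summable_sq := summable_int_sq_mul h4 hp
  hasSum := hasSum_torusCoeff h4.continuous hp
    (summable_norm_of_summable_sq_mul (summable_int_sq_mul h4 hp)).of_norm

theorem continuous_of_hasSum {c : ℤ → ℂ} {p : ℝ → ℂ} (hc : Summable fun k => ‖c k‖)
    (hp : ∀ x, HasSum (fun k => c k * expI k x) (p x)) : Continuous p := by
  rw [show p = fun x => ∑' k, c k * expI k x from funext fun x => (hp x).tsum_eq.symm]
  refine continuous_tsum (fun k => continuous_const.mul (continuous_expI k)) hc fun k x => ?_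
  rw [norm_mul, norm_expI, mul_one]

theorem periodic_of_hasSum {c : ℤ → ℂ} {p : ℝ → ℂ}
    (hp : ∀ x, HasSum (fun k => c k * expI k x) (p x)) :
    Function.Periodic p (2 * Real.pi) := fun x => by
  refine (hp (x + 2 * Real.pi)).unique ?_
  simp only [expI_periodic _ x]
  exact hp x

/-- The symbol `(1 - (1 + 2εω)(j + σ₁)² - σ₂²)²`. -/
def blochSym (ε ω : ℝ) (σ : ℝ × ℝ) (j : ℤ) : ℝ :=
  (1 - (1 + 2 * ε * ω) * (j + σ.1) ^ 2 - σ.2 ^ 2) ^ 2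

theorem blochSym_nonneg (ε ω : ℝ) (σ : ℝ × ℝ) (j : ℤ) : 0 ≤ blochSym ε ω σ j := sq_nonneg _

/-- Ellipticity: as 1 + 2εω > 0, the base of the square in the symbol is of order j² for large |j|.
The shift Λ > 0 takes care of the indices where the symbol is small. -/
theorem exists_le_blochSym {ε ω : ℝ} (hk : 0 < 1 + 2 * ε * ω) (σ : ℝ × ℝ) {Λ : ℝ} (hΛ : 0 < Λ) :
    ∃ C : ℝ, 0 < C ∧ ∀ j : ℤ, (1 + (j : ℝ) ^ 2) ^ 2 ≤ C * (blochSym ε ω σ j + Λ) := by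
  set κ := 1 + 2 * ε * ω with hκ
  set A := 1 + 2 * σ.1 ^ 2 + 2 / κ * (1 + σ.2 ^ 2) with hA
  set B := 2 / κ with hB
  have hB0 : 0 < B := by positivity
  have hA0 : 0 < A := by positivity
  refine ⟨2 * A ^ 2 / Λ + 2 * B ^ 2, by positivity, fun j => ?_⟩
  set r := 1 - κ * (j + σ.1) ^ 2 - σ.2 ^ 2 with hr
  have h1 : 1 + (j : ℝ) ^ 2 ≤ A + B * |r| := by
    have h2 : (j + σ.1) ^ 2 = (1 - σ.2 ^ 2 - r) / κ := by
      rw [eq_div_iff hk.ne', hr]; ring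
    have h3 : (j : ℝ) ^ 2 ≤ 2 * (j + σ.1) ^ 2 + 2 * σ.1 ^ 2 := by nlinarith [sq_nonneg (j + 2 * σ.1)]
    have h4 : (j + σ.1) ^ 2 ≤ (1 + σ.2 ^ 2 + |r|) / κ := by
      rw [h2]
      gcongr
      nlinarith [neg_abs_le r, sq_nonneg σ.2]
    have h5 : A + B * |r| = 1 + 2 * σ.1 ^ 2 + 2 * ((1 + σ.2 ^ 2 + |r|) / κ) := by
      rw [hA, hB]; ring
    rw [h5]
    linarith
  have h2 : (1 + (j : ℝ) ^ 2) ^ 2 ≤ (A + B * |r|) ^ 2 := by gcongr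
  have h3 : (A + B * |r|) ^ 2 ≤ 2 * A ^ 2 + 2 * B ^ 2 * r ^ 2 := by
    nlinarith [sq_nonneg (A - B * |r|), sq_abs r]
  have h4 : blochSym ε ω σ j = r ^ 2 := rfl
  rw [h4]
  refine h2.trans (h3.trans ?_)
  have h5 : 2 * A ^ 2 / Λ * Λ = 2 * A ^ 2 := by field_simp
  have h6 : 0 ≤ 2 * A ^ 2 / Λ * r ^ 2 := by positivity
  have h7 : 0 ≤ 2 * B ^ 2 * Λ := by positivity
  linarith [h5, h6, h7]

theorem summable_inv_one_add_int_sq : Summable fun j : ℤ => (1 + (j : ℝ) ^ 2)⁻¹ := by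
  have h := (Real.summable_one_div_int_pow (p := 2)).2 one_lt_two
  refine Summable.of_norm_bounded_eventually h ?_
  filter_upwards [(Set.finite_singleton (0 : ℤ)).compl_mem_cofinite] with j hj
  have hj' : (0 : ℝ) < (j : ℝ) ^ 2 := by
    have : (j : ℝ) ≠ 0 := by exact_mod_cast hj
    positivity
  rw [Real.norm_of_nonneg (by positivity), one_div]
  exact inv_anti₀ hj' (by linarith)

/-- Elliptic regularity: the equation puts (symbol + 1) x in ℓ², hence (1 + j²)² x in ℓ², and the
Fourier series with coefficients x is a function in H⁴(𝕋). -/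
theorem isBlochEigenvalue_of_seq {ε ω b s : ℝ} {ut : ℝ → ℝ} (hk : 0 < 1 + 2 * ε * ω) {c : ℤ → ℂ}
    (hc : IsCoeff c fun x => (potential ε b s ut x : ℂ)) {σ : ℝ × ℝ} {μ : ℝ}
    {x : SeqSpace} (hx : x ≠ 0)
    (he : ∀ j, (blochSym ε ω σ j : ℂ) * x j = seqConv c x j - μ * x j) :
    IsBlochEigenvalue ε ω b s ut σ μ := by
  obtain ⟨C, hC0, hC⟩ := exists_le_blochSym hk σ one_pos
  set r : SeqSpace := seqConv c x + ((1 - μ : ℝ) : ℂ) • x with hr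
  have hrj : ∀ j, ((blochSym ε ω σ j + 1 : ℝ) : ℂ) * x j = r j := fun j => by
    have : r j = seqConv c x j + ((1 - μ : ℝ) : ℂ) * x j := rfl
    rw [this]
    push_cast
    linear_combination he j
  have hb : ∀ j : ℤ, (1 + (j : ℝ) ^ 2) ^ 2 * ‖x j‖ ≤ C * ‖r j‖ := fun j => by
    rw [← hrj, norm_mul, Complex.norm_real, Real.norm_of_nonneg (by
      have := blochSym_nonneg ε ω σ j; positivity), ← mul_assoc]
    exact mul_le_mul_of_nonneg_right (hC j) (norm_nonneg _)
  have hs : Summable fun j => ‖x j‖ := by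
    refine Summable.of_nonneg_of_le (fun j => norm_nonneg _) (fun j => ?_)
      (summable_inv_one_add_int_sq.mul_left (C * ‖r‖))
    have h1 := hb j
    have h2 : ‖r j‖ ≤ ‖r‖ := lp.norm_apply_le_norm (by norm_num) r j
    have h3 : (1 : ℝ) ≤ 1 + (j : ℝ) ^ 2 := by nlinarith [sq_nonneg (j : ℝ)]
    rw [← div_eq_mul_inv, le_div_iff₀ (by positivity)]
    calc ‖x j‖ * (1 + (j : ℝ) ^ 2) ≤ (1 + (j : ℝ) ^ 2) ^ 2 * ‖x j‖ := by
          rw [mul_comm]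
          exact mul_le_mul_of_nonneg_right (le_self_pow₀ h3 two_ne_zero) (norm_nonneg _)
      _ ≤ C * ‖r j‖ := h1
      _ ≤ C * ‖r‖ := by gcongr
  set W : ℝ → ℂ := fun y => ∑' j, x j * expI j y with hW
  have hWs : ∀ y, HasSum (fun j => x j * expI j y) (W y) := fun y => by
    refine (Summable.of_norm_bounded hs fun j => ?_).hasSum
    rw [norm_mul, norm_expI, mul_one]
  have hWc : Continuous W := continuous_of_hasSum hs hWs
  have hWx : ∀ j, torusCoeff W j = x j := torusCoeff_of_hasSum hs hWs
  refine ⟨W, ⟨periodic_of_hasSum hWs, ?_, ?_⟩, ?_, fun j => ?_⟩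
  · obtain ⟨B, hB⟩ := exists_bound_of_periodic hWc (periodic_of_hasSum hWs)
    exact MemLp.of_bound hWc.aestronglyMeasurable B (ae_of_all _ hB)
  · refine ENNReal.rpow_lt_top_of_nonneg (by norm_num) (Summable.tsum_ofReal_ne_top ?_)
    refine Summable.of_nonneg_of_le (fun j => by positivity) (fun j => ?_)
      (r.summable.mul_left (C ^ 2))
    rw [hWx, ← mul_pow, show (4 : ℕ) = 2 * 2 from rfl, pow_mul, ← mul_pow]
    exact pow_le_pow_left₀ (by positivity) (hb j) 2
  · by_contra hcon
    push Not at hcon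
    exact hx (lp.ext (funext fun j => (hWx j).symm.trans (hcon j)))
  · have h1 := hasSum_torusCoeff_mul hc.summable hc.hasSum hWc j
    simp only [hWx] at h1
    have h2 := h1.unique (hasSum_seqConv_apply hc.summable x j)
    rw [blochCoeff, h2, hWx]
    have h3 : (1 + (1 + 2 * ε * ω) * (Complex.I * (j + σ.1)) ^ 2 - σ.2 ^ 2 : ℂ) ^ 2 =
        (blochSym ε ω σ j : ℂ) := by
      rw [mul_pow, Complex.I_sq, blochSym]
      push_cast
      ring
    rw [h3]
    linear_combination -he j

/-- Let m be the symbol, Q the convolution with c, D = (m + Λ)^(-1/2) and T = DQD. The resolvent (Λ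
- B(σ))⁻¹ is D(1 - T)⁻¹D, which is compact, and its eigenvalue k corresponds to the eigenvalue Λ -
1/k of B(σ). A bound for the eigenvalues is therefore a bound for the form. Finitely supported
sequences avoid all questions of domain. -/
theorem bloch_form_le {ε ω b s : ℝ} {ut : ℝ → ℝ} {lamM : ℝ} (hk : 0 < 1 + 2 * ε * ω) {c : ℤ → ℂ}
    (hc : IsCoeff c fun x => (potential ε b s ut x : ℂ))
    (hconj : ∀ k, c (-k) = (starRingEnd ℂ) (c k))
    (hmax : ∀ σ μ, IsBlochEigenvalue ε ω b s ut σ μ → μ ≤ lamM) (σ : ℝ × ℝ)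
    {w : SeqSpace} {S : Finset ℤ} (hw : ∀ j ∉ S, w j = 0) :
    ∑ j ∈ S, (-blochSym ε ω σ j * ‖w j‖ ^ 2 + ((starRingEnd ℂ) (w j) * seqConv c w j).re) ≤
      lamM * ∑ j ∈ S, ‖w j‖ ^ 2 := by
  set Q := seqConv c with hQ
  have hQn : ‖Q‖ ≤ ∑' k, ‖c k‖ := norm_seqConv_le hc.summable
  have hq0 : 0 ≤ ∑' k, ‖c k‖ := tsum_nonneg fun k => norm_nonneg _
  -- Λ exceeds the norm of Q, so that ‖T‖ < 1, and it exceeds λ_M.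
  set Λ := |lamM| + (∑' k, ‖c k‖) + 1 with hΛ
  have hΛ0 : 0 < Λ := by positivity
  have hΛM : 0 < Λ - lamM := by have := le_abs_self lamM; linarith
  have hmΛ : ∀ j, 0 < blochSym ε ω σ j + Λ := fun j => by
    have := blochSym_nonneg ε ω σ j; positivity
  obtain ⟨C, hC0, hC⟩ := exists_le_blochSym hk σ hΛ0
  set d : ℤ → ℝ := fun j => (Real.sqrt (blochSym ε ω σ j + Λ))⁻¹ with hd
  have hdpos : ∀ j, 0 < d j := fun j => inv_pos.2 (Real.sqrt_pos.2 (hmΛ j))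
  have hd2 : ∀ j, d j * d j * (blochSym ε ω σ j + Λ) = 1 := fun j => by
    rw [hd]
    simp only
    rw [← mul_inv, Real.mul_self_sqrt (hmΛ j).le, inv_mul_cancel₀ (hmΛ j).ne']
  have hdb : ∀ j, |d j| ≤ (Real.sqrt Λ)⁻¹ := fun j => by
    rw [abs_of_pos (hdpos j)]
    exact inv_anti₀ (Real.sqrt_pos.2 hΛ0) (Real.sqrt_le_sqrt (by
      linarith [blochSym_nonneg ε ω σ j]))
  have hdlim : Tendsto d cofinite (𝓝 0) := by
    have h1 := (summable_inv_one_add_int_sq.mul_left (Real.sqrt C)).tendsto_cofinite_zero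
    refine squeeze_zero (fun j => (hdpos j).le) (fun j => ?_) h1
    have h2 : 1 + (j : ℝ) ^ 2 ≤ Real.sqrt C * Real.sqrt (blochSym ε ω σ j + Λ) := by
      rw [← Real.sqrt_mul hC0.le]
      exact Real.le_sqrt_of_sq_le (hC j)
    rw [hd, ← div_eq_mul_inv, le_div_iff₀ (by positivity), inv_mul_eq_div,
      div_le_iff₀ (Real.sqrt_pos.2 (hmΛ j))]
    exact h2
  set D := diagOp d hdb with hD
  have hDs : D.IsSymmetric := diagOp_symm d hdb
  have hQs : Q.IsSymmetric := seqConv_symm hc.summable hconj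
  set T : SeqSpace →L[ℂ] SeqSpace := D * Q * D with hT
  have hTa : ∀ u, T u = D (Q (D u)) := fun u => rfl
  have hTs : T.IsSymmetric := fun x y =>
    (hDs (Q (D x)) y).trans ((hQs (D x) (D y)).trans (hDs x (Q (D y))))
  have hTn : ‖T‖ < 1 := by
    have hDn : ‖D‖ ≤ (Real.sqrt Λ)⁻¹ := norm_diagOp_le d hdb
    have h1 : ‖T‖ ≤ (Real.sqrt Λ)⁻¹ * (∑' k, ‖c k‖) * (Real.sqrt Λ)⁻¹ := by
      refine (norm_mul_le _ _).trans (mul_le_mul ((norm_mul_le _ _).trans ?_) hDn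
        (norm_nonneg _) (by positivity))
      exact mul_le_mul hDn hQn (norm_nonneg _) (by positivity)
    refine h1.trans_lt ?_
    have h2 : (Real.sqrt Λ)⁻¹ * (∑' k, ‖c k‖) * (Real.sqrt Λ)⁻¹ = (∑' k, ‖c k‖) / Λ := by
      rw [mul_right_comm, ← mul_inv, Real.mul_self_sqrt hΛ0.le, inv_mul_eq_div]
    rw [h2, div_lt_one hΛ0]
    have := abs_nonneg lamM
    linarith
  -- u = (m + Λ)w and v = (m + Λ)^(1/2) w, so that D u = v and D v = w. Then z = u - Q w solves D z
  -- = v - T v.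
  set u : SeqSpace := ⟨fun j => ((blochSym ε ω σ j + Λ : ℝ) : ℂ) * w j, memlp_two_iff.2
    (summable_of_ne_finset_zero (s := S) fun j hj => by simp [hw j hj])⟩ with hu
  set v : SeqSpace := ⟨fun j => (((d j)⁻¹ : ℝ) : ℂ) * w j, memlp_two_iff.2
    (summable_of_ne_finset_zero (s := S) fun j hj => by simp [hw j hj])⟩ with hv
  have hdne : ∀ j, (d j : ℂ) ≠ 0 := fun j => Complex.ofReal_ne_zero.2 (hdpos j).ne'
  have hDv : D v = w := lp.ext (funext fun j => by
    rw [hD, diagOp_apply]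
    change (d j : ℂ) * ((((d j)⁻¹ : ℝ) : ℂ) * w j) = w j
    rw [← mul_assoc, ← Complex.ofReal_mul, mul_inv_cancel₀ (hdpos j).ne', Complex.ofReal_one,
      one_mul])
  have hDu : D u = v := lp.ext (funext fun j => by
    rw [hD, diagOp_apply]
    change (d j : ℂ) * (((blochSym ε ω σ j + Λ : ℝ) : ℂ) * w j) = (((d j)⁻¹ : ℝ) : ℂ) * w j
    rw [← mul_assoc, ← Complex.ofReal_mul]
    congr 2
    refine eq_inv_of_mul_eq_one_left ?_
    linarith [hd2 j])
  -- An eigenvector y for k gives x = D y with B(σ)x = (Λ - 1/k)x. Hence Λ - 1/k ≤ λ_M, which forces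
  -- k > 0 and k ≤ (Λ - λ_M)⁻¹.
  have key := norm_sq_le_of_eigenvalues (D := D) (T := T) hDs hTs
    (isCompactOperator_diagOp d hdb hdlim) hTn (γ := (Λ - lamM)⁻¹) (inv_pos.2 hΛM) (fun k hk0 y hy hDy => by
      have hx0 : D y ≠ 0 := fun h => hy (lp.ext (funext fun j => by
        have h1 : (d j : ℂ) * y j = 0 := by
          rw [← diagOp_apply d hdb, ← hD, h]; rfl
        exact (mul_eq_zero.1 h1).resolve_left (hdne j)))
      have h1 := hmax σ (Λ - k⁻¹) (isBlochEigenvalue_of_seq hk hc (x := D y) hx0 fun j => by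
        have h2 : (d j : ℂ) * D y j = k * (y j - d j * Q (D y) j) := by
          have h3 := congrArg (fun z : SeqSpace => z j) hDy
          exact h3
        have h4 : D y j = (d j : ℂ) * y j := rfl
        have h5 : (d j : ℂ) * d j * (blochSym ε ω σ j + Λ) = 1 := by exact_mod_cast hd2 j
        have hkc : (k : ℂ) ≠ 0 := Complex.ofReal_ne_zero.2 hk0
        have h6 : y j = d j * (blochSym ε ω σ j + Λ) * D y j := by
          rw [h4]; linear_combination (-y j) * h5
        have h7 : (d j : ℂ) * D y j = d j * (k * ((blochSym ε ω σ j + Λ) * D y j - Q (D y) j)) := by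
          rw [h2]; nth_rewrite 1 [h6]; ring
        have h8 := mul_left_cancel₀ (hdne j) h7
        have h9 : (k : ℂ)⁻¹ * D y j = (blochSym ε ω σ j + Λ) * D y j - Q (D y) j := by
          nth_rewrite 1 [h8]; rw [← mul_assoc, inv_mul_cancel₀ hkc, one_mul]
        push_cast
        linear_combination -h9)
      have h2 : Λ - lamM ≤ k⁻¹ := by linarith
      have h3 : 0 < k := inv_pos.1 (hΛM.trans_le h2)
      rw [abs_of_pos h3]
      exact (le_inv_comm₀ hΛM h3).1 h2) (v := v) (z := u - Q w) (by
      rw [map_sub, hDu, hTa, hDv])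
  rw [hDv, ← div_eq_inv_mul, le_div_iff₀ hΛM, inner_sub_right, hTa, hDv] at key
  have e1 : inner ℂ v (D (Q w)) = inner ℂ w (Q w) := by
    rw [← hDv]; exact (hDs v (Q (D v))).symm
  have e2 : inner ℂ v v = inner ℂ w u := by
    nth_rewrite 2 [← hDu]
    rw [← hDv]; exact (hDs v u).symm
  have f1 : ∀ z : SeqSpace, inner ℂ w z = ∑ j ∈ S, (starRingEnd ℂ) (w j) * z j := fun z => by
    rw [lp.inner_eq_tsum]
    refine (tsum_eq_sum fun j hj => ?_).trans (Finset.sum_congr rfl fun j _ => ?_)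
    · rw [hw j hj, inner_zero_left]
    · rw [RCLike.inner_apply, mul_comm]
  have f2 : ‖w‖ ^ 2 = ∑ j ∈ S, ‖w j‖ ^ 2 := by
    rw [SeqSpace.norm_sq]
    exact tsum_eq_sum fun j hj => by simp [hw j hj]
  rw [e1, e2, f1, f1, f2] at key
  have f3 : (∑ j ∈ S, (starRingEnd ℂ) (w j) * u j).re =
      ∑ j ∈ S, blochSym ε ω σ j * ‖w j‖ ^ 2 + Λ * ∑ j ∈ S, ‖w j‖ ^ 2 := by
    rw [Complex.re_sum, Finset.mul_sum, ← Finset.sum_add_distrib]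
    refine Finset.sum_congr rfl fun j _ => ?_
    change ((starRingEnd ℂ) (w j) * (((blochSym ε ω σ j + Λ : ℝ) : ℂ) * w j)).re = _
    rw [mul_left_comm, Complex.re_ofReal_mul, ← Complex.normSq_eq_conj_mul_self,
      Complex.ofReal_re, Complex.normSq_eq_norm_sq]
    ring
  rw [Complex.sub_re, f3] at key
  rw [Finset.sum_add_distrib, ← Complex.re_sum]
  simp only [neg_mul, Finset.sum_neg_distrib]
  linarith

end

noncomputable section

/-! ### The quadratic form of the linearization -/

theorem shiftVec_apply_zero (k : ℤ) : shiftVec k 0 = k / (2 * Real.pi) := by simp [shiftVec]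

theorem shiftVec_apply_one (k : ℤ) : shiftVec k 1 = 0 := by simp [shiftVec]

theorem two_pi_mul_add_shiftVec (ξ : Plane) (k : ℤ) :
    2 * Real.pi * (ξ + shiftVec k) 0 = 2 * Real.pi * ξ 0 + k := by
  rw [PiLp.add_apply, shiftVec_apply_zero]
  field_simp

theorem sym_add_shiftVec (ε ω : ℝ) (ξ : Plane) (j : ℤ) :
    sym ε ω (ξ + shiftVec j) = blochSym ε ω (2 * Real.pi * ξ 0, 2 * Real.pi * ξ 1) j := by
  rw [sym, symA, two_pi_mul_add_shiftVec, PiLp.add_apply, shiftVec_apply_one, add_zero, blochSym]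
  ring

theorem measurable_floor_coord : Measurable fun ξ : Plane => ⌊2 * Real.pi * ξ 0⌋ :=
  Int.measurable_floor.comp (by fun_prop : Continuous fun ξ : Plane => 2 * Real.pi * ξ 0).measurable

/-- An integral over the plane is computed on the strips `j ≤ 2πξ₀ < j + 1`. -/
theorem integral_eq_integral_strip {F : Plane → ℝ} (hF : Integrable F) (M : Finset ℤ)
    (hM : ∀ ξ, F ξ ≠ 0 → ⌊2 * Real.pi * ξ 0⌋ ∈ M) :
    ∫ ξ, F ξ = ∫ ξ in {ξ : Plane | ⌊2 * Real.pi * ξ 0⌋ = 0}, ∑ j ∈ M, F (ξ + shiftVec j) := by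
  have hmeas : ∀ j : ℤ, MeasurableSet {ξ : Plane | ⌊2 * Real.pi * ξ 0⌋ = j} := fun j =>
    measurable_floor_coord (measurableSet_singleton j)
  have h1 : ∀ ξ, F ξ = ∑ j ∈ M, {ξ : Plane | ⌊2 * Real.pi * ξ 0⌋ = j}.indicator F ξ := fun ξ => by
    by_cases h : F ξ = 0
    · rw [h]
      exact (Finset.sum_eq_zero fun j _ => by simp [Set.indicator_apply, h]).symm
    · rw [Finset.sum_eq_single_of_mem _ (hM ξ h) fun j _ hj =>
        Set.indicator_of_notMem (fun h' => hj h'.symm) _]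
      exact (Set.indicator_of_mem (by rfl) _).symm
  rw [integral_congr_ae (ae_of_all _ h1), integral_finsetSum _ fun j _ =>
    hF.indicator (hmeas j), integral_finsetSum _ fun j _ =>
    (hF.comp_add_right (shiftVec j)).integrableOn]
  refine Finset.sum_congr rfl fun j _ => ?_
  rw [← integral_indicator (hmeas 0), ← integral_add_right_eq_self _ (shiftVec j)]
  congr 1
  funext ξ
  have : (ξ + shiftVec j ∈ {ξ : Plane | ⌊2 * Real.pi * ξ 0⌋ = j}) ↔
      ξ ∈ {ξ : Plane | ⌊2 * Real.pi * ξ 0⌋ = 0} := by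
    simp only [Set.mem_ofPred_eq, two_pi_mul_add_shiftVec, Int.floor_add_intCast]
    omega
  by_cases h : ξ ∈ {ξ : Plane | ⌊2 * Real.pi * ξ 0⌋ = 0}
  · rw [Set.indicator_of_mem (this.2 h), Set.indicator_of_mem h]
  · rw [Set.indicator_of_notMem (mt this.1 h), Set.indicator_of_notMem h]

/-- Floquet–Bloch decomposition: the potential couples only the frequencies ξ + `shiftVec k`, so on
each fibre the form is that of B(2πξ) on the sequence j ↦ z(ξ + `shiftVec j`). The fibre
inequalities are integrated over one strip. The frequency cut-off makes all these sequences finitely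
supported. -/
theorem form_le {ε ω b s : ℝ} {ut : ℝ → ℝ} {lamM : ℝ} (hk : 0 < 1 + 2 * ε * ω) {c : ℤ → ℂ}
    (hc : IsCoeff c fun x => (potential ε b s ut x : ℂ))
    (hconj : ∀ k, c (-k) = (starRingEnd ℂ) (c k))
    (hmax : ∀ σ μ, IsBlochEigenvalue ε ω b s ut σ μ → μ ≤ lamM) {n : ℕ} {z : FreqSpace}
    (hz : cutOp n z = z) :
    (inner ℂ z (genOp ε ω n z + convHat c z)).re ≤ lamM * ‖z‖ ^ 2 := by
  -- This representative vanishes everywhere outside the ball, not only almost everywhere; its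
  -- values along whole fibres are needed.
  set Z : Plane → ℂ := fun ξ => (cut n ξ : ℂ) * z ξ with hZ
  have hzZ : z =ᵐ[volume] Z := by
    have := coeFn_mulOp (bddMeas_cut n) z
    rw [← cutOp, hz] at this
    exact this
  have hZ0 : ∀ ξ, Z ξ ≠ 0 → ‖ξ‖ ≤ n := fun ξ h => by
    by_contra hcon
    exact h (by rw [hZ]; simp [cut_of_lt (not_le.1 hcon)])
  set B : ℤ := ⌈2 * Real.pi * n⌉ + 1 with hB
  have hfloor : ∀ ξ, Z ξ ≠ 0 → ⌊2 * Real.pi * ξ 0⌋ ∈ Finset.Icc (-B) B := fun ξ h => by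
    have h1 : |ξ 0| ≤ n := (PiLp.norm_apply_le ξ 0).trans (hZ0 ξ h)
    have h2 : |2 * Real.pi * ξ 0| ≤ 2 * Real.pi * n := by
      rw [abs_mul, abs_of_pos Real.two_pi_pos]
      gcongr
    have h3 := Int.le_ceil (2 * Real.pi * n)
    rw [abs_le] at h2
    rw [Finset.mem_Icc]
    constructor
    · rw [Int.le_floor]
      push_cast [hB]
      linarith
    · have h4 : (⌊2 * Real.pi * ξ 0⌋ : ℝ) ≤ B := by
        push_cast [hB]
        linarith [Int.floor_le (2 * Real.pi * ξ 0)]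
      exact_mod_cast h4
  have hsupp : ∀ ξ : Plane, ∀ k : ℤ, Z (ξ + shiftVec k) ≠ 0 →
      ⌊2 * Real.pi * ξ 0⌋ + k ∈ Finset.Icc (-B) B := fun ξ k h => by
    have := hfloor _ h
    rwa [two_pi_mul_add_shiftVec, Int.floor_add_intCast] at this
  set G : Plane → ℂ := fun ξ => ∑' k, c k * Z (ξ - shiftVec k) with hG
  have hGs : ∀ ξ, HasSum (fun k => c k * Z (ξ - shiftVec k)) (G ξ) := fun ξ => by
    refine (summable_of_ne_finset_zero
      (s := Finset.Icc (⌊2 * Real.pi * ξ 0⌋ - B) (⌊2 * Real.pi * ξ 0⌋ + B)) fun k hk => ?_).hasSum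
    by_contra hcon
    have h1 := hsupp ξ (-k) (by
      rw [shiftVec_neg, ← sub_eq_add_neg]
      exact (mul_ne_zero_iff.1 hcon).2)
    rw [Finset.mem_Icc] at h1 hk
    omega
  have hGz : convHat c z =ᵐ[volume] G := coeFn_convHat hc.summable hzZ (ae_of_all _ hGs)
  set F : Plane → ℝ := fun ξ => -sym ε ω ξ * ‖Z ξ‖ ^ 2 +
    ((starRingEnd ℂ) (Z ξ) * G ξ).re - lamM * ‖Z ξ‖ ^ 2 with hF
  have hFae : ∀ᵐ ξ, (inner ℂ (z ξ) ((genOp ε ω n z + convHat c z) ξ)).re -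
      lamM * (inner ℂ (z ξ) (z ξ)).re = F ξ := by
    filter_upwards [hzZ, hGz, Lp.coeFn_add (genOp ε ω n z) (convHat c z),
      coeFn_mulOp (bddMeas_gen ε ω n) z] with ξ h1 h2 h3 h4
    rw [h3, Pi.add_apply, h2, genOp, h4, h1]
    have hcut : (cut n ξ : ℂ) * Z ξ = Z ξ := by
      rw [hZ]; simp only; rw [← mul_assoc, ← Complex.ofReal_mul, cut_mul_self]
    simp only [RCLike.inner_apply, add_mul, Complex.add_re]
    have e1 : ((-sym ε ω ξ * cut n ξ : ℝ) : ℂ) * Z ξ * (starRingEnd ℂ) (Z ξ) =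
        ((-sym ε ω ξ * ‖Z ξ‖ ^ 2 : ℝ) : ℂ) := by
      rw [Complex.ofReal_mul, mul_assoc (((-sym ε ω ξ : ℝ)) : ℂ), hcut, mul_assoc,
        Complex.mul_conj, Complex.normSq_eq_norm_sq, ← Complex.ofReal_mul]
    rw [e1, Complex.ofReal_re, Complex.mul_conj, Complex.ofReal_re, Complex.normSq_eq_norm_sq, hF]
    simp only
    rw [mul_comm (G ξ)]
  have hi1 : Integrable fun ξ => (inner ℂ (z ξ) ((genOp ε ω n z + convHat c z) ξ)).re :=
    (L2.integrable_inner (𝕜 := ℂ) z (genOp ε ω n z + convHat c z)).re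
  have hi2 : Integrable fun ξ => (inner ℂ (z ξ) (z ξ)).re := 
    (L2.integrable_inner (𝕜 := ℂ) z z).re
  have hFi : Integrable F := (hi1.sub (hi2.const_mul lamM)).congr hFae
  have hint : (inner ℂ z (genOp ε ω n z + convHat c z)).re - lamM * ‖z‖ ^ 2 = ∫ ξ, F ξ := by
    rw [← integral_congr_ae hFae, integral_sub hi1 (hi2.const_mul lamM), integral_const_mul]
    have e1 : ∀ y : FreqSpace, (inner ℂ z y).re = ∫ ξ, (inner ℂ (z ξ) (y ξ)).re := fun y => by
      rw [L2.inner_def]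
      exact (integral_re (L2.integrable_inner (𝕜 := ℂ) z y)).symm
    rw [← e1, ← e1 z]
    congr 2
    exact (inner_self_eq_norm_sq (𝕜 := ℂ) z).symm
  have hneg : ∫ ξ, F ξ ≤ 0 := by
    rw [integral_eq_integral_strip hFi (Finset.Icc (-B) B) fun ξ h => hfloor ξ fun h0 => h (by
      rw [hF]; simp [h0])]
    refine setIntegral_nonpos (measurable_floor_coord (measurableSet_singleton 0)) fun ξ hξ => ?_
    have hξ' : ⌊2 * Real.pi * ξ 0⌋ = 0 := hξ
    have hw0 : ∀ j ∉ Finset.Icc (-B) B, Z (ξ + shiftVec j) = 0 := fun j hj => by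
      by_contra hcon
      have := hsupp ξ j hcon
      rw [hξ', zero_add] at this
      exact hj this
    set w : SeqSpace := ⟨fun j => Z (ξ + shiftVec j), memlp_two_iff.2
      (summable_of_ne_finset_zero (s := Finset.Icc (-B) B) fun j hj => by simp [hw0 j hj])⟩ with hw
    have hwj : ∀ j, w j = Z (ξ + shiftVec j) := fun j => rfl
    have key := bloch_form_le hk hc hconj hmax (2 * Real.pi * ξ 0, 2 * Real.pi * ξ 1)
      (w := w) (S := Finset.Icc (-B) B) hw0
    have hconv : ∀ j, seqConv c w j = G (ξ + shiftVec j) := fun j => by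
      refine (hasSum_seqConv_apply hc.summable w j).unique ?_
      convert hGs (ξ + shiftVec j) using 3 with k
      rw [hwj, sub_eq_add_neg j k, shiftVec_add, shiftVec_neg]
      congr 1
      abel
    rw [Finset.mul_sum, ← sub_nonpos, ← Finset.sum_sub_distrib] at key
    refine le_trans (le_of_eq (Finset.sum_congr rfl fun j _ => ?_)) key
    rw [hF]
    simp only [sym_add_shiftVec, hconv, hwj]
  linarith

end

noncomputable section

/-! ### The energy form -/

theorem wt_eq (ξ : Plane) :
    wt ξ = 1 + (2 * Real.pi * ξ 0) ^ 2 + (2 * Real.pi * ξ 1) ^ 2 := by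
  rw [wt, mul_pow, EuclideanSpace.norm_sq_eq, Fin.sum_univ_two, Real.norm_eq_abs,
    Real.norm_eq_abs, sq_abs, sq_abs]
  ring

theorem sym_le {ε ω : ℝ} (hk : 0 < 1 + 2 * ε * ω) (ξ : Plane) :
    sym ε ω ξ ≤ (2 + 2 * ε * ω) ^ 2 * wt ξ ^ 2 := by
  rw [sym, ← mul_pow]
  refine sq_le_sq' ?_ ?_ <;>
  · rw [symA, wt_eq]
    have h1 := sq_nonneg (2 * Real.pi * ξ 0)
    have h2 := sq_nonneg (2 * Real.pi * ξ 1)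
    nlinarith [mul_nonneg hk.le h1, mul_nonneg hk.le h2]

/-- The symbol of 𝒜 controls κ(2πξ₀)² + (2πξ₁)² up to a constant, and A is chosen with A ≥ 1 and Aκ
≥ 1. With `sym_le` this makes 𝒜² + Λ comparable with (1 - Δ)², which is why the form of Λ - 𝓛
measures the H² norm. -/
theorem exists_wt_sq_le {ε ω : ℝ} (hk : 0 < 1 + 2 * ε * ω) :
    ∃ r Λ : ℝ, 0 < r ∧ 0 < Λ ∧ ∀ ξ, r * wt ξ ^ 2 ≤ Λ + sym ε ω ξ := by
  set κ := 1 + 2 * ε * ω with hκ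
  set A := 1 + 1 / κ with hA
  have hA1 : 1 ≤ A := by rw [hA]; have : 0 < 1 / κ := by positivity
                         linarith
  have hAκ : 1 ≤ A * κ := by
    rw [hA, add_mul, one_div, inv_mul_cancel₀ hk.ne']; linarith
  refine ⟨1 / (2 * A ^ 2), (1 + A) ^ 2 / A ^ 2, by positivity, by positivity, fun ξ => ?_⟩
  have h0 := wt_pos ξ
  have h1 : wt ξ ≤ 1 + A + A * |symA ε ω ξ| := by
    have e : symA ε ω ξ = 1 - κ * (2 * Real.pi * ξ 0) ^ 2 - (2 * Real.pi * ξ 1) ^ 2 := rfl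
    have h2 : κ * (2 * Real.pi * ξ 0) ^ 2 + (2 * Real.pi * ξ 1) ^ 2 ≤ 1 + |symA ε ω ξ| := by
      have := neg_abs_le (symA ε ω ξ); linarith
    have h3 := mul_le_mul_of_nonneg_left h2 (by positivity : 0 ≤ A)
    have h4 := mul_le_mul_of_nonneg_right hAκ (sq_nonneg (2 * Real.pi * ξ 0))
    have h5 := mul_le_mul_of_nonneg_right hA1 (sq_nonneg (2 * Real.pi * ξ 1))
    rw [wt_eq]
    linarith
  have h2 : wt ξ ^ 2 ≤ 2 * (1 + A) ^ 2 + 2 * A ^ 2 * sym ε ω ξ := by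
    have h3 : wt ξ ^ 2 ≤ (1 + A + A * |symA ε ω ξ|) ^ 2 := by gcongr
    have h4 := sq_abs (symA ε ω ξ)
    rw [sym]
    nlinarith [sq_nonneg (1 + A - A * |symA ε ω ξ|)]
  have h3 : (1 + A) ^ 2 / A ^ 2 + sym ε ω ξ =
      1 / (2 * A ^ 2) * (2 * (1 + A) ^ 2 + 2 * A ^ 2 * sym ε ω ξ) := by
    field_simp
  rw [h3]
  gcongr

theorem le_inner_mulOp {h : Plane → ℝ} (hh : BddMeas h) {r : ℝ} (hr : ∀ ξ, r ≤ h ξ)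
    (a : FreqSpace) : r * ‖a‖ ^ 2 ≤ (inner ℂ (mulOp h a) a).re := by
  set k : Plane → ℝ := fun ξ => Real.sqrt (h ξ + -r) with hk
  have hk2 : ∀ ξ, k ξ * k ξ = h ξ + -r := fun ξ => Real.mul_self_sqrt (by linarith [hr ξ])
  have hkb : BddMeas k := by
    obtain ⟨C, hC⟩ := (hh.add (BddMeas.const (-r))).bdd
    refine ⟨(hh.add (BddMeas.const (-r))).meas.sqrt, Real.sqrt C, fun ξ => ?_⟩
    rw [abs_of_nonneg (Real.sqrt_nonneg _)]
    exact Real.sqrt_le_sqrt ((le_abs_self _).trans (hC ξ))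
  have h1 : mulOp h a = (r : ℂ) • a + mulOp k (mulOp k a) := by
    rw [mulOp_mulOp hkb hkb, ← mulOp_const, ← mulOp_add (BddMeas.const r) (hkb.mul hkb)]
    congr 2
    funext ξ
    rw [hk2]; ring
  have e : ∀ x : FreqSpace, (inner ℂ x x).re = ‖x‖ ^ 2 := fun x => inner_self_eq_norm_sq (𝕜 := ℂ) x
  rw [h1, inner_add_left, inner_smul_left, inner_mulOp_left hkb, Complex.conj_ofReal,
    Complex.add_re, Complex.re_ofReal_mul, e, e]
  exact le_add_of_nonneg_right (sq_nonneg _)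

/-- T represents the form of Λ - 𝓛 on L² in H² coordinates: ⟨Ta, a⟩ = ⟨(Λ - 𝓛)z, z⟩, where z is the
Fourier transform of the function. Coercivity is ellipticity. The last property says that this
energy grows at rate at most 2λ_M along the truncated flow. It uses only the form bound for R =
Re⟨z, 𝓛z⟩ and Cauchy–Schwarz, so the H² estimate inherits the L² rate without loss. -/
theorem exists_energyForm {ε ω b s : ℝ} {ut : ℝ → ℝ} {lamM : ℝ} (hk : 0 < 1 + 2 * ε * ω)
    {c : ℤ → ℂ} (hc : IsCoeff c fun x => (potential ε b s ut x : ℂ))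
    (hconj : ∀ k, c (-k) = (starRingEnd ℂ) (c k))
    (hmax : ∀ σ μ, IsBlochEigenvalue ε ω b s ut σ μ → μ ≤ lamM) :
    ∃ (T : FreqSpace →L[ℂ] FreqSpace) (r : ℝ), 0 < r ∧
      (∀ x y, inner ℂ (T x) y = inner ℂ x (T y)) ∧
      (∀ a, r * ‖a‖ ^ 2 ≤ (inner ℂ (T a) a).re) ∧
      ∀ n a, cutOp n a = a →
        (inner ℂ (T a) (genOp ε ω n a + cutOp n (multH2 c a))).re ≤ lamM * (inner ℂ (T a) a).re := by
  obtain ⟨r, Λ₀, hr, hΛ₀, hwt⟩ := exists_wt_sq_le hk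
  -- Λ₁ makes the total shift Λ = Λ₁ + q at least λ_M, and q = ‖Q‖ makes q - Q nonnegative.
  set Λ₁ := Λ₀ + |lamM| + 1 with hΛ₁
  set q := ‖convHat c‖ with hq
  have hw := bddMeas_wt_inv
  set h : Plane → ℝ := fun ξ => (Λ₁ + sym ε ω ξ) * ((wt ξ)⁻¹ * (wt ξ)⁻¹) with hh
  have hw2 : ∀ ξ, wt ξ ^ 2 * ((wt ξ)⁻¹ * (wt ξ)⁻¹) = 1 := fun ξ => by
    have := (wt_pos ξ).ne'
    field_simp
  have hw0 : ∀ ξ, 0 ≤ (wt ξ)⁻¹ * (wt ξ)⁻¹ := fun ξ => by have := wt_pos ξ; positivity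
  have hw1 : ∀ ξ, (wt ξ)⁻¹ * (wt ξ)⁻¹ ≤ 1 := fun ξ => by
    have := inv_le_one_of_one_le₀ (one_le_wt ξ)
    have h0 := inv_nonneg.2 (wt_pos ξ).le
    nlinarith
  have hhb : BddMeas h := by
    refine ⟨((continuous_const.add (continuous_sym ε ω)).mul
      (continuous_wt_inv.mul continuous_wt_inv)).measurable, Λ₁ + (2 + 2 * ε * ω) ^ 2, fun ξ => ?_⟩
    have h1 : 0 < Λ₁ := by positivity
    rw [abs_of_nonneg (mul_nonneg (add_nonneg h1.le (sym_nonneg ε ω ξ)) (hw0 ξ)), add_mul]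
    refine add_le_add (mul_le_of_le_one_right h1.le (hw1 ξ)) ?_
    have := mul_le_mul_of_nonneg_right (sym_le hk ξ) (hw0 ξ)
    rwa [mul_assoc, hw2, mul_one] at this
  have hhr : ∀ ξ, r ≤ h ξ := fun ξ => by
    have h1 : r * wt ξ ^ 2 ≤ Λ₁ + sym ε ω ξ := by
      have := hwt ξ; have := abs_nonneg lamM; linarith
    have := mul_le_mul_of_nonneg_right h1 (hw0 ξ)
    rwa [mul_assoc, hw2, mul_one] at this
  have hJ : ∀ x y, inner ℂ (hatOp x) y = inner ℂ x (hatOp y) := inner_mulOp_left hw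
  have hQ := inner_convHat hc.summable hconj
  -- The three terms are Λ₁ - L, q and -Q, each flanked by `wt⁻¹` on both sides.
  refine ⟨mulOp h + (q : ℂ) • (hatOp * hatOp) - hatOp * convHat c * hatOp, r, hr,
    fun x y => ?_, fun a => ?_, fun n a ha => ?_⟩
  · simp only [sub_apply, add_apply, smul_apply, mul_apply_eq_comp, inner_sub_left,
      inner_sub_right, inner_add_left, inner_add_right, inner_smul_left, inner_smul_right,
      Complex.conj_ofReal, inner_mulOp_left hhb, hJ, hQ]
  · have h1 := le_inner_mulOp hhb hhr a
    have h2 : (inner ℂ (convHat c (hatOp a)) (hatOp a)).re ≤ q * ‖hatOp a‖ ^ 2 := by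
      refine (Complex.re_le_norm _).trans ((norm_inner_le_norm _ _).trans ?_)
      rw [sq, ← mul_assoc]
      exact mul_le_mul_of_nonneg_right ((convHat c).le_opNorm _) (norm_nonneg _)
    have h3 : (inner ℂ (hatOp a) (hatOp a)).re = ‖hatOp a‖ ^ 2 := inner_self_eq_norm_sq (𝕜 := ℂ) _
    simp only [sub_apply, add_apply, smul_apply, mul_apply_eq_comp, inner_sub_left,
      inner_add_left, inner_smul_left, Complex.conj_ofReal, Complex.sub_re, Complex.add_re,
      Complex.re_ofReal_mul]
    rw [hJ (hatOp a) a, hJ (convHat c (hatOp a)) a, h3]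
    linarith
  · set z := hatOp a with hz
    have hcut := bddMeas_cut n
    have hzc : cutOp n z = z := by
      rw [hz, hatOp, cutOp, mulOp_comm hcut hw]
      exact congrArg _ ha
    set y := genOp ε ω n z + convHat c z with hy
    set Λ := Λ₁ + q with hΛ
    have hT : (mulOp h + (q : ℂ) • (hatOp * hatOp) - hatOp * convHat c * hatOp) a =
        hatOp ((Λ : ℂ) • z - y) := by
      have h1 : mulOp h a = hatOp ((Λ₁ : ℂ) • z - genOp ε ω n z) := by
        have e1 : mulOp h a = mulOp (fun ξ => (wt ξ)⁻¹ *
            ((Λ₁ + -(-sym ε ω ξ * cut n ξ)) * (wt ξ)⁻¹)) a := by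
          rw [← ha, cutOp, mulOp_mulOp hhb hcut, mulOp_mulOp (hw.mul
            (((BddMeas.const Λ₁).add (bddMeas_gen ε ω n).neg).mul hw)) hcut]
          congr 2
          funext ξ
          rw [hh]
          rcases cut_eq n ξ with h | h <;> rw [h] <;> ring
        rw [e1, ← mulOp_mulOp hw (((BddMeas.const Λ₁).add (bddMeas_gen ε ω n).neg).mul hw),
          ← mulOp_mulOp ((BddMeas.const Λ₁).add (bddMeas_gen ε ω n).neg) hw,
          mulOp_add (BddMeas.const Λ₁) (bddMeas_gen ε ω n).neg, mulOp_const,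
          mulOp_neg (bddMeas_gen ε ω n), ← sub_eq_add_neg]
        rfl
      simp only [sub_apply, add_apply, smul_apply, mul_apply_eq_comp]
      rw [h1, hy, ← hz, hΛ]
      simp only [map_sub, map_add, map_smul, Complex.ofReal_add, add_smul]
      abel
    have hJb : hatOp (genOp ε ω n a + cutOp n (multH2 c a)) = cutOp n y := by
      rw [map_add, hy, map_add, cutOp_genOp, hz, ← hatOp_multH2 hc.summable_sq]
      congr 1
      · exact mulOp_comm hw (bddMeas_gen ε ω n) a
      · exact mulOp_comm hw hcut _
    rw [hT, hJ, hJ, hJb, ← hz]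
    have hP : ∀ x y, inner ℂ (cutOp n x) y = inner ℂ x (cutOp n y) := inner_mulOp_left hcut
    have e1 : inner ℂ y (cutOp n y) = inner ℂ (cutOp n y) (cutOp n y) := by
      rw [hP, cutOp_cutOp]
    have e2 : inner ℂ z (cutOp n y) = inner ℂ z y := by rw [← hP, hzc]
    have e : ∀ x : FreqSpace, (inner ℂ x x).re = ‖x‖ ^ 2 := fun x =>
      inner_self_eq_norm_sq (𝕜 := ℂ) x
    have e3 : (inner ℂ y z).re = (inner ℂ z y).re := by
      rw [← inner_conj_symm, Complex.conj_re]
    rw [inner_sub_left, inner_sub_left, inner_smul_left, inner_smul_left, Complex.conj_ofReal,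
      Complex.sub_re, Complex.sub_re, Complex.re_ofReal_mul, Complex.re_ofReal_mul, e1, e, e, e2, e3]
    have hform : (inner ℂ z y).re ≤ lamM * ‖z‖ ^ 2 := form_le hk hc hconj hmax hzc
    have hcs : (inner ℂ z y).re ^ 2 ≤ ‖z‖ ^ 2 * ‖cutOp n y‖ ^ 2 := by
      rw [← mul_pow, ← e2, ← sq_abs]
      exact pow_le_pow_left₀ (abs_nonneg _) ((Complex.abs_re_le_norm _).trans
        (norm_inner_le_norm _ _)) 2
    have hΛM : lamM ≤ Λ := by
      have := le_abs_self lamM; have : 0 ≤ q := norm_nonneg _; linarith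
    generalize (inner ℂ z y).re = R at *
    have hN : 0 ≤ ‖z‖ ^ 2 := sq_nonneg _
    have hL : 0 ≤ ‖cutOp n y‖ ^ 2 := sq_nonneg _
    generalize ‖z‖ ^ 2 = N at *
    generalize ‖cutOp n y‖ ^ 2 = L at *
    -- The claim is ΛR - L ≤ λ_M(ΛN - R) with R² ≤ NL. After multiplication by N > 0 it follows from
    -- (λ_M N - R)(ΛN - R) ≥ 0, where both factors are nonnegative by the form bound and λ_M ≤ Λ.
    rcases hN.eq_or_lt with h0 | h0
    · rw [← h0] at hcs ⊢
      have : R = 0 := by nlinarith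
      rw [this]; linarith
    · have h1 : R ≤ Λ * N := hform.trans (mul_le_mul_of_nonneg_right hΛM hN)
      have h2 := mul_nonneg (sub_nonneg.2 hform) (sub_nonneg.2 h1)
      by_contra hcon
      push Not at hcon
      have := mul_lt_mul_of_pos_right hcon h0
      nlinarith

end

noncomputable section

/-! ### The energy estimate for linear evolution equations -/

/-- A Gronwall inequality for `√E`. -/
theorem sqrt_le_of_deriv_le {E E' h : ℝ → ℝ} {lam t : ℝ} (ht : 0 ≤ t) (hlam : 0 ≤ lam)
    (hE0 : ∀ τ, 0 ≤ E τ) (hE : ∀ τ, HasDerivAt E (E' τ) τ) (hh : Continuous h) (hh0 : ∀ τ, 0 ≤ h τ)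
    (hle : ∀ τ ∈ Set.Ioo 0 t, E' τ ≤ 2 * lam * E τ + 2 * Real.sqrt (E τ) * h τ) :
    Real.sqrt (E t) ≤ Real.exp (lam * t) * Real.sqrt (E 0) +
      ∫ τ in (0 : ℝ)..t, Real.exp (lam * (t - τ)) * h τ := by
  -- √E need not be differentiable where E = 0, so E + η is used and η tends to 0 at the end.
  have key : ∀ η : ℝ, 0 < η → Real.sqrt (E t + η) ≤ Real.exp (lam * t) * Real.sqrt (E 0 + η) +
      ∫ τ in (0 : ℝ)..t, Real.exp (lam * (t - τ)) * h τ := fun η hη => by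
    have hcont : Continuous fun τ => Real.exp (-(lam * τ)) * h τ := by fun_prop
    set Φ : ℝ → ℝ := fun τ => Real.exp (-(lam * τ)) * Real.sqrt (E τ + η) -
      ∫ x in (0 : ℝ)..τ, Real.exp (-(lam * x)) * h x with hΦ
    have hpos : ∀ τ, 0 < E τ + η := fun τ => by have := hE0 τ; positivity
    have hd : ∀ τ, HasDerivAt Φ (Real.exp (-(lam * τ)) * -lam * Real.sqrt (E τ + η) +
        Real.exp (-(lam * τ)) * (E' τ / (2 * Real.sqrt (E τ + η))) -
        Real.exp (-(lam * τ)) * h τ) τ := fun τ => by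
      refine HasDerivAt.sub (HasDerivAt.mul ?_ (((hE τ).add_const η).sqrt (hpos τ).ne'))
        (intervalIntegral.integral_hasDerivAt_right (hcont.intervalIntegrable _ _)
          (hcont.stronglyMeasurableAtFilter _ _) hcont.continuousAt)
      have := ((hasDerivAt_id τ).const_mul lam).neg.exp
      simpa using this
    have hanti : AntitoneOn Φ (Set.Icc 0 t) := by
      refine antitoneOn_of_deriv_nonpos (convex_Icc 0 t)
        (fun τ _ => (hd τ).continuousAt.continuousWithinAt)
        (fun τ _ => (hd τ).differentiableAt.differentiableWithinAt) fun τ hτ => ?_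
      rw [interior_Icc] at hτ
      rw [(hd τ).deriv]
      set φ := Real.sqrt (E τ + η) with hφ
      have hφ0 : 0 < φ := Real.sqrt_pos.2 (hpos τ)
      have hφ2 : φ ^ 2 = E τ + η := Real.sq_sqrt (hpos τ).le
      have h1 : Real.sqrt (E τ) ≤ φ := Real.sqrt_le_sqrt (by linarith)
      have h2 : E' τ / (2 * φ) ≤ lam * φ + h τ := by
        rw [div_le_iff₀ (by positivity)]
        have h3 := hle τ hτ
        have h4 : Real.sqrt (E τ) * h τ ≤ φ * h τ := mul_le_mul_of_nonneg_right h1 (hh0 τ)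
        have h5 : lam * E τ ≤ lam * φ ^ 2 := by
          rw [hφ2]; exact mul_le_mul_of_nonneg_left (by linarith) hlam
        nlinarith
      have h3 := mul_le_mul_of_nonneg_left h2 (Real.exp_pos (-(lam * τ))).le
      linarith
    have h1 := hanti (Set.left_mem_Icc.2 ht) (Set.right_mem_Icc.2 ht) ht
    simp only [hΦ, mul_zero, neg_zero, Real.exp_zero, one_mul, intervalIntegral.integral_same,
      sub_zero] at h1
    have h2 := mul_le_mul_of_nonneg_left (sub_le_iff_le_add.1 h1) (Real.exp_pos (lam * t)).le
    rw [← mul_assoc, ← Real.exp_add, add_neg_cancel, Real.exp_zero, one_mul, mul_add,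
      ← intervalIntegral.integral_const_mul] at h2
    refine h2.trans (le_of_eq ?_)
    congr 1
    refine intervalIntegral.integral_congr fun τ _ => ?_
    rw [← mul_assoc, ← Real.exp_add]
    congr 2
    ring
  have hl : ∀ x : ℝ, Tendsto (fun η => Real.sqrt (x + η)) (𝓝[>] 0) (𝓝 (Real.sqrt x)) := fun x => by
    have : Continuous fun η => Real.sqrt (x + η) := by fun_prop
    simpa using (this.tendsto 0).mono_left nhdsWithin_le_nhds
  exact le_of_tendsto_of_tendsto (hl _) (((hl _).const_mul _).add_const _)
    (eventually_nhdsWithin_of_forall key)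

/-- The energy is differentiated along the truncated solution, for which all operators are bounded.
Truncation does not commute with multiplication by the potential; the commutator is the term with `a
τ - cutOp n (a τ)`, which disappears as n → ∞. -/
theorem IsFreqSol.energy_le_aux {ε ω lamM r : ℝ} {c : ℤ → ℂ} {T : FreqSpace →L[ℂ] FreqSpace}
    (hr : 0 < r) (hlam : 0 ≤ lamM) (hsymm : ∀ x y, inner ℂ (T x) y = inner ℂ x (T y))
    (hcoer : ∀ a, r * ‖a‖ ^ 2 ≤ (inner ℂ (T a) a).re)
    (hdiss : ∀ n a, cutOp n a = a →
        (inner ℂ (T a) (genOp ε ω n a + cutOp n (multH2 c a))).re ≤ lamM * (inner ℂ (T a) a).re)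
    {t : ℝ} (ht : 0 ≤ t) {a g : ℝ → FreqSpace} (ha : Continuous a) (hg : Continuous g)
    (hsol : IsFreqSol ε ω (Set.Icc 0 t) a fun τ => multH2 c (a τ) + g τ) (n : ℕ) :
    Real.sqrt r * ‖cutOp n (a t)‖ ≤ Real.exp (lamM * t) * (Real.sqrt ‖T‖ * ‖a 0‖) +
      ∫ τ in (0 : ℝ)..t, Real.exp (lamM * (t - τ)) *
        (‖T‖ / Real.sqrt r * (‖multH2 c (a τ - cutOp n (a τ))‖ + ‖g τ‖)) := by
  -- The integral defines A on the whole line, so it is differentiable everywhere; it agrees with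
  -- `cutOp n (a τ)` on [0, t].
  set A : ℝ → FreqSpace := fun τ => cutOp n (a 0) +
    ∫ x in (0 : ℝ)..τ, (genOp ε ω n (a x) + cutOp n (multH2 c (a x) + g x)) with hA
  set A' : ℝ → FreqSpace := fun x => genOp ε ω n (a x) + cutOp n (multH2 c (a x) + g x) with hA'
  have hA'c : Continuous A' := by fun_prop
  have hAa : ∀ τ ∈ Set.Icc 0 t, cutOp n (a τ) = A τ := fun τ hτ => hsol τ hτ n
  have hAd : ∀ τ, HasDerivAt A (A' τ) τ := fun τ =>
    (intervalIntegral.integral_hasDerivAt_right (hA'c.intervalIntegrable _ _)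
      hA'c.aestronglyMeasurable.stronglyMeasurableAtFilter hA'c.continuousAt).const_add _
  have hTA : ∀ τ, HasDerivAt (fun x => T (A x)) (T (A' τ)) τ := fun τ =>
    (T.restrictScalars ℝ).hasFDerivAt.comp_hasDerivAt τ (hAd τ)
  set E : ℝ → ℝ := fun τ => (inner ℂ (T (A τ)) (A τ)).re with hE
  have hre : ∀ x y, (inner ℂ (T x) y).re = (inner ℂ (T y) x).re := fun x y => by
    rw [hsymm, ← inner_conj_symm, Complex.conj_re]
  have hEd : ∀ τ, HasDerivAt E (2 * (inner ℂ (T (A τ)) (A' τ)).re) τ := fun τ => by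
    have h1 := Complex.reCLM.hasFDerivAt.comp_hasDerivAt τ ((hTA τ).inner ℂ (hAd τ))
    refine h1.congr_deriv ?_
    rw [Complex.reCLM_apply, Complex.add_re, hre (A' τ) (A τ)]
    ring
  have hE0 : ∀ τ, 0 ≤ E τ := fun τ => (by positivity : 0 ≤ r * ‖A τ‖ ^ 2).trans (hcoer _)
  have hsr : 0 < Real.sqrt r := Real.sqrt_pos.2 hr
  have hEA : ∀ τ, Real.sqrt r * ‖A τ‖ ≤ Real.sqrt (E τ) := fun τ => by
    rw [← Real.sqrt_sq (norm_nonneg (A τ)), ← Real.sqrt_mul hr.le]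
    exact Real.sqrt_le_sqrt (hcoer _)
  have hET : ∀ τ, Real.sqrt (E τ) ≤ Real.sqrt ‖T‖ * ‖A τ‖ := fun τ => by
    refine Real.sqrt_le_iff.2 ⟨by positivity, ?_⟩
    rw [mul_pow, Real.sq_sqrt (norm_nonneg _), sq, ← mul_assoc]
    exact (Complex.re_le_norm _).trans ((norm_inner_le_norm _ _).trans
      (mul_le_mul_of_nonneg_right (T.le_opNorm _) (norm_nonneg _)))
  have h0 : (0 : ℝ) ∈ Set.Icc 0 t := Set.left_mem_Icc.2 ht
  have key := sqrt_le_of_deriv_le (E := E) ht hlam hE0 hEd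
    (h := fun τ => ‖T‖ / Real.sqrt r * (‖multH2 c (a τ - cutOp n (a τ))‖ + ‖g τ‖))
    (by fun_prop) (fun τ => by positivity) fun τ hτ => by
      have hτ' : τ ∈ Set.Icc 0 t := Set.Ioo_subset_Icc_self hτ
      have e : A' τ = (genOp ε ω n (A τ) + cutOp n (multH2 c (A τ))) +
          cutOp n (multH2 c (a τ - cutOp n (a τ)) + g τ) := by
        rw [← hAa τ hτ', genOp_cutOp, hA']
        simp only [map_add, map_sub]
        abel
      have h1 := hdiss n (A τ) (by rw [← hAa τ hτ', cutOp_cutOp])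
      have h2 : (inner ℂ (T (A τ)) (cutOp n (multH2 c (a τ - cutOp n (a τ)) + g τ))).re ≤
          Real.sqrt (E τ) *
            (‖T‖ / Real.sqrt r * (‖multH2 c (a τ - cutOp n (a τ))‖ + ‖g τ‖)) := by
        refine (Complex.re_le_norm _).trans ((norm_inner_le_norm _ _).trans ?_)
        have h3 : ‖T (A τ)‖ ≤ ‖T‖ / Real.sqrt r * Real.sqrt (E τ) := by
          refine (T.le_opNorm _).trans ?_
          rw [div_mul_eq_mul_div, mul_div_assoc]
          exact mul_le_mul_of_nonneg_left ((le_div_iff₀' hsr).2 (hEA τ)) (norm_nonneg _)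
        have h4 := (norm_cutOp_apply_le n (multH2 c (a τ - cutOp n (a τ)) + g τ)).trans
          (norm_add_le _ _)
        refine (mul_le_mul h3 h4 (norm_nonneg _) (by positivity)).trans (le_of_eq ?_)
        ring
      rw [e, inner_add_right, Complex.add_re]
      linarith
  rw [hAa t (Set.right_mem_Icc.2 ht)]
  refine (hEA t).trans (key.trans ?_)
  gcongr
  refine (hET 0).trans ?_
  gcongr
  rw [← hAa 0 h0]
  exact norm_cutOp_apply_le _ _

theorem IsFreqSol.energy_le {ε ω lamM r : ℝ} {c : ℤ → ℂ} {T : FreqSpace →L[ℂ] FreqSpace}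
    (hr : 0 < r) (hlam : 0 ≤ lamM) (hsymm : ∀ x y, inner ℂ (T x) y = inner ℂ x (T y))
    (hcoer : ∀ a, r * ‖a‖ ^ 2 ≤ (inner ℂ (T a) a).re)
    (hdiss : ∀ n a, cutOp n a = a →
        (inner ℂ (T a) (genOp ε ω n a + cutOp n (multH2 c a))).re ≤ lamM * (inner ℂ (T a) a).re)
    {t : ℝ} (ht : 0 ≤ t) {a g : ℝ → FreqSpace} (ha : Continuous a) (hg : Continuous g)
    (hsol : IsFreqSol ε ω (Set.Icc 0 t) a fun τ => multH2 c (a τ) + g τ) :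
    Real.sqrt r * ‖a t‖ ≤ Real.exp (lamM * t) * (Real.sqrt ‖T‖ * ‖a 0‖) +
      ∫ τ in (0 : ℝ)..t, Real.exp (lamM * (t - τ)) * (‖T‖ / Real.sqrt r * ‖g τ‖) := by
  refine le_of_tendsto_of_tendsto (((tendsto_cutOp (a t)).norm).const_mul _) ?_
    (Eventually.of_forall (IsFreqSol.energy_le_aux hr hlam hsymm hcoer hdiss ht ha hg hsol))
  refine Tendsto.const_add _ ?_
  refine intervalIntegral.tendsto_integral_filter_of_dominated_convergence
    (fun τ => Real.exp (lamM * (t - τ)) *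
      (‖T‖ / Real.sqrt r * (‖multH2 c‖ * (‖a τ‖ + ‖a τ‖) + ‖g τ‖))) ?_ ?_ ?_ ?_
  · exact Eventually.of_forall fun n => Continuous.aestronglyMeasurable (by fun_prop)
  · refine Eventually.of_forall fun n => ae_of_all _ fun τ _ => ?_
    rw [Real.norm_of_nonneg (by positivity)]
    gcongr
    exact ((multH2 c).le_opNorm _).trans (mul_le_mul_of_nonneg_left ((norm_sub_le _ _).trans
      (add_le_add le_rfl (norm_cutOp_apply_le _ _))) (norm_nonneg _))
  · exact Continuous.intervalIntegrable (by fun_prop) _ _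
  · refine ae_of_all _ fun τ _ => ?_
    have h1 : Tendsto (fun n => ‖multH2 c (a τ - cutOp n (a τ))‖) atTop (𝓝 0) := by
      have := ((multH2 c).continuous.tendsto _).comp ((tendsto_cutOp (a τ)).const_sub (a τ))
      simpa using this.norm
    simpa using ((h1.add_const ‖g τ‖).const_mul (‖T‖ / Real.sqrt r)).const_mul
      (Real.exp (lamM * (t - τ)))

theorem IsFreqSol.congr {ε ω : ℝ} {S : Set ℝ} {a a' g g' : ℝ → FreqSpace}
    (h : IsFreqSol ε ω S a g) (hS : ∀ t ∈ S, 0 ≤ t ∧ Set.Icc 0 t ⊆ S)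
    (ha : ∀ t ∈ S, a' t = a t) (hg : ∀ t ∈ S, g' t = g t) : IsFreqSol ε ω S a' g' := by
  intro t ht n
  obtain ⟨h0, h1⟩ := hS t ht
  rw [ha t ht, ha 0 (h1 (Set.left_mem_Icc.2 h0)), h t ht n]
  congr 1
  refine intervalIntegral.integral_congr fun τ hτ => ?_
  rw [Set.uIcc_of_le h0] at hτ
  rw [ha τ (h1 hτ), hg τ (h1 hτ)]

theorem exists_energy_estimate {ε ω b s : ℝ} {ut : ℝ → ℝ} {lamM : ℝ} (hk : 0 < 1 + 2 * ε * ω)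
    {c : ℤ → ℂ} (hc : IsCoeff c fun x => (potential ε b s ut x : ℂ))
    (hconj : ∀ k, c (-k) = (starRingEnd ℂ) (c k)) (hlam : 0 ≤ lamM)
    (hmax : ∀ σ μ, IsBlochEigenvalue ε ω b s ut σ μ → μ ≤ lamM) :
    ∃ C : ℝ, 0 < C ∧ ∀ (t : ℝ) (a g : ℝ → FreqSpace), 0 ≤ t → ContinuousOn a (Set.Icc 0 t) →
      ContinuousOn g (Set.Icc 0 t) →
      IsFreqSol ε ω (Set.Icc 0 t) a (fun τ => multH2 c (a τ) + g τ) →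
      ‖a t‖ ≤ C * (Real.exp (lamM * t) * ‖a 0‖ +
        ∫ τ in (0 : ℝ)..t, Real.exp (lamM * (t - τ)) * ‖g τ‖) := by
  obtain ⟨T, r, hr, hsymm, hcoer, hdiss⟩ := exists_energyForm hk hc hconj hmax
  have hsr : 0 < Real.sqrt r := Real.sqrt_pos.2 hr
  refine ⟨(Real.sqrt ‖T‖ + ‖T‖ / Real.sqrt r + 1) / Real.sqrt r, by positivity,
    fun t a g ht ha hg hsol => ?_⟩
  have hS : ∀ x ∈ Set.Icc 0 t, 0 ≤ x ∧ Set.Icc 0 x ⊆ Set.Icc 0 t := fun x hx =>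
    ⟨hx.1, Set.Icc_subset_Icc_right hx.2⟩
  -- The functions are frozen outside [0, t], since `IsFreqSol.energy_le` asks for continuity on the
  -- whole line.
  set p : ℝ → ℝ := fun τ => (Set.projIcc 0 t ht τ : ℝ) with hp
  have hpc : Continuous p := continuous_subtype_val.comp continuous_projIcc
  have hpm : ∀ τ, p τ ∈ Set.Icc 0 t := fun τ => (Set.projIcc 0 t ht τ).2
  have hpe : ∀ τ ∈ Set.Icc 0 t, p τ = τ := fun τ hτ => by
    rw [hp]; simp only; rw [Set.projIcc_of_mem ht hτ]
  have key := IsFreqSol.energy_le (a := fun τ => a (p τ)) (g := fun τ => g (p τ)) hr hlam hsymm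
    hcoer hdiss ht (ha.comp_continuous hpc hpm) (hg.comp_continuous hpc hpm)
    (hsol.congr hS (fun τ hτ => by rw [hpe τ hτ]) fun τ hτ => by rw [hpe τ hτ])
  simp only [hpe t (Set.right_mem_Icc.2 ht), hpe 0 (Set.left_mem_Icc.2 ht)] at key
  have e : ∫ τ in (0 : ℝ)..t, Real.exp (lamM * (t - τ)) * (‖T‖ / Real.sqrt r * ‖g (p τ)‖) =
      ‖T‖ / Real.sqrt r * ∫ τ in (0 : ℝ)..t, Real.exp (lamM * (t - τ)) * ‖g τ‖ := by
    rw [← intervalIntegral.integral_const_mul]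
    refine intervalIntegral.integral_congr fun τ hτ => ?_
    rw [Set.uIcc_of_le ht] at hτ
    rw [hpe τ hτ]
    ring
  rw [e] at key
  have hI : 0 ≤ ∫ τ in (0 : ℝ)..t, Real.exp (lamM * (t - τ)) * ‖g τ‖ :=
    intervalIntegral.integral_nonneg ht fun τ _ => by positivity
  rw [div_mul_eq_mul_div, le_div_iff₀ hsr, mul_comm ‖a t‖]
  refine key.trans ?_
  have h1 : 0 ≤ Real.exp (lamM * t) * ‖a 0‖ := by positivity
  have h2 : 0 ≤ ‖T‖ / Real.sqrt r := by positivity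
  have h3 := Real.sqrt_nonneg ‖T‖
  nlinarith [mul_nonneg h2 h1, mul_nonneg h3 hI]

end

noncomputable section

/-! ### The semigroup of the constant coefficient operator -/

/-- The multiplier is bounded, so |eˣ - 1 - x| ≤ x² applies uniformly in the frequency. This makes t
↦ e^{th} differentiable in operator norm. -/
theorem norm_mulOp_exp_sub_le {h : Plane → ℝ} (hh : BddMeas h) {C : ℝ} (hC : ∀ ξ, |h ξ| ≤ C)
    {t x : ℝ} (hx : |x| * C ≤ 1) :
    ‖mulOp (fun ξ => Real.exp ((t + x) * h ξ)) - mulOp (fun ξ => Real.exp (t * h ξ)) -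
      x • (mulOp h * mulOp fun ξ => Real.exp (t * h ξ))‖ ≤ Real.exp (|t| * C) * C ^ 2 * x ^ 2 := by
  have h1 := (hh.const_mul (t + x)).exp
  have h2 := (hh.const_mul t).exp
  have hm : BddMeas fun ξ => Real.exp ((t + x) * h ξ) +
      (-Real.exp (t * h ξ) + -(x * (h ξ * Real.exp (t * h ξ)))) :=
    h1.add (h2.neg.add ((hh.mul h2).const_mul x).neg)
  have e : mulOp (fun ξ => Real.exp ((t + x) * h ξ)) - mulOp (fun ξ => Real.exp (t * h ξ)) -
      x • (mulOp h * mulOp fun ξ => Real.exp (t * h ξ)) =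
      mulOp fun ξ => Real.exp ((t + x) * h ξ) +
        (-Real.exp (t * h ξ) + -(x * (h ξ * Real.exp (t * h ξ)))) := by
    ext1 f
    rw [mulOp_add h1 (h2.neg.add ((hh.mul h2).const_mul x).neg),
      mulOp_add h2.neg ((hh.mul h2).const_mul x).neg, mulOp_neg h2,
      mulOp_neg ((hh.mul h2).const_mul x), mulOp_const_mul (hh.mul h2), ← mulOp_mulOp hh h2]
    simp only [sub_apply, smul_apply, mul_apply_eq_comp, Complex.coe_smul]
    abel
  rw [e]
  refine norm_mulOp_le hm.meas fun ξ => ?_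
  have e2 : Real.exp ((t + x) * h ξ) + (-Real.exp (t * h ξ) + -(x * (h ξ * Real.exp (t * h ξ)))) =
      Real.exp (t * h ξ) * (Real.exp (x * h ξ) - 1 - x * h ξ) := by
    rw [add_mul, Real.exp_add]; ring
  have hC0 : 0 ≤ C := (abs_nonneg _).trans (hC 0)
  have h3 : |x * h ξ| ≤ 1 := by
    rw [abs_mul]
    exact (mul_le_mul_of_nonneg_left (hC ξ) (abs_nonneg _)).trans hx
  rw [e2, abs_mul, abs_of_pos (Real.exp_pos _), mul_assoc]
  refine mul_le_mul (Real.exp_le_exp.2 ?_) ((Real.abs_exp_sub_one_sub_id_le h3).trans ?_)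
    (abs_nonneg _) (Real.exp_pos _).le
  · refine (le_abs_self _).trans ?_
    rw [abs_mul]
    exact mul_le_mul_of_nonneg_left (hC ξ) (abs_nonneg _)
  · rw [mul_pow, mul_comm]
    refine mul_le_mul_of_nonneg_right ?_ (sq_nonneg _)
    rw [← sq_abs]
    exact pow_le_pow_left₀ (abs_nonneg _) (hC ξ) 2

theorem hasDerivAt_mulOp_exp {h : Plane → ℝ} (hh : BddMeas h) (t : ℝ) :
    HasDerivAt (fun t : ℝ => mulOp fun ξ => Real.exp (t * h ξ))
      (mulOp h * mulOp fun ξ => Real.exp (t * h ξ)) t := by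
  obtain ⟨C, hC⟩ := hh.bdd
  have hC0 : 0 ≤ C := (abs_nonneg _).trans (hC 0)
  rw [hasDerivAt_iff_isLittleO_nhds_zero]
  refine Asymptotics.IsBigO.trans_isLittleO (g := fun x : ℝ => x ^ 2) ?_
    (Asymptotics.isLittleO_pow_id one_lt_two)
  refine Asymptotics.IsBigO.of_bound (Real.exp (|t| * C) * C ^ 2) ?_
  have : Tendsto (fun x : ℝ => |x| * C) (𝓝 0) (𝓝 0) := by
    have : Continuous fun x : ℝ => |x| * C := by fun_prop
    simpa using this.tendsto 0
  filter_upwards [this.eventually (gt_mem_nhds zero_lt_one)] with x hx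
  rw [Real.norm_of_nonneg (sq_nonneg x)]
  exact norm_mulOp_exp_sub_le hh hC hx.le

/-- The semigroup `e^{tL}`, with `e^{tL} = 1` for negative `t`. -/
def semi (ε ω t : ℝ) : FreqSpace →L[ℂ] FreqSpace :=
  mulOp fun ξ => Real.exp (max t 0 * -sym ε ω ξ)

theorem measurable_semi (ε ω t : ℝ) : Measurable fun ξ => Real.exp (max t 0 * -sym ε ω ξ) :=
  (Real.continuous_exp.comp (continuous_const.mul (continuous_sym ε ω).neg)).measurable

theorem abs_semi_le (ε ω t : ℝ) (ξ : Plane) : |Real.exp (max t 0 * -sym ε ω ξ)| ≤ 1 := by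
  rw [abs_of_pos (Real.exp_pos _), Real.exp_le_one_iff, mul_neg, neg_nonpos]
  exact mul_nonneg (le_max_right _ _) (sym_nonneg ε ω ξ)

theorem bddMeas_semi (ε ω t : ℝ) : BddMeas fun ξ => Real.exp (max t 0 * -sym ε ω ξ) :=
  ⟨measurable_semi ε ω t, 1, abs_semi_le ε ω t⟩

theorem norm_semi_apply_le (ε ω t : ℝ) (a : FreqSpace) : ‖semi ε ω t a‖ ≤ ‖a‖ := by
  simpa [semi] using norm_mulOp_apply_le (measurable_semi ε ω t) (abs_semi_le ε ω t) a

theorem semi_zero (ε ω : ℝ) (a : FreqSpace) : semi ε ω 0 a = a := by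
  simp only [semi, max_self, zero_mul, Real.exp_zero]
  rw [mulOp_const]; simp

theorem continuous_semi_apply (ε ω : ℝ) (a : FreqSpace) : Continuous fun t => semi ε ω t a :=
  continuous_iff_continuousAt.2 fun t₀ => tendsto_mulOp (fun t => measurable_semi ε ω t)
    (fun t => abs_semi_le ε ω t) (measurable_semi ε ω t₀) (abs_semi_le ε ω t₀) (fun ξ => by
      have : Continuous fun t : ℝ => Real.exp (max t 0 * -sym ε ω ξ) := by fun_prop
      exact this.tendsto t₀) a

/-- Strong continuity in time and the contraction bound together give joint continuity. -/
theorem continuous_semi {Y : Type*} [TopologicalSpace Y] (ε ω : ℝ) {t : Y → ℝ} {f : Y → FreqSpace}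
    (ht : Continuous t) (hf : Continuous f) : Continuous fun y => semi ε ω (t y) (f y) := by
  refine continuous_iff_continuousAt.2 fun y₀ => ?_
  have h1 : Tendsto (fun y => semi ε ω (t y) (f y₀)) (𝓝 y₀) (𝓝 (semi ε ω (t y₀) (f y₀))) :=
    ((continuous_semi_apply ε ω (f y₀)).comp ht).tendsto y₀
  have h2 : Tendsto (fun y => semi ε ω (t y) (f y - f y₀)) (𝓝 y₀) (𝓝 0) := by
    refine squeeze_zero_norm (fun y => norm_semi_apply_le _ _ _ _) ?_
    have := ((hf.tendsto y₀).sub_const (f y₀)).norm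
    simpa using this
  have h3 := h1.add h2
  rw [add_zero] at h3
  refine h3.congr fun y => ?_
  rw [map_sub]; abel

theorem cutOp_semi (ε ω : ℝ) (n : ℕ) {t : ℝ} (ht : 0 ≤ t) (a : FreqSpace) :
    cutOp n (semi ε ω t a) = mulOp (fun ξ => Real.exp (t * (-sym ε ω ξ * cut n ξ))) (cutOp n a) := by
  rw [cutOp, semi, mulOp_mulOp (bddMeas_cut n) (bddMeas_semi ε ω t),
    mulOp_mulOp ((bddMeas_gen ε ω n).const_mul t).exp (bddMeas_cut n), max_eq_left ht]
  congr 2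
  funext ξ
  rcases cut_eq n ξ with h | h <;> rw [h] <;> simp

/-- A mild solution is a solution on every ball of frequencies. -/
theorem isFreqSol_of_mild {ε ω : ℝ} {a f : ℝ → FreqSpace} (hf : Continuous f)
    (ha : ∀ t, 0 ≤ t → a t = semi ε ω t (a 0) + ∫ τ in (0 : ℝ)..t, semi ε ω (t - τ) (f τ)) :
    IsFreqSol ε ω (Set.Ici 0) a f := by
  intro t ht n
  have ht0 : 0 ≤ t := ht
  set h : Plane → ℝ := fun ξ => -sym ε ω ξ * cut n ξ with hh
  have hb : BddMeas h := bddMeas_gen ε ω n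
  -- On a ball of frequencies the generator is bounded and generates a group. The variation of
  -- constants formula becomes E(t)B(t), with B a primitive of E(-τ) applied to the forcing, and the
  -- product rule applies.
  set E : ℝ → FreqSpace →L[ℂ] FreqSpace := fun t => mulOp fun ξ => Real.exp (t * h ξ) with hE
  have hEd : ∀ t, HasDerivAt E (genOp ε ω n * E t) t := hasDerivAt_mulOp_exp hb
  have hEc : Continuous E := continuous_iff_continuousAt.2 fun t => (hEd t).continuousAt
  have hEadd : ∀ x y u, E x (E y u) = E (x + y) u := fun x y u => by
    rw [hE]
    simp only
    rw [mulOp_mulOp (hb.const_mul x).exp (hb.const_mul y).exp]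
    simp only [← Real.exp_add, ← add_mul]
  have hE0 : ∀ u, E 0 u = u := fun u => by
    rw [hE]
    simp only [zero_mul, Real.exp_zero]
    rw [mulOp_const]; simp
  set w : ℝ → FreqSpace := fun x => E (-x) (cutOp n (f x)) with hw
  have hwc : Continuous w := (hEc.comp continuous_neg).clm_apply ((cutOp n).continuous.comp hf)
  set B : ℝ → FreqSpace := fun x => cutOp n (a 0) + ∫ τ in (0 : ℝ)..x, w τ with hB
  have hBd : ∀ x, HasDerivAt B (w x) x := fun x =>
    (intervalIntegral.integral_hasDerivAt_right (hwc.intervalIntegrable _ _)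
      hwc.aestronglyMeasurable.stronglyMeasurableAtFilter hwc.continuousAt).const_add _
  have hBc : Continuous B := continuous_iff_continuousAt.2 fun t => (hBd t).continuousAt
  have hAB : ∀ x, 0 ≤ x → cutOp n (a x) = E x (B x) := fun x hx => by
    rw [ha x hx, map_add, cutOp_semi ε ω n hx, hB]
    simp only
    rw [map_add]
    congr 1
    rw [← ContinuousLinearMap.intervalIntegral_comp_comm _
        ((continuous_semi ε ω (by fun_prop) hf).intervalIntegrable _ _),
      ← ContinuousLinearMap.intervalIntegral_comp_comm _ (hwc.intervalIntegrable _ _)]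
    refine intervalIntegral.integral_congr fun τ hτ => ?_
    rw [Set.uIcc_of_le hx] at hτ
    rw [cutOp_semi ε ω n (sub_nonneg.2 hτ.2), hw]
    simp only
    rw [hEadd, ← sub_eq_add_neg]
  have hd : ∀ x, HasDerivAt (fun x => E x (B x)) (genOp ε ω n (E x (B x)) + E x (w x)) x :=
    fun x => by
    have h1 := (ContinuousLinearMap.restrictScalarsL ℂ FreqSpace FreqSpace ℝ ℝ).hasFDerivAt.comp_hasDerivAt
      x (hEd x)
    exact h1.clm_apply (hBd x)
  have hEw : ∀ x, E x (w x) = cutOp n (f x) := fun x => by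
    rw [hw]
    simp only
    rw [hEadd, add_neg_cancel, hE0]
  have hint := intervalIntegral.integral_eq_sub_of_hasDerivAt (a := 0) (b := t)
    (fun x _ => hd x) (Continuous.intervalIntegrable (by
      simp only [hEw]
      exact ((genOp ε ω n).continuous.comp (hEc.clm_apply hBc)).add
        ((cutOp n).continuous.comp hf)) _ _)
  have e0 : E 0 (B 0) = cutOp n (a 0) := by rw [hE0, hB]; simp
  rw [hAB t ht0, ← sub_eq_iff_eq_add', ← e0, ← hint]
  refine intervalIntegral.integral_congr fun τ hτ => ?_
  rw [Set.uIcc_of_le ht0] at hτ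
  rw [hEw, ← hAB τ hτ.1, genOp_cutOp]

theorem integral_exp_mul_le {β : ℝ} (hβ : 0 < β) (t : ℝ) :
    ∫ τ in (0 : ℝ)..t, Real.exp (β * τ) ≤ Real.exp (β * t) / β := by
  rw [intervalIntegral.integral_comp_mul_left _ hβ.ne', integral_exp, mul_zero, Real.exp_zero,
    smul_eq_mul, inv_mul_eq_div]
  gcongr
  linarith

/-- Global existence for semilinear equations with a globally Lipschitz nonlinearity. -/
theorem exists_freqSol (ε ω : ℝ) {F : ℝ → FreqSpace → FreqSpace}
    (hF : Continuous fun p : ℝ × FreqSpace => F p.1 p.2) {L M β : ℝ}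
    (hL : ∀ t x y, ‖F t x - F t y‖ ≤ L * ‖x - y‖)
    (hM : ∀ t, 0 ≤ t → ‖F t 0‖ ≤ M * Real.exp (β * t)) (a₀ : FreqSpace) :
    ∃ a : ℝ → FreqSpace, Continuous a ∧ a 0 = a₀ ∧
      IsFreqSol ε ω (Set.Ici 0) a fun t => F t (a t) := by
  -- The weight e^{γt} turns the integral operator into a contraction with factor |L|/γ ≤ 1/2, and γ
  -- ≥ β keeps the weighted forcing bounded.
  set γ := |β| + 2 * |L| + 1 with hγ
  have hγ0 : 0 < γ := by positivity
  have hM0 : 0 ≤ M := by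
    have := (norm_nonneg _).trans (hM 0 le_rfl)
    simpa using this
  set f : (ℝ → FreqSpace) → ℝ → FreqSpace := fun b τ => F τ (Real.exp (γ * τ) • b τ) with hf
  have hfc : ∀ b, Continuous b → Continuous (f b) := fun b hb =>
    hF.comp (continuous_id.prodMk ((by fun_prop : Continuous fun τ : ℝ => Real.exp (γ * τ)).smul hb))
  set I : (ℝ → FreqSpace) → ℝ → FreqSpace := fun b t =>
    semi ε ω t a₀ + ∫ τ in (0 : ℝ)..t, semi ε ω (t - τ) (f b τ) with hI
  have hIc : ∀ b, Continuous b → Continuous (I b) := fun b hb =>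
    (continuous_semi_apply ε ω a₀).add
      (intervalIntegral.continuous_parametric_intervalIntegral_of_continuous
        (f := fun t τ => semi ε ω (t - τ) (f b τ))
        (continuous_semi ε ω (by fun_prop) ((hfc b hb).comp continuous_snd)) continuous_id)
  have hdiff : ∀ b b' : ℝ → FreqSpace, Continuous b → Continuous b' → ∀ D : ℝ,
      (∀ τ, ‖b τ - b' τ‖ ≤ D) → ∀ t, 0 ≤ t → ‖I b t - I b' t‖ ≤ |L| * D * (Real.exp (γ * t) / γ) := by
    intro b b' hb hb' D hD t ht
    have hD0 : 0 ≤ D := (norm_nonneg _).trans (hD 0)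
    have e : I b t - I b' t = ∫ τ in (0 : ℝ)..t, semi ε ω (t - τ) (f b τ - f b' τ) := by
      rw [hI]
      simp only [map_sub]
      rw [intervalIntegral.integral_sub
        ((continuous_semi ε ω (by fun_prop) (hfc b hb)).intervalIntegrable _ _)
        ((continuous_semi ε ω (by fun_prop) (hfc b' hb')).intervalIntegrable _ _)]
      abel
    rw [e]
    refine (intervalIntegral.norm_integral_le_of_norm_le ht (ae_of_all _ fun τ _ => ?_)
      (Continuous.intervalIntegrable (u := fun τ => |L| * D * Real.exp (γ * τ)) (by fun_prop) _ _)).trans ?_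
    · refine (norm_semi_apply_le _ _ _ _).trans ((hL _ _ _).trans ?_)
      rw [← smul_sub, norm_smul, Real.norm_of_nonneg (Real.exp_pos _).le]
      calc L * (Real.exp (γ * τ) * ‖b τ - b' τ‖)
          ≤ |L| * (Real.exp (γ * τ) * D) := by
            gcongr
            · exact le_abs_self L
            · exact hD τ
        _ = |L| * D * Real.exp (γ * τ) := by ring
    · rw [intervalIntegral.integral_const_mul]
      exact mul_le_mul_of_nonneg_left (integral_exp_mul_le hγ0 t) (by positivity)
  have hzero : ∀ t, 0 ≤ t → ‖I 0 t‖ ≤ ‖a₀‖ + M * (Real.exp (γ * t) / γ) := fun t ht => by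
    refine (norm_add_le _ _).trans (add_le_add (norm_semi_apply_le _ _ _ _) ?_)
    refine (intervalIntegral.norm_integral_le_of_norm_le ht (ae_of_all _ fun τ hτ => ?_)
      (Continuous.intervalIntegrable (u := fun τ => M * Real.exp (γ * τ)) (by fun_prop) _ _)).trans ?_
    · refine (norm_semi_apply_le _ _ _ _).trans ?_
      have hτ0 : 0 ≤ τ := hτ.1.le
      have e : f 0 τ = F τ 0 := by rw [hf]; simp
      rw [e]
      refine (hM τ hτ0).trans ?_
      have : β ≤ γ := by rw [hγ]; have := le_abs_self β; have := abs_nonneg L; linarith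
      gcongr
    · rw [intervalIntegral.integral_const_mul]
      exact mul_le_mul_of_nonneg_left (integral_exp_mul_le hγ0 t) hM0
  -- The unknown b is e^{-γt} times the solution. Times are clamped at 0, so that the fixed point
  -- can be sought among the bounded continuous functions on the whole line.
  set J : (ℝ → FreqSpace) → ℝ → FreqSpace := fun b t =>
    Real.exp (-(γ * max t 0)) • I b (max t 0) with hJ
  have hJc : ∀ b, Continuous b → Continuous (J b) := fun b hb =>
    (by fun_prop : Continuous fun t : ℝ => Real.exp (-(γ * max t 0))).smul
      ((hIc b hb).comp (by fun_prop))
  have hexp : ∀ x : ℝ, Real.exp (-x) * Real.exp x = 1 := fun x => by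
    rw [← Real.exp_add, neg_add_cancel, Real.exp_zero]
  have hJd : ∀ b b' : ℝ → FreqSpace, Continuous b → Continuous b' → ∀ D : ℝ,
      (∀ τ, ‖b τ - b' τ‖ ≤ D) → ∀ t, ‖J b t - J b' t‖ ≤ 1 / 2 * D := by
    intro b b' hb hb' D hD t
    have hD0 : 0 ≤ D := (norm_nonneg _).trans (hD 0)
    have h1 := hdiff b b' hb hb' D hD (max t 0) (le_max_right _ _)
    rw [hJ]
    simp only
    rw [← smul_sub, norm_smul, Real.norm_of_nonneg (Real.exp_pos _).le]
    refine (mul_le_mul_of_nonneg_left h1 (Real.exp_pos _).le).trans ?_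
    have e : Real.exp (-(γ * max t 0)) * (|L| * D * (Real.exp (γ * max t 0) / γ)) =
        |L| / γ * D * (Real.exp (-(γ * max t 0)) * Real.exp (γ * max t 0)) := by ring
    rw [e, hexp, mul_one]
    refine mul_le_mul_of_nonneg_right ?_ hD0
    rw [div_le_iff₀ hγ0, hγ]
    have := abs_nonneg β
    linarith
  have hJb : ∀ b : BoundedContinuousFunction ℝ FreqSpace, ∀ t,
      ‖J b t‖ ≤ ‖a₀‖ + M / γ + 1 / 2 * ‖b‖ := fun b t => by
    have h1 := hJd b 0 b.continuous continuous_const ‖b‖ (fun τ => by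
      simpa using b.norm_coe_le_norm τ) t
    have h2 : ‖J 0 t‖ ≤ ‖a₀‖ + M / γ := by
      rw [hJ]
      simp only
      rw [norm_smul, Real.norm_of_nonneg (Real.exp_pos _).le]
      refine (mul_le_mul_of_nonneg_left (hzero (max t 0) (le_max_right _ _))
        (Real.exp_pos _).le).trans ?_
      have e : Real.exp (-(γ * max t 0)) * (M * (Real.exp (γ * max t 0) / γ)) =
        M / γ * (Real.exp (-(γ * max t 0)) * Real.exp (γ * max t 0)) := by ring
      rw [mul_add, e, hexp, mul_one]
      gcongr
      refine mul_le_of_le_one_left (norm_nonneg _) (Real.exp_le_one_iff.2 ?_)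
      exact neg_nonpos.2 (mul_nonneg hγ0.le (le_max_right _ _))
    have h3 := norm_add_le (J b t - J 0 t) (J 0 t)
    rw [sub_add_cancel] at h3
    linarith
  set Φ : BoundedContinuousFunction ℝ FreqSpace → BoundedContinuousFunction ℝ FreqSpace := fun b =>
    BoundedContinuousFunction.ofNormedAddCommGroup (J b) (hJc b b.continuous) _ (hJb b) with hΦ
  have hcontr : ContractingWith (1 / 2) Φ := by
    refine ⟨by rw [← NNReal.coe_lt_coe]; norm_num, LipschitzWith.of_dist_le_mul fun b b' => ?_⟩
    rw [BoundedContinuousFunction.dist_le (by positivity)]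
    intro t
    rw [dist_eq_norm]
    exact hJd b b' b.continuous b'.continuous (dist b b') (fun τ => by
      rw [← dist_eq_norm]; exact b.dist_coe_le_dist τ) t
  obtain ⟨b, hb⟩ : ∃ b, Φ b = b := ⟨_, hcontr.fixedPoint_isFixedPt⟩
  have hbt : ∀ t, J b t = b t := fun t => congrArg (fun u : BoundedContinuousFunction ℝ FreqSpace => u t) hb
  set a : ℝ → FreqSpace := fun t => Real.exp (γ * t) • b t with ha
  have hac : Continuous a :=
    (by fun_prop : Continuous fun τ : ℝ => Real.exp (γ * τ)).smul b.continuous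
  have hat : ∀ t, 0 ≤ t → a t = semi ε ω t a₀ + ∫ τ in (0 : ℝ)..t, semi ε ω (t - τ) (F τ (a τ)) :=
    fun t ht => by
      have h1 := hbt t
      rw [hJ] at h1
      simp only [max_eq_left ht] at h1
      rw [ha]
      simp only
      rw [← h1, smul_smul, ← Real.exp_add, add_neg_cancel, Real.exp_zero, one_smul]
  have ha0 : a 0 = a₀ := by
    rw [hat 0 le_rfl, semi_zero, intervalIntegral.integral_same, add_zero]
  refine ⟨a, hac, ha0, isFreqSol_of_mild (hF.comp (continuous_id.prodMk hac)) ?_⟩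
  rwa [ha0]

end

noncomputable section

/-! ### The family of eigenfunctions -/

open Classical in
/-- The weighted Fourier coefficients of a function in `H²(𝕋)`. -/
def torusSeq (h : ℝ → ℂ) : SeqSpace :=
  if hh : Memℓp (fun j : ℤ => ((1 + (j : ℝ) ^ 2 : ℝ) : ℂ) * torusCoeff h j) 2 then ⟨_, hh⟩ else 0

theorem summable_of_tsum_ofReal_rpow {f : ℤ → ℝ} (hf : ∀ j, 0 ≤ f j)
    (h : (∑' j, ENNReal.ofReal (f j)) ^ (1 / 2 : ℝ) < ⊤) : Summable f := by
  have h1 : ∑' j, ENNReal.ofReal (f j) ≠ ⊤ := fun h' => by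
    rw [h', ENNReal.top_rpow_of_pos (by norm_num)] at h
    exact lt_irrefl _ h
  have h2 := ENNReal.summable_toReal h1
  simpa only [ENNReal.toReal_ofReal (hf _)] using h2

theorem norm_sq_one_add_mul (j : ℤ) (z : ℂ) :
    ‖((1 + (j : ℝ) ^ 2 : ℝ) : ℂ) * z‖ ^ 2 = (1 + (j : ℝ) ^ 2) ^ 2 * ‖z‖ ^ 2 := by
  rw [norm_mul, mul_pow, Complex.norm_real, Real.norm_of_nonneg (by positivity)]

theorem torusSeq_apply {h : ℝ → ℂ} (hh : torusNorm 2 h < ⊤) (j : ℤ) :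
    torusSeq h j = ((1 + (j : ℝ) ^ 2 : ℝ) : ℂ) * torusCoeff h j := by
  have h1 : Memℓp (fun j : ℤ => ((1 + (j : ℝ) ^ 2 : ℝ) : ℂ) * torusCoeff h j) 2 := by
    refine memlp_two_iff.2 ?_
    simp only [norm_sq_one_add_mul]
    exact summable_of_tsum_ofReal_rpow (fun j => by positivity) hh
  rw [torusSeq, dif_pos h1]

theorem ofReal_norm_torusSeq {h : ℝ → ℂ} (hh : torusNorm 2 h < ⊤) :
    ENNReal.ofReal ‖torusSeq h‖ = torusNorm 2 h := by
  rw [torusNorm, ← Real.sqrt_sq (norm_nonneg (torusSeq h)), Real.sqrt_eq_rpow,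
    ← ENNReal.ofReal_rpow_of_nonneg (sq_nonneg _) (by norm_num), SeqSpace.norm_sq,
    ENNReal.ofReal_tsum_of_nonneg (fun j => sq_nonneg _) (SeqSpace.summable _)]
  simp only [torusSeq_apply hh, norm_sq_one_add_mul]

theorem MemTorus.torusNorm_two_lt_top {h : ℝ → ℂ} (hh : MemTorus 4 h) : torusNorm 2 h < ⊤ := by
  refine lt_of_le_of_lt (ENNReal.rpow_le_rpow (ENNReal.tsum_le_tsum fun j =>
    ENNReal.ofReal_le_ofReal ?_) (by norm_num)) hh.norm_lt_top
  refine mul_le_mul_of_nonneg_right (pow_le_pow_right₀ ?_ (by norm_num)) (sq_nonneg _)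
  nlinarith [sq_nonneg (j : ℝ)]

theorem torusCoeff_sub {f g : ℝ → ℂ} (hf : Continuous f) (hg : Continuous g) (j : ℤ) :
    torusCoeff (f - g) j = torusCoeff f j - torusCoeff g j := by
  rw [torusCoeff, torusCoeff, torusCoeff, ← mul_sub, ← intervalIntegral.integral_sub
    (Continuous.intervalIntegrable (by fun_prop) _ _)
    (Continuous.intervalIntegrable (by fun_prop) _ _)]
  simp only [Pi.sub_apply, mul_sub]

section

variable {ε ω b s : ℝ} {ut : ℝ → ℝ} {σbar : ℝ × ℝ} {lam : ℝ × ℝ → ℝ} {c₁ : ℝ} {W : ℝ × ℝ → ℝ → ℂ}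

theorem IsEigenfunctionFamily.norm_lt_top (hW : IsEigenfunctionFamily ε ω b s ut σbar lam c₁ W)
    {σ : ℝ × ℝ} (hσ : σ ∈ square σbar c₁) : torusNorm 2 (W σ) < ⊤ :=
  (hW.eigenfunction σ hσ).mem.torusNorm_two_lt_top

theorem IsEigenfunctionFamily.continuousOn (hW : IsEigenfunctionFamily ε ω b s ut σbar lam c₁ W) :
    ContinuousOn (fun σ => torusSeq (W σ)) (square σbar c₁) := by
  intro σ₀ h₀
  rw [ContinuousWithinAt, tendsto_iff_norm_sub_tendsto_zero]
  have h1 := (ENNReal.tendsto_toReal ENNReal.zero_ne_top).comp (hW.tendsto σ₀ h₀)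
  have hfin : ∀ᶠ σ in 𝓝[square σbar c₁] σ₀, torusNorm 2 (W σ - W σ₀) < ⊤ :=
    (hW.tendsto σ₀ h₀).eventually (gt_mem_nhds ENNReal.zero_lt_top)
  refine h1.congr' ?_
  filter_upwards [hfin, self_mem_nhdsWithin] with σ hσ hmem
  rw [Function.comp_apply, ← ofReal_norm_torusSeq hσ, ENNReal.toReal_ofReal (norm_nonneg _)]
  congr 1
  refine lp.ext (funext fun j => ?_)
  rw [lp.coeFn_sub, Pi.sub_apply, torusSeq_apply hσ, torusSeq_apply (hW.norm_lt_top hmem),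
    torusSeq_apply (hW.norm_lt_top h₀),
    torusCoeff_sub (hW.continuous σ hmem) (hW.continuous σ₀ h₀), mul_sub]

theorem IsEigenfunctionFamily.continuousOn_coeff
    (hW : IsEigenfunctionFamily ε ω b s ut σbar lam c₁ W) (j : ℤ) :
    ContinuousOn (fun σ => torusCoeff (W σ) j) (square σbar c₁) := by
  have h1 : ContinuousOn (fun σ => torusSeq (W σ) j) (square σbar c₁) :=
    (lp.evalCLM ℂ (fun _ : ℤ => ℂ) 2 j).continuous.comp_continuousOn hW.continuousOn
  have hne : (((1 + (j : ℝ) ^ 2 : ℝ)) : ℂ) ≠ 0 :=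
    Complex.ofReal_ne_zero.2 (by positivity)
  refine ContinuousOn.congr (f := fun σ => (((1 + (j : ℝ) ^ 2 : ℝ)) : ℂ)⁻¹ * torusSeq (W σ) j)
    (continuousOn_const.mul h1) fun σ hσ => ?_
  simp only
  rw [torusSeq_apply (hW.norm_lt_top hσ), ← mul_assoc, inv_mul_cancel₀ hne, one_mul]

theorem isCompact_square (σbar : ℝ × ℝ) (c : ℝ) : IsCompact (square σbar c) :=
  isCompact_Icc.prod isCompact_Icc

theorem measurableSet_square (σbar : ℝ × ℝ) (c : ℝ) : MeasurableSet (square σbar c) :=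
  (isCompact_square σbar c).measurableSet

theorem IsEigenfunctionFamily.exists_bound
    (hW : IsEigenfunctionFamily ε ω b s ut σbar lam c₁ W) :
    ∃ C, 0 ≤ C ∧ ∀ σ ∈ square σbar c₁, ‖torusSeq (W σ)‖ ≤ C := by
  obtain ⟨C, hC⟩ := (isCompact_square σbar c₁).exists_bound_of_continuousOn hW.continuousOn
  exact ⟨max C 0, le_max_right _ _, fun σ hσ => (hC σ hσ).trans (le_max_left _ _)⟩

theorem norm_torusCoeff_le_seq {h : ℝ → ℂ} (hh : torusNorm 2 h < ⊤) (j : ℤ) :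
    ‖torusCoeff h j‖ ≤ ‖torusSeq h‖ * (1 + (j : ℝ) ^ 2)⁻¹ := by
  have h1 : ‖torusSeq h j‖ ≤ ‖torusSeq h‖ := lp.norm_apply_le_norm (by norm_num) _ j
  rw [torusSeq_apply hh, norm_mul, Complex.norm_real, Real.norm_of_nonneg (by positivity)] at h1
  rw [← div_eq_mul_inv, le_div_iff₀ (by positivity)]
  linarith

theorem IsEigenfunctionFamily.hasSum (hW : IsEigenfunctionFamily ε ω b s ut σbar lam c₁ W)
    {σ : ℝ × ℝ} (hσ : σ ∈ square σbar c₁) (x : ℝ) :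
    HasSum (fun j => torusCoeff (W σ) j * expI j x) (W σ x) :=
  hasSum_torusCoeff (hW.continuous σ hσ) (hW.eigenfunction σ hσ).mem.periodic
    (Summable.of_norm (Summable.of_nonneg_of_le (fun _ => norm_nonneg _)
      (norm_torusCoeff_le_seq (hW.norm_lt_top hσ)) (summable_inv_one_add_int_sq.mul_left _))) x

theorem IsEigenfunctionFamily.hasSum_eigen
    (hW : IsEigenfunctionFamily ε ω b s ut σbar lam c₁ W) {c : ℤ → ℂ}
    (hc : IsCoeff c fun x => (potential ε b s ut x : ℂ)) {σ : ℝ × ℝ} (hσ : σ ∈ square σbar c₁)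
    (j : ℤ) : HasSum (fun k => c k * torusCoeff (W σ) (j - k))
      (((lam σ + blochSym ε ω σ j : ℝ) : ℂ) * torusCoeff (W σ) j) := by
  have h1 := hasSum_torusCoeff_mul hc.summable hc.hasSum (hW.continuous σ hσ) j
  have h2 := (hW.eigenfunction σ hσ).eigen j
  rw [blochCoeff] at h2
  have h3 : (1 + (1 + 2 * ε * ω) * (Complex.I * (j + σ.1)) ^ 2 - σ.2 ^ 2 : ℂ) ^ 2 =
      (blochSym ε ω σ j : ℂ) := by
    rw [mul_pow, Complex.I_sq, blochSym]
    push_cast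
    ring
  rw [h3] at h2
  convert h1 using 1
  push_cast
  linear_combination -h2

end

/-! ### Superposition of Bloch waves -/

/-- The frequency of the Bloch wave with vector `σ` and index `j`. -/
def waveVec (j : ℤ) (σ : ℝ × ℝ) : Plane := !₂[(σ.1 + j) / (2 * Real.pi), σ.2 / (2 * Real.pi)]

/-- The index of the Bloch wave with frequency `ξ`. -/
def waveIndex (σbar : ℝ × ℝ) (ξ : Plane) : ℤ := ⌊2 * Real.pi * ξ 0 - σbar.1⌋

/-- The Bloch vector of the wave with frequency `ξ`. -/
def waveSigma (σbar : ℝ × ℝ) (ξ : Plane) : ℝ × ℝ :=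
  (2 * Real.pi * ξ 0 - waveIndex σbar ξ, 2 * Real.pi * ξ 1)

/-- A fundamental domain for the Bloch vectors. -/
def cell (σbar : ℝ × ℝ) : Set (ℝ × ℝ) := Set.Ico σbar.1 (σbar.1 + 1) ×ˢ Set.univ

theorem measurableSet_cell (σbar : ℝ × ℝ) : MeasurableSet (cell σbar) :=
  measurableSet_Ico.prod MeasurableSet.univ

theorem measurable_waveIndex (σbar : ℝ × ℝ) : Measurable (waveIndex σbar) :=
  Int.measurable_floor.comp
    (by fun_prop : Continuous fun ξ : Plane => 2 * Real.pi * ξ 0 - σbar.1).measurable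

theorem measurable_waveSigma (σbar : ℝ × ℝ) : Measurable (waveSigma σbar) := by
  have h1 : Measurable fun ξ : Plane => (waveIndex σbar ξ : ℝ) :=
    (measurable_of_countable (fun j : ℤ => (j : ℝ))).comp (measurable_waveIndex σbar)
  exact ((by fun_prop : Continuous fun ξ : Plane => 2 * Real.pi * ξ 0).measurable.sub h1).prodMk
    (by fun_prop : Continuous fun ξ : Plane => 2 * Real.pi * ξ 1).measurable

theorem waveVec_zero (j : ℤ) (σ : ℝ × ℝ) : 2 * Real.pi * waveVec j σ 0 = σ.1 + j := by
  have := Real.pi_ne_zero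
  simp only [waveVec, PiLp.toLp_apply, Matrix.cons_val_zero]
  field_simp

theorem waveVec_one (j : ℤ) (σ : ℝ × ℝ) : 2 * Real.pi * waveVec j σ 1 = σ.2 := by
  have := Real.pi_ne_zero
  simp only [waveVec, PiLp.toLp_apply, Matrix.cons_val_one]
  exact mul_div_cancel₀ _ (by positivity)

theorem waveIndex_waveVec {σbar σ : ℝ × ℝ} (hσ : σ ∈ cell σbar) (j : ℤ) :
    waveIndex σbar (waveVec j σ) = j := by
  rw [waveIndex, waveVec_zero, Int.floor_eq_iff]
  have h1 := hσ.1.1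
  have h2 := hσ.1.2
  constructor <;> linarith

theorem waveSigma_waveVec {σbar σ : ℝ × ℝ} (hσ : σ ∈ cell σbar) (j : ℤ) :
    waveSigma σbar (waveVec j σ) = σ := by
  rw [waveSigma, waveIndex_waveVec hσ, waveVec_zero, waveVec_one]
  ext <;> simp

theorem waveIndex_sub_shiftVec (σbar : ℝ × ℝ) (ξ : Plane) (k : ℤ) :
    waveIndex σbar (ξ - shiftVec k) = waveIndex σbar ξ - k := by
  rw [waveIndex, sub_eq_add_neg ξ, ← shiftVec_neg, two_pi_mul_add_shiftVec, waveIndex,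
    ← Int.floor_sub_intCast]
  congr 1
  push_cast
  ring

theorem waveSigma_sub_shiftVec (σbar : ℝ × ℝ) (ξ : Plane) (k : ℤ) :
    waveSigma σbar (ξ - shiftVec k) = waveSigma σbar ξ := by
  rw [waveSigma, waveIndex_sub_shiftVec, sub_eq_add_neg ξ, ← shiftVec_neg, two_pi_mul_add_shiftVec,
    PiLp.add_apply, shiftVec_apply_one, waveSigma]
  ext
  · push_cast; ring
  · simp

theorem sym_eq_blochSym (ε ω : ℝ) (σbar : ℝ × ℝ) (ξ : Plane) :
    sym ε ω ξ = blochSym ε ω (waveSigma σbar ξ) (waveIndex σbar ξ) := by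
  rw [sym, symA, blochSym, waveSigma]
  ring

theorem measurable_waveVec (j : ℤ) : Measurable (waveVec j) := by
  have h : Continuous (waveVec j) := by
    refine (PiLp.continuous_toLp 2 _).comp (continuous_pi fun i => ?_)
    fin_cases i
    · exact (by fun_prop : Continuous fun σ : ℝ × ℝ => (σ.1 + j) / (2 * Real.pi))
    · exact (by fun_prop : Continuous fun σ : ℝ × ℝ => σ.2 / (2 * Real.pi))
  exact h.measurable

theorem volume_eq_map_scale : (volume : Measure Plane) = ENNReal.ofReal ((2 * Real.pi) ^ 2)⁻¹ •
    Measure.map (waveVec 0) (volume : Measure (ℝ × ℝ)) := by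
  have h1 := (PiLp.volume_preserving_toLp (Fin 2)).comp
    ((volume_preserving_finTwoArrow ℝ).symm MeasurableEquiv.finTwoArrow)
  have h2 := Measure.map_addHaar_smul (volume : Measure Plane) (r := (2 * Real.pi)⁻¹)
    (by positivity)
  rw [finrank_euclideanSpace_fin, inv_pow, inv_inv, abs_of_pos (by positivity), ← h1.map_eq,
    Measure.map_map (by fun_prop) h1.measurable] at h2
  have e : ((fun x : Plane => (2 * Real.pi)⁻¹ • x) ∘
      (WithLp.toLp 2 ∘ (MeasurableEquiv.finTwoArrow (α := ℝ)).symm)) = waveVec 0 := by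
    funext σ
    ext i
    fin_cases i <;> simp [waveVec, MeasurableEquiv.finTwoArrow, div_eq_inv_mul]
  rw [e, h1.map_eq] at h2
  rw [h2, smul_smul, ← ENNReal.ofReal_mul (by positivity), inv_mul_cancel₀ (by positivity),
    ENNReal.ofReal_one, one_smul]

/-- Every frequency is (σ₁ + j, σ₂)/(2π) for exactly one index j and one σ in the cell: the plane is
a disjoint union of strips, each a scaled copy of the cell. The factor is the Jacobian of the
scaling. -/
theorem volume_eq_sum_waves (σbar : ℝ × ℝ) : (volume : Measure Plane) = Measure.sum fun j : ℤ =>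
    ENNReal.ofReal ((2 * Real.pi) ^ 2)⁻¹ • Measure.map (waveVec j) (volume.restrict (cell σbar)) := by
  ext A hA
  have hS : Measurable fun η : ℝ × ℝ => ⌊η.1 - σbar.1⌋ :=
    Int.measurable_floor.comp (measurable_fst.sub_const _)
  have hB : MeasurableSet (waveVec 0 ⁻¹' A) := measurable_waveVec 0 hA
  have hsplit : volume (waveVec 0 ⁻¹' A) =
      ∑' j : ℤ, volume (waveVec 0 ⁻¹' A ∩ (fun η : ℝ × ℝ => ⌊η.1 - σbar.1⌋) ⁻¹' {j}) := by
    rw [← measure_iUnion (fun i j hij => Set.disjoint_left.2 fun η h1 h2 =>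
      hij (h1.2.symm.trans h2.2)) fun j => hB.inter (hS (measurableSet_singleton j)),
      ← Set.inter_iUnion]
    congr 1
    refine (Set.inter_eq_left.2 fun η _ => Set.mem_iUnion.2 ?_).symm
    exact ⟨⌊η.1 - σbar.1⌋, Set.mem_singleton _⟩
  rw [volume_eq_map_scale, Measure.smul_apply, Measure.map_apply (measurable_waveVec 0) hA, hsplit,
    Measure.sum_apply _ hA, smul_eq_mul, ← ENNReal.tsum_mul_left]
  refine tsum_congr fun j => ?_
  rw [Measure.smul_apply, smul_eq_mul, Measure.map_apply (measurable_waveVec j) hA,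
    Measure.restrict_apply (measurable_waveVec j hA),
    ← measure_preimage_add_right volume ((j : ℝ), (0 : ℝ))]
  congr 2
  ext η
  have e1 : waveVec 0 (η + ((j : ℝ), (0 : ℝ))) = waveVec j η := by
    simp [waveVec]
  have e2 : ⌊(η + ((j : ℝ), (0 : ℝ))).1 - σbar.1⌋ = j ↔ η ∈ cell σbar := by
    rw [Int.floor_eq_iff, cell, Set.mem_prod, Set.mem_Ico]
    simp only [Prod.fst_add, Set.mem_univ, and_true]
    constructor <;> rintro ⟨h1, h2⟩ <;> constructor <;> linarith
  simp only [Set.mem_preimage, Set.mem_inter_iff, Set.mem_singleton_iff, e1, e2]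

theorem lintegral_eq_tsum_waves (σbar : ℝ × ℝ) {f : Plane → ℝ≥0∞} (hf : Measurable f) :
    ∫⁻ ξ, f ξ = ENNReal.ofReal ((2 * Real.pi) ^ 2)⁻¹ *
      ∑' j : ℤ, ∫⁻ σ in cell σbar, f (waveVec j σ) := by
  rw [volume_eq_sum_waves σbar, lintegral_sum_measure, ← ENNReal.tsum_mul_left]
  refine tsum_congr fun j => ?_
  rw [lintegral_smul_measure, lintegral_map hf (measurable_waveVec j), smul_eq_mul]

theorem hasSum_integral_waves (σbar : ℝ × ℝ) {f : Plane → ℂ} (hm : Measurable f)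
    (hf : Integrable f) : HasSum (fun j : ℤ => (((2 * Real.pi) ^ 2)⁻¹ : ℝ) *
      ∫ σ in cell σbar, f (waveVec j σ)) (∫ ξ, f ξ) := by
  have hf' := hf
  rw [volume_eq_sum_waves σbar] at hf'
  have h := hasSum_integral_measure hf'
  rw [← volume_eq_sum_waves σbar] at h
  refine h.congr_fun ?_
  intro j
  rw [integral_smul_measure, ENNReal.toReal_ofReal (by positivity),
    integral_map (measurable_waveVec j).aemeasurable hm.aestronglyMeasurable, Complex.real_smul]

end

noncomputable section

/-! ### The first profile -/

section

variable (σbar : ℝ × ℝ) (lam : ℝ × ℝ → ℝ) (W : ℝ × ℝ → ℝ → ℂ) (c₀ : ℝ)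

/-- The amplitude of the Bloch wave with vector `σ` and index `j` in the initial datum. -/
def waveCoeff (σ : ℝ × ℝ) (j : ℤ) : ℂ :=
  (square σbar c₀).indicator (fun σ => torusCoeff (W σ) j) σ

/-- The Fourier transform of the initial datum. -/
def waveAmp (ξ : Plane) : ℂ :=
  ((2 * Real.pi) ^ 2 : ℝ) * waveCoeff σbar W c₀ (waveSigma σbar ξ) (waveIndex σbar ξ)

/-- The growth rate of the Bloch wave with frequency `ξ`. -/
def waveRate (ξ : Plane) : ℝ := (square σbar c₀).indicator lam (waveSigma σbar ξ)

end

variable {ε ω b s : ℝ} {ut : ℝ → ℝ} {σbar : ℝ × ℝ} {lam : ℝ × ℝ → ℝ} {c₁ c₀ : ℝ}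
  {W : ℝ × ℝ → ℝ → ℂ}

theorem square_subset_cell (h : c₀ < 1) : square σbar c₀ ⊆ cell σbar := fun σ hσ =>
  ⟨⟨hσ.1.1, hσ.1.2.trans_lt (by linarith)⟩, trivial⟩

theorem square_mono (h : c₀ ≤ c₁) : square σbar c₀ ⊆ square σbar c₁ :=
  Set.prod_mono (Set.Icc_subset_Icc_right (by linarith)) (Set.Icc_subset_Icc_right (by linarith))

theorem measurable_indicator_of_continuousOn {E : Type*} [TopologicalSpace E] [Zero E]
    [MeasurableSpace E] [BorelSpace E] {f : ℝ × ℝ → E} {S : Set (ℝ × ℝ)} (hS : MeasurableSet S)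
    (hf : ContinuousOn f S) : Measurable (S.indicator f) := by
  classical
  rw [← Set.piecewise_eq_indicator]
  exact hf.measurable_piecewise continuousOn_const hS

theorem measurable_waveAmp (hW : IsEigenfunctionFamily ε ω b s ut σbar lam c₁ W) (h : c₀ ≤ c₁) :
    Measurable (waveAmp σbar W c₀) := by
  have h1 : ∀ j, Measurable fun σ => waveCoeff σbar W c₀ σ j := fun j =>
    measurable_indicator_of_continuousOn (measurableSet_square σbar c₀)
      ((hW.continuousOn_coeff j).mono (square_mono h))
  have h2 : Measurable fun p : (ℝ × ℝ) × ℤ => waveCoeff σbar W c₀ p.1 p.2 :=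
    measurable_from_prod_countable_left h1
  have h3 : Measurable fun ξ => waveCoeff σbar W c₀ (waveSigma σbar ξ) (waveIndex σbar ξ) :=
    Measurable.comp (g := fun p : (ℝ × ℝ) × ℤ => waveCoeff σbar W c₀ p.1 p.2)
      (f := fun ξ => (waveSigma σbar ξ, waveIndex σbar ξ)) h2
      ((measurable_waveSigma σbar).prodMk (measurable_waveIndex σbar))
  unfold waveAmp
  exact h3.const_mul _

theorem bddMeas_waveRate (hlam : ContinuousOn lam (square σbar c₀)) :
    BddMeas (waveRate σbar lam c₀) := by
  obtain ⟨C, hC⟩ := (isCompact_square σbar c₀).exists_bound_of_continuousOn hlam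
  refine ⟨(measurable_indicator_of_continuousOn (measurableSet_square σbar c₀) hlam).comp
    (measurable_waveSigma σbar), max C 0, fun ξ => ?_⟩
  rw [waveRate]
  by_cases h : waveSigma σbar ξ ∈ square σbar c₀
  · rw [Set.indicator_of_mem h]
    exact (hC _ h).trans (le_max_left _ _)
  · simp [Set.indicator_of_notMem h]

theorem waveAmp_waveVec {σ : ℝ × ℝ} (hσ : σ ∈ cell σbar) (j : ℤ) :
    waveAmp σbar W c₀ (waveVec j σ) = ((2 * Real.pi) ^ 2 : ℝ) * waveCoeff σbar W c₀ σ j := by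
  rw [waveAmp, waveSigma_waveVec hσ, waveIndex_waveVec hσ]

theorem waveRate_waveVec {σ : ℝ × ℝ} (hσ : σ ∈ cell σbar) (j : ℤ) :
    waveRate σbar lam c₀ (waveVec j σ) = (square σbar c₀).indicator lam σ := by
  rw [waveRate, waveSigma_waveVec hσ]

theorem wt_waveVec (j : ℤ) (σ : ℝ × ℝ) : wt (waveVec j σ) = 1 + (σ.1 + j) ^ 2 + σ.2 ^ 2 := by
  rw [wt_eq, waveVec_zero, waveVec_one]

theorem exists_wt_waveVec_le (σbar : ℝ × ℝ) (c₁ : ℝ) :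
    ∃ D, 0 < D ∧ ∀ σ ∈ square σbar c₁, ∀ j : ℤ, wt (waveVec j σ) ≤ D * (1 + (j : ℝ) ^ 2) := by
  obtain ⟨D, hD⟩ := (isCompact_square σbar c₁).exists_bound_of_continuousOn
    (f := fun σ : ℝ × ℝ => 2 + 2 * σ.1 ^ 2 + σ.2 ^ 2) (by fun_prop)
  refine ⟨max D 1, by positivity, fun σ hσ j => ?_⟩
  have h1 := (le_abs_self _).trans ((hD σ hσ).trans (le_max_left D 1))
  rw [wt_waveVec]
  have h2 := mul_le_mul_of_nonneg_right h1 (by positivity : 0 ≤ 1 + (j : ℝ) ^ 2)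
  nlinarith [sq_nonneg (σ.1 - j), mul_nonneg (sq_nonneg σ.1) (sq_nonneg (j : ℝ)),
    mul_nonneg (sq_nonneg σ.2) (sq_nonneg (j : ℝ)), sq_nonneg (j : ℝ), sq_nonneg σ.1]

theorem growth_nonneg (σbar : ℝ × ℝ) (lam : ℝ × ℝ → ℝ) (c₀ t : ℝ) : 0 ≤ growth σbar lam c₀ t :=
  mul_nonneg (Real.exp_pos _).le (Real.sqrt_nonneg _)

theorem growth_sq (σbar : ℝ × ℝ) (lam : ℝ × ℝ → ℝ) (c₀ t : ℝ) :
    growth σbar lam c₀ t ^ 2 = ∫ σ in square σbar c₀, Real.exp (2 * t * lam σ) := by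
  rw [growth, prefactor, mul_pow, Real.sq_sqrt (integral_nonneg fun σ => (Real.exp_pos _).le),
    ← integral_const_mul]
  refine integral_congr_ae (ae_of_all _ fun σ => ?_)
  simp only
  rw [sq, ← Real.exp_add, ← Real.exp_add]
  congr 1
  ring

/-- Over the cell the squared H² norm splits into the squared H²(𝕋) norm of W(·, σ), up to
constants, times e^{2tλ(σ)}. The former is bounded on the compact square, and the latter integrates
to the squared growth factor. -/
theorem exists_lintegral_wave_le (hW : IsEigenfunctionFamily ε ω b s ut σbar lam c₁ W)
    (hlam : ContinuousOn lam (square σbar c₁)) :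
    ∃ B, 0 < B ∧ ∀ c₀ t : ℝ, c₀ ≤ c₁ → c₀ < 1 →
      ∫⁻ ξ, ‖(wt ξ : ℂ) * ((Real.exp (t * waveRate σbar lam c₀ ξ) : ℂ) * waveAmp σbar W c₀ ξ)‖ₑ ^ 2 ≤
        ENNReal.ofReal ((B * growth σbar lam c₀ t) ^ 2) := by
  obtain ⟨D, hD0, hD⟩ := exists_wt_waveVec_le σbar c₁
  obtain ⟨C, hC0, hC⟩ := hW.exists_bound
  -- The amplitude contributes (2π)⁴ and the Jacobian (2π)⁻², hence one factor 2π in B. Using C + 1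
  -- instead of C keeps B positive.
  refine ⟨2 * Real.pi * D * (C + 1), by positivity, fun c₀ t h1 h2 => ?_⟩
  have hmr := (bddMeas_waveRate (hlam.mono (square_mono h1))).meas
  have hma := measurable_waveAmp hW h1
  have hm : Measurable fun ξ => ‖(wt ξ : ℂ) *
      ((Real.exp (t * waveRate σbar lam c₀ ξ) : ℂ) * waveAmp σbar W c₀ ξ)‖ₑ ^ 2 := by
    refine Measurable.pow_const (Measurable.enorm ((Complex.measurable_ofReal.comp
      continuous_wt.measurable).mul (Measurable.mul ?_ hma))) 2
    exact Complex.measurable_ofReal.comp (Real.measurable_exp.comp (hmr.const_mul t))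
  set K : ℝ × ℝ → ℝ := fun σ => (2 * Real.pi) ^ 4 * D ^ 2 * (C + 1) ^ 2 * Real.exp (2 * t * lam σ)
    with hK
  have hK0 : ∀ σ, 0 ≤ K σ := fun σ => by positivity
  have hKc : ContinuousOn K (square σbar c₀) := by
    refine continuousOn_const.mul (Real.continuous_exp.comp_continuousOn
      (continuousOn_const.mul (hlam.mono (square_mono h1))))
  have hpt : ∀ σ ∈ cell σbar, ∑' j : ℤ, ‖(wt (waveVec j σ) : ℂ) *
      ((Real.exp (t * waveRate σbar lam c₀ (waveVec j σ)) : ℂ) *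
        waveAmp σbar W c₀ (waveVec j σ))‖ₑ ^ 2 ≤
      (square σbar c₀).indicator (fun σ => ENNReal.ofReal (K σ)) σ := fun σ hσ => by
    simp only [waveAmp_waveVec hσ, waveRate_waveVec hσ, waveCoeff]
    by_cases hs : σ ∈ square σbar c₀
    · simp only [Set.indicator_of_mem hs]
      have hs1 := square_mono h1 hs
      have hle : ∀ j : ℤ, ‖(wt (waveVec j σ) : ℂ) * ((Real.exp (t * lam σ) : ℂ) *
          (((2 * Real.pi) ^ 2 : ℝ) * torusCoeff (W σ) j))‖ₑ ^ 2 ≤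
          ENNReal.ofReal ((2 * Real.pi) ^ 4 * D ^ 2 * Real.exp (2 * t * lam σ) *
            ‖torusSeq (W σ) j‖ ^ 2) := fun j => by
        rw [← ofReal_norm, ← ENNReal.ofReal_pow (norm_nonneg _)]
        refine ENNReal.ofReal_le_ofReal ?_
        rw [torusSeq_apply (hW.norm_lt_top hs1), norm_sq_one_add_mul, norm_mul, norm_mul, norm_mul,
          Complex.norm_real, Complex.norm_real, Complex.norm_real,
          Real.norm_of_nonneg (wt_pos _).le, Real.norm_of_nonneg (Real.exp_pos _).le,
          Real.norm_of_nonneg (by positivity), mul_pow, mul_pow, mul_pow]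
        have e1 : Real.exp (t * lam σ) ^ 2 = Real.exp (2 * t * lam σ) := by
          rw [sq, ← Real.exp_add]; congr 1; ring
        have e2 : wt (waveVec j σ) ^ 2 ≤ D ^ 2 * (1 + (j : ℝ) ^ 2) ^ 2 := by
          rw [← mul_pow]
          exact pow_le_pow_left₀ (wt_pos _).le (hD σ hs1 j) 2
        rw [e1]
        have e3 := mul_le_mul_of_nonneg_right e2 (by positivity : 0 ≤ Real.exp (2 * t * lam σ) *
          (((2 * Real.pi) ^ 2) ^ 2 * ‖torusCoeff (W σ) j‖ ^ 2))
        refine e3.trans (le_of_eq ?_)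
        ring
      refine (ENNReal.tsum_le_tsum hle).trans ?_
      rw [← ENNReal.ofReal_tsum_of_nonneg (fun j => by positivity)
        ((SeqSpace.summable _).mul_left _), tsum_mul_left, ← SeqSpace.norm_sq]
      refine ENNReal.ofReal_le_ofReal ?_
      have h3 : ‖torusSeq (W σ)‖ ^ 2 ≤ (C + 1) ^ 2 :=
        pow_le_pow_left₀ (norm_nonneg _) (by linarith [hC σ hs1]) 2
      have h4 := mul_le_mul_of_nonneg_left h3
        (by positivity : 0 ≤ (2 * Real.pi) ^ 4 * D ^ 2 * Real.exp (2 * t * lam σ))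
      refine h4.trans (le_of_eq ?_)
      rw [hK]
      ring
    · simp [Set.indicator_of_notMem hs]
  have hswap := lintegral_tsum (μ := volume.restrict (cell σbar)) fun j : ℤ =>
    (hm.comp (measurable_waveVec j)).aemeasurable
  simp only [Function.comp_apply] at hswap
  rw [lintegral_eq_tsum_waves σbar hm, ← hswap]
  have h3 : ∫⁻ σ in cell σbar, ∑' j : ℤ, ‖(wt (waveVec j σ) : ℂ) *
      ((Real.exp (t * waveRate σbar lam c₀ (waveVec j σ)) : ℂ) *
        waveAmp σbar W c₀ (waveVec j σ))‖ₑ ^ 2 ≤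
      ENNReal.ofReal (∫ σ in square σbar c₀, K σ) := by
    refine (setLIntegral_mono' (measurableSet_cell σbar) hpt).trans
      ((lintegral_mono' Measure.restrict_le_self le_rfl).trans ?_)
    rw [lintegral_indicator (measurableSet_square σbar c₀),
      ofReal_integral_eq_lintegral_ofReal (hKc.integrableOn_compact (isCompact_square σbar c₀))
        (ae_of_all _ hK0)]
  refine (mul_le_mul_right h3 _).trans ?_
  rw [← ENNReal.ofReal_mul (by positivity)]
  refine ENNReal.ofReal_le_ofReal (le_of_eq ?_)
  rw [hK, integral_const_mul, mul_pow _ (growth σbar lam c₀ t), growth_sq]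
  have := Real.pi_ne_zero
  field_simp

end

noncomputable section

/-! ### The initial datum as a superposition of Bloch waves, and its exact evolution. -/

theorem hatOp_injective {x y : FreqSpace} (h : hatOp x = hatOp y) : x = y := by
  refine Lp.ext ?_
  filter_upwards [coeFn_hatOp x, coeFn_hatOp y] with ξ h1 h2
  rw [h, h2] at h1
  exact (mul_left_cancel₀ (inv_ne_zero (wt_ne_zero ξ)) h1).symm

variable {ε ω b s : ℝ} {ut : ℝ → ℝ} {σbar : ℝ × ℝ} {lam : ℝ × ℝ → ℝ} {c₁ c₀ : ℝ}
  {W : ℝ × ℝ → ℝ → ℂ}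

/-- The inversion integral is taken strip by strip, and the Jacobian cancels the factor (2π)² of
`waveAmp`. Since c₀ < 1 the square lies in one cell, so no frequency carries two waves. Exchanging
the sum over j with the integral over σ, by the bound C(1 + j²)⁻¹ on the coefficients, rebuilds the
Fourier series of W(·, σ). -/
theorem recon_eq_modeData (hW : IsEigenfunctionFamily ε ω b s ut σbar lam c₁ W) (h1 : c₀ ≤ c₁)
    (h2 : c₀ < 1) {a : FreqSpace} (ha : hatOp a =ᵐ[volume] waveAmp σbar W c₀) (p : Plane) :
    recon a p = modeData σbar W c₀ p := by
  have hma := measurable_waveAmp hW h1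
  obtain ⟨C, hC0, hC⟩ := hW.exists_bound
  set f : Plane → ℂ := fun ξ => Complex.exp (2 * Real.pi * (ξ 0 * p 0 + ξ 1 * p 1) * Complex.I) *
    waveAmp σbar W c₀ ξ with hf
  have hec : Continuous fun ξ : Plane =>
      Complex.exp (2 * Real.pi * (ξ 0 * p 0 + ξ 1 * p 1) * Complex.I) := by fun_prop
  have hfm : Measurable f := hec.measurable.mul hma
  have hamp : (fun ξ => ((wt ξ)⁻¹ : ℂ) * a ξ) =ᵐ[volume] waveAmp σbar W c₀ :=
    (coeFn_hatOp a).symm.trans ha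
  have hfi : Integrable f := by
    refine ((integrable_wt_inv_mul a).congr hamp).bdd_mul (c := 1) hec.aestronglyMeasurable
      (ae_of_all _ fun ξ => le_of_eq ?_)
    have : (2 * Real.pi * (ξ 0 * p 0 + ξ 1 * p 1) * Complex.I : ℂ) =
      ((2 * Real.pi * (ξ 0 * p 0 + ξ 1 * p 1) : ℝ) : ℂ) * Complex.I := by push_cast; ring
    rw [this, Complex.norm_exp_ofReal_mul_I]
  have e1 : recon a p = ∫ ξ, f ξ := by
    rw [recon_eq]
    refine integral_congr_ae ?_
    filter_upwards [hamp] with ξ hξ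
    rw [hξ, Circle.smul_def, Real.fourierChar_apply, smul_eq_mul, hf]
    simp only [PiLp.inner_apply, Fin.sum_univ_two, RCLike.inner_apply, conj_trivial]
    congr 2
    push_cast
    ring
  have h3 := hasSum_integral_waves σbar hfm hfi
  have h4 : ∀ j : ℤ, (((2 * Real.pi) ^ 2)⁻¹ : ℝ) * ∫ σ in cell σbar, f (waveVec j σ) =
      ∫ σ in square σbar c₀, Complex.exp (Complex.I * (σ.1 * p 0 + σ.2 * p 1)) *
        (torusCoeff (W σ) j * expI j (p 0)) := fun j => by
    have e2 : ∀ σ ∈ cell σbar, (((2 * Real.pi) ^ 2)⁻¹ : ℝ) * f (waveVec j σ) =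
        (square σbar c₀).indicator (fun σ => Complex.exp (Complex.I * (σ.1 * p 0 + σ.2 * p 1)) *
        (torusCoeff (W σ) j * expI j (p 0))) σ := fun σ hσ => by
      rw [hf]
      simp only
      rw [waveAmp_waveVec hσ, waveCoeff]
      by_cases hs : σ ∈ square σbar c₀
      · have hone : ((((2 * Real.pi) ^ 2)⁻¹ : ℝ) : ℂ) * (((2 * Real.pi) ^ 2 : ℝ) : ℂ) = 1 := by
          rw [← Complex.ofReal_mul, inv_mul_cancel₀ (by positivity), Complex.ofReal_one]
        rw [Set.indicator_of_mem hs, Set.indicator_of_mem hs, mul_left_comm,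
          ← mul_assoc (((((2 * Real.pi) ^ 2)⁻¹ : ℝ)) : ℂ), hone, one_mul, expI,
          mul_comm (torusCoeff (W σ) j), ← mul_assoc, ← Complex.exp_add]
        congr 2
        have w0 := congrArg (fun x : ℝ => (x : ℂ)) (waveVec_zero j σ)
        have w1 := congrArg (fun x : ℝ => (x : ℂ)) (waveVec_one j σ)
        push_cast at w0 w1
        linear_combination (p 0 : ℂ) * Complex.I * w0 + (p 1 : ℂ) * Complex.I * w1
      · simp [Set.indicator_of_notMem hs]
    rw [← integral_const_mul, setIntegral_congr_fun (measurableSet_cell σbar) e2,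
      setIntegral_indicator (measurableSet_square σbar c₀),
      Set.inter_eq_right.2 (square_subset_cell h2)]
  simp only [h4] at h3
  have h5 : HasSum (fun j : ℤ => ∫ σ in square σbar c₀,
      Complex.exp (Complex.I * (σ.1 * p 0 + σ.2 * p 1)) *
        (torusCoeff (W σ) j * expI j (p 0))) (modeData σbar W c₀ p) := by
    have hsum := summable_inv_one_add_int_sq.mul_left C
    have hmem : ∀ᵐ σ ∂(volume.restrict (square σbar c₀)), σ ∈ square σbar c₀ :=
      ae_restrict_mem (measurableSet_square σbar c₀)
    refine hasSum_integral_of_dominated_convergence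
      (fun j _ => C * (1 + (j : ℝ) ^ 2)⁻¹) (fun j => ?_) (fun j => ?_) (ae_of_all _ fun _ => hsum)
      ?_ ?_
    · have hc : ContinuousOn (fun σ => torusCoeff (W σ) j) (square σbar c₀) :=
        (hW.continuousOn_coeff j).mono (square_mono h1)
      refine ContinuousOn.aestronglyMeasurable ?_ (measurableSet_square σbar c₀)
      have he : Continuous fun σ : ℝ × ℝ =>
        Complex.exp (Complex.I * (σ.1 * p 0 + σ.2 * p 1)) := by fun_prop
      exact he.continuousOn.mul (hc.mul continuousOn_const)
    · filter_upwards [hmem] with σ hσ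
      have : (Complex.I * (σ.1 * p 0 + σ.2 * p 1) : ℂ) =
        ((σ.1 * p 0 + σ.2 * p 1 : ℝ) : ℂ) * Complex.I := by push_cast; ring
      rw [norm_mul, norm_mul, norm_expI, mul_one, this, Complex.norm_exp_ofReal_mul_I, one_mul]
      have hσ1 := square_mono h1 hσ
      refine (norm_torusCoeff_le_seq (hW.norm_lt_top hσ1) j).trans ?_
      exact mul_le_mul_of_nonneg_right (hC σ hσ1) (by positivity)
    · exact integrableOn_const (isCompact_square σbar c₀).measure_lt_top.ne
    · filter_upwards [hmem] with σ hσ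
      exact (hW.hasSum (square_mono h1 hσ) (p 0)).mul_left _
  rw [e1]
  exact h3.unique h5

/-- Multiplication by the potential leaves `waveSigma` fixed and acts as a convolution in
`waveIndex`. The eigenvalue equation therefore says that 𝓛 acts on the superposition as
multiplication by `waveRate`, and the solution is obtained by multiplying each wave by e^{tλ(σ)}. -/
theorem exists_first_profile (hW : IsEigenfunctionFamily ε ω b s ut σbar lam c₁ W)
    (hlam : ContinuousOn lam (square σbar c₁)) {c : ℤ → ℂ}
    (hc : IsCoeff c fun x => (potential ε b s ut x : ℂ)) :
    ∃ B, 0 < B ∧ ∀ c₀ : ℝ, c₀ ≤ c₁ → c₀ < 1 → ∃ a : ℝ → FreqSpace, Continuous a ∧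
      (∀ p, recon (a 0) p = modeData σbar W c₀ p) ∧
      (∀ t, ‖a t‖ ≤ B * growth σbar lam c₀ t) ∧
      IsFreqSol ε ω (Set.Ici 0) a fun t => multH2 c (a t) := by
  obtain ⟨B, hB0, hB⟩ := exists_lintegral_wave_le hW hlam
  refine ⟨B, hB0, fun c₀ h1 h2 => ?_⟩
  have hr := bddMeas_waveRate (hlam.mono (square_mono h1))
  have hma := measurable_waveAmp hW h1
  have hL : MemLp (fun ξ => (wt ξ : ℂ) * waveAmp σbar W c₀ ξ) 2 volume := by
    refine ⟨((Complex.measurable_ofReal.comp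
      continuous_wt.measurable).mul hma).aestronglyMeasurable, ?_⟩
    rw [eLpNorm_lt_top_iff_lintegral_rpow_enorm_lt_top two_ne_zero ENNReal.ofNat_ne_top]
    have := hB c₀ 0 h1 h2
    simp only [zero_mul, Real.exp_zero, Complex.ofReal_one, one_mul] at this
    simpa using this.trans_lt ENNReal.ofReal_lt_top
  set E : ℝ → FreqSpace →L[ℂ] FreqSpace := fun t =>
    mulOp fun ξ => Real.exp (t * waveRate σbar lam c₀ ξ) with hE
  have hEd := hasDerivAt_mulOp_exp hr
  have hEc : Continuous E := continuous_iff_continuousAt.2 fun t => (hEd t).continuousAt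
  set a : ℝ → FreqSpace := fun t => E t hL.toLp with ha
  have hac : Continuous a := hEc.clm_apply continuous_const
  have hat : ∀ t, a t =ᵐ[volume] fun ξ =>
      (wt ξ : ℂ) * ((Real.exp (t * waveRate σbar lam c₀ ξ) : ℂ) * waveAmp σbar W c₀ ξ) :=
    fun t => by
      filter_upwards [coeFn_mulOp (hr.const_mul t).exp hL.toLp, hL.coeFn_toLp] with ξ h3 h4
      rw [ha, hE]
      simp only
      rw [h3, h4]
      ring
  have hhat : ∀ t, hatOp (a t) =ᵐ[volume] fun ξ =>
      (Real.exp (t * waveRate σbar lam c₀ ξ) : ℂ) * waveAmp σbar W c₀ ξ := fun t => by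
    filter_upwards [coeFn_hatOp (a t), hat t] with ξ h3 h4
    rw [h3, h4, ← mul_assoc, inv_mul_cancel₀ (wt_ne_zero ξ), one_mul]
  refine ⟨a, hac, fun p => recon_eq_modeData hW h1 h2 ?_ p, fun t => ?_, ?_⟩
  · simpa using hhat 0
  · have h3 := hB c₀ t h1 h2
    have h4 : (fun ξ => ‖a t ξ‖ₑ ^ 2) =ᵐ[volume] fun ξ => ‖(wt ξ : ℂ) *
        ((Real.exp (t * waveRate σbar lam c₀ ξ) : ℂ) * waveAmp σbar W c₀ ξ)‖ₑ ^ 2 := by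
      filter_upwards [hat t] with ξ h
      rw [h]
    rw [← lintegral_congr_ae h4, lintegral_enorm_sq,
      ← ENNReal.ofReal_pow (norm_nonneg _), ENNReal.ofReal_le_ofReal_iff (sq_nonneg _)] at h3
    exact (pow_le_pow_iff_left₀ (norm_nonneg _)
      (mul_nonneg hB0.le (growth_nonneg _ _ _ _)) two_ne_zero).1 h3
  -- Since `hatOp` is injective, the identity may be checked on Fourier transforms, where it is the
  -- eigenvalue equation on each fibre and 0 = 0 for Bloch vectors outside the square.
  · have hrate : ∀ n t, genOp ε ω n (a t) + cutOp n (multH2 c (a t)) =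
        cutOp n (mulOp (waveRate σbar lam c₀) (a t)) := fun n t => by
      refine hatOp_injective ?_
      have hcut := bddMeas_cut n
      have hw := bddMeas_wt_inv
      have k1 : hatOp (genOp ε ω n (a t)) = genOp ε ω n (hatOp (a t)) :=
        mulOp_comm hw (bddMeas_gen ε ω n) _
      have k2 : ∀ x, hatOp (cutOp n x) = cutOp n (hatOp x) := fun x => mulOp_comm hw hcut x
      have k3 : hatOp (mulOp (waveRate σbar lam c₀) (a t)) =
        mulOp (waveRate σbar lam c₀) (hatOp (a t)) := mulOp_comm hw hr _
      rw [map_add, k1, k2, k2, k3, hatOp_multH2 hc.summable_sq]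
      have hconv := coeFn_convHat hc.summable (hhat t)
        (G := fun ξ => ((waveRate σbar lam c₀ ξ + sym ε ω ξ : ℝ) : ℂ) *
          ((Real.exp (t * waveRate σbar lam c₀ ξ) : ℂ) * waveAmp σbar W c₀ ξ))
        (ae_of_all _ fun ξ => by
          simp only [waveRate, waveAmp, waveSigma_sub_shiftVec, waveIndex_sub_shiftVec]
          by_cases hs : waveSigma σbar ξ ∈ square σbar c₀
          · have h3 := (hW.hasSum_eigen hc (square_mono h1 hs) (waveIndex σbar ξ)).mul_left
              ((Real.exp (t * lam (waveSigma σbar ξ)) : ℂ) * ((2 * Real.pi) ^ 2 : ℝ))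
            simp only [waveCoeff, Set.indicator_of_mem hs]
            rw [sym_eq_blochSym ε ω σbar ξ]
            rw [show ∀ x y z w : ℂ, x * (y * (z * w)) = y * z * (x * w) from
              fun x y z w => by ring]
            exact h3.congr_fun fun k => by ring
          · simp only [waveCoeff, Set.indicator_of_notMem hs, mul_zero]
            exact hasSum_zero)
      refine Lp.ext ?_
      filter_upwards [hconv, hhat t, coeFn_mulOp (bddMeas_gen ε ω n) (hatOp (a t)),
        coeFn_mulOp hcut (convHat c (hatOp (a t))),
        coeFn_mulOp hcut (mulOp (waveRate σbar lam c₀) (hatOp (a t))),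
        coeFn_mulOp hr (hatOp (a t)),
        Lp.coeFn_add (genOp ε ω n (hatOp (a t))) (cutOp n (convHat c (hatOp (a t))))]
        with ξ i1 i2 i3 i4 i5 i6 i7
      rw [i7, Pi.add_apply, genOp, i3, cutOp, i4, i5, i6, i1, i2]
      push_cast
      ring
    intro t ht n
    have hda : ∀ x, HasDerivAt (fun x => cutOp n (a x))
        (genOp ε ω n (a x) + cutOp n (multH2 c (a x))) x := fun x => by
      have h3 := (ContinuousLinearMap.restrictScalarsL ℂ FreqSpace FreqSpace ℝ ℝ).hasFDerivAt.comp_hasDerivAt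
        x (hEd x)
      have h4 := h3.clm_apply (hasDerivAt_const x hL.toLp)
      rw [map_zero, add_zero] at h4
      rw [hrate]
      exact ((cutOp n).restrictScalars ℝ).hasFDerivAt.comp_hasDerivAt x h4
    rw [intervalIntegral.integral_eq_sub_of_hasDerivAt (fun x _ => hda x)
      (Continuous.intervalIntegrable (by fun_prop) _ _)]
    abel

end

noncomputable section

/-! ### Rolls are weak stationary solutions -/

theorem integrable_comp_mul_test {h : ℝ → ℝ} (hc : Continuous h) {ψ : Plane → ℝ} (hψ : IsTest ψ) :
    Integrable fun p : Plane => h (p 0) * ψ p :=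
  ((hc.comp (by fun_prop : Continuous fun p : Plane => p 0)).mul
    hψ.smooth.continuous).integrable_of_hasCompactSupport hψ.compact.mul_left

theorem integral_comp_mul_partialD {h h' : ℝ → ℝ} (hd : ∀ x, HasDerivAt h (h' x) x)
    (hc : Continuous h') {ψ : Plane → ℝ} (hψ : IsTest ψ) (i : Fin 2) :
    ∫ p : Plane, h (p 0) * partialD i ψ p = -∫ p : Plane, (if i = 0 then h' (p 0) else 0) * ψ p := by
  have hcont : Continuous h := continuous_iff_continuousAt.2 fun x => (hd x).continuousAt
  have hfd : ∀ p : Plane, HasFDerivAt (fun p : Plane => h (p 0))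
      (h' (p 0) • (EuclideanSpace.proj 0 : Plane →L[ℝ] ℝ)) p := fun p =>
    (hd (p 0)).comp_hasFDerivAt p (EuclideanSpace.proj 0 : Plane →L[ℝ] ℝ).hasFDerivAt
  have hfv : ∀ p : Plane, fderiv ℝ (fun p : Plane => h (p 0)) p (EuclideanSpace.single i 1) =
      if i = 0 then h' (p 0) else 0 := fun p => by
    rw [(hfd p).fderiv]
    fin_cases i <;> simp
  have hpd := hψ.partialD i
  rw [partialD_eq hψ.differentiable] at hpd ⊢
  have h1 := integral_mul_fderiv_eq_neg_fderiv_mul_of_integrable (μ := (volume : Measure Plane))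
    (f := fun p : Plane => h (p 0)) (g := ψ) (v := EuclideanSpace.single i 1) ?_
    (integrable_comp_mul_test hcont hpd) (integrable_comp_mul_test hcont hψ)
    (fun p _ => (hfd p).differentiableAt) fun p _ => hψ.differentiable p
  · simp only [hfv] at h1
    exact h1
  · simp only [hfv]
    by_cases hi : i = 0
    · simp only [hi, if_true]
      exact integrable_comp_mul_test hc hψ
    · simp only [hi, if_false, zero_mul]
      exact integrable_zero _ _ _

theorem integral_comp_mul_opA (ε ω : ℝ) {h : ℝ → ℝ} (hh : ContDiff ℝ 2 h) {ψ : Plane → ℝ}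
    (hψ : IsTest ψ) :
    ∫ p : Plane, h (p 0) * opA ε ω ψ p = ∫ p : Plane, rollOp ε ω h (p 0) * ψ p := by
  have hd0 : ∀ x, HasDerivAt h (deriv h x) x := fun x =>
    (hh.differentiable (by norm_num) x).hasDerivAt
  have hh1 : ContDiff ℝ 1 (deriv h) := ((contDiff_succ_iff_deriv (n := 1)).1 hh).2.2
  have hd1 : ∀ x, HasDerivAt (deriv h) (iteratedDeriv 2 h x) x := fun x => by
    rw [iteratedDeriv_succ, iteratedDeriv_one]
    exact (hh1.differentiable (by norm_num) x).hasDerivAt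
  have hc2 : Continuous (iteratedDeriv 2 h) := hh.continuous_iteratedDeriv 2 le_rfl
  have e0 : ∫ p : Plane, h (p 0) * partialD 0 (partialD 0 ψ) p =
      ∫ p : Plane, iteratedDeriv 2 h (p 0) * ψ p := by
    rw [integral_comp_mul_partialD hd0 hh1.continuous (hψ.partialD 0)]
    simp only [if_true]
    rw [integral_comp_mul_partialD hd1 hc2 hψ]
    simp
  have e1 : ∫ p : Plane, h (p 0) * partialD 1 (partialD 1 ψ) p = 0 := by
    rw [integral_comp_mul_partialD hd0 hh1.continuous (hψ.partialD 1)]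
    simp
  have i1 := integrable_comp_mul_test hh.continuous hψ
  have i2 := (integrable_comp_mul_test hh.continuous ((hψ.partialD 0).partialD 0)).const_mul
    (1 + 2 * ε * ω)
  have i3 := integrable_comp_mul_test hh.continuous ((hψ.partialD 1).partialD 1)
  have e2 : ∀ p : Plane, h (p 0) * opA ε ω ψ p = h (p 0) * ψ p +
      (1 + 2 * ε * ω) * (h (p 0) * partialD 0 (partialD 0 ψ) p) +
      h (p 0) * partialD 1 (partialD 1 ψ) p := fun p => by rw [opA]; ring
  have e3 : ∀ p : Plane, rollOp ε ω h (p 0) * ψ p = h (p 0) * ψ p +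
      (1 + 2 * ε * ω) * (iteratedDeriv 2 h (p 0) * ψ p) := fun p => by rw [rollOp]; ring
  have i12 : Integrable fun p : Plane => h (p 0) * ψ p +
      (1 + 2 * ε * ω) * (h (p 0) * partialD 0 (partialD 0 ψ) p) := i1.add i2
  simp only [e2, e3]
  rw [integral_add i12 i3, integral_add i1 i2, e1, add_zero, integral_const_mul, e0,
    integral_add i1 ((integrable_comp_mul_test hc2 hψ).const_mul _), integral_const_mul]

theorem contDiff_rollOp (ε ω : ℝ) {h : ℝ → ℝ} (hh : ContDiff ℝ 4 h) : ContDiff ℝ 2 (rollOp ε ω h) :=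
  (hh.of_le (by norm_num)).add (contDiff_const.mul (by
    rw [iteratedDeriv_eq_iterate]
    exact hh.iterate_deriv' 2 2))

/-- The test function has compact support, so both factors 𝒜 can be moved onto the roll; the
y-derivatives drop out because the roll depends on x alone. -/
theorem IsRoll.integral_weak {ε ω b s : ℝ} {ut : ℝ → ℝ} (hut : IsRoll ε ω b s ut) {φ : Plane → ℝ}
    (hφ : IsTest φ) : ∫ p : Plane, (ut (p 0) * opL ε ω φ p +
      (ε ^ 2 * ut (p 0) + b * ut (p 0) ^ 2 - s * ut (p 0) ^ 3) * φ p) = 0 := by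
  have h1 := integral_comp_mul_opA ε ω (hut.contDiff.of_le (by norm_num)) (hφ.opA ε ω)
  have h2 := integral_comp_mul_opA ε ω (contDiff_rollOp ε ω hut.contDiff) hφ
  have hcu := hut.contDiff.continuous
  have i1 := integrable_comp_mul_test hcu (hφ.opL ε ω)
  have i2 := integrable_comp_mul_test (h := fun x => ε ^ 2 * ut x + b * ut x ^ 2 - s * ut x ^ 3)
    (by fun_prop) hφ
  rw [integral_add i1 i2]
  have e1 : ∀ p : Plane, ut (p 0) * opL ε ω φ p = -(ut (p 0) * opA ε ω (opA ε ω φ) p) := fun p => by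
    rw [opL]; ring
  simp only [e1]
  rw [integral_neg, h1, h2, neg_add_eq_zero]
  refine integral_congr_ae (ae_of_all _ fun p => ?_)
  have := hut.stationary (p 0)
  simp only
  rw [show rollOp ε ω (rollOp ε ω ut) (p 0) =
    ε ^ 2 * ut (p 0) + b * ut (p 0) ^ 2 - s * ut (p 0) ^ 3 by linarith]

/-- A periodic roll is in general not in H²(ℝ²), so it has to be removed before passing to
coordinates. Its own contribution to the weak equation integrates to zero at each time. -/
theorem IsRoll.isWeakSolution_add_iff {ε ω b s : ℝ} {ut : ℝ → ℝ} (hut : IsRoll ε ω b s ut)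
    {S : Set ℝ} (hS : ∀ t ∈ S, 0 ≤ t ∧ Set.Icc 0 t ⊆ S) {w : ℝ → Plane → ℂ} {a : ℝ → FreqSpace}
    (hw : ∀ t ∈ S, w t =ᵐ[volume] recon (a t)) :
    IsWeakSolution ε ω S (fun t p => ut (p 0) + w t p) (fun t p => nonlin ε b s (ut (p 0) + w t p)) ↔
      IsWeakSolution ε ω S w fun t p => nonlin ε b s (ut (p 0) + w t p) - nonlin ε b s (ut (p 0)) := by
  have hcu : Continuous fun p : Plane => (ut (p 0) : ℂ) :=
    Complex.continuous_ofReal.comp (hut.contDiff.continuous.comp (by fun_prop))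
  have hI : ∀ t ∈ S, ∀ φ, IsTest φ → Integrable fun p => w t p * (φ p : ℂ) := fun t ht φ hφ =>
    (continuous_test_integrable hφ (continuous_recon (a t))).congr (by
      filter_upwards [hw t ht] with p hp; rw [hp])
  have hA : ∀ t ∈ S, ∀ φ, IsTest φ → ∫ p, (ut (p 0) + w t p) * (φ p : ℂ) =
      (∫ p : Plane, (ut (p 0) : ℂ) * (φ p : ℂ)) + ∫ p, w t p * (φ p : ℂ) := fun t ht φ hφ => by
    rw [← integral_add (continuous_test_integrable hφ hcu) (hI t ht φ hφ)]
    simp only [add_mul]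
  have hB : ∀ t ∈ S, ∀ φ, IsTest φ → ∫ p, ((ut (p 0) + w t p) * (opL ε ω φ p : ℂ) +
      nonlin ε b s (ut (p 0) + w t p) * (φ p : ℂ)) = ∫ p, (w t p * (opL ε ω φ p : ℂ) +
      (nonlin ε b s (ut (p 0) + w t p) - nonlin ε b s (ut (p 0))) * (φ p : ℂ)) :=
    fun t ht φ hφ => by
      have j1 : Integrable fun p : Plane => (ut (p 0) : ℂ) * (opL ε ω φ p : ℂ) +
          nonlin ε b s (ut (p 0)) * (φ p : ℂ) :=
        (continuous_test_integrable (hφ.opL ε ω) hcu).add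
          (continuous_test_integrable (u := fun p : Plane => nonlin ε b s (ut (p 0))) hφ
            (by unfold nonlin; fun_prop))
      have j2 : Integrable fun p : Plane => w t p * (opL ε ω φ p : ℂ) +
          (nonlin ε b s (ut (p 0) + w t p) - nonlin ε b s (ut (p 0))) * (φ p : ℂ) := by
        have hcr := continuous_recon (a t)
        refine ((continuous_test_integrable (hφ.opL ε ω) hcr).add
          (continuous_test_integrable (u := fun p : Plane => nonlin ε b s (ut (p 0) + recon (a t) p) -
            nonlin ε b s (ut (p 0))) hφ (by unfold nonlin; fun_prop))).congr ?_
        filter_upwards [hw t ht] with p hp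
        simp only [Pi.add_apply, hp]
      have j3 : ∫ p : Plane, ((ut (p 0) : ℂ) * (opL ε ω φ p : ℂ) +
          nonlin ε b s (ut (p 0)) * (φ p : ℂ)) = 0 := by
        have := congrArg (fun x : ℝ => (x : ℂ)) (hut.integral_weak hφ)
        simp only [Complex.ofReal_zero] at this
        rw [← this, ← integral_complex_ofReal]
        refine integral_congr_ae (ae_of_all _ fun p => ?_)
        simp only [nonlin]
        push_cast
        ring
      rw [← zero_add (∫ p, (w t p * (opL ε ω φ p : ℂ) + _)), ← j3, ← integral_add j1 j2]
      refine integral_congr_ae (ae_of_all _ fun p => ?_)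
      simp only
      ring
  refine forall_congr' fun φ => forall_congr' fun h1 => forall_congr' fun h2 =>
    forall_congr' fun t => forall_congr' fun ht => ?_
  have hφ : IsTest φ := ⟨h1, h2⟩
  obtain ⟨ht0, hsub⟩ := hS t ht
  have hC : ∫ τ in (0 : ℝ)..t, ∫ p, ((ut (p 0) + w τ p) * (opL ε ω φ p : ℂ) +
      nonlin ε b s (ut (p 0) + w τ p) * (φ p : ℂ)) =
      ∫ τ in (0 : ℝ)..t, ∫ p, (w τ p * (opL ε ω φ p : ℂ) +
        (nonlin ε b s (ut (p 0) + w τ p) - nonlin ε b s (ut (p 0))) * (φ p : ℂ)) :=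
    intervalIntegral.integral_congr fun τ hτ => by
      rw [Set.uIcc_of_le ht0] at hτ
      exact hB τ (hsub hτ) φ hφ
  rw [hA t ht φ hφ, hA 0 (hsub (Set.left_mem_Icc.2 ht0)) φ hφ, hC, add_assoc, add_right_inj]

/-! ### Coordinates of functions with values in `H²` -/

theorem h2Norm_sub_eq {u v : Plane → ℂ} {a c : FreqSpace} (hu : u =ᵐ[volume] recon a)
    (hv : v =ᵐ[volume] recon c) : h2Norm (u - v) = ENNReal.ofReal ‖a - c‖ := by
  rw [← h2Norm_recon]
  refine h2Norm_congr ?_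
  filter_upwards [hu, hv] with p h1 h2
  rw [Pi.sub_apply, h1, h2, recon_sub]

theorem ContinuousInH2.exists_coord {S : Set ℝ} {u : ℝ → Plane → ℂ} (hu : ContinuousInH2 S u) :
    ∃ a : ℝ → FreqSpace, ContinuousOn a S ∧ ∀ t ∈ S, u t =ᵐ[volume] recon (a t) := by
  have h1 : ∀ t, ∃ a : FreqSpace, t ∈ S → u t =ᵐ[volume] recon a := fun t => by
    by_cases ht : t ∈ S
    · obtain ⟨a, ha⟩ := exists_recon_of_h2Norm_lt_top (hu.1 t ht)
      exact ⟨a, fun _ => ha⟩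
    · exact ⟨0, fun h => absurd h ht⟩
  choose a ha using h1
  refine ⟨a, fun t₀ h₀ => ?_, ha⟩
  rw [ContinuousWithinAt, tendsto_iff_norm_sub_tendsto_zero]
  have h2 := (ENNReal.tendsto_toReal ENNReal.zero_ne_top).comp (hu.2 t₀ h₀)
  refine h2.congr' ?_
  filter_upwards [self_mem_nhdsWithin] with t ht
  rw [Function.comp_apply, h2Norm_sub_eq (ha t ht) (ha t₀ h₀), ENNReal.toReal_ofReal (norm_nonneg _)]

theorem continuousInH2_of_coord {S : Set ℝ} {u : ℝ → Plane → ℂ} {a : ℝ → FreqSpace}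
    (ha : ContinuousOn a S) (hu : ∀ t ∈ S, u t =ᵐ[volume] recon (a t)) : ContinuousInH2 S u := by
  refine ⟨fun t ht => ?_, fun t₀ h₀ => ?_⟩
  · rw [h2Norm_congr (hu t ht), h2Norm_recon]
    exact ENNReal.ofReal_lt_top
  · have h1 := tendsto_iff_norm_sub_tendsto_zero.1 (ha t₀ h₀)
    have h2 := ENNReal.tendsto_ofReal h1
    rw [ENNReal.ofReal_zero] at h2
    refine h2.congr' ?_
    filter_upwards [self_mem_nhdsWithin] with t ht
    rw [h2Norm_sub_eq (hu t ht) (hu t₀ h₀)]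

end

noncomputable section

/-! ### Profiles and remainder in coordinates -/

theorem recon_zero (x : Plane) : recon 0 x = 0 := (evalAt x).map_zero

theorem recon_neg (a : FreqSpace) (x : Plane) : recon (-a) x = -recon a x := (evalAt x).map_neg a

theorem recon_sum {ι : Type*} (S : Finset ι) (a : ι → FreqSpace) (x : Plane) :
    recon (∑ i ∈ S, a i) x = ∑ i ∈ S, recon (a i) x := map_sum (evalAt x) a S

theorem IsFreqSol.add {ε ω : ℝ} {S : Set ℝ} (hS : ∀ t ∈ S, 0 ≤ t ∧ Set.Icc 0 t ⊆ S)
    {a a' g g' : ℝ → FreqSpace} (ha : ContinuousOn a S) (ha' : ContinuousOn a' S)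
    (hg : ContinuousOn g S) (hg' : ContinuousOn g' S) (h : IsFreqSol ε ω S a g)
    (h' : IsFreqSol ε ω S a' g') :
    IsFreqSol ε ω S (fun t => a t + a' t) fun t => g t + g' t := by
  intro t ht n
  have hsub : Set.uIcc 0 t ⊆ S := by rw [Set.uIcc_of_le (hS t ht).1]; exact (hS t ht).2
  have i1 : IntervalIntegrable (fun τ => genOp ε ω n (a τ) + cutOp n (g τ)) volume 0 t :=
    intervalIntegrable_clm_add _ _ (ha.mono hsub) (hg.mono hsub)
  have i2 : IntervalIntegrable (fun τ => genOp ε ω n (a' τ) + cutOp n (g' τ)) volume 0 t :=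
    intervalIntegrable_clm_add _ _ (ha'.mono hsub) (hg'.mono hsub)
  rw [map_add, h t ht n, h' t ht n, map_add, add_add_add_comm,
    ← intervalIntegral.integral_add i1 i2]
  congr 2
  funext τ
  rw [map_add, map_add]
  abel

theorem IsFreqSol.smul {ε ω : ℝ} {S : Set ℝ} {a g : ℝ → FreqSpace} (h : IsFreqSol ε ω S a g)
    (r : ℂ) : IsFreqSol ε ω S (fun t => r • a t) fun t => r • g t := by
  intro t ht n
  rw [map_smul, h t ht n, map_smul, smul_add, ← intervalIntegral.integral_smul]
  congr 2
  funext τ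
  rw [map_smul, map_smul, smul_add]

theorem IsFreqSol.sum {ε ω : ℝ} {S : Set ℝ} (hS : ∀ t ∈ S, 0 ≤ t ∧ Set.Icc 0 t ⊆ S)
    {ι : Type*} (I : Finset ι) {a g : ι → ℝ → FreqSpace} (ha : ∀ i ∈ I, ContinuousOn (a i) S)
    (hg : ∀ i ∈ I, ContinuousOn (g i) S) (h : ∀ i ∈ I, IsFreqSol ε ω S (a i) (g i)) :
    IsFreqSol ε ω S (fun t => ∑ i ∈ I, a i t) fun t => ∑ i ∈ I, g i t := by
  induction I using Finset.cons_induction with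
  | empty => intro t _ n; simp
  | cons i I hi ih =>
    simp only [Finset.sum_cons]
    have hm : ∀ k ∈ I, k ∈ Finset.cons i I hi := fun k hk => Finset.mem_cons_of_mem hk
    have h0 : i ∈ Finset.cons i I hi := Finset.mem_cons_self i I
    exact IsFreqSol.add hS (ha i h0) (continuousOn_finsetSum _ fun k hk => ha k (hm k hk)) (hg i h0)
      (continuousOn_finsetSum _ fun k hk => hg k (hm k hk)) (h i h0)
      (ih (fun k hk => ha k (hm k hk)) (fun k hk => hg k (hm k hk)) fun k hk => h k (hm k hk))

/-- The sum of the products `a k * a l`, `k + l = j`. -/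
def quadSum (a : ℕ → FreqSpace) (j : ℕ) : FreqSpace :=
  ∑ k ∈ Finset.Icc 1 j, ∑ l ∈ Finset.Icc 1 j, if k + l = j then prodH2 (a k) (a l) else 0

/-- The sum of the products `a k * a l * a q`, `k + l + q = j`. -/
def cubeSum (a : ℕ → FreqSpace) (j : ℕ) : FreqSpace :=
  ∑ k ∈ Finset.Icc 1 j, ∑ l ∈ Finset.Icc 1 j, ∑ q ∈ Finset.Icc 1 j,
    if k + l + q = j then prodH2 (prodH2 (a k) (a l)) (a q) else 0

/-- The forcing of the profiles in coordinates. -/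
def forcing (d : ℤ → ℂ) (s : ℝ) (a : ℕ → FreqSpace) (j : ℕ) : FreqSpace :=
  -multH2 d (quadSum a j) - (s : ℂ) • cubeSum a j

/-- The terms of second and third order of the nonlinearity in coordinates. -/
def nonlinH2 (d : ℤ → ℂ) (s : ℝ) (w : FreqSpace) : FreqSpace :=
  -multH2 d (prodH2 w w) - (s : ℂ) • prodH2 (prodH2 w w) w

theorem continuous_nonlinH2 (d : ℤ → ℂ) (s : ℝ) : Continuous (nonlinH2 d s) := by
  unfold nonlinH2
  fun_prop

theorem continuousOn_smul_fun {f : ℝ → FreqSpace} {S : Set ℝ} (r : ℂ) (hf : ContinuousOn f S) :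
    ContinuousOn (fun t => r • f t) S := hf.const_smul r

theorem continuousOn_forcing {d : ℤ → ℂ} {s : ℝ} {S : Set ℝ} {a : ℕ → ℝ → FreqSpace} {j : ℕ}
    (ha : ∀ k ∈ Finset.Icc 1 j, ContinuousOn (a k) S) :
    ContinuousOn (fun t => forcing d s (fun k => a k t) j) S := by
  have hp : ∀ {f g : ℝ → FreqSpace}, ContinuousOn f S → ContinuousOn g S →
      ContinuousOn (fun t => prodH2 (f t) (g t)) S := fun hf hg =>
    (prodH2.continuous.comp_continuousOn hf).clm_apply hg
  unfold forcing quadSum cubeSum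
  refine ContinuousOn.sub (ContinuousOn.neg ((multH2 d).continuous.comp_continuousOn ?_))
    (continuousOn_smul_fun _ ?_)
  · refine continuousOn_finsetSum _ fun k hk => continuousOn_finsetSum _ fun l hl => ?_
    split_ifs
    · exact hp (ha k hk) (ha l hl)
    · exact continuousOn_const
  · refine continuousOn_finsetSum _ fun k hk => continuousOn_finsetSum _ fun l hl =>
      continuousOn_finsetSum _ fun q hq => ?_
    split_ifs
    · exact hp (hp (ha k hk) (ha l hl)) (ha q hq)
    · exact continuousOn_const

section

variable {ε ω b s : ℝ} {ut : ℝ → ℝ} {c d : ℤ → ℂ}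

theorem recon_forcing (hd : IsCoeff d fun x => (3 * s * ut x - b : ℂ)) {V : ℕ → ℝ → Plane → ℂ}
    {a : ℕ → ℝ → FreqSpace} {j : ℕ} {t : ℝ} {p : Plane}
    (hV : ∀ k ∈ Finset.Icc 1 j, V k t p = recon (a k t) p) :
    profileForcing b s ut V j t p = recon (forcing d s (fun k => a k t) j) p := by
  rw [forcing, recon_sub, recon_neg, recon_multH2 hd.summable_sq hd.hasSum, recon_smul, quadSum,
    cubeSum, profileForcing]
  simp only [recon_sum]
  rw [neg_mul]
  refine congrArg₂ _ (congrArg _ (congrArg _ ?_)) (congrArg _ ?_)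
  · refine Finset.sum_congr rfl fun k hk => Finset.sum_congr rfl fun l hl => ?_
    split_ifs
    · rw [recon_prodH2, hV k hk, hV l hl]
    · rw [recon_zero]
  · refine Finset.sum_congr rfl fun k hk => Finset.sum_congr rfl fun l hl =>
      Finset.sum_congr rfl fun q hq => ?_
    split_ifs
    · rw [recon_prodH2, recon_prodH2, hV k hk, hV l hl, hV q hq]
    · rw [recon_zero]

/-- The Taylor expansion of the cubic f at the roll is exact: f'(ũ)w - (3sũ - b)w² - s w³. -/
theorem recon_nonlinH2 (hc : IsCoeff c fun x => (potential ε b s ut x : ℂ))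
    (hd : IsCoeff d fun x => (3 * s * ut x - b : ℂ)) (w : FreqSpace) (p : Plane) :
    recon (multH2 c w + nonlinH2 d s w) p =
      nonlin ε b s (ut (p 0) + recon w p) - nonlin ε b s (ut (p 0)) := by
  rw [recon_add, nonlinH2, recon_sub, recon_neg, recon_multH2 hd.summable_sq hd.hasSum, recon_smul,
    recon_multH2 hc.summable_sq hc.hasSum, recon_prodH2, recon_prodH2, recon_prodH2, nonlin, nonlin,
    potential]
  push_cast
  ring

/-- The profiles in coordinates. -/
structure IsCoordProfiles (ε ω s : ℝ) (c d : ℤ → ℂ) (a₀ : FreqSpace) (N : ℕ)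
    (a : ℕ → ℝ → FreqSpace) : Prop where
  cont : ∀ j ∈ Finset.Icc 1 N, ContinuousOn (a j) (Set.Ici 0)
  init : ∀ j ∈ Finset.Icc 1 N, a j 0 = if j = 1 then a₀ else 0
  sol : ∀ j ∈ Finset.Icc 1 N, IsFreqSol ε ω (Set.Ici 0) (a j)
    fun t => multH2 c (a j t) + forcing d s (fun k => a k t) j

theorem Icc_subset_Ici_zero : ∀ t ∈ Set.Ici (0 : ℝ), 0 ≤ t ∧ Set.Icc 0 t ⊆ Set.Ici 0 := fun _ ht =>
  ⟨ht, fun _ h => h.1⟩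

theorem Icc_subset_Icc_zero (T : ℝ) : ∀ t ∈ Set.Icc (0 : ℝ) T, 0 ≤ t ∧ Set.Icc 0 t ⊆ Set.Icc 0 T :=
  fun _ ht => ⟨ht.1, Set.Icc_subset_Icc_right ht.2⟩

theorem IsCoordProfiles.cont_of_mem {a₀ : FreqSpace} {N : ℕ} {a : ℕ → ℝ → FreqSpace}
    (h : IsCoordProfiles ε ω s c d a₀ N a) {j : ℕ} (hj : j ∈ Finset.Icc 1 N) :
    ∀ k ∈ Finset.Icc 1 j, ContinuousOn (a k) (Set.Ici 0) := fun k hk => by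
  rw [Finset.mem_Icc] at hj hk
  exact h.cont k (Finset.mem_Icc.2 ⟨hk.1, hk.2.trans hj.2⟩)

theorem isProfiles_solution_iff (hc : IsCoeff c fun x => (potential ε b s ut x : ℂ))
    (hd : IsCoeff d fun x => (3 * s * ut x - b : ℂ)) {V : ℕ → ℝ → Plane → ℂ}
    {a : ℕ → ℝ → FreqSpace} {j : ℕ} (hj : 1 ≤ j)
    (ha : ∀ k ∈ Finset.Icc 1 j, ContinuousOn (a k) (Set.Ici 0))
    (hV : ∀ k ∈ Finset.Icc 1 j, ∀ t, 0 ≤ t → V k t =ᵐ[volume] recon (a k t)) :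
    IsWeakSolution ε ω (Set.Ici 0) (V j)
      (fun t p => (potential ε b s ut (p 0) : ℂ) * V j t p + profileForcing b s ut V j t p) ↔
    IsFreqSol ε ω (Set.Ici 0) (a j) fun t => multH2 c (a j t) + forcing d s (fun k => a k t) j := by
  have hjj : j ∈ Finset.Icc 1 j := Finset.mem_Icc.2 ⟨hj, le_rfl⟩
  refine isWeakSolution_iff Icc_subset_Ici_zero (ha j hjj)
    (((multH2 c).continuous.comp_continuousOn (ha j hjj)).add (continuousOn_forcing ha))
    (fun t ht => hV j hjj t ht) fun t ht => ?_
  have h1 : ∀ᵐ p, ∀ k ∈ Finset.Icc 1 j, V k t p = recon (a k t) p :=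
    (Finset.eventually_all _).2 fun k hk => hV k hk t ht
  filter_upwards [h1] with p hp
  rw [recon_add, recon_multH2 hc.summable_sq hc.hasSum, recon_forcing hd hp, hp j hjj]

theorem IsProfiles.exists_coord (hc : IsCoeff c fun x => (potential ε b s ut x : ℂ))
    (hd : IsCoeff d fun x => (3 * s * ut x - b : ℂ)) {U : Plane → ℂ} {a₀ : FreqSpace}
    (hU : U =ᵐ[volume] recon a₀) {N : ℕ} {V : ℕ → ℝ → Plane → ℂ}
    (hV : IsProfiles ε ω b s ut U N V) :
    ∃ a, IsCoordProfiles ε ω s c d a₀ N a ∧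
      ∀ j ∈ Finset.Icc 1 N, ∀ t, 0 ≤ t → V j t =ᵐ[volume] recon (a j t) := by
  have h1 : ∀ j, ∃ a : ℝ → FreqSpace, j ∈ Finset.Icc 1 N → ContinuousOn a (Set.Ici 0) ∧
      ∀ t ∈ Set.Ici (0 : ℝ), V j t =ᵐ[volume] recon (a t) := fun j => by
    by_cases hj : j ∈ Finset.Icc 1 N
    · obtain ⟨a, ha⟩ := (hV.continuousInH2 j hj).exists_coord
      exact ⟨a, fun _ => ha⟩
    · exact ⟨0, fun h => absurd h hj⟩
  choose a ha using h1
  have hsub : ∀ j ∈ Finset.Icc 1 N, ∀ k ∈ Finset.Icc 1 j, k ∈ Finset.Icc 1 N := fun j hj k hk => by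
    rw [Finset.mem_Icc] at *
    exact ⟨hk.1, hk.2.trans hj.2⟩
  refine ⟨a, ⟨fun j hj => (ha j hj).1, fun j hj => recon_injective ?_, fun j hj => ?_⟩,
    fun j hj => (ha j hj).2⟩
  · filter_upwards [(ha j hj).2 0 Set.self_mem_Ici, hV.initial j hj, hU] with p h1 h2 h3
    rw [← h1, h2]
    split_ifs
    · exact h3
    · rw [recon_zero]; rfl
  · exact (isProfiles_solution_iff hc hd (Finset.mem_Icc.1 hj).1
      (fun k hk => (ha k (hsub j hj k hk)).1) fun k hk => (ha k (hsub j hj k hk)).2).1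
      (hV.solution j hj)

theorem IsCoordProfiles.isProfiles (hc : IsCoeff c fun x => (potential ε b s ut x : ℂ))
    (hd : IsCoeff d fun x => (3 * s * ut x - b : ℂ)) {U : Plane → ℂ} {a₀ : FreqSpace}
    (hU : U =ᵐ[volume] recon a₀) {N : ℕ} {a : ℕ → ℝ → FreqSpace}
    (h : IsCoordProfiles ε ω s c d a₀ N a) :
    IsProfiles ε ω b s ut U N fun j t => recon (a j t) where
  continuousInH2 j hj := continuousInH2_of_coord (h.cont j hj) fun _ _ => EventuallyEq.rfl
  initial j hj := by
    rw [h.init j hj]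
    split_ifs
    · exact hU.symm
    · exact ae_of_all _ fun p => recon_zero p
  solution j hj := (isProfiles_solution_iff hc hd (Finset.mem_Icc.1 hj).1 (h.cont_of_mem hj)
    fun _ _ _ _ => EventuallyEq.rfl).2 (h.sol j hj)

/-- The approximate solution, without the roll, in coordinates. -/
def approxH2 (a : ℕ → ℝ → FreqSpace) (N : ℕ) (δ t : ℝ) : FreqSpace :=
  ∑ j ∈ Finset.Icc 1 N, (δ : ℂ) ^ j • a j t

/-- The forcing of the approximate solution in coordinates. -/
def approxForcing (d : ℤ → ℂ) (s : ℝ) (a : ℕ → ℝ → FreqSpace) (N : ℕ) (δ t : ℝ) : FreqSpace :=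
  ∑ j ∈ Finset.Icc 1 N, (δ : ℂ) ^ j • forcing d s (fun k => a k t) j

theorem IsCoordProfiles.continuousOn_approxH2 {a₀ : FreqSpace} {N : ℕ} {a : ℕ → ℝ → FreqSpace}
    (h : IsCoordProfiles ε ω s c d a₀ N a) (δ : ℝ) :
    ContinuousOn (approxH2 a N δ) (Set.Ici 0) :=
  continuousOn_finsetSum _ fun j hj => continuousOn_smul_fun _ (h.cont j hj)

theorem IsCoordProfiles.continuousOn_approxForcing {a₀ : FreqSpace} {N : ℕ}
    {a : ℕ → ℝ → FreqSpace} (h : IsCoordProfiles ε ω s c d a₀ N a) (δ : ℝ) :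
    ContinuousOn (approxForcing d s a N δ) (Set.Ici 0) :=
  continuousOn_finsetSum _ fun _ hj =>
    continuousOn_smul_fun _ (continuousOn_forcing (h.cont_of_mem hj))

theorem IsCoordProfiles.sol_approxH2 {a₀ : FreqSpace} {N : ℕ} {a : ℕ → ℝ → FreqSpace}
    (h : IsCoordProfiles ε ω s c d a₀ N a) (δ : ℝ) :
    IsFreqSol ε ω (Set.Ici 0) (approxH2 a N δ)
      fun t => multH2 c (approxH2 a N δ t) + approxForcing d s a N δ t := by
  have h1 := IsFreqSol.sum (ε := ε) (ω := ω) Icc_subset_Ici_zero (Finset.Icc 1 N)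
    (a := fun j t => (δ : ℂ) ^ j • a j t)
    (g := fun j t => (δ : ℂ) ^ j • (multH2 c (a j t) + forcing d s (fun k => a k t) j))
    (fun j hj => continuousOn_smul_fun _ (h.cont j hj))
    (fun j hj => continuousOn_smul_fun _ (((multH2 c).continuous.comp_continuousOn
      (h.cont j hj)).add (continuousOn_forcing (h.cont_of_mem hj))))
    (fun j hj => (h.sol j hj).smul _)
  refine h1.congr Icc_subset_Ici_zero (fun t _ => rfl) fun t _ => ?_
  rw [approxH2, approxForcing, map_sum, ← Finset.sum_add_distrib]
  simp only [map_smul, smul_add]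

theorem IsFreqSol.mono {S S' : Set ℝ} {a g : ℝ → FreqSpace} (h : IsFreqSol ε ω S a g)
    (hS : S' ⊆ S) : IsFreqSol ε ω S' a g := fun t ht n => h t (hS ht) n

/-- The perturbation A + r and the approximation A solve equations with the same linear operator and
known forcings. Subtracting or adding the equation of A passes between the two sides, in both
directions. -/
theorem remainder_solution_iff (hut : IsRoll ε ω b s ut)
    (hc : IsCoeff c fun x => (potential ε b s ut x : ℂ))
    (hd : IsCoeff d fun x => (3 * s * ut x - b : ℂ)) {a₀ : FreqSpace} {N : ℕ}
    {a : ℕ → ℝ → FreqSpace} (h : IsCoordProfiles ε ω s c d a₀ N a) {V : ℕ → ℝ → Plane → ℂ}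
    (hV : ∀ j ∈ Finset.Icc 1 N, ∀ t, 0 ≤ t → V j t =ᵐ[volume] recon (a j t)) {δ T : ℝ}
    {v : ℝ → Plane → ℂ} {r : ℝ → FreqSpace} (hr : ContinuousOn r (Set.Icc 0 T))
    (hv : ∀ t ∈ Set.Icc 0 T, v t =ᵐ[volume] recon (r t)) :
    IsWeakSolution ε ω (Set.Icc 0 T) (fun t p => approx ut N V δ t p + v t p)
      (fun t p => nonlin ε b s (approx ut N V δ t p + v t p)) ↔
    IsFreqSol ε ω (Set.Icc 0 T) r fun t => multH2 c (r t) +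
      (nonlinH2 d s (approxH2 a N δ t + r t) - approxForcing d s a N δ t) := by
  have hS := Icc_subset_Icc_zero T
  have hsub : Set.Icc 0 T ⊆ Set.Ici (0 : ℝ) := fun _ ht => ht.1
  set A := approxH2 a N δ with hA
  set F := approxForcing d s a N δ with hF
  have hAc : ContinuousOn A (Set.Icc 0 T) := (h.continuousOn_approxH2 δ).mono hsub
  have hFc : ContinuousOn F (Set.Icc 0 T) := (h.continuousOn_approxForcing δ).mono hsub
  have hAs : IsFreqSol ε ω (Set.Icc 0 T) A fun t => multH2 c (A t) + F t :=
    (h.sol_approxH2 δ).mono hsub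
  set w : ℝ → Plane → ℂ := fun t p => (∑ j ∈ Finset.Icc 1 N, (δ : ℂ) ^ j * V j t p) + v t p with hw
  have hwr : ∀ t ∈ Set.Icc 0 T, w t =ᵐ[volume] recon (A t + r t) := fun t ht => by
    have h1 : ∀ᵐ p, ∀ j ∈ Finset.Icc 1 N, V j t p = recon (a j t) p :=
      (Finset.eventually_all _).2 fun j hj => hV j hj t ht.1
    filter_upwards [h1, hv t ht] with p h2 h3
    rw [recon_add, hA, approxH2, recon_sum, hw]
    simp only [recon_smul]
    rw [h3]
    congr 1
    exact Finset.sum_congr rfl fun j hj => by rw [h2 j hj]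
  have e1 : (fun t p => approx ut N V δ t p + v t p) = fun t p => (ut (p 0) : ℂ) + w t p := by
    funext t p
    rw [approx, hw]
    ring
  have e2 : (fun t p => nonlin ε b s (approx ut N V δ t p + v t p)) =
      fun t p => nonlin ε b s ((ut (p 0) : ℂ) + w t p) := by
    funext t p
    rw [approx, hw]
    congr 1
    ring
  have hArc : ContinuousOn (fun t => A t + r t) (Set.Icc 0 T) := hAc.add hr
  have hNc : ContinuousOn (fun t => nonlinH2 d s (A t + r t)) (Set.Icc 0 T) :=
    (continuous_nonlinH2 d s).comp_continuousOn hArc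
  have hKc : ∀ {f : ℝ → FreqSpace}, ContinuousOn f (Set.Icc 0 T) →
      ContinuousOn (fun t => multH2 c (f t)) (Set.Icc 0 T) := fun hf =>
    (multH2 c).continuous.comp_continuousOn hf
  rw [e1, e2, hut.isWeakSolution_add_iff hS hwr, isWeakSolution_iff hS hArc
    (g := fun t => multH2 c (A t + r t) + nonlinH2 d s (A t + r t)) ((hKc hArc).add hNc) hwr
    fun t ht => by
      filter_upwards [hwr t ht] with p hp
      rw [recon_nonlinH2 hc hd, hp]]
  constructor
  · intro h1
    have h2 := IsFreqSol.add hS hArc (continuousOn_smul_fun (-1 : ℂ) hAc)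
      (g := fun t => multH2 c (A t + r t) + nonlinH2 d s (A t + r t)) ((hKc hArc).add hNc)
      (g' := fun t => (-1 : ℂ) • (multH2 c (A t) + F t))
      (continuousOn_smul_fun (-1 : ℂ) ((hKc hAc).add hFc)) h1 (hAs.smul (-1))
    refine h2.congr hS (fun t _ => ?_) fun t _ => ?_
    · rw [neg_one_smul]; abel
    · rw [neg_one_smul, map_add]; abel
  · intro h1
    have h2 := IsFreqSol.add hS hAc hr (g := fun t => multH2 c (A t) + F t)
      ((hKc hAc).add hFc) (g' := fun t => multH2 c (r t) + (nonlinH2 d s (A t + r t) - F t))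
      ((hKc hr).add (hNc.sub hFc)) hAs h1
    refine h2.congr hS (fun t _ => rfl) fun t _ => ?_
    rw [map_add]; abel

end

end

noncomputable section

/-! ### Convolution estimates -/

/-- The weight `k⁻²`. -/
def invSq (k : ℕ) : ℝ := ((k : ℝ) ^ 2)⁻¹

theorem invSq_nonneg (k : ℕ) : 0 ≤ invSq k := by unfold invSq; positivity

theorem sum_invSq_le (n : ℕ) : ∑ k ∈ Finset.Icc 1 n, invSq k ≤ 2 := by
  have h : Finset.Icc 1 n = Finset.Ioo 0 (n + 1) := by ext k; simp; omega
  rw [h]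
  have := sum_Ioo_inv_sq_le (α := ℝ) 0 (n + 1)
  simpa [invSq] using this

/-- Equivalent to (k + l)² ≤ 2(k² + l²); the version for three indices is (k + l + q)² ≤ 3(k² + l² +
q²). -/
theorem invSq_mul_le {k l j : ℕ} (hk : 1 ≤ k) (hl : 1 ≤ l) (h : k + l = j) :
    invSq k * invSq l ≤ 2 * invSq j * (invSq k + invSq l) := by
  have hk' : (0 : ℝ) < k := by exact_mod_cast hk
  have hl' : (0 : ℝ) < l := by exact_mod_cast hl
  have hj : (j : ℝ) = k + l := by rw [← h]; push_cast; ring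
  unfold invSq
  rw [hj, ← sub_nonneg]
  have e : 2 * (((k : ℝ) + l) ^ 2)⁻¹ * (((k : ℝ) ^ 2)⁻¹ + ((l : ℝ) ^ 2)⁻¹) -
      ((k : ℝ) ^ 2)⁻¹ * ((l : ℝ) ^ 2)⁻¹ = ((k : ℝ) - l) ^ 2 / ((k + l) ^ 2 * k ^ 2 * l ^ 2) := by
    field_simp
    ring
  rw [e]
  positivity

theorem invSq_mul_mul_le {k l q j : ℕ} (hk : 1 ≤ k) (hl : 1 ≤ l) (hq : 1 ≤ q)
    (h : k + l + q = j) : invSq k * invSq l * invSq q ≤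
      3 * invSq j * (invSq k * invSq l + invSq k * invSq q + invSq l * invSq q) := by
  have hk' : (0 : ℝ) < k := by exact_mod_cast hk
  have hl' : (0 : ℝ) < l := by exact_mod_cast hl
  have hq' : (0 : ℝ) < q := by exact_mod_cast hq
  have hj : (j : ℝ) = k + l + q := by rw [← h]; push_cast; ring
  unfold invSq
  rw [hj, ← sub_nonneg]
  have e : 3 * (((k : ℝ) + l + q) ^ 2)⁻¹ * (((k : ℝ) ^ 2)⁻¹ * ((l : ℝ) ^ 2)⁻¹ +
      ((k : ℝ) ^ 2)⁻¹ * ((q : ℝ) ^ 2)⁻¹ + ((l : ℝ) ^ 2)⁻¹ * ((q : ℝ) ^ 2)⁻¹) -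
      ((k : ℝ) ^ 2)⁻¹ * ((l : ℝ) ^ 2)⁻¹ * ((q : ℝ) ^ 2)⁻¹ =
      (((k : ℝ) - l) ^ 2 + ((k : ℝ) - q) ^ 2 + ((l : ℝ) - q) ^ 2) /
        ((k + l + q) ^ 2 * k ^ 2 * l ^ 2 * q ^ 2) := by
    field_simp
    ring
  rw [e]
  positivity

theorem sum_ite_add_eq_le (I : Finset ℕ) (k j : ℕ) {c : ℝ} (hc : 0 ≤ c) :
    (∑ l ∈ I, if k + l = j then c else 0) ≤ c := by
  rw [← Finset.sum_filter, Finset.sum_const, nsmul_eq_mul]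
  have h : (I.filter fun l => k + l = j).card ≤ 1 := Finset.card_le_one.2 fun x hx y hy => by
    rw [Finset.mem_filter] at hx hy
    omega
  have h' : ((I.filter fun l => k + l = j).card : ℝ) ≤ 1 := by exact_mod_cast h
  nlinarith

/-- Up to a constant independent of j, the weight k⁻² is reproduced by discrete convolution. This
keeps the profile bounds uniform in N, where counting the pairs would produce growing constants. -/
theorem sum_invSq_conv_le (j : ℕ) :
    (∑ k ∈ Finset.Icc 1 j, ∑ l ∈ Finset.Icc 1 j, if k + l = j then invSq k * invSq l else 0) ≤
      8 * invSq j := by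
  set S := Finset.Icc 1 j
  have h1 : ∑ k ∈ S, ∑ l ∈ S, (if k + l = j then invSq k else 0) ≤ 2 :=
    (Finset.sum_le_sum fun k _ => sum_ite_add_eq_le S k j (invSq_nonneg k)).trans (sum_invSq_le j)
  have h2 : ∑ k ∈ S, ∑ l ∈ S, (if k + l = j then invSq l else 0) ≤ 2 := by
    rw [Finset.sum_comm]
    simpa only [add_comm] using h1
  calc _ ≤ ∑ k ∈ S, ∑ l ∈ S, 2 * invSq j *
        ((if k + l = j then invSq k else 0) + if k + l = j then invSq l else 0) := by
        refine Finset.sum_le_sum fun k hk => Finset.sum_le_sum fun l hl => ?_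
        split_ifs with h
        · exact invSq_mul_le (Finset.mem_Icc.1 hk).1 (Finset.mem_Icc.1 hl).1 h
        · simp
    _ = 2 * invSq j * (∑ k ∈ S, ∑ l ∈ S, (if k + l = j then invSq k else 0) +
        ∑ k ∈ S, ∑ l ∈ S, if k + l = j then invSq l else 0) := by
        simp only [← Finset.mul_sum, Finset.sum_add_distrib]
    _ ≤ 2 * invSq j * (2 + 2) :=
        mul_le_mul_of_nonneg_left (add_le_add h1 h2) (by have := invSq_nonneg j; positivity)
    _ = 8 * invSq j := by ring

theorem sum_invSq_conv_conv_le (j : ℕ) :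
    (∑ k ∈ Finset.Icc 1 j, ∑ l ∈ Finset.Icc 1 j, ∑ q ∈ Finset.Icc 1 j,
      if k + l + q = j then invSq k * invSq l * invSq q else 0) ≤ 36 * invSq j := by
  set S := Finset.Icc 1 j
  have h4 : ∑ k ∈ S, ∑ l ∈ S, invSq k * invSq l ≤ 4 := by
    rw [← Finset.sum_mul_sum]
    have := sum_invSq_le j
    have h0 : 0 ≤ ∑ k ∈ S, invSq k := Finset.sum_nonneg fun k _ => invSq_nonneg k
    nlinarith
  have h1 : ∑ k ∈ S, ∑ l ∈ S, ∑ q ∈ S, (if k + l + q = j then invSq k * invSq l else 0) ≤ 4 :=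
    (Finset.sum_le_sum fun k _ => Finset.sum_le_sum fun l _ => sum_ite_add_eq_le S (k + l) j
      (mul_nonneg (invSq_nonneg k) (invSq_nonneg l))).trans h4
  have h2 : ∑ k ∈ S, ∑ l ∈ S, ∑ q ∈ S, (if k + l + q = j then invSq k * invSq q else 0) ≤ 4 := by
    refine le_trans (le_of_eq (Finset.sum_congr rfl fun k _ => ?_)) h1
    rw [Finset.sum_comm]
    exact Finset.sum_congr rfl fun l _ => Finset.sum_congr rfl fun q _ => by
      rw [add_right_comm]
  have h3 : ∑ k ∈ S, ∑ l ∈ S, ∑ q ∈ S, (if k + l + q = j then invSq l * invSq q else 0) ≤ 4 := by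
    refine le_trans (le_of_eq ?_) h2
    rw [Finset.sum_comm]
    exact Finset.sum_congr rfl fun l _ => Finset.sum_congr rfl fun q _ =>
      Finset.sum_congr rfl fun k _ => by rw [add_comm q l]
  calc _ ≤ ∑ k ∈ S, ∑ l ∈ S, ∑ q ∈ S, 3 * invSq j *
        ((if k + l + q = j then invSq k * invSq l else 0) +
          (if k + l + q = j then invSq k * invSq q else 0) +
          if k + l + q = j then invSq l * invSq q else 0) := by
        refine Finset.sum_le_sum fun k hk => Finset.sum_le_sum fun l hl =>
          Finset.sum_le_sum fun q hq => ?_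
        split_ifs with h
        · exact invSq_mul_mul_le (Finset.mem_Icc.1 hk).1 (Finset.mem_Icc.1 hl).1
            (Finset.mem_Icc.1 hq).1 h
        · simp
    _ = 3 * invSq j * (∑ k ∈ S, ∑ l ∈ S, ∑ q ∈ S, (if k + l + q = j then invSq k * invSq l else 0) +
          ∑ k ∈ S, ∑ l ∈ S, ∑ q ∈ S, (if k + l + q = j then invSq k * invSq q else 0) +
          ∑ k ∈ S, ∑ l ∈ S, ∑ q ∈ S, if k + l + q = j then invSq l * invSq q else 0) := by
        simp only [← Finset.mul_sum, Finset.sum_add_distrib]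
    _ ≤ 3 * invSq j * (4 + 4 + 4) :=
        mul_le_mul_of_nonneg_left (add_le_add (add_le_add h1 h2) h3)
          (by have := invSq_nonneg j; positivity)
    _ = 36 * invSq j := by ring

theorem norm_prodH2_le {x y : FreqSpace} {p q : ℝ} (hx : ‖x‖ ≤ p) (hy : ‖y‖ ≤ q) :
    ‖prodH2 x y‖ ≤ ‖prodH2‖ * p * q :=
  (prodH2.le_opNorm₂ x y).trans (by
    have := (norm_nonneg x).trans hx
    gcongr)

variable {d : ℤ → ℂ} {s : ℝ}

/-- Indices start at 1, so k + l = j forces k, l < j and only bounds on earlier profiles enter. -/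
theorem norm_quadSum_le {a : ℕ → FreqSpace} {j : ℕ} {η X : ℝ} (hX : 0 ≤ X)
    (h : ∀ k, 1 ≤ k → k < j → ‖a k‖ ≤ η * invSq k * X ^ k) :
    ‖quadSum a j‖ ≤ 8 * ‖prodH2‖ * η ^ 2 * (invSq j * X ^ j) := by
  set S := Finset.Icc 1 j
  calc ‖quadSum a j‖ ≤ ∑ k ∈ S, ∑ l ∈ S, ‖if k + l = j then prodH2 (a k) (a l) else 0‖ :=
        (norm_sum_le _ _).trans (Finset.sum_le_sum fun k _ => norm_sum_le _ _)
    _ ≤ ∑ k ∈ S, ∑ l ∈ S, ‖prodH2‖ * η ^ 2 * X ^ j *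
          (if k + l = j then invSq k * invSq l else 0) := by
        refine Finset.sum_le_sum fun k hk => Finset.sum_le_sum fun l hl => ?_
        rw [Finset.mem_Icc] at hk hl
        split_ifs with hkl
        · refine (norm_prodH2_le (h k hk.1 (by omega)) (h l hl.1 (by omega))).trans (le_of_eq ?_)
          rw [← hkl, pow_add]
          ring
        · simp
    _ = ‖prodH2‖ * η ^ 2 * X ^ j *
          ∑ k ∈ S, ∑ l ∈ S, (if k + l = j then invSq k * invSq l else 0) := by
        simp only [← Finset.mul_sum]
    _ ≤ ‖prodH2‖ * η ^ 2 * X ^ j * (8 * invSq j) := by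
        have := sum_invSq_conv_le j
        gcongr
    _ = _ := by ring

theorem norm_cubeSum_le {a : ℕ → FreqSpace} {j : ℕ} {η X : ℝ} (hη : 0 ≤ η) (hX : 0 ≤ X)
    (h : ∀ k, 1 ≤ k → k < j → ‖a k‖ ≤ η * invSq k * X ^ k) :
    ‖cubeSum a j‖ ≤ 36 * ‖prodH2‖ ^ 2 * η ^ 3 * (invSq j * X ^ j) := by
  set S := Finset.Icc 1 j
  calc ‖cubeSum a j‖ ≤ ∑ k ∈ S, ∑ l ∈ S, ∑ q ∈ S,
          ‖if k + l + q = j then prodH2 (prodH2 (a k) (a l)) (a q) else 0‖ :=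
        (norm_sum_le _ _).trans (Finset.sum_le_sum fun k _ => (norm_sum_le _ _).trans
          (Finset.sum_le_sum fun l _ => norm_sum_le _ _))
    _ ≤ ∑ k ∈ S, ∑ l ∈ S, ∑ q ∈ S, ‖prodH2‖ ^ 2 * η ^ 3 * X ^ j *
          (if k + l + q = j then invSq k * invSq l * invSq q else 0) := by
        refine Finset.sum_le_sum fun k hk => Finset.sum_le_sum fun l hl =>
          Finset.sum_le_sum fun q hq => ?_
        rw [Finset.mem_Icc] at hk hl hq
        split_ifs with hkl
        · refine (norm_prodH2_le (norm_prodH2_le (h k hk.1 (by omega)) (h l hl.1 (by omega)))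
            (h q hq.1 (by omega))).trans (le_of_eq ?_)
          rw [← hkl, pow_add, pow_add]
          ring
        · simp
    _ = ‖prodH2‖ ^ 2 * η ^ 3 * X ^ j *
          ∑ k ∈ S, ∑ l ∈ S, ∑ q ∈ S,
            (if k + l + q = j then invSq k * invSq l * invSq q else 0) := by
        simp only [← Finset.mul_sum]
    _ ≤ ‖prodH2‖ ^ 2 * η ^ 3 * X ^ j * (36 * invSq j) := by
        have := sum_invSq_conv_conv_le j
        gcongr
    _ = _ := by ring

/-- A bound for the coefficients of the nonlinearity. -/
def nonlinBound (d : ℤ → ℂ) (s : ℝ) : ℝ := 36 * (‖multH2 d‖ * ‖prodH2‖ + |s| * ‖prodH2‖ ^ 2)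

theorem nonlinBound_nonneg (d : ℤ → ℂ) (s : ℝ) : 0 ≤ nonlinBound d s := by
  unfold nonlinBound; positivity

theorem norm_mult_sub_smul_le {x y : FreqSpace} {z : ℝ} (hx : ‖x‖ ≤ 36 * ‖prodH2‖ * z) (hy : ‖y‖ ≤ 36 * ‖prodH2‖ ^ 2 * z) :
    ‖-multH2 d x - (s : ℂ) • y‖ ≤ nonlinBound d s * z := by
  calc ‖-multH2 d x - (s : ℂ) • y‖ ≤ ‖multH2 d x‖ + ‖(s : ℂ) • y‖ := by
        rw [← norm_neg (multH2 d x)]; exact norm_sub_le _ _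
    _ ≤ ‖multH2 d‖ * (36 * ‖prodH2‖ * z) + |s| * (36 * ‖prodH2‖ ^ 2 * z) := by
        rw [norm_smul, Complex.norm_real, Real.norm_eq_abs]
        refine add_le_add (((multH2 d).le_opNorm x).trans ?_) ?_ <;> gcongr
    _ = nonlinBound d s * z := by unfold nonlinBound; ring

/-- The nonlinearity is at least quadratic, so the bound carries η², while the induction only has to
reproduce η. The spare factor η is the small parameter. -/
theorem norm_forcing_le {a : ℕ → FreqSpace} {j : ℕ} {η X : ℝ} (hη : 0 ≤ η) (hη1 : η ≤ 1)
    (hX : 0 ≤ X) (h : ∀ k, 1 ≤ k → k < j → ‖a k‖ ≤ η * invSq k * X ^ k) :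
    ‖forcing d s a j‖ ≤ nonlinBound d s * (η ^ 2 * (invSq j * X ^ j)) := by
  have h0 := invSq_nonneg j
  refine norm_mult_sub_smul_le ((norm_quadSum_le hX h).trans ?_) ((norm_cubeSum_le hη hX h).trans ?_)
  · rw [← mul_assoc (36 * _)]
    gcongr
    norm_num
  · rw [← mul_assoc (36 * _)]
    have h3 : η ^ 3 ≤ η ^ 2 := pow_le_pow_of_le_one hη hη1 (by norm_num)
    exact mul_le_mul_of_nonneg_right (mul_le_mul_of_nonneg_left h3 (by positivity)) (by positivity)

theorem forcing_congr {a a' : ℕ → FreqSpace} {j : ℕ} (h : ∀ k, 1 ≤ k → k < j → a k = a' k) :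
    forcing d s a j = forcing d s a' j := by
  unfold forcing
  refine congrArg₂ (fun x y => -multH2 d x - (s : ℂ) • y) ?_ ?_
  · refine Finset.sum_congr rfl fun k hk => Finset.sum_congr rfl fun l hl => ?_
    rw [Finset.mem_Icc] at hk hl
    split_ifs with hkl
    · rw [h k hk.1 (by omega), h l hl.1 (by omega)]
    · rfl
  · refine Finset.sum_congr rfl fun k hk => Finset.sum_congr rfl fun l hl =>
      Finset.sum_congr rfl fun q hq => ?_
    rw [Finset.mem_Icc] at hk hl hq
    split_ifs with hkl
    · rw [h k hk.1 (by omega), h l hl.1 (by omega), h q hq.1 (by omega)]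
    · rfl

/-- Homogeneity of degree j lets the powers of δ be attached to the profiles, so that estimates in
powers of X hold in powers of δX. -/
theorem forcing_smul (r : ℂ) (a : ℕ → FreqSpace) (j : ℕ) :
    forcing d s (fun k => r ^ k • a k) j = r ^ j • forcing d s a j := by
  have h2 : quadSum (fun k => r ^ k • a k) j = r ^ j • quadSum a j := by
    simp only [quadSum, Finset.smul_sum]
    refine Finset.sum_congr rfl fun k _ => Finset.sum_congr rfl fun l _ => ?_
    split_ifs with h
    · simp only [map_smul, smul_apply, smul_smul]
      rw [← h, pow_add, mul_comm]
    · rw [smul_zero]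
  have h3 : cubeSum (fun k => r ^ k • a k) j = r ^ j • cubeSum a j := by
    simp only [cubeSum, Finset.smul_sum]
    refine Finset.sum_congr rfl fun k _ => Finset.sum_congr rfl fun l _ =>
      Finset.sum_congr rfl fun q _ => ?_
    split_ifs with h
    · simp only [map_smul, smul_apply, smul_smul]
      rw [← h, pow_add, pow_add]
      congr 1
      ring
    · rw [smul_zero]
  rw [forcing, forcing, h2, h3, map_smul, smul_sub, smul_neg, smul_comm]

theorem sum_quadSum (a : ℕ → FreqSpace) (N : ℕ) :
    ∑ j ∈ Finset.Icc 1 N, quadSum a j = ∑ k ∈ Finset.Icc 1 N, ∑ l ∈ Finset.Icc 1 N,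
      if k + l ≤ N then prodH2 (a k) (a l) else 0 := by
  have h : ∀ j ∈ Finset.Icc 1 N, quadSum a j = ∑ k ∈ Finset.Icc 1 N, ∑ l ∈ Finset.Icc 1 N,
      if k + l = j then prodH2 (a k) (a l) else 0 := fun j hj => by
    rw [Finset.mem_Icc] at hj
    have hsub : Finset.Icc 1 j ⊆ Finset.Icc 1 N := Finset.Icc_subset_Icc_right hj.2
    have hout : ∀ k ∈ Finset.Icc 1 N, k ∉ Finset.Icc 1 j → j < k := fun k hk hk' => by
      rw [Finset.mem_Icc] at hk hk'
      omega
    rw [quadSum, ← Finset.sum_subset hsub fun k hk hk' => Finset.sum_eq_zero fun l _ =>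
      if_neg (by have := hout k hk hk'; omega)]
    exact Finset.sum_congr rfl fun k _ => Finset.sum_subset hsub fun l hl hl' =>
      if_neg (by have := hout l hl hl'; omega)
  rw [Finset.sum_congr rfl h, Finset.sum_comm]
  refine Finset.sum_congr rfl fun k hk => ?_
  rw [Finset.sum_comm]
  refine Finset.sum_congr rfl fun l _ => ?_
  rw [Finset.sum_ite_eq]
  rw [Finset.mem_Icc] at hk
  exact if_congr (by rw [Finset.mem_Icc]; omega) rfl rfl

theorem sum_cubeSum (a : ℕ → FreqSpace) (N : ℕ) :
    ∑ j ∈ Finset.Icc 1 N, cubeSum a j = ∑ k ∈ Finset.Icc 1 N, ∑ l ∈ Finset.Icc 1 N,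
      ∑ q ∈ Finset.Icc 1 N, if k + l + q ≤ N then prodH2 (prodH2 (a k) (a l)) (a q) else 0 := by
  have h : ∀ j ∈ Finset.Icc 1 N, cubeSum a j = ∑ k ∈ Finset.Icc 1 N, ∑ l ∈ Finset.Icc 1 N,
      ∑ q ∈ Finset.Icc 1 N, if k + l + q = j then prodH2 (prodH2 (a k) (a l)) (a q) else 0 :=
      fun j hj => by
    rw [Finset.mem_Icc] at hj
    have hsub : Finset.Icc 1 j ⊆ Finset.Icc 1 N := Finset.Icc_subset_Icc_right hj.2
    have hout : ∀ k ∈ Finset.Icc 1 N, k ∉ Finset.Icc 1 j → j < k := fun k hk hk' => by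
      rw [Finset.mem_Icc] at hk hk'
      omega
    rw [cubeSum, ← Finset.sum_subset hsub fun k hk hk' => Finset.sum_eq_zero fun l _ =>
      Finset.sum_eq_zero fun q _ => if_neg (by have := hout k hk hk'; omega)]
    refine Finset.sum_congr rfl fun k _ => ?_
    rw [← Finset.sum_subset hsub fun l hl hl' => Finset.sum_eq_zero fun q _ =>
      if_neg (by have := hout l hl hl'; omega)]
    exact Finset.sum_congr rfl fun l _ => Finset.sum_subset hsub fun q hq hq' =>
      if_neg (by have := hout q hq hq'; omega)
  rw [Finset.sum_congr rfl h, Finset.sum_comm]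
  refine Finset.sum_congr rfl fun k hk => ?_
  rw [Finset.sum_comm]
  refine Finset.sum_congr rfl fun l _ => ?_
  rw [Finset.sum_comm]
  refine Finset.sum_congr rfl fun q _ => ?_
  rw [Finset.sum_ite_eq]
  rw [Finset.mem_Icc] at hk
  exact if_congr (by rw [Finset.mem_Icc]; omega) rfl rfl

theorem norm_sum_le_of_le_invSq {a : ℕ → FreqSpace} {N : ℕ} {η x : ℝ} (hη1 : η ≤ 1)
    (hx : 0 ≤ x) (hx1 : x ≤ 1) (h : ∀ k ∈ Finset.Icc 1 N, ‖a k‖ ≤ η * invSq k * x ^ k) :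
    ‖∑ k ∈ Finset.Icc 1 N, a k‖ ≤ 2 := by
  refine (norm_sum_le _ _).trans ((Finset.sum_le_sum fun k hk => (h k hk).trans ?_).trans
    (sum_invSq_le N))
  have h1 := invSq_nonneg k
  have h2 : x ^ k ≤ 1 := pow_le_one₀ hx hx1
  have h3 : 0 ≤ x ^ k := pow_nonneg hx k
  calc η * invSq k * x ^ k ≤ 1 * invSq k * 1 := by gcongr
    _ = invSq k := by ring

theorem prodH2_sum (S : Finset ℕ) (a b : ℕ → FreqSpace) :
    prodH2 (∑ k ∈ S, a k) (∑ l ∈ S, b l) = ∑ k ∈ S, ∑ l ∈ S, prodH2 (a k) (b l) := by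
  rw [map_sum, Finset.sum_comm]
  refine Finset.sum_congr rfl fun l _ => ?_
  rw [map_sum, sum_apply]

theorem prodH2_prodH2_sum (S : Finset ℕ) (a b c : ℕ → FreqSpace) :
    prodH2 (prodH2 (∑ k ∈ S, a k) (∑ l ∈ S, b l)) (∑ q ∈ S, c q) =
      ∑ k ∈ S, ∑ l ∈ S, ∑ q ∈ S, prodH2 (prodH2 (a k) (b l)) (c q) := by
  rw [prodH2_sum, prodH2_sum]
  refine Finset.sum_congr rfl fun k _ => ?_
  rw [Finset.sum_comm]
  refine Finset.sum_congr rfl fun q _ => ?_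
  rw [map_sum, sum_apply]

/-- By `sum_quadSum` and `sum_cubeSum` the forcings up to order N collect exactly the products of
total order at most N. The products left over have order at least N + 1, and x ≤ 1 bounds their
powers by x^(N+1). The weights are summable, so no factor N appears. -/
theorem norm_residual_le {a : ℕ → FreqSpace} {N : ℕ} {η x : ℝ} (hη1 : η ≤ 1)
    (hx : 0 ≤ x) (hx1 : x ≤ 1) (h : ∀ k ∈ Finset.Icc 1 N, ‖a k‖ ≤ η * invSq k * x ^ k) :
    ‖nonlinH2 d s (∑ k ∈ Finset.Icc 1 N, a k) - ∑ j ∈ Finset.Icc 1 N, forcing d s a j‖ ≤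
      nonlinBound d s * x ^ (N + 1) := by
  set S := Finset.Icc 1 N with hS
  have h' : ∀ k ∈ S, ‖a k‖ ≤ invSq k * x ^ k := fun k hk => (h k hk).trans (by
    have h1 := invSq_nonneg k
    have h3 : 0 ≤ x ^ k := pow_nonneg hx k
    calc η * invSq k * x ^ k ≤ 1 * invSq k * x ^ k := by gcongr
      _ = invSq k * x ^ k := by rw [one_mul])
  have hs2 : (∑ k ∈ S, invSq k) ≤ 2 := sum_invSq_le N
  have hs0 : 0 ≤ ∑ k ∈ S, invSq k := Finset.sum_nonneg fun k _ => invSq_nonneg k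
  set q2 := ∑ k ∈ S, ∑ l ∈ S, if k + l ≤ N then 0 else prodH2 (a k) (a l) with hq2
  set q3 := ∑ k ∈ S, ∑ l ∈ S, ∑ q ∈ S,
    if k + l + q ≤ N then 0 else prodH2 (prodH2 (a k) (a l)) (a q) with hq3
  have e2 : prodH2 (∑ k ∈ S, a k) (∑ k ∈ S, a k) = ∑ j ∈ S, quadSum a j + q2 := by
    rw [sum_quadSum, hq2, prodH2_sum, ← hS]
    simp only [← Finset.sum_add_distrib]
    refine Finset.sum_congr rfl fun k _ => Finset.sum_congr rfl fun l _ => ?_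
    split_ifs <;> simp
  have e3 : prodH2 (prodH2 (∑ k ∈ S, a k) (∑ k ∈ S, a k)) (∑ k ∈ S, a k) =
      ∑ j ∈ S, cubeSum a j + q3 := by
    rw [sum_cubeSum, hq3, prodH2_prodH2_sum, ← hS]
    simp only [← Finset.sum_add_distrib]
    refine Finset.sum_congr rfl fun k _ => Finset.sum_congr rfl fun l _ =>
      Finset.sum_congr rfl fun q _ => ?_
    split_ifs <;> simp
  have e : nonlinH2 d s (∑ k ∈ S, a k) - ∑ j ∈ S, forcing d s a j =
      -multH2 d q2 - (s : ℂ) • q3 := by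
    rw [nonlinH2, e3, e2, map_add, smul_add, map_sum (multH2 d), Finset.smul_sum]
    simp only [forcing, Finset.sum_sub_distrib, Finset.sum_neg_distrib]
    abel
  have b2 : ‖q2‖ ≤ 36 * ‖prodH2‖ * x ^ (N + 1) := by
    calc ‖q2‖ ≤ ∑ k ∈ S, ∑ l ∈ S, ‖if k + l ≤ N then 0 else prodH2 (a k) (a l)‖ :=
          (norm_sum_le _ _).trans (Finset.sum_le_sum fun k _ => norm_sum_le _ _)
      _ ≤ ∑ k ∈ S, ∑ l ∈ S, ‖prodH2‖ * x ^ (N + 1) * (invSq k * invSq l) := by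
          refine Finset.sum_le_sum fun k hk => Finset.sum_le_sum fun l hl => ?_
          have hk0 := invSq_nonneg k
          have hl0 := invSq_nonneg l
          split_ifs with hkl
          · rw [norm_zero]; positivity
          · refine (norm_prodH2_le (h' k hk) (h' l hl)).trans ?_
            have : x ^ (k + l) ≤ x ^ (N + 1) := pow_le_pow_of_le_one hx hx1 (by omega)
            calc _ = ‖prodH2‖ * x ^ (k + l) * (invSq k * invSq l) := by rw [pow_add]; ring
              _ ≤ _ := by gcongr
      _ = ‖prodH2‖ * x ^ (N + 1) * ((∑ k ∈ S, invSq k) * ∑ k ∈ S, invSq k) := by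
          rw [Finset.sum_mul_sum]; simp only [← Finset.mul_sum]
      _ ≤ ‖prodH2‖ * x ^ (N + 1) * 36 := by gcongr; nlinarith
      _ = _ := by ring
  have b3 : ‖q3‖ ≤ 36 * ‖prodH2‖ ^ 2 * x ^ (N + 1) := by
    calc ‖q3‖ ≤ ∑ k ∈ S, ∑ l ∈ S, ∑ q ∈ S,
            ‖if k + l + q ≤ N then 0 else prodH2 (prodH2 (a k) (a l)) (a q)‖ :=
          (norm_sum_le _ _).trans (Finset.sum_le_sum fun k _ => (norm_sum_le _ _).trans
            (Finset.sum_le_sum fun l _ => norm_sum_le _ _))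
      _ ≤ ∑ k ∈ S, ∑ l ∈ S, ∑ q ∈ S,
            ‖prodH2‖ ^ 2 * x ^ (N + 1) * (invSq k * (invSq l * invSq q)) := by
          refine Finset.sum_le_sum fun k hk => Finset.sum_le_sum fun l hl =>
            Finset.sum_le_sum fun q hq => ?_
          have hk0 := invSq_nonneg k
          have hl0 := invSq_nonneg l
          have hq0 := invSq_nonneg q
          split_ifs with hkl
          · rw [norm_zero]; positivity
          · refine (norm_prodH2_le (norm_prodH2_le (h' k hk) (h' l hl)) (h' q hq)).trans ?_
            have : x ^ (k + l + q) ≤ x ^ (N + 1) := pow_le_pow_of_le_one hx hx1 (by omega)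
            calc _ = ‖prodH2‖ ^ 2 * x ^ (k + l + q) * (invSq k * (invSq l * invSq q)) := by
                  rw [pow_add, pow_add]; ring
              _ ≤ _ := by gcongr
      _ = ‖prodH2‖ ^ 2 * x ^ (N + 1) *
            ((∑ k ∈ S, invSq k) * ((∑ k ∈ S, invSq k) * ∑ k ∈ S, invSq k)) := by
          rw [Finset.sum_mul_sum, Finset.sum_mul_sum]; simp only [← Finset.mul_sum]
      _ ≤ ‖prodH2‖ ^ 2 * x ^ (N + 1) * 36 := by
          gcongr
          calc _ ≤ (2 : ℝ) * (2 * 2) := by gcongr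
            _ ≤ 36 := by norm_num
      _ = _ := by ring
  rw [e]
  exact norm_mult_sub_smul_le b2 b3

/-- The radius 3 is the bound 2 for the approximate solution plus the bound 1 for the remainder. The
cubic term costs 18 + 9 = 27 ≤ 36. -/
theorem norm_nonlinH2_sub_le {x y : FreqSpace} (hx : ‖x‖ ≤ 3) (hy : ‖y‖ ≤ 3) :
    ‖nonlinH2 d s x - nonlinH2 d s y‖ ≤ nonlinBound d s * ‖x - y‖ := by
  have e2 : prodH2 x x - prodH2 y y = prodH2 (x - y) x + prodH2 y (x - y) := by
    simp only [map_sub, sub_apply]; abel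
  have b2 : ‖prodH2 x x - prodH2 y y‖ ≤ ‖prodH2‖ * 6 * ‖x - y‖ := by
    rw [e2]
    refine (norm_add_le_of_le (norm_prodH2_le le_rfl hx) (norm_prodH2_le hy le_rfl)).trans
      (le_of_eq ?_)
    ring
  have e3 : prodH2 (prodH2 x x) x - prodH2 (prodH2 y y) y =
      prodH2 (prodH2 x x - prodH2 y y) x + prodH2 (prodH2 y y) (x - y) := by
    simp only [map_sub, sub_apply]; abel
  have b3 : ‖prodH2 (prodH2 x x) x - prodH2 (prodH2 y y) y‖ ≤ 36 * ‖prodH2‖ ^ 2 * ‖x - y‖ := by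
    rw [e3]
    refine (norm_add_le_of_le (norm_prodH2_le b2 hx)
      (norm_prodH2_le (norm_prodH2_le hy hy) le_rfl)).trans ?_
    have : 0 ≤ ‖prodH2‖ ^ 2 * ‖x - y‖ := by positivity
    nlinarith
  have e : nonlinH2 d s x - nonlinH2 d s y = -multH2 d (prodH2 x x - prodH2 y y) -
      (s : ℂ) • (prodH2 (prodH2 x x) x - prodH2 (prodH2 y y) y) := by
    rw [nonlinH2, nonlinH2, map_sub, smul_sub]; abel
  rw [e]
  refine norm_mult_sub_smul_le (b2.trans ?_) b3
  have : 0 ≤ ‖prodH2‖ * ‖x - y‖ := by positivity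
  nlinarith

end

noncomputable section

/-! ### The growth factor -/

/-- `X` grows at rates between `3 lamM / 4` and `lamM`. -/
structure IsGrowth (lamM : ℝ) (X : ℝ → ℝ) : Prop where
  cont : Continuous X
  pos : ∀ t, 0 < X t
  decay : ∀ τ t, τ ≤ t → X τ ≤ X t * Real.exp (-(3 / 4 * lamM * (t - τ)))
  le_exp : ∀ t, 0 ≤ t → X t ≤ X 0 * Real.exp (lamM * t)

section

variable {lamM : ℝ} {X : ℝ → ℝ}

theorem IsGrowth.const_mul (h : IsGrowth lamM X) {r : ℝ} (hr : 0 < r) :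
    IsGrowth lamM fun t => r * X t where
  cont := continuous_const.mul h.cont
  pos t := mul_pos hr (h.pos t)
  decay τ t ht := by
    rw [mul_assoc]
    exact mul_le_mul_of_nonneg_left (h.decay τ t ht) hr.le
  le_exp t ht := by
    rw [mul_assoc]
    exact mul_le_mul_of_nonneg_left (h.le_exp t ht) hr.le

theorem IsGrowth.strictMono (h : IsGrowth lamM X) (hlam : 0 < lamM) : StrictMono X := fun τ t ht =>
  (h.decay τ t ht.le).trans_lt (mul_lt_of_lt_one_right (h.pos t) (Real.exp_lt_one_iff.2 (by
    have := sub_pos.2 ht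
    have : 0 < 3 / 4 * lamM * (t - τ) := by positivity
    linarith)))

theorem IsGrowth.tendsto_atTop (h : IsGrowth lamM X) (hlam : 0 < lamM) :
    Tendsto X atTop atTop := by
  have h1 : Tendsto (fun t : ℝ => X 0 * Real.exp (3 / 4 * lamM * t)) atTop atTop :=
    (Real.tendsto_exp_atTop.comp (tendsto_id.const_mul_atTop (by positivity))).const_mul_atTop
      (h.pos 0)
  refine tendsto_atTop_mono' _ ?_ h1
  filter_upwards [eventually_ge_atTop (0 : ℝ)] with t ht
  have h2 := h.decay 0 t ht
  rw [sub_zero, Real.exp_neg] at h2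
  have h3 := Real.exp_pos (3 / 4 * lamM * t)
  rwa [← div_eq_mul_inv, le_div_iff₀ h3] at h2

theorem IsGrowth.exists_eq (h : IsGrowth lamM X) (hlam : 0 < lamM) {θ : ℝ} (hθ : X 0 ≤ θ) :
    ∃ T, 0 ≤ T ∧ X T = θ := by
  obtain ⟨t, ht, htθ⟩ := ((eventually_ge_atTop (0 : ℝ)).and
    ((h.tendsto_atTop hlam).eventually_ge_atTop θ)).exists
  obtain ⟨T, hT, hTθ⟩ := intermediate_value_Icc ht h.cont.continuousOn ⟨hθ, htθ⟩
  exact ⟨T, hT.1, hTθ⟩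

/-- The estimate of the semigroup generated by the linearization. -/
def HasEnergyEstimate (ε ω : ℝ) (c : ℤ → ℂ) (lamM C : ℝ) : Prop :=
  ∀ (t : ℝ) (a g : ℝ → FreqSpace), 0 ≤ t → ContinuousOn a (Set.Icc 0 t) →
    ContinuousOn g (Set.Icc 0 t) →
    IsFreqSol ε ω (Set.Icc 0 t) a (fun τ => multH2 c (a τ) + g τ) →
    ‖a t‖ ≤ C * (Real.exp (lamM * t) * ‖a 0‖ +
      ∫ τ in (0 : ℝ)..t, Real.exp (lamM * (t - τ)) * ‖g τ‖)

variable {ε ω C : ℝ} {c : ℤ → ℂ}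

/-- X^j grows at rate at least 3jλ_M/4, which exceeds λ_M for j ≥ 2, so the Duhamel integral is
dominated by its upper end. The excess 3j/4 - 1 is at least j/4, whence the factor 4/(jλ_M). Its
decay in j later absorbs the linear terms of the remainder equation. -/
theorem HasEnergyEstimate.norm_le_pow (hE : HasEnergyEstimate ε ω c lamM C) (hC : 0 ≤ C)
    (hlam : 0 < lamM) (hX : IsGrowth lamM X) {j : ℕ} (hj : 2 ≤ j) {t m : ℝ}
    {a g : ℝ → FreqSpace} (ht : 0 ≤ t) (ha : ContinuousOn a (Set.Icc 0 t))
    (hg : ContinuousOn g (Set.Icc 0 t))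
    (hsol : IsFreqSol ε ω (Set.Icc 0 t) a (fun τ => multH2 c (a τ) + g τ)) (h0 : a 0 = 0)
    (hm : ∀ τ ∈ Set.Icc 0 t, ‖g τ‖ ≤ m * X τ ^ j) :
    ‖a t‖ ≤ C * (4 / (j * lamM)) * m * X t ^ j := by
  have hj' : (2 : ℝ) ≤ j := by exact_mod_cast hj
  have hm0 : 0 ≤ m := by
    have h1 := (norm_nonneg _).trans (hm 0 ⟨le_rfl, ht⟩)
    exact nonneg_of_mul_nonneg_left h1 (pow_pos (hX.pos 0) j)
  set β := j * lamM / 4 with hβ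
  have hβ0 : 0 < β := by positivity
  have hXt := pow_pos (hX.pos t) j
  have h1 : ∀ τ ∈ Set.Icc 0 t, Real.exp (lamM * (t - τ)) * ‖g τ‖ ≤
      m * X t ^ j * Real.exp (-(β * t)) * Real.exp (β * τ) := fun τ hτ => by
    have hs := sub_nonneg.2 hτ.2
    have h2 : X τ ^ j ≤ X t ^ j * Real.exp (-(j * (3 / 4 * lamM * (t - τ)))) := by
      refine (pow_le_pow_left₀ (hX.pos τ).le (hX.decay τ t hτ.2) j).trans (le_of_eq ?_)
      rw [mul_pow, ← Real.exp_nat_mul]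
      congr 2
      ring
    calc Real.exp (lamM * (t - τ)) * ‖g τ‖
        ≤ Real.exp (lamM * (t - τ)) * (m * (X t ^ j * Real.exp (-(j * (3 / 4 * lamM * (t - τ)))))) := by
          gcongr
          exact (hm τ hτ).trans (by gcongr)
      _ = m * X t ^ j * Real.exp (lamM * (t - τ) - j * (3 / 4 * lamM * (t - τ))) := by
          rw [sub_eq_add_neg (lamM * _), Real.exp_add]; ring
      _ ≤ m * X t ^ j * Real.exp (-(β * t) + β * τ) := by
          gcongr
          rw [hβ]
          have : 0 ≤ (j - 2) * (lamM * (t - τ)) :=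
            mul_nonneg (by linarith) (by positivity)
          nlinarith
      _ = _ := by rw [Real.exp_add]; ring
  have h2 : ∫ τ in (0 : ℝ)..t, Real.exp (lamM * (t - τ)) * ‖g τ‖ ≤ m * X t ^ j * (1 / β) := by
    have hi : IntervalIntegrable (fun τ => Real.exp (lamM * (t - τ)) * ‖g τ‖) volume 0 t := by
      refine ContinuousOn.intervalIntegrable ?_
      rw [Set.uIcc_of_le ht]
      exact (by fun_prop : Continuous fun τ => Real.exp (lamM * (t - τ))).continuousOn.mul hg.norm
    have hi' : IntervalIntegrable
        (fun τ => m * X t ^ j * Real.exp (-(β * t)) * Real.exp (β * τ)) volume 0 t :=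
      Continuous.intervalIntegrable (by fun_prop) _ _
    refine (intervalIntegral.integral_mono_on ht hi hi' h1).trans ?_
    rw [intervalIntegral.integral_const_mul]
    calc _ ≤ m * X t ^ j * Real.exp (-(β * t)) * (Real.exp (β * t) / β) := by
          gcongr
          exact integral_exp_mul_le hβ0 t
      _ = m * X t ^ j * (Real.exp (-(β * t)) * Real.exp (β * t)) / β := by ring
      _ = _ := by rw [← Real.exp_add, neg_add_cancel, Real.exp_zero]; ring
  refine (hE t a g ht ha hg hsol).trans ?_
  rw [h0, norm_zero, mul_zero, zero_add]
  calc _ ≤ C * (m * X t ^ j * (1 / β)) := by gcongr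
    _ = _ := by rw [hβ]; field_simp

theorem HasEnergyEstimate.eq_zero (hE : HasEnergyEstimate ε ω c lamM C) {a : ℝ → FreqSpace} {t : ℝ}
    (ht : 0 ≤ t) (ha : ContinuousOn a (Set.Icc 0 t))
    (hsol : IsFreqSol ε ω (Set.Icc 0 t) a (fun τ => multH2 c (a τ))) (h0 : a 0 = 0) : a t = 0 := by
  have h1 := hE t a (fun _ => 0) ht ha continuousOn_const
    (hsol.congr (Icc_subset_Icc_zero t) (fun _ _ => rfl) fun _ _ => add_zero _)
  simp only [h0, norm_zero, mul_zero, intervalIntegral.integral_zero, add_zero] at h1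
  exact norm_le_zero_iff.1 h1

end

/-! ### The growth factor of a small square of Bloch vectors. -/

section

variable {σbar : ℝ × ℝ} {lam : ℝ × ℝ → ℝ} {c₀ : ℝ}

theorem growth_eq_sqrt (t : ℝ) : growth σbar lam c₀ t =
    Real.sqrt (∫ σ in square σbar c₀, Real.exp (2 * t * lam σ)) := by
  rw [← growth_sq, Real.sqrt_sq (growth_nonneg _ _ _ _)]

theorem growth_zero : growth σbar lam c₀ 0 = prefactor σbar lam c₀ 0 := by
  rw [growth, mul_zero, Real.exp_zero, one_mul]

theorem volume_square_pos (hc₀ : 0 < c₀) : 0 < volume (square σbar c₀) := by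
  rw [square, Measure.volume_eq_prod, Measure.prod_prod, Real.volume_Icc, Real.volume_Icc]
  have : 0 < ENNReal.ofReal c₀ := ENNReal.ofReal_pos.2 hc₀
  simp only [add_sub_cancel_left]
  positivity

/-- The squared growth factor is the integral of e^{2tλ(σ)}, so inequalities between exponents on
the square pass to the growth factor. Any fraction above 1/2 in place of 3/4 would make its square
outgrow e^{λ_M t}. -/
theorem isGrowth_growth (hc₀ : 0 < c₀) (hlam : ContinuousOn lam (square σbar c₀)) {lamM : ℝ}
    (hM : 0 ≤ lamM) (hlow : ∀ σ ∈ square σbar c₀, 3 / 4 * lamM ≤ lam σ)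
    (hup : ∀ σ ∈ square σbar c₀, lam σ ≤ lamM) : IsGrowth lamM (growth σbar lam c₀) := by
  have hK := isCompact_square σbar c₀
  have hmeas := measurableSet_square σbar c₀
  have hcont : ∀ t : ℝ, ContinuousOn (fun σ => Real.exp (2 * t * lam σ)) (square σbar c₀) :=
    fun t => Real.continuous_exp.comp_continuousOn (continuousOn_const.mul hlam)
  have hint : ∀ t : ℝ, IntegrableOn (fun σ => Real.exp (2 * t * lam σ)) (square σbar c₀) :=
    fun t => (hcont t).integrableOn_compact hK
  have hmem : ∀ᵐ σ ∂(volume.restrict (square σbar c₀)), σ ∈ square σbar c₀ := ae_restrict_mem hmeas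
  have hcmp : ∀ t₁ t₂ r : ℝ, (∀ σ ∈ square σbar c₀, t₁ * lam σ ≤ t₂ * lam σ + r) →
      growth σbar lam c₀ t₁ ≤ growth σbar lam c₀ t₂ * Real.exp r := fun t₁ t₂ r h => by
    refine le_of_sq_le_sq ?_ (mul_nonneg (growth_nonneg _ _ _ _) (Real.exp_pos _).le)
    rw [mul_pow, growth_sq, growth_sq, ← integral_mul_const]
    refine setIntegral_mono_on (hint t₁) ((hint t₂).mul_const _) hmeas fun σ hσ => ?_
    rw [sq, ← Real.exp_add, ← Real.exp_add, Real.exp_le_exp]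
    linarith [h σ hσ]
  refine ⟨?_, fun t => ?_, fun τ t h => hcmp _ _ _ fun σ hσ => ?_, fun t h => hcmp _ _ _ fun σ hσ => ?_⟩
  · rw [show growth σbar lam c₀ = _ from funext growth_eq_sqrt]
    refine Real.continuous_sqrt.comp (continuous_iff_continuousAt.2 fun t₀ => ?_)
    have : IsFiniteMeasure (volume.restrict (square σbar c₀)) :=
      ⟨by rw [Measure.restrict_apply_univ]; exact hK.measure_lt_top⟩
    refine continuousAt_of_dominated (bound := fun _ => Real.exp (2 * ((|t₀| + 1) * lamM)))
      (Eventually.of_forall fun t => (hcont t).aestronglyMeasurable hmeas) ?_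
      (integrable_const _) (ae_of_all _ fun σ => by fun_prop)
    filter_upwards [Metric.ball_mem_nhds t₀ one_pos] with t ht
    filter_upwards [hmem] with σ hσ
    rw [Real.norm_eq_abs, Real.abs_exp, Real.exp_le_exp, mul_assoc]
    have h0 : 0 ≤ lam σ := le_trans (by positivity) (hlow σ hσ)
    have h1 : t ≤ |t₀| + 1 := by
      have := (abs_lt.1 (by simpa [Real.dist_eq] using ht : |t - t₀| < 1)).2
      linarith [le_abs_self t₀]
    have := mul_le_mul h1 (hup σ hσ) h0 (by positivity)
    linarith
  · rw [growth_eq_sqrt, Real.sqrt_pos, setIntegral_pos_iff_support_of_nonneg_ae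
      (ae_of_all _ fun σ => (Real.exp_pos _).le) (hint t),
      Set.inter_eq_right.2 (show square σbar c₀ ⊆ Function.support _ from
        fun σ _ => (Real.exp_pos _).ne')]
    exact volume_square_pos hc₀
  · have := mul_le_mul_of_nonneg_left (hlow σ hσ) (sub_nonneg.2 h)
    linarith
  · have := mul_le_mul_of_nonneg_left (hup σ hσ) h
    linarith

end

end

noncomputable section

/-! ### Existence and size of the profiles -/

variable {ε ω s C lamM : ℝ} {X : ℝ → ℝ} {c d : ℤ → ℂ}

theorem forcing_one (a : ℕ → FreqSpace) : forcing d s a 1 = 0 := by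
  simp [forcing, quadSum, cubeSum]

/-- Induction on the order. The first profile is the explicit Bloch superposition, by uniqueness for
the linear equation. For j ≥ 2 the Duhamel estimate returns the claimed bound multiplied by CKη ·
2/λ_M ≤ 1, where K is `nonlinBound`. The bound holds for any profiles, not only for constructed
ones. -/
theorem IsCoordProfiles.norm_le (hE : HasEnergyEstimate ε ω c lamM C) (hC : 0 ≤ C)
    (hlam : 0 < lamM) (hX : IsGrowth lamM X) {η : ℝ} (hη : 0 ≤ η) (hη1 : η ≤ 1)
    (hηC : C * nonlinBound d s * η * (2 / lamM) ≤ 1) {a₁ : ℝ → FreqSpace} (ha₁ : Continuous a₁)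
    (hsol : IsFreqSol ε ω (Set.Ici 0) a₁ fun t => multH2 c (a₁ t))
    (hbd : ∀ t, ‖a₁ t‖ ≤ η * X t) {N : ℕ} {a : ℕ → ℝ → FreqSpace}
    (h : IsCoordProfiles ε ω s c d (a₁ 0) N a) {j : ℕ} (hj : j ∈ Finset.Icc 1 N) {t : ℝ}
    (ht : 0 ≤ t) : ‖a j t‖ ≤ η * invSq j * X t ^ j := by
  induction j using Nat.strong_induction_on generalizing t with
  | _ j ih =>
    have hj1 := (Finset.mem_Icc.1 hj).1
    rcases hj1.eq_or_lt with rfl | hj2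
    · have h1 : a 1 t = a₁ t := by
        have h2 := IsFreqSol.add Icc_subset_Ici_zero (a := a 1) (a' := fun t => (-1 : ℂ) • a₁ t)
          (g := fun t => multH2 c (a 1 t)) (g' := fun t => (-1 : ℂ) • multH2 c (a₁ t))
          (h.cont 1 hj) (continuousOn_smul_fun _ ha₁.continuousOn)
          ((multH2 c).continuous.comp_continuousOn (h.cont 1 hj))
          (continuousOn_smul_fun _ ((multH2 c).continuous.comp ha₁).continuousOn)
          ((h.sol 1 hj).congr Icc_subset_Ici_zero (fun _ _ => rfl)
            fun t _ => by rw [forcing_one, add_zero]) (hsol.smul _)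
        have h3 := hE.eq_zero (a := fun t => a 1 t + (-1 : ℂ) • a₁ t) ht
          (((h.cont 1 hj).add (continuousOn_smul_fun _ ha₁.continuousOn)).mono Set.Icc_subset_Ici_self)
          ((h2.mono Set.Icc_subset_Ici_self).congr (Icc_subset_Icc_zero t) (fun _ _ => rfl)
            fun t _ => by rw [map_add, map_smul]) (by rw [h.init 1 hj]; simp)
        rw [neg_one_smul, ← sub_eq_add_neg] at h3
        exact sub_eq_zero.1 h3
      rw [h1]
      simpa [invSq] using hbd t
    · have hf : ∀ τ ∈ Set.Icc 0 t, ‖forcing d s (fun k => a k τ) j‖ ≤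
          nonlinBound d s * η ^ 2 * invSq j * X τ ^ j := fun τ hτ => by
        refine (norm_forcing_le hη hη1 (hX.pos τ).le fun k hk1 hkj => ih k hkj
          (Finset.mem_Icc.2 ⟨hk1, hkj.le.trans (Finset.mem_Icc.1 hj).2⟩) hτ.1).trans (le_of_eq ?_)
        ring
      have h1 := hE.norm_le_pow hC hlam hX hj2 ht ((h.cont j hj).mono Set.Icc_subset_Ici_self)
        ((continuousOn_forcing (h.cont_of_mem hj)).mono Set.Icc_subset_Ici_self)
        ((h.sol j hj).mono Set.Icc_subset_Ici_self) (by rw [h.init j hj, if_neg (by omega)]) hf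
      refine h1.trans ?_
      have hj' : (2 : ℝ) ≤ j := by exact_mod_cast hj2
      have hb : 4 / (j * lamM) ≤ 2 / lamM := by
        rw [div_le_div_iff₀ (by positivity) hlam]
        nlinarith
      have hn := nonlinBound_nonneg d s
      have hi := invSq_nonneg j
      have hXj := pow_pos (hX.pos t) j
      calc C * (4 / (j * lamM)) * (nonlinBound d s * η ^ 2 * invSq j) * X t ^ j
          ≤ C * (2 / lamM) * (nonlinBound d s * η ^ 2 * invSq j) * X t ^ j := by gcongr
        _ = (C * nonlinBound d s * η * (2 / lamM)) * (η * invSq j * X t ^ j) := by ring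
        _ ≤ 1 * (η * invSq j * X t ^ j) := by gcongr
        _ = _ := one_mul _

/-- The forcing of order N + 1 contains only earlier profiles, so each step is a linear
inhomogeneous problem. The size estimate supplies the exponential bound on the forcing that
`exists_freqSol` asks for. -/
theorem exists_coordProfiles (hE : HasEnergyEstimate ε ω c lamM C) (hC : 0 ≤ C)
    (hlam : 0 < lamM) (hX : IsGrowth lamM X) {η : ℝ} (hη : 0 ≤ η) (hη1 : η ≤ 1)
    (hηC : C * nonlinBound d s * η * (2 / lamM) ≤ 1) {a₁ : ℝ → FreqSpace} (ha₁ : Continuous a₁)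
    (hsol : IsFreqSol ε ω (Set.Ici 0) a₁ fun t => multH2 c (a₁ t))
    (hbd : ∀ t, ‖a₁ t‖ ≤ η * X t) (N : ℕ) :
    ∃ a, IsCoordProfiles ε ω s c d (a₁ 0) N a := by
  -- Continuity of every `a k` is carried along because `continuousOn_forcing` at order N + 1 asks
  -- for it at the index N + 1 too, although the value there does not contribute.
  suffices h : ∃ a, IsCoordProfiles ε ω s c d (a₁ 0) N a ∧ ∀ k, ContinuousOn (a k) (Set.Ici 0) from
    ⟨h.choose, h.choose_spec.1⟩
  induction N with
  | zero => exact ⟨0, ⟨by simp, by simp, by simp⟩, fun _ => continuousOn_const⟩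
  | succ N ih =>
    obtain ⟨a, ha, hac⟩ := ih
    suffices hnew : ∃ b : ℝ → FreqSpace, ContinuousOn b (Set.Ici 0) ∧
        b 0 = (if N + 1 = 1 then a₁ 0 else 0) ∧ IsFreqSol ε ω (Set.Ici 0) b
          fun t => multH2 c (b t) + forcing d s (fun k => a k t) (N + 1) by
      obtain ⟨b, hb, hb0, hbs⟩ := hnew
      have hlt : ∀ {k}, k < N + 1 → Function.update a (N + 1) b k = a k := fun hk =>
        Function.update_of_ne hk.ne _ _
      have hf : ∀ {j} t, j ≤ N + 1 → forcing d s (fun k => Function.update a (N + 1) b k t) j =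
          forcing d s (fun k => a k t) j := fun t hj => forcing_congr fun k _ hk => by
        rw [hlt (hk.trans_le hj)]
      refine ⟨Function.update a (N + 1) b, ⟨fun j hj => ?_, fun j hj => ?_, fun j hj => ?_⟩,
        fun k => ?_⟩
      · rcases (Finset.mem_Icc.1 hj).2.eq_or_lt with rfl | hjN
        · simpa using hb
        · rw [hlt hjN]
          exact hac j
      · rcases (Finset.mem_Icc.1 hj).2.eq_or_lt with rfl | hjN
        · simpa using hb0
        · rw [hlt hjN]
          exact ha.init j (Finset.mem_Icc.2 ⟨(Finset.mem_Icc.1 hj).1, by omega⟩)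
      · simp only [hf _ (Finset.mem_Icc.1 hj).2]
        rcases (Finset.mem_Icc.1 hj).2.eq_or_lt with rfl | hjN
        · simpa using hbs
        · rw [hlt hjN]
          exact ha.sol j (Finset.mem_Icc.2 ⟨(Finset.mem_Icc.1 hj).1, by omega⟩)
      · by_cases hk : k = N + 1
        · rw [hk]
          simpa using hb
        · rw [Function.update_of_ne hk]
          exact hac k
    rcases Nat.eq_zero_or_pos N with rfl | hN
    · refine ⟨a₁, ha₁.continuousOn, by simp, hsol.congr Icc_subset_Ici_zero (fun _ _ => rfl)
        fun t _ => ?_⟩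
      simp only [zero_add, forcing_one, add_zero]
    · set f : ℝ → FreqSpace := fun t => forcing d s (fun k => a k (max t 0)) (N + 1) with hf
      have hfc : Continuous f := by
        rw [← continuousOn_univ]
        exact continuousOn_forcing fun k _ => ((hac k).comp_continuous (by fun_prop)
          fun t => le_max_right t 0).continuousOn
      have hfb : ∀ t, 0 ≤ t → ‖f t‖ ≤ nonlinBound d s * (η ^ 2 * (invSq (N + 1) * X 0 ^ (N + 1))) *
          Real.exp ((N + 1 : ℕ) * lamM * t) := fun t ht => by
        have hn := nonlinBound_nonneg d s
        have hi := invSq_nonneg (N + 1)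
        have h1 : X t ^ (N + 1) ≤ X 0 ^ (N + 1) * Real.exp ((N + 1 : ℕ) * lamM * t) := by
          refine (pow_le_pow_left₀ (hX.pos t).le (hX.le_exp t ht) _).trans (le_of_eq ?_)
          rw [mul_pow, ← Real.exp_nat_mul, mul_assoc (_ : ℝ) lamM]
        rw [hf]
        simp only [max_eq_left ht]
        refine (norm_forcing_le hη hη1 (hX.pos t).le fun k hk1 hkj =>
          ha.norm_le hE hC hlam hX hη hη1 hηC ha₁ hsol hbd
            (Finset.mem_Icc.2 ⟨hk1, by omega⟩) ht).trans ?_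
        calc _ ≤ nonlinBound d s * (η ^ 2 * (invSq (N + 1) *
              (X 0 ^ (N + 1) * Real.exp ((N + 1 : ℕ) * lamM * t)))) := by gcongr
          _ = _ := by ring
      obtain ⟨b, hb, hb0, hbs⟩ := exists_freqSol ε ω (F := fun t x => multH2 c x + f t)
        (by fun_prop) (L := ‖multH2 c‖)
        (fun t x y => by
          rw [add_sub_add_right_eq_sub, ← map_sub]
          exact (multH2 c).le_opNorm _)
        (fun t ht => by
          rw [map_zero, zero_add]
          exact hfb t ht) 0
      refine ⟨b, hb.continuousOn, by rw [hb0, if_neg (by omega)],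
        hbs.congr Icc_subset_Ici_zero (fun _ _ => rfl) fun t ht => ?_⟩
      rw [hf]
      simp only [max_eq_left (Set.mem_Ici.1 ht)]

end

noncomputable section

/-! ### Existence and size of the remainder -/

/-- The radial retraction onto the unit ball. -/
def retract (x : FreqSpace) : FreqSpace := (((max 1 ‖x‖)⁻¹ : ℝ) : ℂ) • x

theorem retract_of_norm_le {x : FreqSpace} (hx : ‖x‖ ≤ 1) : retract x = x := by
  rw [retract, max_eq_left hx, inv_one, Complex.ofReal_one, one_smul]

theorem norm_retract (x : FreqSpace) : ‖retract x‖ = (max 1 ‖x‖)⁻¹ * ‖x‖ := by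
  rw [retract, norm_smul, Complex.norm_real, Real.norm_of_nonneg (by positivity)]

theorem norm_retract_le (x : FreqSpace) : ‖retract x‖ ≤ ‖x‖ := by
  rw [norm_retract]
  exact mul_le_of_le_one_left (norm_nonneg x) (inv_le_one_of_one_le₀ (le_max_left _ _))

theorem norm_retract_le_one (x : FreqSpace) : ‖retract x‖ ≤ 1 := by
  rw [norm_retract, inv_mul_le_iff₀ (by positivity), mul_one]
  exact le_max_right _ _

theorem norm_retract_sub_le (x y : FreqSpace) : ‖retract x - retract y‖ ≤ 2 * ‖x - y‖ := by
  set m := max 1 ‖x‖ with hm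
  set n := max 1 ‖y‖ with hn
  have hm1 : 1 ≤ m := le_max_left _ _
  have hn1 : 1 ≤ n := le_max_left _ _
  have hm0 : 0 < m := by linarith
  have hn0 : 0 < n := by linarith
  have hmn : |n - m| ≤ ‖x - y‖ := by
    rw [abs_sub_comm, hm, hn, max_comm 1, max_comm 1]
    exact (abs_max_sub_max_le_abs _ _ _).trans (abs_norm_sub_norm_le x y)
  have e : retract x - retract y =
      ((m⁻¹ : ℝ) : ℂ) • (x - y) + ((m⁻¹ - n⁻¹ : ℝ) : ℂ) • y := by
    rw [retract, retract, ← hm, ← hn, smul_sub, Complex.ofReal_sub, sub_smul]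
    abel
  have h1 : ‖((m⁻¹ : ℝ) : ℂ) • (x - y)‖ ≤ ‖x - y‖ := by
    rw [norm_smul, Complex.norm_real, Real.norm_of_nonneg (by positivity)]
    exact mul_le_of_le_one_left (norm_nonneg _) (inv_le_one_of_one_le₀ hm1)
  have h2 : ‖((m⁻¹ - n⁻¹ : ℝ) : ℂ) • y‖ ≤ ‖x - y‖ := by
    rw [norm_smul, Complex.norm_real, Real.norm_eq_abs, inv_sub_inv hm0.ne' hn0.ne', abs_div,
      abs_of_pos (mul_pos hm0 hn0), div_mul_eq_mul_div, div_le_iff₀ (mul_pos hm0 hn0)]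
    have hy : ‖y‖ ≤ m * n := by
      have : ‖y‖ ≤ n := le_max_right _ _
      nlinarith
    exact mul_le_mul hmn hy (norm_nonneg _) (norm_nonneg _)
  rw [e]
  linarith [norm_add_le_of_le h1 h2]

variable {ε ω b s C lamM η δ : ℝ} {X : ℝ → ℝ} {c d : ℤ → ℂ} {N : ℕ} {a : ℕ → ℝ → FreqSpace}

theorem norm_pow_smul_le (hδ : 0 < δ) {t : ℝ}
    (ha : ∀ j ∈ Finset.Icc 1 N, ‖a j t‖ ≤ η * invSq j * X t ^ j) :
    ∀ j ∈ Finset.Icc 1 N, ‖(δ : ℂ) ^ j • a j t‖ ≤ η * invSq j * (δ * X t) ^ j := fun j hj => by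
  rw [norm_smul, norm_pow, Complex.norm_real, Real.norm_of_nonneg hδ.le, mul_pow]
  have := mul_le_mul_of_nonneg_left (ha j hj) (pow_nonneg hδ.le j)
  linarith

theorem norm_approxH2_le (hη1 : η ≤ 1) (hδ : 0 < δ) {t : ℝ} (hX : 0 ≤ X t) (hδX : δ * X t ≤ 1)
    (ha : ∀ j ∈ Finset.Icc 1 N, ‖a j t‖ ≤ η * invSq j * X t ^ j) : ‖approxH2 a N δ t‖ ≤ 2 :=
  norm_sum_le_of_le_invSq hη1 (mul_nonneg hδ.le hX) hδX (norm_pow_smul_le hδ ha)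

theorem norm_approx_residual_le (hη1 : η ≤ 1) (hδ : 0 < δ) {t : ℝ} (hX : 0 ≤ X t)
    (hδX : δ * X t ≤ 1) (ha : ∀ j ∈ Finset.Icc 1 N, ‖a j t‖ ≤ η * invSq j * X t ^ j) :
    ‖nonlinH2 d s (approxH2 a N δ t) - approxForcing d s a N δ t‖ ≤
      nonlinBound d s * (δ * X t) ^ (N + 1) := by
  have h := norm_residual_le (d := d) (s := s) hη1 (mul_nonneg hδ.le hX) hδX (norm_pow_smul_le hδ ha)
  simp only [forcing_smul] at h
  exact h

/-- The forcing of the remainder is of order `N + 1`, up to a linear term. -/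
theorem norm_remainder_forcing_le (hη1 : η ≤ 1) (hδ : 0 < δ) {t : ℝ} (hX : 0 ≤ X t)
    (hδX : δ * X t ≤ 1) (ha : ∀ j ∈ Finset.Icc 1 N, ‖a j t‖ ≤ η * invSq j * X t ^ j)
    {r : FreqSpace} (hr : ‖r‖ ≤ 1) :
    ‖nonlinH2 d s (approxH2 a N δ t + r) - approxForcing d s a N δ t‖ ≤
      nonlinBound d s * (‖r‖ + (δ * X t) ^ (N + 1)) := by
  have hA := norm_approxH2_le hη1 hδ hX hδX ha
  have h1 : ‖nonlinH2 d s (approxH2 a N δ t + r) - nonlinH2 d s (approxH2 a N δ t)‖ ≤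
      nonlinBound d s * ‖r‖ := by
    refine (norm_nonlinH2_sub_le ((norm_add_le _ _).trans (by linarith)) (by linarith)).trans
      (le_of_eq ?_)
    rw [add_sub_cancel_left]
  have h2 := norm_approx_residual_le (d := d) (s := s) hη1 hδ hX hδX ha
  rw [← sub_add_sub_cancel _ (nonlinH2 d s (approxH2 a N δ t)), mul_add]
  exact norm_add_le_of_le h1 h2

/-- Let m be the maximum of ‖r‖/x^j. The forcing is at most K(m + 1)x^j, and the Duhamel estimate
gives m ≤ (m + 1)/2, so m ≤ 1. The linear term is absorbed by the smallness of 4/(jλ_M), without any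
loss in the growth rate. -/
theorem HasEnergyEstimate.norm_le_pow_of_le (hE : HasEnergyEstimate ε ω c lamM C) (hC : 0 ≤ C)
    (hlam : 0 < lamM) {x : ℝ → ℝ} (hx : IsGrowth lamM x) {j : ℕ} (hj : 2 ≤ j) {K : ℝ} (hK : 0 ≤ K)
    (hCK : C * (4 / (j * lamM)) * K ≤ 1 / 2) {T : ℝ} {r g : ℝ → FreqSpace}
    (hr : ContinuousOn r (Set.Icc 0 T)) (hg : ContinuousOn g (Set.Icc 0 T))
    (hsol : IsFreqSol ε ω (Set.Icc 0 T) r (fun τ => multH2 c (r τ) + g τ)) (h0 : r 0 = 0)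
    (hgr : ∀ τ ∈ Set.Icc 0 T, ‖g τ‖ ≤ K * (‖r τ‖ + x τ ^ j)) :
    ∀ t ∈ Set.Icc 0 T, ‖r t‖ ≤ x t ^ j := by
  intro t ht
  have hxj : ∀ τ, 0 < x τ ^ j := fun τ => pow_pos (hx.pos τ) j
  obtain ⟨t₁, ht₁, hmax⟩ := isCompact_Icc.exists_isMaxOn ⟨t, ht⟩
    (hr.norm.div (hx.cont.pow j).continuousOn fun τ _ => (hxj τ).ne')
  set m := ‖r t₁‖ / x t₁ ^ j with hm
  have hle : ∀ τ ∈ Set.Icc 0 T, ‖r τ‖ ≤ m * x τ ^ j := fun τ hτ =>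
    (div_le_iff₀ (hxj τ)).1 (hmax hτ)
  have hsub : Set.Icc 0 t₁ ⊆ Set.Icc 0 T := Set.Icc_subset_Icc_right ht₁.2
  have h1 := hE.norm_le_pow hC hlam hx hj ht₁.1 (hr.mono hsub) (hg.mono hsub) (hsol.mono hsub) h0
    (m := K * (m + 1)) fun τ hτ => (hgr τ (hsub hτ)).trans (by
      have := hle τ (hsub hτ)
      rw [mul_assoc]
      refine mul_le_mul_of_nonneg_left ?_ hK
      linarith)
  have hm0 : 0 ≤ m := div_nonneg (norm_nonneg _) (hxj t₁).le
  have h2 : m ≤ 1 / 2 * (m + 1) := by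
    rw [hm, div_le_iff₀ (hxj t₁), ← hm]
    calc ‖r t₁‖ ≤ C * (4 / (j * lamM)) * (K * (m + 1)) * x t₁ ^ j := h1
      _ = C * (4 / (j * lamM)) * K * ((m + 1) * x t₁ ^ j) := by ring
      _ ≤ 1 / 2 * ((m + 1) * x t₁ ^ j) :=
        mul_le_mul_of_nonneg_right hCK (mul_nonneg (by linarith) (hxj t₁).le)
      _ = _ := by ring
  refine (hle t ht).trans ?_
  nlinarith [hxj t]

/-- Continuity argument: as long as ‖r‖ ≤ 1, the estimate improves to ‖r‖ ≤ (δX)^(N+1) < 1, so the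
value 1 is never reached. It applies to an arbitrary remainder, so uniqueness of the remainder is
not needed. -/
theorem remainder_norm_le (hE : HasEnergyEstimate ε ω c lamM C) (hC : 0 ≤ C)
    (hlam : 0 < lamM) (hX : IsGrowth lamM X) (hη1 : η ≤ 1) (hδ : 0 < δ) (hN : 1 ≤ N)
    (hCN : C * (4 / ((N + 1 : ℕ) * lamM)) * nonlinBound d s ≤ 1 / 2) {a₀ : FreqSpace}
    (ha : IsCoordProfiles ε ω s c d a₀ N a)
    (hab : ∀ j ∈ Finset.Icc 1 N, ∀ t, 0 ≤ t → ‖a j t‖ ≤ η * invSq j * X t ^ j) {T : ℝ}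
    (hT : δ * X T < 1) {r : ℝ → FreqSpace} (hr : ContinuousOn r (Set.Icc 0 T))
    (h0 : r 0 = 0) (hsol : IsFreqSol ε ω (Set.Icc 0 T) r fun t => multH2 c (r t) +
      (nonlinH2 d s (approxH2 a N δ t + r t) - approxForcing d s a N δ t)) :
    ∀ t ∈ Set.Icc 0 T, ‖r t‖ ≤ (δ * X t) ^ (N + 1) := by
  have hx := hX.const_mul hδ
  have hxT : ∀ t ≤ T, δ * X t < 1 := fun t ht =>
    ((hx.strictMono hlam).monotone ht).trans_lt hT
  have hbound : ∀ T' ≤ T, (∀ t ∈ Set.Icc 0 T', ‖r t‖ ≤ 1) →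
      ∀ t ∈ Set.Icc 0 T', ‖r t‖ ≤ (δ * X t) ^ (N + 1) := fun T' hT' hr1 => by
    have hsub : Set.Icc 0 T' ⊆ Set.Icc 0 T := Set.Icc_subset_Icc_right hT'
    have hrc := hr.mono hsub
    exact hE.norm_le_pow_of_le hC hlam hx (by omega) (nonlinBound_nonneg d s) hCN hrc
      (((continuous_nonlinH2 d s).comp_continuousOn
        (((ha.continuousOn_approxH2 δ).mono Set.Icc_subset_Ici_self).add hrc)).sub
        ((ha.continuousOn_approxForcing δ).mono Set.Icc_subset_Ici_self)) (hsol.mono hsub) h0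
      fun τ hτ => norm_remainder_forcing_le hη1 hδ (hX.pos τ).le (hxT τ (hτ.2.trans hT')).le
        (fun j hj => hab j hj τ hτ.1) (hr1 τ hτ)
  by_cases hall : ∀ t ∈ Set.Icc 0 T, ‖r t‖ ≤ 1
  · exact hbound T le_rfl hall
  exfalso
  push Not at hall
  obtain ⟨t₂, ht₂, hrt₂⟩ := hall
  have hn : ContinuousOn (fun t => ‖r t‖) (Set.Icc 0 T) := hr.norm
  have hivt : ∀ t ∈ Set.Icc 0 T, 1 < ‖r t‖ → ∃ τ ∈ Set.Icc 0 t, ‖r τ‖ = 1 := fun t ht h =>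
    intermediate_value_Icc ht.1 (hn.mono (Set.Icc_subset_Icc_right ht.2))
      ⟨by rw [h0, norm_zero]; exact zero_le_one, h.le⟩
  -- The set of times where the norm equals 1 is compact, and nonempty by the intermediate value
  -- theorem from r(0) = 0; its least element is the first such time.
  set S := Set.Icc 0 T ∩ (fun t => ‖r t‖) ⁻¹' {1} with hS
  have hSc : IsCompact S := isCompact_Icc.of_isClosed_subset
    (hn.preimage_isClosed_of_isClosed isClosed_Icc isClosed_singleton) Set.inter_subset_left
  have hSn : S.Nonempty := by
    obtain ⟨τ, hτ, hτ1⟩ := hivt t₂ ht₂ hrt₂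
    exact ⟨τ, ⟨hτ.1, hτ.2.trans ht₂.2⟩, hτ1⟩
  obtain ⟨t₁, ht₁, hmin⟩ := hSc.exists_isLeast hSn
  have h1 : ∀ t ∈ Set.Icc 0 t₁, ‖r t‖ ≤ 1 := fun t ht => by
    by_contra! hcon
    obtain ⟨τ, hτ, hτ1⟩ := hivt t ⟨ht.1, ht.2.trans ht₁.1.2⟩ hcon
    have h2 := hmin ⟨⟨hτ.1, hτ.2.trans (ht.2.trans ht₁.1.2)⟩, hτ1⟩
    have h3 : τ = t := le_antisymm hτ.2 (ht.2.trans h2)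
    rw [← h3, hτ1] at hcon
    exact lt_irrefl _ hcon
  have h2 := hbound t₁ ht₁.1.2 h1 t₁ ⟨ht₁.1.1, le_rfl⟩
  have h3 : (δ * X t₁) ^ (N + 1) < 1 :=
    pow_lt_one₀ (hx.pos t₁).le (hxT t₁ ht₁.1.2) (by omega)
  have h4 : ‖r t₁‖ = 1 := ht₁.2
  linarith

-- Composition with the retraction onto the unit ball makes the nonlinearity globally Lipschitz, so
-- a global solution exists. The bound ‖r‖ ≤ (δX)^(N+1) ≤ 1 holds for this modified problem and
-- shows that the retraction acts as the identity, so the original equation is solved.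
set_option maxHeartbeats 1000000 in
theorem exists_coord_remainder (hE : HasEnergyEstimate ε ω c lamM C) (hC : 0 ≤ C)
    (hlam : 0 < lamM) (hX : IsGrowth lamM X) (hη1 : η ≤ 1) (hδ : 0 < δ) (hN : 1 ≤ N)
    (hCN : C * (4 / ((N + 1 : ℕ) * lamM)) * nonlinBound d s ≤ 1 / 2) {a₀ : FreqSpace}
    (ha : IsCoordProfiles ε ω s c d a₀ N a)
    (hab : ∀ j ∈ Finset.Icc 1 N, ∀ t, 0 ≤ t → ‖a j t‖ ≤ η * invSq j * X t ^ j) {T : ℝ} (hT0 : 0 ≤ T)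
    (hT : δ * X T ≤ 1) :
    ∃ r : ℝ → FreqSpace, ContinuousOn r (Set.Icc 0 T) ∧ r 0 = 0 ∧
      (∀ t ∈ Set.Icc 0 T, ‖r t‖ ≤ (δ * X t) ^ (N + 1)) ∧
      IsFreqSol ε ω (Set.Icc 0 T) r fun t => multH2 c (r t) +
        (nonlinH2 d s (approxH2 a N δ t + r t) - approxForcing d s a N δ t) := by
  have hx := hX.const_mul hδ
  have hxT : ∀ t ≤ T, δ * X t ≤ 1 := fun t ht => ((hx.strictMono hlam).monotone ht).trans hT
  -- Times are clamped to [0, T], where δX ≤ 1 keeps the approximate solution in the ball of radius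
  -- 2.
  set cl : ℝ → ℝ := fun t => min (max t 0) T with hcl
  have hclc : Continuous cl := by fun_prop
  have hcl0 : ∀ t, 0 ≤ cl t := fun t => le_min (le_max_right _ _) hT0
  have hclT : ∀ t, cl t ≤ T := fun t => min_le_right _ _
  have hcle : ∀ t ∈ Set.Icc 0 T, cl t = t := fun t ht => by
    rw [hcl]
    simp only [max_eq_left ht.1, min_eq_left ht.2]
  set A : ℝ → FreqSpace := fun t => approxH2 a N δ (cl t) with hA
  set F : ℝ → FreqSpace := fun t => approxForcing d s a N δ (cl t) with hF
  have hAc : Continuous A := (ha.continuousOn_approxH2 δ).comp_continuous hclc hcl0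
  have hFc : Continuous F := (ha.continuousOn_approxForcing δ).comp_continuous hclc hcl0
  have hA2 : ∀ t, ‖A t‖ ≤ 2 := fun t => norm_approxH2_le hη1 hδ (hX.pos _).le (hxT _ (hclT t))
    fun j hj => hab j hj _ (hcl0 t)
  have hRc : Continuous retract :=
    (LipschitzWith.of_dist_le_mul (K := 2) fun x y => by
      simpa [dist_eq_norm] using norm_retract_sub_le x y).continuous
  have hK0 := nonlinBound_nonneg d s
  obtain ⟨r, hr, hr0, hrs⟩ := exists_freqSol ε ω
    (F := fun t y => multH2 c y + (nonlinH2 d s (A t + retract y) - F t))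
    (((multH2 c).continuous.comp continuous_snd).add (((continuous_nonlinH2 d s).comp
      ((hAc.comp continuous_fst).add (hRc.comp continuous_snd))).sub (hFc.comp continuous_fst)))
    (L := ‖multH2 c‖ + nonlinBound d s * 2) (M := nonlinBound d s) (β := 0)
    (fun t x y => by
      have h1 : ∀ z, ‖A t + retract z‖ ≤ 3 := fun z =>
        (norm_add_le_of_le (hA2 t) (norm_retract_le_one z)).trans (by norm_num)
      have h2 := norm_nonlinH2_sub_le (d := d) (s := s) (h1 x) (h1 y)
      rw [add_sub_add_left_eq_sub] at h2
      have h3 := mul_le_mul_of_nonneg_left (norm_retract_sub_le x y) hK0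
      have h4 := (multH2 c).le_opNorm (x - y)
      rw [add_sub_add_comm, ← map_sub, sub_sub_sub_cancel_right]
      refine (norm_add_le_of_le h4 (h2.trans h3)).trans (le_of_eq ?_)
      ring)
    (fun t _ => by
      rw [map_zero, zero_add, retract_of_norm_le (by simp), add_zero, zero_mul, Real.exp_zero,
        mul_one]
      refine (norm_approx_residual_le hη1 hδ (hX.pos _).le (hxT _ (hclT t))
        fun j hj => hab j hj _ (hcl0 t)).trans ?_
      exact mul_le_of_le_one_right hK0 (pow_le_one₀ (hx.pos _).le (hxT _ (hclT t)))) 0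
  have hrs' : IsFreqSol ε ω (Set.Icc 0 T) r fun t => multH2 c (r t) +
      (nonlinH2 d s (A t + retract (r t)) - F t) := hrs.mono Set.Icc_subset_Ici_self
  have hgc : Continuous fun t => nonlinH2 d s (A t + retract (r t)) - F t :=
    ((continuous_nonlinH2 d s).comp (hAc.add (hRc.comp hr))).sub hFc
  have hg : ∀ τ ∈ Set.Icc 0 T, ‖nonlinH2 d s (A τ + retract (r τ)) - F τ‖ ≤
      nonlinBound d s * (‖r τ‖ + (δ * X τ) ^ (N + 1)) := fun τ hτ => by
    have h1 := norm_remainder_forcing_le (d := d) (s := s) hη1 hδ (hX.pos _).le (hxT τ hτ.2)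
      (fun j hj => hab j hj τ hτ.1) (norm_retract_le_one (r τ))
    simp only [hA, hF, hcle τ hτ]
    refine h1.trans (mul_le_mul_of_nonneg_left ?_ hK0)
    linarith [norm_retract_le (r τ)]
  have hbd := hE.norm_le_pow_of_le hC hlam hx (j := N + 1) (by omega) hK0 hCN hr.continuousOn
    hgc.continuousOn hrs' hr0 hg
  refine ⟨r, hr.continuousOn, hr0, hbd, hrs'.congr (Icc_subset_Icc_zero T) (fun _ _ => rfl)
    fun t ht => ?_⟩
  have h1 : ‖r t‖ ≤ 1 := (hbd t ht).trans (pow_le_one₀ (hx.pos _).le (hxT t ht.2))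
  simp only [hA, hF, hcle t ht, retract_of_norm_le h1]

end

noncomputable section

/-! ### The energy estimate -/

theorem IsRoll.isCoeff_potential {ε ω b s : ℝ} {ut : ℝ → ℝ} (hut : IsRoll ε ω b s ut) :
    IsCoeff (torusCoeff fun x => (potential ε b s ut x : ℂ)) fun x => (potential ε b s ut x : ℂ) := by
  refine isCoeff_torusCoeff ?_ fun x => by simp only [potential, hut.periodic x]
  have h : ContDiff ℝ 4 fun x => potential ε b s ut x := by
    have := hut.contDiff
    unfold potential
    fun_prop
  exact Complex.ofRealCLM.contDiff.comp h

theorem IsRoll.isCoeff_quadratic {ε ω b s : ℝ} {ut : ℝ → ℝ} (hut : IsRoll ε ω b s ut) :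
    IsCoeff (torusCoeff fun x => (3 * s * ut x - b : ℂ)) fun x => (3 * s * ut x - b : ℂ) := by
  refine isCoeff_torusCoeff ?_ fun x => by simp only [hut.periodic x]
  have h : ContDiff ℝ 4 fun x => (ut x : ℂ) := Complex.ofRealCLM.contDiff.comp hut.contDiff
  fun_prop

theorem exists_square_le {lam : ℝ × ℝ → ℝ} {σbar : ℝ × ℝ} (hc : ContinuousAt lam σbar) {r : ℝ}
    (hr : r < lam σbar) : ∃ c₁ : ℝ, 0 < c₁ ∧ ∀ c₀ ≤ c₁, ∀ σ ∈ square σbar c₀, r ≤ lam σ := by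
  obtain ⟨e, he, hball⟩ := Metric.eventually_nhds_iff.1 (hc.eventually (lt_mem_nhds hr))
  refine ⟨e / 2, by positivity, fun c₀ h₀ σ hσ => (hball ?_).le⟩
  have h1 := hσ.1
  have h2 := hσ.2
  rw [Set.mem_Icc] at h1 h2
  rw [Prod.dist_eq, max_lt_iff, Real.dist_eq, Real.dist_eq, abs_lt, abs_lt]
  exact ⟨⟨by linarith, by linarith⟩, by linarith, by linarith⟩

/-- This determines N₀: the factor 1/(N + 1) from the Duhamel estimate beats the fixed constant CK.
-/
theorem exists_forall_ge_mul_le {C K lamM : ℝ} (hlam : 0 < lamM) :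
    ∃ N₀ : ℕ, ∀ N : ℕ, N₀ ≤ N → 1 ≤ N ∧ C * (4 / ((N + 1 : ℕ) * lamM)) * K ≤ 1 / 2 := by
  obtain ⟨N₀, hN₀⟩ := exists_nat_ge (8 * (C * K) / lamM)
  refine ⟨max 1 N₀, fun N hN => ⟨(le_max_left _ _).trans hN, ?_⟩⟩
  have h1 : (N₀ : ℝ) ≤ N := by exact_mod_cast (le_max_right _ _).trans hN
  have h2 := hN₀.trans h1
  rw [div_le_iff₀ hlam] at h2
  have h3 : C * (4 / ((N + 1 : ℕ) * lamM)) * K = 4 * (C * K) / ((N + 1 : ℕ) * lamM) := by ring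
  rw [h3, div_le_iff₀ (by positivity)]
  push_cast
  nlinarith

theorem invSq_le_one {j : ℕ} (hj : 1 ≤ j) : invSq j ≤ 1 := by
  have hj' : (1 : ℝ) ≤ j := by exact_mod_cast hj
  exact inv_le_one_of_one_le₀ (one_le_pow₀ hj')

theorem lt_maximalTime {ε ω b s : ℝ} {ut : ℝ → ℝ} {N : ℕ} {V : ℕ → ℝ → Plane → ℂ} {δ T₀ T : ℝ}
    {v : ℝ → Plane → ℂ} (h0 : 0 < T) (hT : T₀ < T) (hv : IsRemainder ε ω b s ut N V δ T v)
    (hb : ∀ t ∈ Set.Icc 0 T, h2Norm (v t) ≤ 1 / 2) :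
    (T₀ : EReal) < maximalTime ε ω b s ut N V δ :=
  (EReal.coe_lt_coe_iff.2 hT).trans_le (le_sSup ⟨T, ⟨h0, v, hv, hb⟩, rfl⟩)

end

end GSHE

/-! ### Choice of the constants and proof of the estimate. -/

theorem lemma4p2 (ε ω b s : ℝ) (hε : 0 < ε) (hω : ω ∈ Set.Ioo (-(1 / 2) : ℝ) (1 / 2))
    (hk : 0 < 1 + 2 * ε * ω) (hb : b ≠ 0) (hs : 0 < 27 * s - 38 * b ^ 2)
    (ut : ℝ → ℝ) (hut : GSHE.IsRoll ε ω b s ut)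
    (σbar : ℝ × ℝ) (𝒩 : Set (ℝ × ℝ)) (lam : ℝ × ℝ → ℝ)
    (hlam : GSHE.IsMostUnstableBranch ε ω b s ut σbar 𝒩 lam)
    (cbar : ℝ) (hcbar : 0 < cbar) (hsquare : GSHE.square σbar cbar ⊆ 𝒩)
    (W : ℝ × ℝ → ℝ → ℂ) (hW : GSHE.IsEigenfunctionFamily ε ω b s ut σbar lam cbar W) :
    ∃ ρ C : ℝ, 0 < ρ ∧ 0 < C ∧ ∃ N₀ : ℕ, ∀ N : ℕ, N₀ ≤ N →
      ∀ θ : ℝ, 0 < θ → θ < 1 / 2 → C * (N : ℝ) ^ 2 * θ ^ (N + 1) < 1 / 2 →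
      ∃ cstar : ℝ, 0 < cstar ∧ cstar ≤ cbar ∧ ∀ c₀ : ℝ, 0 < c₀ → c₀ ≤ cstar →
        (∃ V, GSHE.IsProfiles ε ω b s ut (GSHE.modeData σbar W c₀) N V) ∧
        ∀ V, GSHE.IsProfiles ε ω b s ut (GSHE.modeData σbar W c₀) N V →
          (∀ j ∈ Finset.Icc 1 N, ∀ t : ℝ, 0 ≤ t →
            GSHE.h2Norm (V j t) ≤ ENNReal.ofReal ((ρ * GSHE.growth σbar lam c₀ t) ^ j)) ∧
          ∀ δ : ℝ, 0 < δ → δ * ρ * GSHE.prefactor σbar lam c₀ 0 ≤ θ →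
            ∃ Tδ : ℝ, 0 ≤ Tδ ∧
              (∀ t : ℝ, 0 ≤ t → (δ * ρ * GSHE.growth σbar lam c₀ t = θ ↔ t = Tδ)) ∧
              (Tδ : EReal) < GSHE.maximalTime ε ω b s ut N V δ ∧
              ∀ T : ℝ, T ≤ Tδ → ∀ v, GSHE.IsRemainder ε ω b s ut N V δ T v →
                ∀ t ∈ Set.Icc 0 T, GSHE.h2Norm (v t) ≤
                  ENNReal.ofReal
                    (C * (N : ℝ) ^ 2 * (δ * ρ * GSHE.growth σbar lam c₀ t) ^ (N + 1)) := by
  open GSHE in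
  set lamM := lam σbar with hlamM
  have hM : 0 < lamM := (hlam.unstable σbar hlam.mem).1
  have hmax : ∀ σ μ, IsBlochEigenvalue ε ω b s ut σ μ → μ ≤ lamM := fun σ μ h =>
    hlam.isGreatest.2 ⟨σ, h⟩
  have hlamc : ContinuousOn lam (square σbar cbar) := hlam.analytic.continuousOn.mono hsquare
  have hc := hut.isCoeff_potential
  have hd := hut.isCoeff_quadratic
  set c := torusCoeff fun x => (potential ε b s ut x : ℂ) with hcdef
  set d := torusCoeff fun x => (3 * s * ut x - b : ℂ) with hddef
  obtain ⟨C, hC, hE⟩ := exists_energy_estimate hk hc (torusCoeff_neg_of_real _) hM.le hmax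
  replace hE : HasEnergyEstimate ε ω c lamM C := hE
  obtain ⟨B, hB, hfirst⟩ := exists_first_profile hW hlamc hc
  obtain ⟨N₀, hN₀⟩ := exists_forall_ge_mul_le (C := C) (K := nonlinBound d s) hM
  obtain ⟨c₁, hc₁, hlow⟩ := exists_square_le
    (hlam.analytic.continuousOn.continuousAt (hlam.isOpen.mem_nhds hlam.mem))
    (show 3 / 4 * lamM < lam σbar by rw [← hlamM]; linarith)
  have hK := nonlinBound_nonneg d s
  -- With this η the product CKη · 2/λ_M equals 2CK/(2CK + λ_M), which is the smallness that the
  -- profile induction needs.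
  set η := lamM / (2 * (C * nonlinBound d s) + lamM) with hη
  have hη0 : 0 < η := by positivity
  have hη1 : η ≤ 1 := div_le_one_of_le₀ (le_add_of_nonneg_left (by positivity)) (by positivity)
  have hηC : C * nonlinBound d s * η * (2 / lamM) ≤ 1 := by
    rw [hη, mul_div_assoc', mul_div_assoc', div_le_one hM, div_mul_eq_mul_div,
      div_le_iff₀ (by positivity)]
    nlinarith [mul_pos hM hM]
  -- ρ = B/η turns the bound B · growth of the first profile into η(ρ · growth). C = 1 suffices
  -- because the remainder is bounded by (δρ · growth)^(N+1) and N ≥ 1. In the side length, `cbar`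
  -- keeps the family W available, 1/2 keeps the square in one cell, and c₁ keeps λ ≥ ¾λ_M.
  refine ⟨B / η, 1, by positivity, one_pos, N₀, fun N hN θ hθ0 hθ1 _ =>
    ⟨min cbar (min (1 / 2) c₁), by positivity, min_le_left _ _, fun c₀ hc₀ hc₀' => ?_⟩⟩
  obtain ⟨hN1, hCN⟩ := hN₀ N hN
  have h1 : c₀ ≤ cbar := hc₀'.trans (min_le_left _ _)
  have h2 : c₀ < 1 := (hc₀'.trans ((min_le_right _ _).trans (min_le_left _ _))).trans_lt (by norm_num)
  have h3 : c₀ ≤ c₁ := hc₀'.trans ((min_le_right _ _).trans (min_le_right _ _))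
  have hG : IsGrowth lamM (growth σbar lam c₀) := isGrowth_growth hc₀ (hlamc.mono (square_mono h1))
    hM.le (hlow c₀ h3) fun σ hσ =>
      hmax σ _ (hlam.unstable σ (hsquare (square_mono h1 hσ))).2
  have hX := hG.const_mul (div_pos hB hη0)
  obtain ⟨a₁, ha₁c, ha₁0, ha₁b, ha₁s⟩ := hfirst c₀ h1 h2
  have ha₁X : ∀ t, ‖a₁ t‖ ≤ η * (B / η * growth σbar lam c₀ t) := fun t => by
    rw [← mul_assoc, mul_div_cancel₀ _ hη0.ne']
    exact ha₁b t
  have hU : modeData σbar W c₀ =ᵐ[MeasureTheory.volume] recon (a₁ 0) :=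
    MeasureTheory.ae_of_all _ fun p => (ha₁0 p).symm
  refine ⟨?_, fun V hV => ?_⟩
  · obtain ⟨a, ha⟩ := exists_coordProfiles (s := s) (d := d) hE hC.le hM hX hη0.le hη1 hηC ha₁c ha₁s
      ha₁X N
    exact ⟨_, ha.isProfiles hc hd hU⟩
  obtain ⟨a, ha, hVa⟩ := hV.exists_coord hc hd hU
  have hab : ∀ j ∈ Finset.Icc 1 N, ∀ t, 0 ≤ t →
      ‖a j t‖ ≤ η * invSq j * (B / η * growth σbar lam c₀ t) ^ j := fun j hj t ht =>
    ha.norm_le hE hC.le hM hX hη0.le hη1 hηC ha₁c ha₁s ha₁X hj ht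
  refine ⟨fun j hj t ht => ?_, fun δ hδ hδθ => ?_⟩
  · rw [h2Norm_congr (hVa j hj t ht), h2Norm_recon]
    refine ENNReal.ofReal_le_ofReal ((hab j hj t ht).trans ?_)
    exact mul_le_of_le_one_left (pow_nonneg (hX.pos t).le j)
      (mul_le_one₀ hη1 (invSq_nonneg j) (invSq_le_one (Finset.mem_Icc.1 hj).1))
  have hx := hX.const_mul hδ
  have hmono := hx.strictMono hM
  have hx0 : δ * (B / η * growth σbar lam c₀ 0) ≤ θ := by rwa [growth_zero, ← mul_assoc]
  obtain ⟨Tδ, hT0, hTθ⟩ := hx.exists_eq hM hx0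
  -- At T₁ the quantity δρ · growth equals 1/2 > θ, so T₁ > T^δ. A remainder on [0, T₁] gives the
  -- strict inequality T^δ < T_M, also when T^δ = 0.
  obtain ⟨T₁, hT10, hT1⟩ := hx.exists_eq hM (hx0.trans hθ1.le)
  have hTT : Tδ < T₁ := hmono.lt_iff_lt.1 (by rw [hTθ, hT1]; exact hθ1)
  refine ⟨Tδ, hT0, fun t _ => ?_, ?_, fun T hT v hv t ht => ?_⟩
  · rw [mul_assoc, ← hTθ]
    exact hmono.injective.eq_iff
  · obtain ⟨r, hr, hr0, hrb, hrs⟩ := exists_coord_remainder hE hC.le hM hX hη1 hδ hN1 hCN ha hab hT10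
      (by rw [hT1]; norm_num)
    refine lt_maximalTime (hT0.trans_lt hTT) hTT (v := fun t => recon (r t))
      ⟨continuousInH2_of_coord hr fun _ _ => Filter.EventuallyEq.rfl, ?_,
        (remainder_solution_iff hut hc hd ha hVa hr fun _ _ => Filter.EventuallyEq.rfl).2 hrs⟩
      fun t ht => ?_
    · rw [hr0]
      exact MeasureTheory.ae_of_all _ fun p => recon_zero p
    · rw [h2Norm_recon]
      have h4 : δ * (B / η * growth σbar lam c₀ t) ≤ 1 / 2 := by
        rw [← hT1]
        exact hmono.monotone ht.2
      have h5 : ‖r t‖ ≤ 1 / 2 := by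
        refine (hrb t ht).trans ((pow_le_pow_of_le_one (hx.pos t).le (by linarith) (m := 1)
          (by omega)).trans ?_)
        rwa [pow_one]
      refine (ENNReal.ofReal_le_ofReal h5).trans (le_of_eq ?_)
      rw [ENNReal.ofReal_div_of_pos two_pos, ENNReal.ofReal_one, ENNReal.ofReal_ofNat]
  -- Here v is an arbitrary remainder; δρ · growth stays at most θ < 1 on [0, T], so the continuity
  -- argument applies to it.
  · obtain ⟨r, hr, hvr⟩ := hv.continuousInH2.exists_coord
    have hr0 : r 0 = 0 := recon_injective (by
      filter_upwards [hvr 0 ⟨le_rfl, ht.1.trans ht.2⟩, hv.initial] with p h4 h5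
      rw [← h4, h5, recon_zero]
      rfl)
    have hTl : δ * (B / η * growth σbar lam c₀ T) < 1 :=
      ((hmono.monotone hT).trans_eq hTθ).trans_lt (by linarith)
    have h4 := remainder_norm_le hE hC.le hM hX hη1 hδ hN1 hCN ha hab hTl hr hr0
      ((remainder_solution_iff hut hc hd ha hVa hr hvr).1 hv.solution) t ht
    rw [h2Norm_congr (hvr t ht), h2Norm_recon, mul_assoc δ, one_mul]
    refine ENNReal.ofReal_le_ofReal (h4.trans (le_mul_of_one_le_left (pow_nonneg (hx.pos t).le _) ?_))
    exact one_le_pow₀ (by exact_mod_cast hN1)
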